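/- **Theorem 5.4 (Two moment theorem for elliptic polynomials, complex case).** For every $\varepsilon>0$ there is a constant $c_0>0$, depending only on $\varepsilon$, such that for every integer $k\ge 1$ and every real $C>0$ there is a constant $\tilde C$, depending only on $k,\varepsilon,C$, for which the following holds. Let $n\ge 1$ be an integer, and let $\xi,\tilde\xi$ be complex random variables of mean zero and variance one, i.e. $\mathbf E\xi=\mathbf E\tilde\xi=0$ and $\mathbf E|\xi|^2=\mathbf E|\tilde\xi|^2=1$, which match moments to second order, i.e. $$\mathbf E\,(\operatorname{Re}\xi)^a(\operatorname{Im}\xi)^b=\mathbf E\,(\operatorname{Re}\tilde\xi)^a(\operatorname{Im}\tilde\xi)^b\qquad\text{for all integers } a,b\ge 0,\ a+b\le 2,$$ and which satisfy $\mathbf E|\xi|^{2+\varepsilon}\le C$ and $\mathbf E|\tilde\xi|^{2+\varepsilon}\le C$. Let $$f_{n,\xi}(z)=\sum_{i=0}^n\sqrt{\binom ni n^{-i}}\;\xi_i z^i,\qquad f_{n,\tilde\xi}(z)=\sum_{i=0}^n\sqrt{\binom ni n^{-i}}\;\tilde\xi_i z^i,$$ where $\xi_0,\dots,\xi_n$ are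 jointly independent copies of $\xi$ and $\tilde\xi_0,\dots,\tilde\xi_n$ are jointly independent copies of $\tilde\xi$. For a random polynomial $f$ of degree at most $n$, let $\rho^{(k)}_f$ be its $k$-point correlation function, in general a measure on $\mathbb C^k$, determined by $$\mathbf E\sum_{i_1,\dots,i_k\text{ distinct}}\varphi(\zeta_{i_1},\dots,\zeta_{i_k})=\int_{\mathbb C^k}\varphi(z_1,\dots,z_k)\,\rho^{(k)}_f(z_1,\dots,z_k)\,dz_1\cdots dz_k$$ for all continuous compactly supported $\varphi:\mathbb C^k\to\mathbb C$, where $\zeta_1,\zeta_2,\dots$ are the zeros of $f$ in $\mathbb C$ listed with multiplicity (with no zeros in $\mathbb C$ when $f$ vanishes identically), only the indices being required to be distinct, and $dz$ is Lebesgue measure on $\mathbb C$. Let $z_1,\dots,z_k\in\mathbb C$ satisfy $n^{\varepsilon}\le|z_i|\le C\sqrt n$ for all $i$, and let $G:\mathbb C^k\to\mathbb C$ be a smooth function (in the real sense), supported on the polydisc $B(0,C)^k$, with $$|\nabla^aG(w)|\le C\qquad\text{for all } 0\le a\le 5k+1,\ w\in\mathbb C^k,$$ where $|\nabla^aG(w)|$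 is the square root of the sum of the squared absolute values of all partial derivatives $\frac{\partial^a G}{\partial x_{i_1}\cdots\partial x_{i_a}}(w)$ in the $2k$ real coordinates $x_1,\dots,x_{2k}$ of $\mathbb C^k$, over all $a$-tuples $(i_1,\dots,i_a)$. Then $$\Big|\int_{\mathbb C^k}G(w_1,\dots,w_k)\,\rho^{(k)}_{f_{n,\xi}}(z_1+w_1,\dots,z_k+w_k)\,dw_1\cdots dw_k-\int_{\mathbb C^k}G(w_1,\dots,w_k)\,\rho^{(k)}_{f_{n,\tilde\xi}}(z_1+w_1,\dots,z_k+w_k)\,dw_1\cdots dw_k\Big|\le\tilde C\,n^{-c_0}.$$ -/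

import Mathlib

open MeasureTheory ProbabilityTheory
open scoped ENNReal

/-- The counting measure, on `ℂᵏ`, of the `k`-tuples `(ζ_{i₁}, …, ζ_{i_k})` of complex zeros of `p`
with distinct indices `i₁, …, i_k`. The type `p.roots` enumerates the zeros with multiplicity, so
that a multiple zero may be repeated in a tuple. For `p = 0` there are no complex zeros. -/
noncomputable def zeroTupleMeasure (k : ℕ) (p : Polynomial ℂ) : Measure (Fin k → ℂ) :=
  ∑ e : Fin k ↪ p.roots, Measure.dirac (fun j => (e j : ℂ))

/-- The `k`-point correlation function of the random polynomial `f`, as a measure on `ℂᵏ`: the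
expectation of `zeroTupleMeasure k (f ω)`. If the correlation function exists as a function, this is
the measure having it as density with respect to Lebesgue measure. -/
noncomputable def correlationMeasure {Ω : Type*} [MeasurableSpace Ω] (P : Measure Ω)
    (f : Ω → Polynomial ℂ) (k : ℕ) : Measure (Fin k → ℂ) :=
  P.bind (fun ω => zeroTupleMeasure k (f ω))

/-- `∑ᵢ √(C(n,i) n⁻ⁱ) xᵢ zⁱ`. -/
noncomputable def rescaledElliptic (n : ℕ) (x : Fin (n + 1) → ℂ) : Polynomial ℂ :=
  ∑ i : Fin (n + 1), Polynomial.monomial (i : ℕ)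
    (((Real.sqrt ((n.choose i : ℝ) * ((n : ℝ) ^ (i : ℕ))⁻¹) : ℝ) : ℂ) * x i)

/-- `X₀, …, X_n` are jointly independent copies of `ξ`. -/
structure IsIndepCopies {Ω : Type*} [MeasurableSpace Ω] (P : Measure Ω) {n : ℕ} (ξ : Ω → ℂ)
    (X : Fin (n + 1) → Ω → ℂ) : Prop where
  indep : iIndepFun X P
  identDistrib : ∀ i, IdentDistrib (X i) ξ P P

/-- `E (Re ξ)ᵃ (Im ξ)ᵇ = E (Re ξ')ᵃ (Im ξ')ᵇ` whenever `a + b ≤ m`. -/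
def MatchMoments {Ω Ω' : Type*} [MeasurableSpace Ω] [MeasurableSpace Ω'] (P : Measure Ω)
    (P' : Measure Ω') (ξ : Ω → ℂ) (ξ' : Ω' → ℂ) (m : ℕ) : Prop :=
  ∀ a b : ℕ, a + b ≤ m →
    ∫ ω, (ξ ω).re ^ a * (ξ ω).im ^ b ∂P = ∫ ω, (ξ' ω).re ^ a * (ξ' ω).im ^ b ∂P'

/-- The standard real basis of `ℂᵏ = ℝ²ᵏ`; `(j, 0)` is the real direction and `(j, 1)` the imaginary
direction of the `j`-th coordinate. -/
noncomputable def realBasisVec {k : ℕ} (s : Fin k × Fin 2) : Fin k → ℂ :=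
  Pi.single s.1 (if s.2 = 0 then 1 else Complex.I)

/-- `|∇ᵃ G (w)|`: the square root of the sum of the squares of all the real partial derivatives
`∂ᵃ G / ∂x_{i₁} … ∂x_{i_a}` at `w`, where `(i₁, …, i_a)` runs over all `a`-tuples of the `2k` real
coordinates. -/
noncomputable def gradNorm {k : ℕ} (a : ℕ) (G : (Fin k → ℂ) → ℂ) (w : Fin k → ℂ) : ℝ :=
  Real.sqrt (∑ s : Fin a → Fin k × Fin 2,
    ‖iteratedFDeriv ℝ a G w (fun j => realBasisVec (s j))‖ ^ 2)

/-! Well-definedness of the correlation measure. -/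

theorem zeroTupleMeasure_eq {d : ℕ} (k : ℕ) (p : Polynomial ℂ) (r : Fin d → ℂ)
    (h : p.roots = Finset.univ.val.map r) :
    zeroTupleMeasure k p = ∑ e : Fin k ↪ Fin d, Measure.dirac (fun j => r (e j)) := by
  classical
  have key : ∃ E : Fin d ≃ p.roots, ∀ i, ((E i : p.roots) : ℂ) = r i := by
    let E₁ : Fin d ≃ ((Finset.univ : Finset (Fin d)).val : Multiset (Fin d)) :=
      { toFun := fun i => ⟨i, ⟨0, by simp⟩⟩
        invFun := fun x => x.1
        left_inv := fun i => rfl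
        right_inv := by
          rintro ⟨x, ⟨i, hi⟩⟩
          have : i = 0 := by simpa using hi
          subst this
          rfl }
    refine ⟨E₁.trans ((Multiset.mapEquiv _ r).trans (Multiset.cast h.symm)), fun i => ?_⟩
    simp only [Equiv.trans_apply, Multiset.cast_apply_fst, Multiset.mapEquiv_apply]
    rfl
  obtain ⟨E, hE⟩ := key
  unfold zeroTupleMeasure
  symm
  refine Fintype.sum_equiv (Equiv.embeddingCongr (Equiv.refl _) E) _ _ (fun e => ?_)
  congr 1
  funext j
  simp [hE]

theorem measurable_zeroTupleMeasure (n k : ℕ) :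
    Measurable (fun a : Fin (n + 1) → ℂ =>
      zeroTupleMeasure k (∑ i : Fin (n + 1), Polynomial.monomial (i : ℕ) (a i))) := by
  classical
  let q : (Fin (n + 1) × ℂ × (Fin n → ℂ)) → Polynomial ℂ := fun x =>
    Polynomial.C x.2.1 *
      ∏ j : Fin (x.1 : ℕ), (Polynomial.X - Polynomial.C (x.2.2 (j.castLE (Nat.lt_succ_iff.1 x.1.2))))
  let F : (Fin (n + 1) × ℂ × (Fin n → ℂ)) → (Fin (n + 1) → ℂ) := fun x i => (q x).coeff i
  have hqdeg : ∀ x, (q x).natDegree ≤ n := by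
    intro x
    refine (Polynomial.natDegree_C_mul_le _ _).trans ?_
    rw [Polynomial.natDegree_prod_of_monic _ _ (fun j _ => Polynomial.monic_X_sub_C _)]
    simpa using Nat.lt_succ_iff.1 x.1.2
  have hrec : ∀ p : Polynomial ℂ, p.natDegree ≤ n →
      ∑ i : Fin (n + 1), Polynomial.monomial (i : ℕ) (p.coeff i) = p := by
    intro p hp
    rw [Fin.sum_univ_eq_sum_range (fun i => Polynomial.monomial i (p.coeff i)) (n + 1)]
    exact (p.as_sum_range' (n + 1) (Nat.lt_succ_iff.2 hp)).symm
  have hFm : Measurable F := by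
    refine measurable_from_prod_countable_right (fun d => ?_)
    refine measurable_pi_lambda _ (fun i => ?_)
    refine Continuous.measurable ?_
    have hc : ∀ (s : Finset (Fin (d : ℕ))) (m : ℕ), Continuous (fun x : ℂ × (Fin n → ℂ) =>
        (∏ j ∈ s, (Polynomial.X -
          Polynomial.C (x.2 (j.castLE (Nat.lt_succ_iff.1 d.2))))).coeff m) := by
      intro s
      induction s using Finset.induction_on with
      | empty => intro m; simp only [Finset.prod_empty]; exact continuous_const
      | insert j s hj ih =>
        intro m
        simp only [Finset.prod_insert hj, sub_mul, Polynomial.coeff_sub, Polynomial.coeff_C_mul]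
        refine Continuous.sub ?_ (Continuous.mul (by fun_prop) (ih m))
        cases m with
        | zero => simp only [Polynomial.mul_coeff_zero, Polynomial.coeff_X_zero, zero_mul]
                  exact continuous_const
        | succ m => simp only [Polynomial.coeff_X_mul]; exact ih m
    simp only [F, q, Polynomial.coeff_C_mul]
    exact (by fun_prop : Continuous (fun x : ℂ × (Fin n → ℂ) => x.1)).mul
      (hc Finset.univ (i : ℕ))
  have hFs : Function.Surjective F := by
    intro a
    set p : Polynomial ℂ := ∑ i : Fin (n + 1), Polynomial.monomial (i : ℕ) (a i) with hp
    have hpc : ∀ i : Fin (n + 1), p.coeff i = a i := by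
      intro i
      simp only [hp, Polynomial.finsetSum_coeff, Polynomial.coeff_monomial, Fin.val_inj]
      simp
    have hpd : p.natDegree ≤ n := by
      refine Polynomial.natDegree_sum_le_of_forall_le _ _ (fun i _ => ?_)
      exact (Polynomial.natDegree_monomial_le _).trans (Nat.lt_succ_iff.1 i.2)
    have hcard : p.roots.toList.length = p.natDegree := by
      rw [Multiset.length_toList]
      exact IsAlgClosed.card_roots_eq_natDegree
    have hlist : ∀ (l : List ℂ) (m : ℕ), l.length = m →
        ∏ j : Fin m, (Polynomial.X - Polynomial.C (l.getD j 0)) =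
          (l.map (fun z => Polynomial.X - Polynomial.C z)).prod := by
      rintro l _ rfl
      rw [← Fin.prod_univ_fun_getElem]
      exact Finset.prod_congr rfl (fun j _ => by simp)
    refine ⟨(⟨p.natDegree, Nat.lt_succ_iff.2 hpd⟩, p.leadingCoeff,
      fun j => p.roots.toList.getD j 0), ?_⟩
    have hq : q (⟨p.natDegree, Nat.lt_succ_iff.2 hpd⟩, p.leadingCoeff,
      fun j => p.roots.toList.getD j 0) = p := by
      conv_rhs => rw [(IsAlgClosed.splits p).eq_prod_roots]
      simp only [q, Fin.val_castLE]
      congr 1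
      conv_rhs => rw [← Multiset.coe_toList p.roots]
      rw [Multiset.map_coe, Multiset.prod_coe]
      exact hlist _ _ hcard
    funext i
    simp only [F, hq, hpc]
  rw [← hFm.measurable_comp_iff_of_surjective hFs]
  have hcomp : ∀ x, ((fun a : Fin (n + 1) → ℂ => zeroTupleMeasure k
      (∑ i : Fin (n + 1), Polynomial.monomial (i : ℕ) (a i))) ∘ F) x = zeroTupleMeasure k (q x) := by
    intro x
    simp only [Function.comp, F, hrec _ (hqdeg x)]
  rw [show _ = _ from funext hcomp]
  refine measurable_from_prod_countable_right (fun d => ?_)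
  have hval : ∀ x : ℂ × (Fin n → ℂ), zeroTupleMeasure k (q (d, x)) =
      if x.1 = 0 then zeroTupleMeasure k 0 else ∑ e : Fin k ↪ Fin (d : ℕ),
        Measure.dirac (fun j => x.2 ((e j).castLE (Nat.lt_succ_iff.1 d.2))) := by
    intro x
    split_ifs with h0
    · simp [q, h0]
    · refine zeroTupleMeasure_eq k _ (fun j => x.2 (j.castLE (Nat.lt_succ_iff.1 d.2))) ?_
      simp only [q]
      rw [Polynomial.roots_C_mul _ h0, Polynomial.roots_prod]
      · simp [Polynomial.roots_X_sub_C]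
      · exact Finset.prod_ne_zero_iff.2 (fun j _ => Polynomial.X_sub_C_ne_zero _)
  rw [show _ = _ from funext hval]
  refine Measurable.ite (measurable_fst (measurableSet_singleton 0)) measurable_const ?_
  refine Measure.measurable_of_measurable_coe _ (fun s hs => ?_)
  simp only [Measure.finsetSum_apply]
  refine Finset.measurable_sum _ (fun e _ => ?_)
  exact (Measure.measurable_coe hs).comp (Measure.measurable_dirac.comp (by fun_prop))

theorem correlationMeasure_eq_bind {Ω : Type*} [MeasurableSpace Ω] (P : Measure Ω)
    (f : Ω → Polynomial ℂ) (n k : ℕ) (hdeg : ∀ ω, (f ω).natDegree ≤ n)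
    (hf : ∀ i, AEMeasurable (fun ω => (f ω).coeff i) P) :
    correlationMeasure P f k = (P.map (fun ω (i : Fin (n + 1)) => (f ω).coeff i)).bind
      (fun a => zeroTupleMeasure k (∑ i : Fin (n + 1), Polynomial.monomial (i : ℕ) (a i))) := by
  have hrec : ∀ ω, ∑ i : Fin (n + 1), Polynomial.monomial (i : ℕ) ((f ω).coeff i) = f ω := by
    intro ω
    rw [Fin.sum_univ_eq_sum_range (fun i => Polynomial.monomial i ((f ω).coeff i)) (n + 1)]
    exact ((f ω).as_sum_range' (n + 1) (Nat.lt_succ_iff.2 (hdeg ω))).symm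
  have hA : AEMeasurable (fun ω (i : Fin (n + 1)) => (f ω).coeff i) P :=
    aemeasurable_pi_lambda _ (fun i => hf i)
  unfold correlationMeasure Measure.bind
  rw [AEMeasurable.map_map_of_aemeasurable (measurable_zeroTupleMeasure n k).aemeasurable hA]
  congr 2
  funext ω
  simp only [Function.comp, hrec]

/-- The defining property of the `k`-point correlation function. -/
theorem integral_correlationMeasure {Ω : Type*} [MeasurableSpace Ω] (P : Measure Ω)
    [IsProbabilityMeasure P] (f : Ω → Polynomial ℂ) (n k : ℕ) (hdeg : ∀ ω, (f ω).natDegree ≤ n)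
    (hf : ∀ i, AEMeasurable (fun ω => (f ω).coeff i) P) (φ : (Fin k → ℂ) → ℂ) (hφ : Continuous φ)
    (hφc : HasCompactSupport φ) :
    Integrable φ (correlationMeasure P f k) ∧
      ∫ u, φ u ∂(correlationMeasure P f k) =
        ∫ ω, ∑ e : Fin k ↪ (f ω).roots, φ (fun j => (e j : ℂ)) ∂P := by
  have hrec : ∀ ω, ∑ i : Fin (n + 1), Polynomial.monomial (i : ℕ) ((f ω).coeff i) = f ω := by
    intro ω
    rw [Fin.sum_univ_eq_sum_range (fun i => Polynomial.monomial i ((f ω).coeff i)) (n + 1)]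
    exact ((f ω).as_sum_range' (n + 1) (Nat.lt_succ_iff.2 (hdeg ω))).symm
  have hA : AEMeasurable (fun ω (i : Fin (n + 1)) => (f ω).coeff i) P :=
    aemeasurable_pi_lambda _ (fun i => hf i)
  have : IsProbabilityMeasure (P.map (fun ω (i : Fin (n + 1)) => (f ω).coeff i)) :=
    Measure.isProbabilityMeasure_map hA
  have hint : ∀ p : Polynomial ℂ, Integrable φ (zeroTupleMeasure k p) ∧
      ∫ u, φ u ∂(zeroTupleMeasure k p) = ∑ e : Fin k ↪ p.roots, φ (fun j => (e j : ℂ)) := by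
    intro p
    have h1 : ∀ e ∈ (Finset.univ : Finset (Fin k ↪ p.roots)),
        Integrable φ (Measure.dirac (fun j => (e j : ℂ))) :=
      fun e _ => integrable_dirac (by simp)
    unfold zeroTupleMeasure
    refine ⟨integrable_finsetSum_measure.2 h1, ?_⟩
    rw [integral_finsetSum_measure h1]
    simp
  let κ : Kernel (Fin (n + 1) → ℂ) (Fin k → ℂ) :=
    ⟨fun a => zeroTupleMeasure k (∑ i : Fin (n + 1), Polynomial.monomial (i : ℕ) (a i)),
      measurable_zeroTupleMeasure n k⟩
  have hκ : correlationMeasure P f k = (P.map (fun ω (i : Fin (n + 1)) => (f ω).coeff i)).bind κ :=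
    correlationMeasure_eq_bind P f n k hdeg hf
  have hmass : ∀ a, κ a Set.univ ≤ ((n ^ k : ℕ) : ℝ≥0∞) := by
    intro a
    change zeroTupleMeasure k _ Set.univ ≤ _
    have hdg : (∑ i : Fin (n + 1), Polynomial.monomial (i : ℕ) (a i)).natDegree ≤ n :=
      Polynomial.natDegree_sum_le_of_forall_le _ _ (fun i _ =>
        (Polynomial.natDegree_monomial_le _).trans (Nat.lt_succ_iff.1 i.2))
    unfold zeroTupleMeasure
    simp only [Measure.finsetSum_apply, measure_univ, Finset.sum_const, nsmul_eq_mul, mul_one,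
      Finset.card_univ, Fintype.card_embedding_eq, Multiset.card_coe, Fintype.card_fin]
    exact_mod_cast (Nat.descFactorial_le_pow _ _).trans
      (Nat.pow_le_pow_left ((Polynomial.card_roots' _).trans hdg) _)
  have : IsFiniteKernel κ := ⟨⟨_, ENNReal.natCast_lt_top _, hmass⟩⟩
  have hI : Integrable φ ((P.map (fun ω (i : Fin (n + 1)) => (f ω).coeff i)).bind κ) :=
    hφ.integrable_of_hasCompactSupport hφc
  rw [hκ]
  refine ⟨hI, ?_⟩
  rw [Measure.comp_eq_comp_const_apply] at hI ⊢
  rw [Kernel.integral_comp hI, Kernel.const_apply, integral_map hA]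
  · refine integral_congr_ae (Filter.Eventually.of_forall (fun ω => ?_))
    change ∫ u, φ u ∂(zeroTupleMeasure k _) = _
    rw [hrec, (hint (f ω)).2]
  · exact (StronglyMeasurable.integral_kernel hφ.stronglyMeasurable).aestronglyMeasurable

/-! Zeros enter through Green's formula: Δ log|f| is 2π times the counting measure of the zeros.
Hence a sum of H over all m-tuples of zeros is (2π)^(-m) times the integral of Δ₁⋯Δ_m H against ∏
log|f(u_q)| (`integral_lapList_mul_prod`). Tuples with distinct indices reduce to unrestricted
tuples in fewer variables by inclusion–exclusion over coincidences (`sum_embedding_eq`,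
`exists_surjective_factor`). It remains to compare the means of ∏ log|f(u_q)| under the two laws,
for u_q in a disc of radius C about some z_i.

Real affine functions are harmonic, so in Green's formula f(u) may be replaced by e^(-A(u)) f(u),
where A is the affine approximation at the centre to half the logarithm of the variance E|f(u)|² =
(1 + |u|²/n)^n. On the disc the tilted polynomial is a linear form in the random coefficients whose
variance lies between two constants. The bounds n^ε ≤ |z_i| ≤ C√n spread the binomial profile over
at least about n^ε indices, so every coefficient of the form is O(n^(-ε/2))
(`exists_ellipticCoeff_bounds`).

The logarithm is replaced by `truncLog d`, which is smooth, bounded by log(1/d), and has j-th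
derivatives of order d^(-j) up to logarithms. For products of truncated logarithms Lindeberg's
exchange applies: the second order Taylor terms agree by the matching of moments, and changing the
law of the i-th variable costs (αᵢ/d)^(2+ε) up to logarithms, where αᵢ bounds the i-th coefficients
(`exists_lindeberg_bound`). The sum of these costs is small because the αᵢ are uniformly small and
square summable.

The truncation itself is controlled by two anticoncentration estimates. Characteristic functions
give P(|form| ≤ δ) ≲ δ + n^(-ε)/δ² (`exists_small_ball_bound`). A lacunary subfamily of the
coefficients, found on one side of the binomial mode, gives that |form| ≤ exp(-n^η) has
superpolynomially small probability (`eventually_elliptic_small_ball`). Together with a crude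
deterministic bound in terms of the roots, the latter shows that every moment of log|form| is O(n^η)
for each η > 0 (`exists_log_moment_le`). The crude bound needs the event `ellipticGood` at each
centre. Its failure has probability at most n^(-k-1), which beats the trivial bound of order n^k for
the number of k-tuples.

With truncation level d = n^(-2γ) and γ = ε²/24, after reducing to ε ≤ 1, all errors are
O(n^(-γ/12)). -/

section

/-! ### Green's formula for the logarithm of a polynomial in the plane. -/

/-- The derivative of `h` in the direction `v`, as a function. -/
noncomputable def dirDeriv {E : Type*} [NormedAddCommGroup E] [NormedSpace ℝ E] (v : E)
    (h : E → ℂ) (u : E) : ℂ := fderiv ℝ h u v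

/-- The Laplacian of a function on `ℂ`, in the real sense. -/
noncomputable def lap (h : ℂ → ℂ) (u : ℂ) : ℂ :=
  dirDeriv 1 (dirDeriv 1 h) u + dirDeriv Complex.I (dirDeriv Complex.I h) u

section dirDeriv

variable {E : Type*} [NormedAddCommGroup E] [NormedSpace ℝ E]

theorem contDiff_dirDeriv {h : E → ℂ} (hh : ContDiff ℝ (⊤ : ℕ∞) h) (v : E) :
    ContDiff ℝ (⊤ : ℕ∞) (dirDeriv v h) :=
  (hh.fderiv_right (m := (⊤ : ℕ∞)) (by simp)).clm_apply contDiff_const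

theorem support_dirDeriv_subset (h : E → ℂ) (v : E) :
    Function.support (dirDeriv v h) ⊆ tsupport h := by
  intro u hu
  by_contra hn
  exact hu (by simp [dirDeriv, fderiv_of_notMem_tsupport ℝ hn])

theorem tsupport_dirDeriv_subset (h : E → ℂ) (v : E) : tsupport (dirDeriv v h) ⊆ tsupport h :=
  closure_minimal (support_dirDeriv_subset h v) (isClosed_tsupport h)

theorem hasCompactSupport_dirDeriv {h : E → ℂ} (hc : HasCompactSupport h) (v : E) :
    HasCompactSupport (dirDeriv v h) :=
  hc.of_isClosed_subset (isClosed_tsupport _) (tsupport_dirDeriv_subset h v)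

theorem integral_dirDeriv_mul [MeasurableSpace E] [BorelSpace E] [FiniteDimensional ℝ E]
    (μ : Measure E) [μ.IsAddHaarMeasure] {h g : E → ℂ} (hh : ContDiff ℝ (⊤ : ℕ∞) h)
    (hc : HasCompactSupport h) (hg : ContDiff ℝ (⊤ : ℕ∞) g) (v : E) :
    ∫ u, dirDeriv v h u * g u ∂μ = - ∫ u, h u * dirDeriv v g u ∂μ := by
  have hint : ∀ {p q : E → ℂ}, ContDiff ℝ (⊤ : ℕ∞) p → ContDiff ℝ (⊤ : ℕ∞) q →
      HasCompactSupport p → Integrable (fun u => p u * q u) μ := fun hp hq hpc =>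
    (hp.continuous.mul hq.continuous).integrable_of_hasCompactSupport hpc.mul_right
  have := integral_mul_fderiv_eq_neg_fderiv_mul_of_integrable (μ := μ) (f := h) (g := g) (v := v)
    (hint (contDiff_dirDeriv hh v) hg (hasCompactSupport_dirDeriv hc v))
    (hint hh (contDiff_dirDeriv hg v) hc) (hint hh hg hc)
    (fun x _ => (hh.differentiable (by simp)).differentiableAt)
    (fun x _ => (hg.differentiable (by simp)).differentiableAt)
  simp only [dirDeriv]
  rw [this, neg_neg]

end dirDeriv

theorem contDiff_lap {h : ℂ → ℂ} (hh : ContDiff ℝ (⊤ : ℕ∞) h) : ContDiff ℝ (⊤ : ℕ∞) (lap h) :=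
  (contDiff_dirDeriv (contDiff_dirDeriv hh _) _).add (contDiff_dirDeriv (contDiff_dirDeriv hh _) _)

theorem hasCompactSupport_lap {h : ℂ → ℂ} (hc : HasCompactSupport h) : HasCompactSupport (lap h) :=
  (hasCompactSupport_dirDeriv (hasCompactSupport_dirDeriv hc _) _).add
    (hasCompactSupport_dirDeriv (hasCompactSupport_dirDeriv hc _) _)

theorem integral_lap_mul {h g : ℂ → ℂ} (hh : ContDiff ℝ (⊤ : ℕ∞) h)
    (hc : HasCompactSupport h) (hg : ContDiff ℝ (⊤ : ℕ∞) g) :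
    ∫ u, lap h u * g u = ∫ u, h u * lap g u := by
  have hint : ∀ {p q : ℂ → ℂ}, ContDiff ℝ (⊤ : ℕ∞) p → ContDiff ℝ (⊤ : ℕ∞) q →
      HasCompactSupport p → Integrable (fun u => p u * q u) volume := fun hp hq hpc =>
    (hp.continuous.mul hq.continuous).integrable_of_hasCompactSupport hpc.mul_right
  have key : ∀ v : ℂ, ∫ u, dirDeriv v (dirDeriv v h) u * g u =
      ∫ u, h u * dirDeriv v (dirDeriv v g) u := by
    intro v
    rw [integral_dirDeriv_mul volume (contDiff_dirDeriv hh v) (hasCompactSupport_dirDeriv hc v) hg,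
      integral_dirDeriv_mul volume hh hc (contDiff_dirDeriv hg v), neg_neg]
  simp only [lap, add_mul, mul_add]
  rw [integral_add, integral_add, key, key]
  · exact hint hh (contDiff_dirDeriv (contDiff_dirDeriv hg _) _) hc
  · exact hint hh (contDiff_dirDeriv (contDiff_dirDeriv hg _) _) hc
  · exact hint (contDiff_dirDeriv (contDiff_dirDeriv hh _) _) hg
      (hasCompactSupport_dirDeriv (hasCompactSupport_dirDeriv hc _) _)
  · exact hint (contDiff_dirDeriv (contDiff_dirDeriv hh _) _) hg
      (hasCompactSupport_dirDeriv (hasCompactSupport_dirDeriv hc _) _)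

/-- The smooth approximation `½ log (|u|² + d²)` of `log |u|`. -/
noncomputable def regLog (d : ℝ) (u : ℂ) : ℝ := Real.log (u.re ^ 2 + u.im ^ 2 + d ^ 2) / 2

theorem contDiff_regLog {d : ℝ} (hd : 0 < d) :
    ContDiff ℝ (⊤ : ℕ∞) (fun u : ℂ => ((regLog d u : ℝ) : ℂ)) := by
  have h1 : ContDiff ℝ (⊤ : ℕ∞) (fun u : ℂ => u.re) := Complex.reCLM.contDiff
  have h2 : ContDiff ℝ (⊤ : ℕ∞) (fun u : ℂ => u.im) := Complex.imCLM.contDiff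
  refine Complex.ofRealCLM.contDiff.comp (f := fun u => regLog d u) ?_
  unfold regLog
  refine ContDiff.div_const (ContDiff.log (by fun_prop) (fun u => ?_)) 2
  positivity

/-- This density is the profile 2/(1 + |v|²)², of total mass 2π, rescaled to width d. Pairing with
it therefore recovers 2π h(0) as d → 0. -/
theorem lap_regLog {d : ℝ} (hd : 0 < d) (u : ℂ) :
    lap (fun u : ℂ => ((regLog d u : ℝ) : ℂ)) u
      = ((2 * d ^ 2 / (u.re ^ 2 + u.im ^ 2 + d ^ 2) ^ 2 : ℝ) : ℂ) := by
  have hre : ∀ u : ℂ, HasFDerivAt (fun u : ℂ => u.re) Complex.reCLM u :=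
    fun u => Complex.reCLM.hasFDerivAt
  have him : ∀ u : ℂ, HasFDerivAt (fun u : ℂ => u.im) Complex.imCLM u :=
    fun u => Complex.imCLM.hasFDerivAt
  have hD : ∀ u : ℂ, 0 < u.re ^ 2 + u.im ^ 2 + d ^ 2 := fun u => by positivity
  have hN : ∀ u : ℂ, HasFDerivAt (fun u : ℂ => u.re ^ 2 + u.im ^ 2 + d ^ 2)
      ((2 * u.re) • Complex.reCLM + (2 * u.im) • Complex.imCLM) u := by
    intro u
    have := (((hre u).pow 2).add ((him u).pow 2)).add_const (d ^ 2)
    simpa using this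
  have h1 : ∀ (v : ℂ), dirDeriv v (fun u : ℂ => ((regLog d u : ℝ) : ℂ)) =
      fun u => (((u.re * v.re + u.im * v.im) / (u.re ^ 2 + u.im ^ 2 + d ^ 2) : ℝ) : ℂ) := by
    intro v
    funext u
    have h2 : HasFDerivAt (fun u : ℂ => ((regLog d u : ℝ) : ℂ)) _ u :=
      Complex.ofRealCLM.hasFDerivAt.comp u (f := fun u => regLog d u)
        (((hN u).log (hD u).ne').mul_const (2⁻¹ : ℝ))
    unfold dirDeriv
    rw [h2.fderiv, ContinuousLinearMap.comp_apply, Complex.ofRealCLM_apply]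
    have := (hD u).ne'
    congr 1
    simp
    field_simp
  have h3 : ∀ (v : ℂ) (u : ℂ), dirDeriv v (dirDeriv v (fun u : ℂ => ((regLog d u : ℝ) : ℂ))) u =
      (((v.re ^ 2 + v.im ^ 2) / (u.re ^ 2 + u.im ^ 2 + d ^ 2) -
        2 * (u.re * v.re + u.im * v.im) ^ 2 / (u.re ^ 2 + u.im ^ 2 + d ^ 2) ^ 2 : ℝ) : ℂ) := by
    intro v u
    rw [h1]
    have hnum : HasFDerivAt (fun u : ℂ => u.re * v.re + u.im * v.im)
        (v.re • Complex.reCLM + v.im • Complex.imCLM) u :=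
      ((hre u).mul_const v.re).add ((him u).mul_const v.im)
    have hinv : HasFDerivAt (fun u : ℂ => (u.re ^ 2 + u.im ^ 2 + d ^ 2)⁻¹) _ u :=
      (hasDerivAt_inv (hD u).ne').comp_hasFDerivAt u (hN u)
    have h2 : HasFDerivAt (fun u : ℂ => (((u.re * v.re + u.im * v.im) /
      (u.re ^ 2 + u.im ^ 2 + d ^ 2) : ℝ) : ℂ)) _ u :=
      Complex.ofRealCLM.hasFDerivAt.comp u (f := fun u : ℂ => (u.re * v.re + u.im * v.im) *
        (u.re ^ 2 + u.im ^ 2 + d ^ 2)⁻¹) (hnum.mul hinv)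
    unfold dirDeriv
    rw [h2.fderiv, ContinuousLinearMap.comp_apply, Complex.ofRealCLM_apply]
    have := (hD u).ne'
    congr 1
    simp
    field_simp
    ring
  unfold lap
  rw [h3, h3]
  have := (hD u).ne'
  norm_cast
  simp
  field_simp
  ring

theorem log_norm_le_regLog {d : ℝ} {u : ℂ} (hu : u ≠ 0) : Real.log ‖u‖ ≤ regLog d u := by
  have h : ‖u‖ ^ 2 = u.re ^ 2 + u.im ^ 2 := by rw [Complex.sq_norm, Complex.normSq_apply]; ring
  have hp : 0 < ‖u‖ := norm_pos_iff.2 hu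
  have : Real.log ‖u‖ = Real.log (‖u‖ ^ 2) / 2 := by rw [Real.log_pow]; push_cast; ring
  rw [this, regLog, h]
  have : 0 < u.re ^ 2 + u.im ^ 2 := h ▸ by positivity
  have := Real.log_le_log this (le_add_of_nonneg_right (sq_nonneg d))
  linarith

theorem tendsto_regLog {u : ℂ} (hu : u ≠ 0) :
    Filter.Tendsto (fun d : ℝ => regLog d u) (nhds 0) (nhds (Real.log ‖u‖)) := by
  have h : ‖u‖ ^ 2 = u.re ^ 2 + u.im ^ 2 := by rw [Complex.sq_norm, Complex.normSq_apply]; ring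
  have hp : 0 < ‖u‖ := norm_pos_iff.2 hu
  have h0 : Real.log ‖u‖ = regLog 0 u := by
    rw [regLog, ← h]; simp
  rw [h0]
  have : ContinuousAt (fun d : ℝ => regLog d u) 0 := by
    unfold regLog
    refine ContinuousAt.div_const (ContinuousAt.log (by fun_prop) ?_) 2
    have : 0 < u.re ^ 2 + u.im ^ 2 := h ▸ by positivity
    simpa using this.ne'
  exact this

/-- In polar coordinates the Jacobian t cancels the singularity t⁻¹. All integrability of logarithms
below rests on this, since |log t| ≤ t⁻¹ + t. -/
theorem integrableOn_norm_inv_ball (r : ℝ) :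
    IntegrableOn (fun u : ℂ => ‖u‖⁻¹) (Metric.ball 0 r) := by
  rw [integrableOn_fun_norm_addHaar (E := ℂ) volume (f := fun t => t⁻¹)]
  simp only [Complex.finrank_real_complex, Nat.add_one_sub_one, pow_one, smul_eq_mul]
  refine IntegrableOn.congr_fun (f := fun _ => (1 : ℝ)) ?_ (fun x hx => ?_) measurableSet_Ioo
  · simp
  · exact (mul_inv_cancel₀ hx.1.ne').symm

theorem abs_log_le_inv_add {t : ℝ} (ht : 0 < t) : |Real.log t| ≤ t⁻¹ + t := by
  rw [abs_le]
  constructor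
  · have := Real.log_le_sub_one_of_pos (inv_pos.2 ht)
    rw [Real.log_inv] at this
    linarith
  · have := Real.log_le_sub_one_of_pos ht
    have := inv_pos.2 ht
    linarith

theorem locallyIntegrable_log_norm : LocallyIntegrable (fun u : ℂ => Real.log ‖u‖) := by
  rw [locallyIntegrable_iff]
  intro K hK
  obtain ⟨r, hr⟩ := hK.isBounded.subset_ball 0
  have h1 : IntegrableOn (fun u : ℂ => ‖u‖⁻¹ + ‖u‖) (Metric.ball 0 r) :=
    (integrableOn_norm_inv_ball r).add
      ((continuous_norm.continuousOn.integrableOn_compact (isCompact_closedBall 0 r)).mono_set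
        Metric.ball_subset_closedBall)
  refine IntegrableOn.mono_set ?_ hr
  refine Integrable.mono' h1
    (Real.measurable_log.comp measurable_norm).aestronglyMeasurable (Filter.Eventually.of_forall (fun u => ?_))
  by_cases hu : u = 0
  · simp [hu]
  · exact abs_log_le_inv_add (norm_pos_iff.2 hu)

/-- In polar coordinates the radial density 2t/(t² + 1)² is the derivative of -1/(t² + 1). -/
theorem integrable_inv_sq_and_integral :
    Integrable (fun v : ℂ => 2 / (v.re ^ 2 + v.im ^ 2 + 1) ^ 2) ∧
      ∫ v : ℂ, 2 / (v.re ^ 2 + v.im ^ 2 + 1) ^ 2 = 2 * Real.pi := by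
  have h0 : ∀ v : ℂ, 2 / (v.re ^ 2 + v.im ^ 2 + 1) ^ 2 =
      (fun t : ℝ => 2 / (t ^ 2 + 1) ^ 2) ‖v‖ := by
    intro v
    simp only [Complex.sq_norm, Complex.normSq_apply]
    ring
  have hd : ∀ x ∈ Set.Ioi (0 : ℝ), HasDerivAt (fun t : ℝ => - (t ^ 2 + 1)⁻¹)
      (x * (2 / (x ^ 2 + 1) ^ 2)) x := by
    intro x _
    have h1 : HasDerivAt (fun t : ℝ => t ^ 2 + 1) (2 * x) x := by
      simpa using (hasDerivAt_pow 2 x).add_const 1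
    have := (h1.inv (by positivity)).neg
    refine this.congr_deriv ?_
    ring
  have hlim : Filter.Tendsto (fun t : ℝ => - (t ^ 2 + 1)⁻¹) Filter.atTop (nhds (-0)) := by
    refine (Filter.Tendsto.inv_tendsto_atTop ?_).neg
    exact Filter.tendsto_atTop_add_const_right _ _ (Filter.tendsto_pow_atTop (by norm_num))
  have hcont : ContinuousWithinAt (fun t : ℝ => - (t ^ 2 + 1)⁻¹) (Set.Ici 0) 0 :=
    (ContinuousAt.neg (ContinuousAt.inv₀ (by fun_prop) (by norm_num))).continuousWithinAt
  have hpos : ∀ x ∈ Set.Ioi (0 : ℝ), 0 ≤ x * (2 / (x ^ 2 + 1) ^ 2) := by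
    intro x hx
    have : (0 : ℝ) < x := hx
    positivity
  constructor
  · simp only [h0]
    rw [integrable_fun_norm_addHaar (E := ℂ) volume (f := fun t => 2 / (t ^ 2 + 1) ^ 2)]
    simp only [Complex.finrank_real_complex, Nat.add_one_sub_one, pow_one, smul_eq_mul]
    exact integrableOn_Ioi_deriv_of_nonneg hcont hd hpos hlim
  · simp only [h0]
    rw [integral_fun_norm_addHaar (E := ℂ) volume (f := fun t => 2 / (t ^ 2 + 1) ^ 2)]
    simp only [Complex.finrank_real_complex, Nat.add_one_sub_one, pow_one, smul_eq_mul]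
    rw [integral_Ioi_of_hasDerivAt_of_nonneg hcont hd hpos hlim]
    simp [Measure.real]

/-- The integral of Δh against `regLog d` is evaluated twice in the limit d → 0. Directly it tends
to the integral against log|u|. After moving the Laplacian onto `regLog d`, it is an average of h
over an approximate identity of mass 2π. -/
theorem integral_lap_mul_log_norm {h : ℂ → ℂ} (hh : ContDiff ℝ (⊤ : ℕ∞) h)
    (hc : HasCompactSupport h) :
    ∫ u, lap h u * (Real.log ‖u‖ : ℂ) = 2 * Real.pi * h 0 := by
  let d : ℕ → ℝ := fun N => 1 / ((N : ℝ) + 1)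
  have hd : ∀ N, 0 < d N := fun N => by positivity
  have hd1 : ∀ N, d N ≤ 1 := fun N => by
    simp only [d]; rw [div_le_one (by positivity)]; linarith [(Nat.cast_nonneg N : (0:ℝ) ≤ N)]
  have hd0 : Filter.Tendsto d Filter.atTop (nhds 0) := tendsto_one_div_add_atTop_nhds_zero_nat
  have hne : ∀ᵐ u : ℂ, u ≠ 0 := by
    simp [ae_iff]
  have hlapc := (contDiff_lap hh).continuous
  have hlaps := hasCompactSupport_lap hc
  have lim1 : Filter.Tendsto (fun N => ∫ u, lap h u * ((regLog (d N) u : ℝ) : ℂ)) Filter.atTop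
      (nhds (∫ u, lap h u * (Real.log ‖u‖ : ℂ))) := by
    -- Domination uniform in d ≤ 1: `regLog d` lies above log|u|, and below |u|² + 1 because log t ≤
    -- t - 1.
    have hb : Integrable (fun u : ℂ => ‖lap h u‖ * (|Real.log ‖u‖| + (‖u‖ ^ 2 + 1))) := by
      have : LocallyIntegrable (fun u : ℂ => |Real.log ‖u‖| + (‖u‖ ^ 2 + 1)) :=
        LocallyIntegrable.add (fun x => (locallyIntegrable_log_norm x).norm)
          (Continuous.locallyIntegrable (by fun_prop))
      exact this.integrable_smul_left_of_hasCompactSupport hlapc.norm hlaps.norm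
    refine tendsto_integral_of_dominated_convergence _ (fun N => ?_) hb (fun N => ?_) ?_
    · exact (hlapc.mul (contDiff_regLog (hd N)).continuous).aestronglyMeasurable
    · filter_upwards [hne] with u hu
      rw [norm_mul]
      gcongr
      rw [Complex.norm_real, Real.norm_eq_abs]
      have h1 := log_norm_le_regLog (d := d N) hu
      have h2 : regLog (d N) u ≤ ‖u‖ ^ 2 + 1 := by
        have h : ‖u‖ ^ 2 = u.re ^ 2 + u.im ^ 2 := by
          rw [Complex.sq_norm, Complex.normSq_apply]; ring
        rw [h]
        unfold regLog
        have h3 : 0 < u.re ^ 2 + u.im ^ 2 + d N ^ 2 := by have := hd N; positivity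
        have h4 := Real.log_le_sub_one_of_pos h3
        have h5 : d N ^ 2 ≤ 1 := pow_le_one₀ (hd N).le (hd1 N)
        nlinarith [sq_nonneg u.re, sq_nonneg u.im]
      rw [abs_le]
      constructor
      · have := neg_abs_le (Real.log ‖u‖)
        nlinarith [sq_nonneg ‖u‖]
      · have := abs_nonneg (Real.log ‖u‖)
        linarith
    · filter_upwards [hne] with u hu
      exact (((Complex.continuous_ofReal.tendsto _).comp
        ((tendsto_regLog hu).comp hd0))).const_mul _
  -- The substitution u = d v makes the profile independent of d and moves all dependence on d into
  -- h(d v).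
  have hval : ∀ N, ∫ u, lap h u * ((regLog (d N) u : ℝ) : ℂ) =
      ∫ v : ℂ, h (d N • v) * ((2 / (v.re ^ 2 + v.im ^ 2 + 1) ^ 2 : ℝ) : ℂ) := by
    intro N
    rw [integral_lap_mul hh hc (contDiff_regLog (hd N))]
    have := Measure.integral_comp_smul (volume : Measure ℂ)
      (fun u => h u * ((2 * d N ^ 2 / (u.re ^ 2 + u.im ^ 2 + d N ^ 2) ^ 2 : ℝ) : ℂ)) (d N)
    rw [Complex.finrank_real_complex, abs_of_pos (by have := hd N; positivity),
      eq_inv_smul_iff₀ (by have := hd N; positivity)] at this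
    simp only [lap_regLog (hd N)]
    rw [← this, ← integral_smul]
    refine integral_congr_ae (Filter.Eventually.of_forall (fun v => ?_))
    have hne := (hd N).ne'
    have h1 : (d N * v.re) ^ 2 + (d N * v.im) ^ 2 + d N ^ 2 =
      d N ^ 2 * (v.re ^ 2 + v.im ^ 2 + 1) := by ring
    simp only [Complex.real_smul]
    rw [mul_left_comm, ← Complex.ofReal_mul, Complex.re_ofReal_mul, Complex.im_ofReal_mul, h1]
    congr 2
    field_simp
  have lim2 : Filter.Tendsto (fun N => ∫ u, lap h u * ((regLog (d N) u : ℝ) : ℂ)) Filter.atTop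
      (nhds (∫ v : ℂ, h 0 * ((2 / (v.re ^ 2 + v.im ^ 2 + 1) ^ 2 : ℝ) : ℂ))) := by
    simp only [hval]
    obtain ⟨M, hM⟩ := hh.continuous.bounded_above_of_compact_support hc
    refine tendsto_integral_of_dominated_convergence
      (fun v : ℂ => M * (2 / (v.re ^ 2 + v.im ^ 2 + 1) ^ 2)) (fun N => ?_)
      (integrable_inv_sq_and_integral.1.const_mul M) (fun N => ?_) ?_
    · refine (Continuous.mul (hh.continuous.comp (by fun_prop)) ?_).aestronglyMeasurable
      refine Complex.continuous_ofReal.comp (Continuous.div (by fun_prop) (by fun_prop) ?_)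
      intro v
      positivity
    · refine Filter.Eventually.of_forall (fun v => ?_)
      rw [norm_mul, Complex.norm_real, Real.norm_of_nonneg (by positivity)]
      gcongr
      exact hM _
    · refine Filter.Eventually.of_forall (fun v => ?_)
      refine Filter.Tendsto.mul_const _ ?_
      have : Filter.Tendsto (fun N => d N • v) Filter.atTop (nhds (0 : ℂ)) := by
        simpa using hd0.smul_const v
      exact (hh.continuous.tendsto 0).comp this
  rw [tendsto_nhds_unique lim1 lim2, integral_const_mul, integral_complex_ofReal,
    integrable_inv_sq_and_integral.2]
  push_cast
  ring

theorem dirDeriv_comp_add_right {E : Type*} [NormedAddCommGroup E] [NormedSpace ℝ E] (v a : E)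
    (h : E → ℂ) : dirDeriv v (fun u => h (u + a)) = fun u => dirDeriv v h (u + a) := by
  funext u
  simp only [dirDeriv, fderiv_comp_add_right]

theorem integral_lap_mul_log_norm_sub {h : ℂ → ℂ} (hh : ContDiff ℝ (⊤ : ℕ∞) h)
    (hc : HasCompactSupport h) (ζ : ℂ) :
    ∫ u, lap h u * (Real.log ‖u - ζ‖ : ℂ) = 2 * Real.pi * h ζ := by
  have h1 := integral_lap_mul_log_norm (h := fun u => h (u + ζ))
    (hh.comp (contDiff_id.add contDiff_const)) (hc.comp_homeomorph (Homeomorph.addRight ζ))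
  rw [zero_add] at h1
  rw [← h1, ← integral_add_right_eq_self _ ζ]
  simp only [lap, dirDeriv_comp_add_right, add_sub_cancel_right]

/-- Real affine functions are harmonic. This is what allows tilting: dividing a polynomial by the
exponential of such a function does not affect Green's formula. -/
theorem integral_lap_mul_affine {h : ℂ → ℂ} (hh : ContDiff ℝ (⊤ : ℕ∞) h)
    (hc : HasCompactSupport h) (c : ℝ) (b : ℂ) :
    ∫ u, lap h u * ((c + (b * u).re : ℝ) : ℂ) = 0 := by
  let L : ℂ →L[ℝ] ℂ := Complex.ofRealCLM.comp (Complex.reCLM.comp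
    (ContinuousLinearMap.mul ℝ ℂ b))
  have hL : ∀ u : ℂ, ((c + (b * u).re : ℝ) : ℂ) = (c : ℂ) + L u := fun u => by simp [L]
  have hd : ∀ v, dirDeriv v (fun u : ℂ => (c : ℂ) + L u) = fun _ => L v := by
    intro v
    funext u
    simp [dirDeriv]
  simp only [hL]
  rw [integral_lap_mul hh hc (contDiff_const.add L.contDiff)]
  have : ∀ u, lap (fun u : ℂ => (c : ℂ) + L u) u = 0 := by
    intro u
    simp only [lap, hd]
    simp [dirDeriv]
  simp [this]

theorem locallyIntegrable_log_norm_sub (ζ : ℂ) :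
    LocallyIntegrable (fun u : ℂ => Real.log ‖u - ζ‖) := by
  rw [locallyIntegrable_iff]
  intro K hK
  have hK' : IsCompact ((fun u => u - ζ) '' K) := hK.image (by fun_prop)
  have h1 := (locallyIntegrable_iff.1 locallyIntegrable_log_norm) _ hK'
  have hmp : MeasurePreserving (fun u : ℂ => u - ζ) volume volume :=
    measurePreserving_sub_right volume ζ
  have h2 := (hmp.integrableOn_comp_preimage
    (MeasurableEquiv.subRight ζ).measurableEmbedding).2 h1
  exact h2.mono_set (Set.subset_preimage_image _ _)

section roots

variable {p : Polynomial ℂ} {d : ℕ} {r : Fin d → ℂ}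

theorem eval_eq_prod_roots (hr : p.roots = Finset.univ.val.map r) (u : ℂ) :
    p.eval u = p.leadingCoeff * ∏ i, (u - r i) := by
  conv_lhs => rw [(IsAlgClosed.splits p).eq_prod_roots, hr]
  rw [Multiset.map_map, Polynomial.eval_mul, Polynomial.eval_C]
  change _ * Polynomial.eval u (∏ i, (Polynomial.X - Polynomial.C (r i))) = _
  simp [Polynomial.eval_prod]

theorem log_norm_eval (hp : p ≠ 0) (hr : p.roots = Finset.univ.val.map r) {u : ℂ}
    (hu : ∀ i, u ≠ r i) :
    Real.log ‖p.eval u‖ = Real.log ‖p.leadingCoeff‖ + ∑ i, Real.log ‖u - r i‖ := by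
  have hprod : ∀ i, u - r i ≠ 0 := fun i => sub_ne_zero.2 (hu i)
  rw [eval_eq_prod_roots hr, norm_mul, norm_prod, Real.log_mul, Real.log_prod]
  · exact fun i _ => norm_ne_zero_iff.2 (hprod i)
  · simpa using hp
  · exact Finset.prod_ne_zero_iff.2 (fun i _ => norm_ne_zero_iff.2 (hprod i))

theorem ae_forall_ne (r : Fin d → ℂ) : ∀ᵐ u : ℂ, ∀ i, u ≠ r i :=
  ae_all_iff.2 (fun i => by simp [ae_iff])

theorem locallyIntegrable_log_norm_eval (hp : p ≠ 0) (hr : p.roots = Finset.univ.val.map r) :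
    LocallyIntegrable (fun u : ℂ => Real.log ‖p.eval u‖) := by
  have h1 : LocallyIntegrable (fun u : ℂ => Real.log ‖p.leadingCoeff‖ +
      ∑ i, Real.log ‖u - r i‖) :=
    (Continuous.locallyIntegrable continuous_const).add
      (by
        have := locallyIntegrable_finsetSum (μ := volume) Finset.univ
          (f := fun i (u : ℂ) => Real.log ‖u - r i‖)
          (fun i _ => locallyIntegrable_log_norm_sub (r i))
        simpa using this)
  refine h1.congr ?_
  filter_upwards [ae_forall_ne r] with u hu
  exact (log_norm_eval hp hr hu).symm

/-- Off the zeros, log|p| is a constant plus ∑ log|u - rᵢ|. The constant joins the affine term,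
which contributes nothing, and each root contributes 2π h(rᵢ). -/
theorem integral_lap_mul_log_norm_eval {h : ℂ → ℂ} (hh : ContDiff ℝ (⊤ : ℕ∞) h)
    (hc : HasCompactSupport h) (hp : p ≠ 0) (hr : p.roots = Finset.univ.val.map r)
    (c : ℝ) (b : ℂ) :
    ∫ u, lap h u * ((Real.log ‖p.eval u‖ - (c + (b * u).re) : ℝ) : ℂ) =
      2 * Real.pi * ∑ i, h (r i) := by
  have hI : ∀ {g : ℂ → ℝ}, LocallyIntegrable g →
      Integrable (fun u => lap h u * ((g u : ℝ) : ℂ)) := by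
    intro g hg
    have h1 : LocallyIntegrable (fun u => ((g u : ℝ) : ℂ)) := fun x => by
      obtain ⟨K, hK, hgK⟩ := hg x
      exact ⟨K, hK, hgK.ofReal⟩
    exact h1.integrable_smul_left_of_hasCompactSupport (contDiff_lap hh).continuous
      (hasCompactSupport_lap hc)
  have h1 : ∫ u, lap h u * ((Real.log ‖p.eval u‖ - (c + (b * u).re) : ℝ) : ℂ) =
      ∫ u, (∑ i, lap h u * ((Real.log ‖u - r i‖ : ℝ) : ℂ)) -
        lap h u * (((c - Real.log ‖p.leadingCoeff‖) + (b * u).re : ℝ) : ℂ) := by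
    refine integral_congr_ae ?_
    filter_upwards [ae_forall_ne r] with u hu
    rw [log_norm_eval hp hr hu]
    push_cast
    rw [← Finset.mul_sum]
    ring
  rw [h1, integral_sub, integral_lap_mul_affine hh hc, integral_finsetSum, Finset.mul_sum]
  · simp only [integral_lap_mul_log_norm_sub hh hc, sub_zero]
  · exact fun i _ => hI (locallyIntegrable_log_norm_sub _)
  · exact integrable_finsetSum _ (fun i _ => hI (locallyIntegrable_log_norm_sub _))
  · exact hI (Continuous.locallyIntegrable (by fun_prop))

end roots

end

/-! ### Iterated Laplacians and Green's formula in several complex variables. -/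

section

theorem exists_support_subset_closedBall {E : Type*} [NormedAddCommGroup E] {H : E → ℂ}
    (hc : HasCompactSupport H) : ∃ R : ℝ, 0 < R ∧ Function.support H ⊆ Metric.closedBall 0 R := by
  obtain ⟨R, hR⟩ := hc.isCompact.isBounded.subset_closedBall 0
  exact ⟨max R 1, by positivity, (subset_tsupport H).trans
    (hR.trans (Metric.closedBall_subset_closedBall (le_max_left _ _)))⟩

theorem dirDeriv_comp_affine {E F : Type*} [NormedAddCommGroup E] [NormedSpace ℝ E]
    [NormedAddCommGroup F] [NormedSpace ℝ F] (L : E →L[ℝ] F) (c : F) {H : F → ℂ}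
    (hH : ContDiff ℝ (⊤ : ℕ∞) H) (w : E) :
    dirDeriv w (fun v => H (L v + c)) = fun v => dirDeriv (L w) H (L v + c) := by
  funext v
  have h1 : HasFDerivAt (fun v => L v + c) L v := L.hasFDerivAt.add_const c
  have h2 := ((hH.differentiable (by simp)).differentiableAt (x := L v + c)).hasFDerivAt.comp v h1
  have h3 : fderiv ℝ (fun v => H (L v + c)) v = _ := h2.fderiv
  simp [dirDeriv, h3]

section

variable {m : ℕ}

/-- The Laplacian in the `q`-th complex variable. -/
noncomputable def lapAt (q : Fin m) (H : (Fin m → ℂ) → ℂ) (u : Fin m → ℂ) : ℂ :=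
  dirDeriv (Pi.single q 1) (dirDeriv (Pi.single q 1) H) u +
    dirDeriv (Pi.single q Complex.I) (dirDeriv (Pi.single q Complex.I) H) u

/-- The composition of the Laplacians in the variables listed in `l`. -/
noncomputable def lapList (l : List (Fin m)) (H : (Fin m → ℂ) → ℂ) : (Fin m → ℂ) → ℂ :=
  l.foldr lapAt H

theorem contDiff_lapAt (q : Fin m) {H : (Fin m → ℂ) → ℂ} (hH : ContDiff ℝ (⊤ : ℕ∞) H) :
    ContDiff ℝ (⊤ : ℕ∞) (lapAt q H) :=
  (contDiff_dirDeriv (contDiff_dirDeriv hH _) _).add (contDiff_dirDeriv (contDiff_dirDeriv hH _) _)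

theorem tsupport_lapAt_subset (q : Fin m) (H : (Fin m → ℂ) → ℂ) :
    tsupport (lapAt q H) ⊆ tsupport H := by
  refine (tsupport_add _ _).trans (Set.union_subset ?_ ?_) <;>
  exact (tsupport_dirDeriv_subset _ _).trans (tsupport_dirDeriv_subset _ _)

theorem contDiff_lapList (l : List (Fin m)) {H : (Fin m → ℂ) → ℂ} (hH : ContDiff ℝ (⊤ : ℕ∞) H) :
    ContDiff ℝ (⊤ : ℕ∞) (lapList l H) := by
  induction l with
  | nil => exact hH
  | cons q l ih => exact contDiff_lapAt q ih

theorem tsupport_lapList_subset (l : List (Fin m)) (H : (Fin m → ℂ) → ℂ) :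
    tsupport (lapList l H) ⊆ tsupport H := by
  induction l with
  | nil => exact subset_rfl
  | cons q l ih => exact (tsupport_lapAt_subset q _).trans ih

theorem hasCompactSupport_lapList (l : List (Fin m)) {H : (Fin m → ℂ) → ℂ}
    (hc : HasCompactSupport H) : HasCompactSupport (lapList l H) :=
  hc.of_isClosed_subset (isClosed_tsupport _) (tsupport_lapList_subset l H)

theorem norm_iteratedFDeriv_dirDeriv_le {E : Type*} [NormedAddCommGroup E] [NormedSpace ℝ E]
    {H : E → ℂ} (hH : ContDiff ℝ (⊤ : ℕ∞) H) (v : E) (j : ℕ) (u : E) :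
    ‖iteratedFDeriv ℝ j (dirDeriv v H) u‖ ≤ ‖v‖ * ‖iteratedFDeriv ℝ (j + 1) H u‖ := by
  have h1 : ContDiff ℝ (⊤ : ℕ∞) (fderiv ℝ H) := hH.fderiv_right (m := (⊤ : ℕ∞)) (by simp)
  have h2 := norm_iteratedFDeriv_clm_apply_const (f := fderiv ℝ H) (c := v) (x := u) (n := j)
    (N := (⊤ : ℕ∞)) h1.contDiffAt (by exact_mod_cast le_top)
  rw [norm_iteratedFDeriv_fderiv] at h2
  exact h2

/-- The factor 2 counts the real and the imaginary direction, each a vector of norm one for the sup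
norm. -/
theorem norm_iteratedFDeriv_lapAt_le (q : Fin m) {H : (Fin m → ℂ) → ℂ}
    (hH : ContDiff ℝ (⊤ : ℕ∞) H) (j : ℕ) (u : Fin m → ℂ) :
    ‖iteratedFDeriv ℝ j (lapAt q H) u‖ ≤ 2 * ‖iteratedFDeriv ℝ (j + 2) H u‖ := by
  have hb : ∀ w : ℂ, ‖w‖ ≤ 1 → ‖iteratedFDeriv ℝ j
      (dirDeriv (Pi.single q w) (dirDeriv (Pi.single q w) H)) u‖ ≤
        ‖iteratedFDeriv ℝ (j + 2) H u‖ := fun w hw =>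
    have hw' : ‖(Pi.single q w : Fin m → ℂ)‖ ≤ 1 := by rwa [Pi.norm_single]
    ((norm_iteratedFDeriv_dirDeriv_le (contDiff_dirDeriv hH _) _ _ _).trans
      (mul_le_of_le_one_left (norm_nonneg _) hw')).trans
      ((norm_iteratedFDeriv_dirDeriv_le hH _ _ _).trans
      (mul_le_of_le_one_left (norm_nonneg _) hw'))
  have hj : ((j : ℕ∞) : WithTop ℕ∞) ≤ ((⊤ : ℕ∞) : WithTop ℕ∞) := by exact_mod_cast le_top
  have hadd := iteratedFDeriv_add_apply (𝕜 := ℝ) (i := j) (x := u)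
    (f := dirDeriv (Pi.single q 1) (dirDeriv (Pi.single q 1) H))
    (g := dirDeriv (Pi.single q Complex.I) (dirDeriv (Pi.single q Complex.I) H))
    ((contDiff_dirDeriv (contDiff_dirDeriv hH _) _).of_le hj).contDiffAt
    ((contDiff_dirDeriv (contDiff_dirDeriv hH _) _).of_le hj).contDiffAt
  have : lapAt q H = dirDeriv (Pi.single q 1) (dirDeriv (Pi.single q 1) H) +
    dirDeriv (Pi.single q Complex.I) (dirDeriv (Pi.single q Complex.I) H) := rfl
  rw [this, hadd, two_mul]
  exact (norm_add_le _ _).trans (add_le_add (hb 1 (by simp)) (hb Complex.I (by simp)))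

theorem norm_lapList_le (l : List (Fin m)) {H : (Fin m → ℂ) → ℂ}
    (hH : ContDiff ℝ (⊤ : ℕ∞) H) (j : ℕ) (u : Fin m → ℂ) :
    ‖iteratedFDeriv ℝ j (lapList l H) u‖ ≤
      2 ^ l.length * ‖iteratedFDeriv ℝ (j + 2 * l.length) H u‖ := by
  induction l generalizing j with
  | nil => simp [lapList]
  | cons q l ih =>
    refine (norm_iteratedFDeriv_lapAt_le q (contDiff_lapList l hH) j u).trans ?_
    calc _ ≤ 2 * (2 ^ l.length * ‖iteratedFDeriv ℝ (j + 2 + 2 * l.length) H u‖) := by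
          gcongr; exact ih (j + 2)
      _ = _ := by
        rw [List.length_cons, show j + 2 + 2 * l.length = j + 2 * (l.length + 1) by ring]
        ring

/-- A ball of the sup norm is a product of discs, so each factor may be cut off to its own disc. The
product is then a product of integrable functions of separate variables. -/
theorem integrable_mul_prod {K : (Fin m → ℂ) → ℂ} (hK : Continuous K) (hc : HasCompactSupport K)
    {ℓ : Fin m → ℂ → ℝ} (hℓ : ∀ q, LocallyIntegrable (ℓ q)) :
    Integrable (fun u => K u * ((∏ q, ℓ q (u q) : ℝ) : ℂ)) := by
  obtain ⟨R, hR0, hR⟩ := exists_support_subset_closedBall hc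
  obtain ⟨M, hM⟩ := hK.bounded_above_of_compact_support hc
  let g : Fin m → ℂ → ℂ := fun q => (Metric.closedBall (0 : ℂ) R).indicator (fun w => (ℓ q w : ℂ))
  have hg : ∀ q, Integrable (g q) := fun q =>
    ((integrable_indicator_iff measurableSet_closedBall).2
      (((hℓ q).integrableOn_isCompact (isCompact_closedBall 0 R)).ofReal))
  have h1 : Integrable (fun u : Fin m → ℂ => ∏ q, g q (u q)) := Integrable.fintype_prod hg
  have h2 : Integrable (fun u => K u * ∏ q, g q (u q)) :=
    h1.bdd_mul hK.aestronglyMeasurable (Filter.Eventually.of_forall hM)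
  refine h2.congr (Filter.Eventually.of_forall (fun u => ?_))
  by_cases hu : K u = 0
  · simp [hu]
  · have hu' : ‖u‖ ≤ R := by simpa using hR (Function.mem_support.2 hu)
    have : ∀ q, g q (u q) = (ℓ q (u q) : ℂ) := fun q =>
      Set.indicator_of_mem (by simpa using (norm_le_pi_norm u q).trans hu') _
    simp [this]

end

/-- `v ↦ Fin.cons a v` is affine. -/
theorem fin_cons_eq_affine {m : ℕ} (a : ℂ) (v : Fin m → ℂ) :
    (Fin.cons a v : Fin (m + 1) → ℂ) =
      (ContinuousLinearMap.pi (fun i : Fin (m + 1) => Fin.cases (motive := fun _ =>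
        (Fin m → ℂ) →L[ℝ] ℂ) 0 (fun q => ContinuousLinearMap.proj q) i)) v + Pi.single 0 a := by
  funext i
  refine Fin.cases ?_ (fun q => ?_) i
  · simp
  · simp

theorem lapAt_succ_cons {m : ℕ} (q : Fin m) {H : (Fin (m + 1) → ℂ) → ℂ}
    (hH : ContDiff ℝ (⊤ : ℕ∞) H) (a : ℂ) :
    lapAt q (fun v => H (Fin.cons a v)) = fun v => lapAt q.succ H (Fin.cons a v) := by
  funext v
  have hs : ∀ w : ℂ, (ContinuousLinearMap.pi (fun i : Fin (m + 1) => Fin.cases (motive := fun _ =>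
        (Fin m → ℂ) →L[ℝ] ℂ) 0 (fun q => ContinuousLinearMap.proj q) i)) (Pi.single q w)
        = Pi.single q.succ w := by
    intro w
    funext i
    refine Fin.cases ?_ (fun j => ?_) i
    · simp
    · simp [Pi.single_apply]
  simp only [lapAt, fin_cons_eq_affine]
  rw [dirDeriv_comp_affine _ _ hH, dirDeriv_comp_affine _ _ hH,
    dirDeriv_comp_affine _ _ (contDiff_dirDeriv hH _),
    dirDeriv_comp_affine _ _ (contDiff_dirDeriv hH _)]
  simp only [hs]

theorem lapList_map_succ_cons {m : ℕ} (l : List (Fin m)) {H : (Fin (m + 1) → ℂ) → ℂ}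
    (hH : ContDiff ℝ (⊤ : ℕ∞) H) (a : ℂ) :
    lapList l (fun v => H (Fin.cons a v)) =
      fun v => lapList (l.map Fin.succ) H (Fin.cons a v) := by
  induction l with
  | nil => rfl
  | cons q l ih =>
    change lapAt q (lapList l _) = _
    rw [ih, lapAt_succ_cons q (contDiff_lapList _ hH)]
    rfl

theorem lap_cons {m : ℕ} {H : (Fin (m + 1) → ℂ) → ℂ} (hH : ContDiff ℝ (⊤ : ℕ∞) H)
    (v : Fin m → ℂ) (a : ℂ) :
    lap (fun a => H (Fin.cons a v)) a = lapAt 0 H (Fin.cons a v) := by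
  let L : ℂ →L[ℝ] (Fin (m + 1) → ℂ) := ContinuousLinearMap.single ℝ (fun _ => ℂ) 0
  obtain ⟨c, h1⟩ : ∃ c, ∀ a : ℂ, (Fin.cons a v : Fin (m + 1) → ℂ) = L a + c := by
    refine ⟨Fin.cons 0 v, fun a => funext fun i => ?_⟩
    refine Fin.cases ?_ (fun q => ?_) i
    · simp [L]
    · simp [L]
  simp only [lap, lapAt, h1]
  rw [dirDeriv_comp_affine _ _ hH, dirDeriv_comp_affine _ _ hH,
    dirDeriv_comp_affine _ _ (contDiff_dirDeriv hH _),
    dirDeriv_comp_affine _ _ (contDiff_dirDeriv hH _)]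
  rfl

theorem contDiff_cons_left {m : ℕ} {H : (Fin (m + 1) → ℂ) → ℂ} (hH : ContDiff ℝ (⊤ : ℕ∞) H)
    (a : ℂ) : ContDiff ℝ (⊤ : ℕ∞) (fun v => H (Fin.cons a v)) := by
  simp only [fin_cons_eq_affine]
  exact hH.comp ((ContinuousLinearMap.contDiff _).add contDiff_const)

theorem contDiff_cons_right {m : ℕ} {H : (Fin (m + 1) → ℂ) → ℂ} (hH : ContDiff ℝ (⊤ : ℕ∞) H)
    (v : Fin m → ℂ) : ContDiff ℝ (⊤ : ℕ∞) (fun a => H (Fin.cons a v)) := by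
  refine hH.comp (contDiff_pi.2 (fun i => ?_))
  refine Fin.cases ?_ (fun q => ?_) i
  · simpa using! contDiff_id
  · simpa using contDiff_const

theorem hasCompactSupport_cons_left {m : ℕ} {H : (Fin (m + 1) → ℂ) → ℂ} (hc : HasCompactSupport H)
    (a : ℂ) : HasCompactSupport (fun v => H (Fin.cons a v)) := by
  obtain ⟨R, hR0, hR⟩ := exists_support_subset_closedBall hc
  refine HasCompactSupport.of_support_subset_isCompact (isCompact_closedBall 0 R) (fun v hv => ?_)
  have h1 : ‖(Fin.cons a v : Fin (m + 1) → ℂ)‖ ≤ R := by simpa using hR hv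
  rw [mem_closedBall_zero_iff, pi_norm_le_iff_of_nonneg hR0.le]
  intro q
  simpa using (norm_le_pi_norm (Fin.cons a v : Fin (m + 1) → ℂ) q.succ).trans h1

theorem hasCompactSupport_cons_right {m : ℕ} {H : (Fin (m + 1) → ℂ) → ℂ} (hc : HasCompactSupport H)
    (v : Fin m → ℂ) : HasCompactSupport (fun a => H (Fin.cons a v)) := by
  obtain ⟨R, hR0, hR⟩ := exists_support_subset_closedBall hc
  refine HasCompactSupport.of_support_subset_isCompact (isCompact_closedBall 0 R) (fun a ha => ?_)
  have h1 : ‖(Fin.cons a v : Fin (m + 1) → ℂ)‖ ≤ R := by simpa using hR ha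
  rw [mem_closedBall_zero_iff]
  simpa using (norm_le_pi_norm (Fin.cons a v : Fin (m + 1) → ℂ) 0).trans h1

theorem integral_fin_succ {m : ℕ} {F : (Fin (m + 1) → ℂ) → ℂ} (hF : Integrable F) :
    ∫ u, F u = ∫ v : Fin m → ℂ, ∫ a : ℂ, F (Fin.cons a v) := by
  have hmp := (volume_preserving_piFinSuccAbove (fun _ : Fin (m + 1) => ℂ) 0).symm
  have he : ∀ x : ℂ × (Fin m → ℂ), (MeasurableEquiv.piFinSuccAbove (fun _ : Fin (m + 1) => ℂ)
      0).symm x = Fin.cons x.1 x.2 := by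
    intro x
    simp [MeasurableEquiv.piFinSuccAbove_symm_apply, Fin.insertNthEquiv]
  have hI := (hmp.integrable_comp_emb (MeasurableEquiv.measurableEmbedding _)).2 hF
  rw [← hmp.integral_comp' F]
  have h2 := integral_prod_symm _ hI
  simp only [Function.comp, he] at h2 ⊢
  exact h2

/-- The iterated Green formula: if `∫ Δh ℓ_q = c ∑ h (rᵢ)` for all test functions `h` and all `q`,
then `∫ Δ₁ ⋯ Δ_m H ∏ ℓ_q = c ^ m ∑ H (r_{e₁}, …, r_{e_m})`. -/
theorem integral_lapList_mul_prod {d : ℕ} (r : Fin d → ℂ) (c : ℂ) :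
    ∀ (m : ℕ) (ℓ : Fin m → ℂ → ℝ) (_ : ∀ q, LocallyIntegrable (ℓ q))
      (_ : ∀ q, ∀ h : ℂ → ℂ, ContDiff ℝ (⊤ : ℕ∞) h → HasCompactSupport h →
        ∫ u, lap h u * ((ℓ q u : ℝ) : ℂ) = c * ∑ i, h (r i))
      (H : (Fin m → ℂ) → ℂ) (_ : ContDiff ℝ (⊤ : ℕ∞) H) (_ : HasCompactSupport H),
      ∫ u, lapList (List.finRange m) H u * ((∏ q, ℓ q (u q) : ℝ) : ℂ) =
        c ^ m * ∑ e : Fin m → Fin d, H (fun j => r (e j)) := by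
  intro m
  induction m with
  | zero =>
    intro ℓ _ _ H _ _
    simp only [Finset.univ_eq_empty, Finset.prod_empty, Complex.ofReal_one, mul_one, pow_zero,
      one_mul, List.finRange_zero, lapList, List.foldr_nil]
    rw [volume_pi, Measure.pi_of_empty _ (fun q => q.elim0), integral_dirac, Fintype.sum_unique]
    congr 1
    exact Subsingleton.elim _ _
  | succ m ih =>
    intro ℓ hℓ hG H hH hc
    rw [integral_fin_succ (integrable_mul_prod (contDiff_lapList _ hH).continuous
      (hasCompactSupport_lapList _ hc) hℓ)]
    -- The Laplacian in variable 0 is outermost, so this variable is integrated first. The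
    -- one-variable formula replaces it by the roots, and the remaining Laplacians commute with
    -- freezing it there.
    have hfr : List.finRange (m + 1) = 0 :: (List.finRange m).map Fin.succ := by
      rw [List.finRange_succ]
    set K := lapList ((List.finRange m).map Fin.succ) H with hKdef
    have hK : ContDiff ℝ (⊤ : ℕ∞) K := contDiff_lapList _ hH
    have hKc : HasCompactSupport K := hasCompactSupport_lapList _ hc
    have h1 : ∀ v : Fin m → ℂ, ∫ a : ℂ, lapList (List.finRange (m + 1)) H (Fin.cons a v) *
        ((∏ q, ℓ q ((Fin.cons a v : Fin (m + 1) → ℂ) q) : ℝ) : ℂ) =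
        ∑ i, c * (K (Fin.cons (r i) v) * ((∏ q : Fin m, ℓ q.succ (v q) : ℝ) : ℂ)) := by
      intro v
      have h2 := hG 0 _ (contDiff_cons_right hK v) (hasCompactSupport_cons_right hKc v)
      simp only [lap_cons hK] at h2
      simp only [Fin.prod_univ_succ, Fin.cons_zero, Fin.cons_succ]
      rw [← Finset.mul_sum, ← Finset.sum_mul, ← mul_assoc, ← h2, ← integral_mul_const]
      refine integral_congr_ae (Filter.Eventually.of_forall (fun a => ?_))
      simp only [hfr]
      push_cast
      rw [← mul_assoc]
      rfl
    simp only [h1]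
    rw [integral_finsetSum]
    · have h3 : ∀ i, ∫ v : Fin m → ℂ, c * (K (Fin.cons (r i) v) *
          ((∏ q : Fin m, ℓ q.succ (v q) : ℝ) : ℂ)) =
          c * (c ^ m * ∑ e : Fin m → Fin d, H (Fin.cons (r i) (fun j => r (e j)))) := by
        intro i
        rw [integral_const_mul, ← ih (fun q => ℓ q.succ) (fun q => hℓ _) (fun q => hG _) _
          (contDiff_cons_left hH (r i)) (hasCompactSupport_cons_left hc (r i)),
          lapList_map_succ_cons _ hH]
      simp only [h3]
      rw [← Finset.mul_sum, ← Finset.mul_sum, ← mul_assoc, pow_succ', ]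
      congr 1
      rw [← Fintype.sum_prod_type']
      refine Fintype.sum_equiv (Fin.consEquiv (fun _ => Fin d)) _ _ (fun x => ?_)
      congr 1
      funext j
      refine Fin.cases ?_ (fun q => ?_) j <;> simp [Fin.consEquiv]
    · intro i _
      exact (integrable_mul_prod (contDiff_cons_left hK (r i)).continuous
        (hasCompactSupport_cons_left hKc (r i)) (fun q : Fin m => hℓ q.succ)).const_mul c

end

/-! ### Inclusion–exclusion over coinciding indices, and restriction to diagonals. -/

section

open Classical in
/-- Functions respecting a family of identifications factor through a surjection onto `Fin m`. -/
theorem exists_surjective_factor {k : ℕ} (S : Finset (Fin k × Fin k)) :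
    ∃ (m : ℕ) (π : Fin k → Fin m), Function.Surjective π ∧
      ∀ (d : ℕ) (φ : (Fin k → Fin d) → ℂ),
        (∑ e : Fin k → Fin d, if ∀ p ∈ S, e p.1 = e p.2 then φ e else 0) =
          ∑ e : Fin m → Fin d, φ (e ∘ π) := by
  -- The pairs in S generate an equivalence relation. A tuple satisfies the identifications exactly
  -- when it is constant on classes, and m is the number of classes.
  let s : Setoid (Fin k) := Relation.EqvGen.setoid (fun i j => (i, j) ∈ S)
  let Q := Quotient s
  let E : Q ≃ Fin (Fintype.card Q) := Fintype.equivFin Q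
  refine ⟨Fintype.card Q, fun i => E (Quotient.mk s i),
    E.surjective.comp Quotient.mk_surjective, fun d φ => ?_⟩
  have hπ : Function.Surjective (fun i => E (Quotient.mk s i)) :=
    E.surjective.comp Quotient.mk_surjective
  rw [← Finset.sum_filter]
  symm
  refine Finset.sum_bij (fun e _ => e ∘ fun i => E (Quotient.mk s i)) ?_ ?_ ?_ ?_
  · intro e _
    simp only [Finset.mem_filter, Finset.mem_univ, true_and, Function.comp]
    intro p hp
    have : Quotient.mk s p.1 = Quotient.mk s p.2 :=
      Quotient.sound (Relation.EqvGen.rel _ _ hp)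
    rw [this]
  · intro e₁ _ e₂ _ h
    exact hπ.injective_comp_right h
  · intro e he
    simp only [Finset.mem_filter, Finset.mem_univ, true_and] at he
    have hlift : ∀ i j, Relation.EqvGen (fun i j => (i, j) ∈ S) i j → e i = e j := by
      intro i j h
      induction h with
      | rel x y h => exact he (x, y) h
      | refl x => rfl
      | symm x y _ ih => exact ih.symm
      | trans x y z _ _ ih₁ ih₂ => exact ih₁.trans ih₂
    refine ⟨fun x => Quotient.lift e hlift (E.symm x), Finset.mem_univ _, ?_⟩
    funext i
    simp
  · intro e _
    rfl

open Classical in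
/-- Inclusion–exclusion for sums over injective tuples. -/
theorem sum_embedding_eq {k d : ℕ} (φ : (Fin k → Fin d) → ℂ) :
    ∑ e : Fin k ↪ Fin d, φ e =
      ∑ S ∈ (Finset.univ.filter (fun p : Fin k × Fin k => p.1 < p.2)).powerset,
        (-1) ^ S.card * ∑ e : Fin k → Fin d, if ∀ p ∈ S, e p.1 = e p.2 then φ e else 0 := by
  have h1 : ∑ e : Fin k ↪ Fin d, φ e =
      ∑ e : Fin k → Fin d, (if Function.Injective e then φ e else 0) := by
    rw [← Finset.sum_filter]
    refine Finset.sum_bij (fun e _ => (e : Fin k → Fin d)) ?_ ?_ ?_ ?_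
    · intro e _
      simpa using e.injective
    · intro e₁ _ e₂ _ h
      exact DFunLike.coe_injective h
    · intro e he
      exact ⟨⟨e, by simpa using he⟩, Finset.mem_univ _, rfl⟩
    · intro e _
      rfl
  have h2 : ∀ e : Fin k → Fin d, (if Function.Injective e then φ e else 0) =
      ∑ S ∈ (Finset.univ.filter (fun p : Fin k × Fin k => p.1 < p.2)).powerset,
        (-1) ^ S.card * (if ∀ p ∈ S, e p.1 = e p.2 then φ e else 0) := by
    intro e
    -- The indicator of injectivity is the product over i < j of 1 - 1[e i = e j]; expanding it
    -- gives the signed sum over S.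
    have h3 := Finset.prod_one_add (s := Finset.univ.filter (fun p : Fin k × Fin k => p.1 < p.2))
      (f := fun p => if e p.1 = e p.2 then (-1 : ℂ) else 0)
    have h4 : ∀ S : Finset (Fin k × Fin k), ∏ p ∈ S, (if e p.1 = e p.2 then (-1 : ℂ) else 0) =
        (-1) ^ S.card * (if ∀ p ∈ S, e p.1 = e p.2 then 1 else 0) := by
      intro S
      rw [Finset.prod_ite_zero]
      split_ifs <;> simp
    have h5 : ∏ p ∈ Finset.univ.filter (fun p : Fin k × Fin k => p.1 < p.2),
        (1 + if e p.1 = e p.2 then (-1 : ℂ) else 0) = if Function.Injective e then 1 else 0 := by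
      split_ifs with he
      · refine Finset.prod_eq_one (fun p hp => ?_)
        have : e p.1 ≠ e p.2 := fun h => (Finset.mem_filter.1 hp).2.ne (he h)
        simp [this]
      · simp only [Function.Injective, not_forall] at he
        obtain ⟨i, j, hij, hne⟩ := he
        rcases lt_or_gt_of_ne hne with h | h
        · exact Finset.prod_eq_zero (i := (i, j)) (by simpa using h) (by simp [hij])
        · exact Finset.prod_eq_zero (i := (j, i)) (by simpa using h) (by simp [hij])
    rw [h5] at h3
    calc (if Function.Injective e then φ e else 0)
        = (if Function.Injective e then 1 else 0) * φ e := by split_ifs <;> simp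
      _ = _ := by
        rw [h3, Finset.sum_mul]
        refine Finset.sum_congr rfl (fun S _ => ?_)
        rw [h4]
        split_ifs <;> simp
  rw [h1, Finset.sum_congr rfl (fun e _ => h2 e), Finset.sum_comm]
  simp only [Finset.mul_sum]

/-- The operator norm of `iteratedFDeriv` is controlled by the partial derivatives. -/
theorem norm_iteratedFDeriv_le_gradNorm {k : ℕ} (a : ℕ) (G : (Fin k → ℂ) → ℂ) (w : Fin k → ℂ) :
    ‖iteratedFDeriv ℝ a G w‖ ≤ (2 * k : ℝ) ^ a * gradNorm a G w := by
  have hpart : ∀ s : Fin a → Fin k × Fin 2,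
      ‖iteratedFDeriv ℝ a G w (fun j => realBasisVec (s j))‖ ≤ gradNorm a G w := by
    intro s
    refine Real.le_sqrt_of_sq_le ?_
    exact Finset.single_le_sum (f := fun s : Fin a → Fin k × Fin 2 =>
      ‖iteratedFDeriv ℝ a G w (fun j => realBasisVec (s j))‖ ^ 2)
      (fun _ _ => sq_nonneg _) (Finset.mem_univ s)
  refine ContinuousMultilinearMap.opNorm_le_bound (by unfold gradNorm; positivity) (fun v => ?_)
  let c : (Fin k → ℂ) → Fin k × Fin 2 → ℝ := fun v s => if s.2 = 0 then (v s.1).re else (v s.1).im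
  have hv : ∀ v : Fin k → ℂ, v = ∑ s, c v s • realBasisVec s := by
    intro v
    funext i
    simp only [Fintype.sum_prod_type, Fin.sum_univ_two, Finset.sum_apply,
      Pi.smul_apply, realBasisVec, c]
    rw [Finset.sum_eq_single i]
    · simpa [mul_comm] using (Complex.re_add_im (v i)).symm
    · intro j _ hj
      simp [hj.symm]
    · simp
  have hc : ∀ v s, |c v s| ≤ ‖v‖ := by
    intro v s
    refine le_trans ?_ (norm_le_pi_norm v s.1)
    simp only [c]
    split_ifs
    · exact Complex.abs_re_le_norm _
    · exact Complex.abs_im_le_norm _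
  -- Multilinear expansion in the 2k real coordinates: (2k)^a terms, and each coordinate of a vector
  -- is at most its sup norm.
  have h1 : iteratedFDeriv ℝ a G w v = ∑ s : Fin a → Fin k × Fin 2,
      (∏ j, c (v j) (s j)) • iteratedFDeriv ℝ a G w (fun j => realBasisVec (s j)) := by
    conv_lhs => rw [show v = fun j => ∑ s, c (v j) s • realBasisVec s from funext fun j => hv (v j)]
    have := (iteratedFDeriv ℝ a G w).toMultilinearMap.map_sum
      (g := fun j s => c (v j) s • realBasisVec s)
    simp only [ContinuousMultilinearMap.coe_coe] at this
    rw [this]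
    refine Finset.sum_congr rfl (fun s _ => ?_)
    exact (iteratedFDeriv ℝ a G w).map_smul_univ (fun j => c (v j) (s j)) _
  rw [h1]
  refine (norm_sum_le _ _).trans ?_
  calc _ ≤ ∑ s : Fin a → Fin k × Fin 2, (∏ j, ‖v j‖) * gradNorm a G w := by
        refine Finset.sum_le_sum (fun s _ => ?_)
        rw [norm_smul, Real.norm_eq_abs, Finset.abs_prod]
        refine mul_le_mul (Finset.prod_le_prod (fun _ _ => abs_nonneg _) (fun j _ => hc _ _))
          (hpart s) (norm_nonneg _) (Finset.prod_nonneg (fun _ _ => norm_nonneg _))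
    _ = _ := by
      rw [Finset.sum_const, Finset.card_univ]
      simp
      ring

section pullback

variable {k m : ℕ} (π : Fin k → Fin m)

/-- The restriction to the diagonal given by `π` of the translate by `z` of `G`. -/
noncomputable def diagRestrict (z : Fin k → ℂ) (G : (Fin k → ℂ) → ℂ) (u : Fin m → ℂ) : ℂ :=
  G (fun i => u (π i) - z i)

theorem diagRestrict_eq (z : Fin k → ℂ) (G : (Fin k → ℂ) → ℂ) :
    diagRestrict π z G = (fun v => G (v + -z)) ∘
      (ContinuousLinearMap.pi (fun i => ContinuousLinearMap.proj (π i)) :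
        (Fin m → ℂ) →L[ℝ] (Fin k → ℂ)) := by
  funext u
  rfl

theorem contDiff_diagRestrict (z : Fin k → ℂ) {G : (Fin k → ℂ) → ℂ} (hG : ContDiff ℝ (⊤ : ℕ∞) G) :
    ContDiff ℝ (⊤ : ℕ∞) (diagRestrict π z G) := by
  rw [diagRestrict_eq]
  exact (hG.comp (contDiff_id.add contDiff_const)).comp (ContinuousLinearMap.contDiff _)

/-- Repeating coordinates is linear and does not increase the sup norm, so derivative bounds pass to
diagonals without loss. -/
theorem norm_iteratedFDeriv_diagRestrict_le (z : Fin k → ℂ) {G : (Fin k → ℂ) → ℂ}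
    (hG : ContDiff ℝ (⊤ : ℕ∞) G) (j : ℕ) {M : ℝ} (hM : ∀ w, ‖iteratedFDeriv ℝ j G w‖ ≤ M)
    (u : Fin m → ℂ) : ‖iteratedFDeriv ℝ j (diagRestrict π z G) u‖ ≤ M := by
  rw [diagRestrict_eq]
  set L := (ContinuousLinearMap.pi (fun i => ContinuousLinearMap.proj (π i)) :
        (Fin m → ℂ) →L[ℝ] (Fin k → ℂ)) with hL
  have hLn : ‖L‖ ≤ 1 := by
    refine ContinuousLinearMap.opNorm_le_bound _ zero_le_one (fun v => ?_)
    rw [one_mul, pi_norm_le_iff_of_nonneg (norm_nonneg _)]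
    intro i
    exact norm_le_pi_norm v (π i)
  have hG' : ContDiff ℝ (⊤ : ℕ∞) (fun v => G (v + -z)) := hG.comp (contDiff_id.add contDiff_const)
  have h2 := L.iteratedFDeriv_comp_right hG' u (i := j) (by exact_mod_cast le_top)
  rw [h2]
  refine (ContinuousMultilinearMap.norm_compContinuousLinearMap_le _ _).trans ?_
  rw [iteratedFDeriv_comp_add_right]
  calc _ ≤ M * 1 := by
        refine mul_le_mul (hM _) (Finset.prod_le_one (fun _ _ => norm_nonneg _) (fun _ _ => hLn))
          (Finset.prod_nonneg (fun _ _ => norm_nonneg _)) ((norm_nonneg _).trans (hM 0))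
    _ = M := mul_one M

/-- Any preimage s q of q confines the variable u_q to the disc about z (s q). That point becomes
the centre at which the polynomial is tilted in the variable u_q. -/
theorem tsupport_diagRestrict_subset {z : Fin k → ℂ} {G : (Fin k → ℂ) → ℂ} {C : ℝ}
    (hG : Function.support G ⊆ {w | ∀ i, w i ∈ Metric.ball (0 : ℂ) C}) {s : Fin m → Fin k}
    (hs : ∀ q, π (s q) = q) :
    tsupport (diagRestrict π z G) ⊆ Set.univ.pi (fun q => Metric.closedBall (z (s q)) C) := by
  refine closure_minimal (fun u hu => ?_) (isClosed_set_pi fun _ _ => Metric.isClosed_closedBall)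
  intro q _
  have h1 := hG hu (s q)
  simp only [hs, mem_ball_zero_iff] at h1
  rw [Metric.mem_closedBall, dist_eq_norm]
  exact h1.le

end pullback

end

/-! ### A smooth bounded truncation of the logarithm, and its derivatives up to order three. -/

theorem norm_iteratedFDeriv_comp_affine_le {E F G : Type*} [NormedAddCommGroup E] [NormedSpace ℝ E]
    [NormedAddCommGroup F] [NormedSpace ℝ F] [NormedAddCommGroup G] [NormedSpace ℝ G]
    (L : E →L[ℝ] F) (c : F) {H : F → G} (hH : ContDiff ℝ (⊤ : ℕ∞) H) (j : ℕ) (s : E) :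
    ‖iteratedFDeriv ℝ j (fun s => H (L s + c)) s‖ ≤
      ‖iteratedFDeriv ℝ j H (L s + c)‖ * ‖L‖ ^ j := by
  have hH' : ContDiff ℝ (⊤ : ℕ∞) (fun v => H (v + c)) := hH.comp (contDiff_id.add contDiff_const)
  have h2 := L.iteratedFDeriv_comp_right hH' s (i := j) (by exact_mod_cast le_top)
  have h3 : (fun s => H (L s + c)) = (fun v => H (v + c)) ∘ L := rfl
  rw [h3, h2]
  refine (ContinuousMultilinearMap.norm_compContinuousLinearMap_le _ _).trans ?_
  rw [iteratedFDeriv_comp_add_right]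
  simp

/-- The derivative is w ↦ 2⟨w, ·⟩, which is linear, so the second derivative is constant and the
third vanishes. At first order 2|y| ≤ 1 + |y|² is used. -/
theorem norm_iteratedFDeriv_one_add_norm_sq_le (y : ℂ) (j : ℕ) (hj1 : 1 ≤ j) (hj3 : j ≤ 3) :
    ‖iteratedFDeriv ℝ j (fun w : ℂ => 1 + ‖w‖ ^ 2) y‖ ≤ 2 ^ j * (1 + ‖y‖ ^ 2) := by
  obtain ⟨L, hfd, hL⟩ : ∃ L : ℂ →L[ℝ] ℂ →L[ℝ] ℝ,
      fderiv ℝ (fun w : ℂ => 1 + ‖w‖ ^ 2) = (fun w => L w) ∧ ‖L‖ ≤ 2 := by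
    refine ⟨2 • innerSL ℝ, ?_, ?_⟩
    · funext w
      rw [fderiv_const_add]
      simp
    · refine ContinuousLinearMap.opNorm_le_bound _ (by norm_num) (fun v => ?_)
      have h1 : (2 • innerSL ℝ : ℂ →L[ℝ] ℂ →L[ℝ] ℝ) v = innerSL ℝ v + innerSL ℝ v := by
        rw [two_smul]; rfl
      rw [h1]
      refine (norm_add_le _ _).trans ?_
      have h2 : ‖(innerSL ℝ v : ℂ →L[ℝ] ℝ)‖ = ‖v‖ := innerSL_apply_norm (𝕜 := ℝ) v
      rw [h2]
      linarith
  have hd1 : fderiv ℝ (fun w => L w) = fun _ => L := by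
    funext w
    rw [ContinuousLinearMap.fderiv]
  have hd2 : fderiv ℝ (fun _ : ℂ => L) = fun _ => 0 := by
    funext w
    simp
  have hcases : j = 0 + 1 ∨ j = 0 + 1 + 1 ∨ j = 0 + 1 + 1 + 1 := by omega
  rcases hcases with rfl | rfl | rfl
  · rw [← norm_iteratedFDeriv_fderiv, hfd, norm_iteratedFDeriv_zero]
    have := L.le_of_opNorm_le hL y
    rw [zero_add, pow_one]
    nlinarith [sq_nonneg (‖y‖ - 1), norm_nonneg y]
  · rw [← norm_iteratedFDeriv_fderiv, hfd, ← norm_iteratedFDeriv_fderiv, hd1,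
      norm_iteratedFDeriv_zero]
    rw [show (2 : ℝ) ^ (0 + 1 + 1) = 4 by norm_num]
    nlinarith [sq_nonneg ‖y‖]
  · rw [← norm_iteratedFDeriv_fderiv, hfd, ← norm_iteratedFDeriv_fderiv, hd1,
      ← norm_iteratedFDeriv_fderiv, hd2, norm_iteratedFDeriv_zero, norm_zero]
    positivity

theorem norm_iteratedDeriv_log_one_le (i : ℕ) (hi : i ≤ 3) :
    ‖iteratedDeriv i Real.log 1‖ ≤ 2 := by
  have h : ∀ j : ℕ, iteratedDeriv (j + 1) Real.log 1 = (-1) ^ j * (j.factorial : ℝ) := by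
    intro j
    rw [iteratedDeriv_succ', Real.deriv_log', iteratedDeriv_eq_iterate, iter_deriv_inv]
    simp
  have hi' : i = 0 ∨ i = 1 ∨ i = 2 ∨ i = 3 := by omega
  rcases hi' with rfl | rfl | rfl | rfl
  · simp
  · rw [h 0]; simp
  · rw [h 1]; simp
  · rw [h 2]; simp

theorem regLog_one_eq (y : ℂ) : regLog 1 y = Real.log (1 + ‖y‖ ^ 2) / 2 := by
  rw [regLog, Complex.sq_norm, Complex.normSq_apply]
  ring_nf

theorem contDiff_regLog_real {d : ℝ} (hd : 0 < d) : ContDiff ℝ (⊤ : ℕ∞) (regLog d) := by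
  have h1 : ContDiff ℝ (⊤ : ℕ∞) (fun u : ℂ => u.re) := Complex.reCLM.contDiff
  have h2 : ContDiff ℝ (⊤ : ℕ∞) (fun u : ℂ => u.im) := Complex.imCLM.contDiff
  unfold regLog
  refine ContDiff.div_const (ContDiff.log (by fun_prop) (fun u => ?_)) 2
  positivity

/-- Dividing 1 + |w|² by its value A at y changes the logarithm only by a constant. The quotient f
has f(y) = 1 and i-th derivative at most 2^i there, so the chain rule only involves log near 1,
uniformly in y. The constant is 3!·2·2³ = 96. -/
theorem norm_iteratedFDeriv_regLog_one_le (y : ℂ) (j : ℕ) (hj1 : 1 ≤ j) (hj3 : j ≤ 3) :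
    ‖iteratedFDeriv ℝ j (regLog 1) y‖ ≤ 96 := by
  set A : ℝ := 1 + ‖y‖ ^ 2 with hA
  have hA1 : 1 ≤ A := by rw [hA]; nlinarith [sq_nonneg ‖y‖]
  have hA0 : 0 < A := by linarith
  let f : ℂ → ℝ := fun w => A⁻¹ * (1 + ‖w‖ ^ 2)
  have hfc : ContDiff ℝ (⊤ : ℕ∞) (fun w : ℂ => 1 + ‖w‖ ^ 2) :=
    contDiff_const.add (contDiff_norm_sq ℝ)
  have hf : ContDiff ℝ (⊤ : ℕ∞) f := contDiff_const.mul hfc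
  have hle : ∀ i : ℕ, ((i : ℕ∞) : WithTop ℕ∞) ≤ ((⊤ : ℕ∞) : WithTop ℕ∞) := fun i => by
    exact_mod_cast le_top
  have hD : ∀ i, 1 ≤ i → i ≤ j → ‖iteratedFDeriv ℝ i f y‖ ≤ 2 ^ i := by
    intro i h1 h2
    have h3 := norm_iteratedFDeriv_one_add_norm_sq_le y i h1 (h2.trans hj3)
    have h4 : iteratedFDeriv ℝ i f y = A⁻¹ • iteratedFDeriv ℝ i (fun w : ℂ => 1 + ‖w‖ ^ 2) y :=
      iteratedFDeriv_const_smul_apply (a := A⁻¹) (f := fun w : ℂ => 1 + ‖w‖ ^ 2)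
        (hfc.of_le (hle i)).contDiffAt
    rw [h4, norm_smul, Real.norm_of_nonneg (by positivity), inv_mul_le_iff₀ hA0]
    linarith
  have hrange : Set.range f ⊆ Set.Ioi 0 := by
    rintro _ ⟨w, rfl⟩
    have : 0 < A⁻¹ * (1 + ‖w‖ ^ 2) := by positivity
    exact this
  have hlog : ContDiffOn ℝ (⊤ : ℕ∞) Real.log (Set.Ioi 0) := fun x hx =>
    (Real.contDiffAt_log.2 (ne_of_gt hx)).contDiffWithinAt
  have hfy : f y = 1 := inv_mul_cancel₀ hA0.ne'
  have hC : ∀ i, i ≤ j → ‖iteratedFDerivWithin ℝ i Real.log (Set.Ioi 0) (f y)‖ ≤ 2 := by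
    intro i hi
    rw [hfy, iteratedFDerivWithin_of_isOpen i isOpen_Ioi (by simp),
      norm_iteratedFDeriv_eq_norm_iteratedDeriv]
    exact norm_iteratedDeriv_log_one_le i (hi.trans hj3)
  have key := norm_iteratedFDeriv_comp_le' (N := (⊤ : ℕ∞)) hrange (uniqueDiffOn_Ioi 0) hlog hf
    (hle j) y hC hD
  have heq : regLog 1 = fun w => Real.log A / 2 + (1 / 2 : ℝ) • (Real.log ∘ f) w := by
    funext w
    have : (0 : ℝ) < 1 + ‖w‖ ^ 2 := by positivity
    simp only [f, Function.comp, smul_eq_mul]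
    rw [regLog_one_eq, Real.log_mul (by positivity) (by positivity), Real.log_inv]
    ring
  have hcomp : ContDiff ℝ (⊤ : ℕ∞) (Real.log ∘ f) :=
    ContDiff.log hf (fun w => (hrange ⟨w, rfl⟩ : 0 < f w).ne')
  have h5 : iteratedFDeriv ℝ j (regLog 1) y = (1 / 2 : ℝ) • iteratedFDeriv ℝ j (Real.log ∘ f) y := by
    rw [heq]
    have h6 := iteratedFDeriv_add_apply (𝕜 := ℝ) (i := j) (x := y)
      (f := fun _ : ℂ => Real.log A / 2) (g := fun w => (1 / 2 : ℝ) • (Real.log ∘ f) w)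
      contDiff_const.contDiffAt ((hcomp.of_le (hle j)).const_smul _).contDiffAt
    have h7 : (fun w => Real.log A / 2 + (1 / 2 : ℝ) • (Real.log ∘ f) w) =
      (fun _ : ℂ => Real.log A / 2) + (fun w => (1 / 2 : ℝ) • (Real.log ∘ f) w) := rfl
    rw [h7, h6, iteratedFDeriv_const_of_ne (by omega)]
    simp only [Pi.zero_apply, zero_add]
    exact iteratedFDeriv_const_smul_apply (a := (1 / 2 : ℝ)) (f := Real.log ∘ f)
        (hcomp.of_le (hle j)).contDiffAt
  rw [h5, norm_smul]
  have hj6 : (j.factorial : ℝ) ≤ 6 := by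
    exact_mod_cast (Nat.factorial_le hj3 : j.factorial ≤ 6)
  have hj8 : (2 : ℝ) ^ j ≤ 8 := by
    calc (2 : ℝ) ^ j ≤ 2 ^ 3 := pow_le_pow_right₀ (by norm_num) hj3
      _ = 8 := by norm_num
  have : (j.factorial : ℝ) * 2 * 2 ^ j ≤ 6 * 2 * 8 := by gcongr
  norm_num at this ⊢
  linarith [norm_nonneg (iteratedFDeriv ℝ j (Real.log ∘ f) y)]

/-- A smooth bounded truncation `½ log ((|y|² + d²) / (1 + d²|y|²))` of `log |y|`. -/
noncomputable def truncLog (d : ℝ) (y : ℂ) : ℝ := regLog d y - regLog 1 ((d : ℂ) * y)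

/-- Scaling reduces every level d to level one. Both halves of `truncLog d` are then copies of
`regLog 1`, with arguments multiplied by d⁻¹ and by d. -/
theorem regLog_eq_log_add {d : ℝ} (hd : 0 < d) (y : ℂ) :
    regLog d y = Real.log d + regLog 1 (((d⁻¹ : ℝ) : ℂ) * y) := by
  unfold regLog
  have h1 : y.re ^ 2 + y.im ^ 2 + d ^ 2 =
      d ^ 2 * ((d⁻¹ * y.re) ^ 2 + (d⁻¹ * y.im) ^ 2 + 1 ^ 2) := by field_simp
  rw [Complex.re_ofReal_mul, Complex.im_ofReal_mul, h1, Real.log_mul (by positivity) (by positivity),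
    Real.log_pow]
  push_cast
  ring

theorem contDiff_truncLog {d : ℝ} (hd : 0 < d) : ContDiff ℝ (⊤ : ℕ∞) (truncLog d) :=
  (contDiff_regLog_real hd).sub ((contDiff_regLog_real one_pos).comp
    (contDiff_const.mul contDiff_id))

theorem truncLog_eq {d : ℝ} (hd : 0 < d) (y : ℂ) :
    truncLog d y = Real.log ((‖y‖ ^ 2 + d ^ 2) / (1 + d ^ 2 * ‖y‖ ^ 2)) / 2 := by
  have h : ‖y‖ ^ 2 = y.re ^ 2 + y.im ^ 2 := by rw [Complex.sq_norm, Complex.normSq_apply]; ring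
  rw [Real.log_div (by positivity) (by positivity), truncLog, regLog_one_eq, regLog, ← h, norm_mul,
    mul_pow, Complex.norm_real, Real.norm_of_nonneg hd.le]
  ring

/-- The quotient (|y|² + d²)/(1 + d²|y|²) lies between d² and d⁻². -/
theorem abs_truncLog_le {d : ℝ} (hd : 0 < d) (hd1 : d ≤ 1) (y : ℂ) :
    |truncLog d y| ≤ Real.log d⁻¹ := by
  rw [truncLog_eq hd]
  have hd2 : d ^ 4 ≤ 1 := pow_le_one₀ hd.le hd1
  have h1 : Real.log (d ^ 2) ≤ Real.log ((‖y‖ ^ 2 + d ^ 2) / (1 + d ^ 2 * ‖y‖ ^ 2)) := by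
    refine Real.log_le_log (by positivity) ?_
    rw [le_div_iff₀ (by positivity)]
    nlinarith [sq_nonneg ‖y‖, mul_le_mul_of_nonneg_right hd2 (sq_nonneg ‖y‖)]
  have h2 : Real.log ((‖y‖ ^ 2 + d ^ 2) / (1 + d ^ 2 * ‖y‖ ^ 2)) ≤ Real.log ((d ^ 2)⁻¹) := by
    refine Real.log_le_log (by positivity) ?_
    rw [div_le_iff₀ (by positivity), mul_add, mul_one, inv_mul_cancel_left₀ (by positivity)]
    have : d ^ 2 ≤ (d ^ 2)⁻¹ := by
      rw [le_inv_comm₀ (by positivity) (by positivity)]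
      calc d ^ 2 ≤ 1 := pow_le_one₀ hd.le hd1
        _ ≤ (d ^ 2)⁻¹ := (one_le_inv₀ (by positivity)).2 (pow_le_one₀ hd.le hd1)
    linarith
  rw [Real.log_inv, Real.log_pow] at h2
  rw [Real.log_pow] at h1
  rw [Real.log_inv, abs_le]
  push_cast at h1 h2
  constructor <;> linarith

/-- Derivative bounds for `s ↦ truncLog d (y + a s)`, as a complex-valued function. -/
theorem norm_iteratedFDeriv_truncLog_affine_le {d : ℝ} (hd : 0 < d) (hd1 : d ≤ 1) (y a s : ℂ)
    {α : ℝ} (hα : ‖a‖ ≤ α) (j : ℕ) (hj3 : j ≤ 3) :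
    ‖iteratedFDeriv ℝ j (fun s : ℂ => ((truncLog d (y + a * s) : ℝ) : ℂ)) s‖ ≤
      192 * (1 + Real.log d⁻¹) * (α / d) ^ j := by
  have hα0 : 0 ≤ α := (norm_nonneg a).trans hα
  have hlog : 0 ≤ Real.log d⁻¹ := Real.log_nonneg ((one_le_inv₀ hd).2 hd1)
  rcases Nat.eq_zero_or_pos j with rfl | hj1
  · rw [norm_iteratedFDeriv_zero, Complex.norm_real, Real.norm_eq_abs]
    have := abs_truncLog_le hd hd1 (y + a * s)
    simp only [pow_zero, mul_one]
    linarith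
  have hle : ((j : ℕ∞) : WithTop ℕ∞) ≤ ((⊤ : ℕ∞) : WithTop ℕ∞) := by exact_mod_cast le_top
  let L : ℂ → ℂ →L[ℝ] ℂ := fun c => ContinuousLinearMap.mul ℝ ℂ c
  have hL : ∀ c, ‖L c‖ ≤ ‖c‖ := fun c => ContinuousLinearMap.opNorm_mul_apply_le ℝ ℂ c
  -- Since d ≤ 1, both slopes a/d and d a are at most α/d in modulus, so the two copies of `regLog
  -- 1` obey the same bound; 192 is twice 96.
  have hbd : ∀ c e : ℂ, ‖c‖ ≤ α / d →
      ‖iteratedFDeriv ℝ j (fun s : ℂ => regLog 1 (L c s + e)) s‖ ≤ 96 * (α / d) ^ j := by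
    intro c e hc
    refine (norm_iteratedFDeriv_comp_affine_le (L c) e (contDiff_regLog_real one_pos) j s).trans ?_
    gcongr
    · exact norm_iteratedFDeriv_regLog_one_le _ j hj1 hj3
    · exact (hL c).trans hc
  have hsm : ∀ c e : ℂ, ContDiff ℝ (⊤ : ℕ∞) (fun s : ℂ => regLog 1 (L c s + e)) := fun c e =>
    (contDiff_regLog_real one_pos).comp ((L c).contDiff.add contDiff_const)
  let g₁ : ℂ → ℝ := fun s => regLog 1 (L (((d⁻¹ : ℝ) : ℂ) * a) s + ((d⁻¹ : ℝ) : ℂ) * y)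
  let g₂ : ℂ → ℝ := fun s => regLog 1 (L ((d : ℂ) * a) s + (d : ℂ) * y)
  have heq : (fun s : ℂ => ((truncLog d (y + a * s) : ℝ) : ℂ)) =
      Complex.ofRealLI ∘ ((fun _ => Real.log d) + (g₁ - g₂)) := by
    funext s
    simp only [Function.comp, Pi.add_apply, Pi.sub_apply, Complex.ofRealLI_apply, g₁, g₂, L,
      ContinuousLinearMap.mul_apply']
    rw [truncLog, regLog_eq_log_add hd]
    congr 1
    rw [add_sub_assoc]
    congr 3 <;> ring
  have h12 : ContDiff ℝ (⊤ : ℕ∞) (g₁ - g₂) := (hsm _ _).sub (hsm _ _)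
  rw [heq, LinearIsometry.norm_iteratedFDeriv_comp_left (n := (j : ℕ∞)) _
    (show ContDiffAt ℝ (j : ℕ∞) ((fun _ => Real.log d) + (g₁ - g₂)) s from
      (contDiff_const.add (h12.of_le hle)).contDiffAt) le_rfl,
    iteratedFDeriv_add_apply contDiff_const.contDiffAt (h12.of_le hle).contDiffAt,
    iteratedFDeriv_const_of_ne (by omega)]
  rw [iteratedFDeriv_sub_apply ((hsm _ _).of_le hle).contDiffAt ((hsm _ _).of_le hle).contDiffAt]
  simp only [Pi.zero_apply, zero_add]
  refine (norm_sub_le _ _).trans ?_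
  have h1 := hbd (((d⁻¹ : ℝ) : ℂ) * a) (((d⁻¹ : ℝ) : ℂ) * y) (by
    rw [norm_mul, Complex.norm_real, Real.norm_of_nonneg (by positivity), div_eq_inv_mul]
    gcongr)
  have h2 := hbd ((d : ℂ) * a) ((d : ℂ) * y) (by
    rw [norm_mul, Complex.norm_real, Real.norm_of_nonneg (by positivity), le_div_iff₀ hd]
    calc d * ‖a‖ * d ≤ 1 * α * 1 := by gcongr
      _ = α := by ring)
  have h3 : 0 ≤ (α / d) ^ j := by positivity
  nlinarith [mul_nonneg hlog h3]

/-- Derivative bounds for products of such functions. -/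
theorem exists_norm_iteratedFDeriv_prod_truncLog_le (m : ℕ) : ∃ K : ℝ, 0 < K ∧
    ∀ (d : ℝ), 0 < d → d ≤ 1 → ∀ (y a : Fin m → ℂ) (α : ℝ), (∀ q, ‖a q‖ ≤ α) →
      ∀ (j : ℕ), j ≤ 3 → ∀ s : ℂ,
      ‖iteratedFDeriv ℝ j (fun s : ℂ => ∏ q, ((truncLog d (y q + a q * s) : ℝ) : ℂ)) s‖ ≤
        K * (1 + Real.log d⁻¹) ^ m * (max α 0 / d) ^ j := by
  classical
  -- The number of terms of the Leibniz rule of order j, with multinomial multiplicity. In each of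
  -- them the orders of the factors add up to j, so the powers of α/d multiply to the j-th.
  let c : ℕ → ℝ := fun j => ∑ p ∈ (Finset.univ : Finset (Fin m)).sym j,
    ((p : Multiset (Fin m)).countPerms : ℝ)
  have hc : ∀ j, 0 ≤ c j := fun j => Finset.sum_nonneg (fun _ _ => Nat.cast_nonneg _)
  refine ⟨(1 + ∑ j ∈ Finset.range 4, c j) * 192 ^ m,
    by have := Finset.sum_nonneg (fun j (_ : j ∈ Finset.range 4) => hc j); positivity, ?_⟩
  intro d hd hd1 y a α hα j hj s
  have hlog : 0 ≤ Real.log d⁻¹ := Real.log_nonneg ((one_le_inv₀ hd).2 hd1)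
  have hle : ((j : ℕ∞) : WithTop ℕ∞) ≤ ((⊤ : ℕ∞) : WithTop ℕ∞) := by exact_mod_cast le_top
  -- When m = 0 nothing forces α to be nonnegative, hence the maximum.
  set β := max α 0 / d with hβ
  have hβ0 : 0 ≤ β := by positivity
  refine (norm_iteratedFDeriv_prod_le (𝕜 := ℝ) (u := Finset.univ)
    (f := fun (q : Fin m) (s : ℂ) => ((truncLog d (y q + a q * s) : ℝ) : ℂ)) (N := (⊤ : ℕ∞))
    (fun q _ => Complex.ofRealCLM.contDiff.comp (f := fun s => truncLog d (y q + a q * s))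
      ((contDiff_truncLog hd).comp (contDiff_const.add (contDiff_const.mul contDiff_id))))
    hle).trans ?_
  have hterm : ∀ p ∈ (Finset.univ : Finset (Fin m)).sym j,
      ∏ q, ‖iteratedFDeriv ℝ ((p : Multiset (Fin m)).count q)
        (fun s : ℂ => ((truncLog d (y q + a q * s) : ℝ) : ℂ)) s‖ ≤
        192 ^ m * (1 + Real.log d⁻¹) ^ m * β ^ j := by
    intro p _
    have hcount : ∀ q, (p : Multiset (Fin m)).count q ≤ j := fun q =>
      (Multiset.count_le_card q _).trans p.2.le
    calc _ ≤ ∏ q : Fin m, (192 * (1 + Real.log d⁻¹) * β ^ ((p : Multiset (Fin m)).count q)) := by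
          refine Finset.prod_le_prod (fun _ _ => norm_nonneg _) (fun q _ => ?_)
          exact norm_iteratedFDeriv_truncLog_affine_le hd hd1 (y q) (a q) s
            ((hα q).trans (le_max_left _ _)) _ ((hcount q).trans hj)
      _ = _ := by
        rw [Finset.prod_mul_distrib, Finset.prod_pow_eq_pow_sum, Finset.prod_const,
          Finset.card_univ, Fintype.card_fin, Multiset.sum_count_eq_card (by simp), mul_pow]
        congr 2
        exact p.2
  calc _ ≤ ∑ p ∈ (Finset.univ : Finset (Fin m)).sym j, ((p : Multiset (Fin m)).countPerms : ℝ) *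
          (192 ^ m * (1 + Real.log d⁻¹) ^ m * β ^ j) :=
        Finset.sum_le_sum (fun p hp => mul_le_mul_of_nonneg_left (hterm p hp) (Nat.cast_nonneg _))
    _ = c j * (192 ^ m * (1 + Real.log d⁻¹) ^ m * β ^ j) := by rw [← Finset.sum_mul]
    _ ≤ (1 + ∑ j ∈ Finset.range 4, c j) * (192 ^ m * (1 + Real.log d⁻¹) ^ m * β ^ j) := by
        gcongr
        have := Finset.single_le_sum (f := c) (fun i _ => hc i)
          (Finset.mem_range.2 (Nat.lt_succ_of_le hj))
        linarith
    _ = _ := by ring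

/-! ### Taylor expansion to second order and the exchange of one variable. -/

section

theorem hasDerivAt_comp_smul {h : ℂ → ℂ} (hh : ContDiff ℝ (⊤ : ℕ∞) h) (s : ℂ) (t : ℝ) :
    HasDerivAt (fun t : ℝ => h (t • s)) (dirDeriv s h (t • s)) t := by
  have h1 : HasDerivAt (fun t : ℝ => t • s) s t := by
    simpa using (hasDerivAt_id t).smul_const s
  exact ((hh.differentiable (by simp)).differentiableAt (x := t • s)).hasFDerivAt.comp_hasDerivAt t
    h1

theorem norm_sub_le_of_deriv_le {g g' : ℝ → ℂ} {M : ℝ} (hg : ∀ t, HasDerivAt g (g' t) t)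
    (hM : ∀ t ∈ Set.Icc (0 : ℝ) 1, ‖g' t‖ ≤ M) {t : ℝ} (ht : t ∈ Set.Icc (0 : ℝ) 1) :
    ‖g t - g 0‖ ≤ M := by
  have h0 : 0 ≤ M := (norm_nonneg _).trans (hM 0 (by simp))
  have h1 := norm_image_sub_le_of_norm_deriv_le_segment' (f := g) (f' := g') (C := M) (a := 0)
    (b := 1) (fun x _ => (hg x).hasDerivWithinAt) (fun x hx => hM x ⟨hx.1, hx.2.le⟩) t ht
  calc ‖g t - g 0‖ ≤ M * (t - 0) := h1
    _ ≤ M * 1 := by gcongr; linarith [ht.2]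
    _ = M := mul_one M

/-- Two bounds for one remainder: a quadratic one for large increments and a cubic one for small
increments. Interpolating them gives an error of order 2 + ε, which a moment of that order controls.
-/
theorem norm_taylor_two_le {g g1 g2 g3 : ℝ → ℂ} (d0 : ∀ t, HasDerivAt g (g1 t) t)
    (d1 : ∀ t, HasDerivAt g1 (g2 t) t) (d2 : ∀ t, HasDerivAt g2 (g3 t) t) {B₂ B₃ : ℝ}
    (b2 : ∀ t ∈ Set.Icc (0 : ℝ) 1, ‖g2 t‖ ≤ B₂) (b3 : ∀ t ∈ Set.Icc (0 : ℝ) 1, ‖g3 t‖ ≤ B₃) :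
    ‖g 1 - g 0 - g1 0 - g2 0 / 2‖ ≤ 2 * B₂ ∧ ‖g 1 - g 0 - g1 0 - g2 0 / 2‖ ≤ B₃ := by
  have hid : ∀ t : ℝ, HasDerivAt (fun t : ℝ => (t : ℂ)) 1 t := fun t => Complex.ofRealCLM.hasDerivAt
  have dA : ∀ t : ℝ, HasDerivAt (fun t : ℝ => g t - t * g1 0) (g1 t - g1 0) t := fun t =>
    ((d0 t).sub ((hid t).mul_const (g1 0))).congr_deriv (by simp)
  have dB : ∀ t : ℝ, HasDerivAt (fun t : ℝ => g1 t - t * g2 0) (g2 t - g2 0) t := fun t =>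
    ((d1 t).sub ((hid t).mul_const (g2 0))).congr_deriv (by simp)
  have dC : ∀ t : ℝ, HasDerivAt (fun t : ℝ => g t - t * g1 0 - t ^ 2 * g2 0 / 2)
      (g1 t - g1 0 - t * g2 0) t := by
    intro t
    have e1 : HasDerivAt (fun t : ℝ => (t : ℂ) ^ 2) (2 * t) t :=
      ((hid t).pow 2).congr_deriv (by simp)
    have e2 := (dA t).sub ((e1.mul_const (g2 0)).div_const 2)
    refine e2.congr_deriv ?_
    ring
  have h1m : (1 : ℝ) ∈ Set.Icc (0 : ℝ) 1 := by simp
  constructor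
  · have c1 : ∀ t ∈ Set.Icc (0 : ℝ) 1, ‖g1 t - g1 0‖ ≤ B₂ := fun t ht =>
      norm_sub_le_of_deriv_le d1 b2 ht
    have c2 := norm_sub_le_of_deriv_le dA c1 h1m
    simp only [Complex.ofReal_one, one_mul, Complex.ofReal_zero, zero_mul, sub_zero] at c2
    have c3 : g 1 - g 0 - g1 0 - g2 0 / 2 = (g 1 - g1 0 - g 0) - g2 0 / 2 := by ring
    rw [c3]
    refine (norm_sub_le _ _).trans ?_
    have c4 := b2 0 (by simp)
    rw [norm_div, Complex.norm_ofNat]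
    linarith [norm_nonneg (g2 0)]
  · have c1 : ∀ t ∈ Set.Icc (0 : ℝ) 1, ‖g2 t - g2 0‖ ≤ B₃ := fun t ht =>
      norm_sub_le_of_deriv_le d2 b3 ht
    have c2 : ∀ t ∈ Set.Icc (0 : ℝ) 1, ‖g1 t - g1 0 - t * g2 0‖ ≤ B₃ := by
      intro t ht
      have := norm_sub_le_of_deriv_le dB c1 ht
      simp only [Complex.ofReal_zero, zero_mul, sub_zero] at this
      rwa [sub_right_comm] at this
    have c3 := norm_sub_le_of_deriv_le dC c2 h1m
    have c4 : g 1 - g 0 - g1 0 - g2 0 / 2 = (g 1 - g1 0 - g2 0 / 2) - g 0 := by ring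
    rw [c4]
    simpa using c3

/-- The second order Taylor remainder at `0`. -/
noncomputable def taylorRem (h : ℂ → ℂ) (s : ℂ) : ℂ :=
  h s - h 0 - dirDeriv s h 0 - dirDeriv s (dirDeriv s h) 0 / 2

theorem norm_taylorRem_le {h : ℂ → ℂ} (hh : ContDiff ℝ (⊤ : ℕ∞) h) {M : ℕ → ℝ}
    (hM : ∀ j, j ≤ 3 → ∀ s, ‖iteratedFDeriv ℝ j h s‖ ≤ M j) (s : ℂ) :
    ‖taylorRem h s‖ ≤ 2 * M 2 * ‖s‖ ^ 2 ∧ ‖taylorRem h s‖ ≤ M 3 * ‖s‖ ^ 3 := by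
  have hc1 := contDiff_dirDeriv hh s
  have hc2 := contDiff_dirDeriv hc1 s
  have hc3 := contDiff_dirDeriv hc2 s
  set h1 := dirDeriv s h with hh1
  set h2 := dirDeriv s h1 with hh2
  set h3 := dirDeriv s h2 with hh3
  have b2 : ∀ u, ‖h2 u‖ ≤ M 2 * ‖s‖ ^ 2 := by
    intro u
    have e1 := norm_iteratedFDeriv_dirDeriv_le hc1 s 0 u
    have e2 := norm_iteratedFDeriv_dirDeriv_le hh s 1 u
    rw [norm_iteratedFDeriv_zero] at e1
    calc ‖h2 u‖ ≤ ‖s‖ * (‖s‖ * ‖iteratedFDeriv ℝ (1 + 1) h u‖) := e1.trans (by gcongr)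
      _ ≤ ‖s‖ * (‖s‖ * M 2) := by gcongr; exact hM 2 (by norm_num) u
      _ = _ := by ring
  have b3 : ∀ u, ‖h3 u‖ ≤ M 3 * ‖s‖ ^ 3 := by
    intro u
    have e0 := norm_iteratedFDeriv_dirDeriv_le hc2 s 0 u
    have e1 := norm_iteratedFDeriv_dirDeriv_le hc1 s 1 u
    have e2 := norm_iteratedFDeriv_dirDeriv_le hh s 2 u
    rw [norm_iteratedFDeriv_zero] at e0
    calc ‖h3 u‖ ≤ ‖s‖ * (‖s‖ * (‖s‖ * ‖iteratedFDeriv ℝ (2 + 1) h u‖)) :=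
          e0.trans (by gcongr; exact e1.trans (by gcongr))
      _ ≤ ‖s‖ * (‖s‖ * (‖s‖ * M 3)) := by gcongr; exact hM 3 (by norm_num) u
      _ = _ := by ring
  have d0 := hasDerivAt_comp_smul hh s
  have d1 := hasDerivAt_comp_smul hc1 s
  have d2 := hasDerivAt_comp_smul hc2 s
  obtain ⟨k1, k2⟩ := norm_taylor_two_le d0 d1 d2 (fun t _ => b2 _) (fun t _ => b3 _)
  simp only [one_smul, zero_smul] at k1 k2
  refine ⟨k1.trans (le_of_eq (by ring)), k2⟩

theorem dirDeriv_add_smul {h : ℂ → ℂ} (s u : ℂ) :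
    dirDeriv s h u = s.re * dirDeriv 1 h u + s.im * dirDeriv Complex.I h u := by
  have : s = s.re • (1 : ℂ) + s.im • Complex.I := by
    simp [Complex.re_add_im]
  conv_lhs => rw [this]
  rw [dirDeriv, map_add, map_smul, map_smul]
  simp only [Complex.real_smul, dirDeriv]

/-- The second order term is written in the monomials of Re s and Im s, whose means are the matched
moments. -/
theorem dirDeriv_dirDeriv_eq {h : ℂ → ℂ} (hh : ContDiff ℝ (⊤ : ℕ∞) h) (s u : ℂ) :
    dirDeriv s (dirDeriv s h) u =
      (s.re ^ 2 : ℝ) * dirDeriv 1 (dirDeriv 1 h) u +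
      (s.re * s.im : ℝ) * (dirDeriv 1 (dirDeriv Complex.I h) u +
        dirDeriv Complex.I (dirDeriv 1 h) u) +
      (s.im ^ 2 : ℝ) * dirDeriv Complex.I (dirDeriv Complex.I h) u := by
  have hd : ∀ v w, DifferentiableAt ℝ (dirDeriv v h) w := fun v w =>
    ((contDiff_dirDeriv hh v).differentiable (by simp)).differentiableAt
  have h1 : dirDeriv s h = fun u => s.re • dirDeriv 1 h u + s.im • dirDeriv Complex.I h u := by
    funext w
    rw [dirDeriv_add_smul s w]
    simp only [Complex.real_smul]
  have h2 : ∀ v, dirDeriv v (dirDeriv s h) u =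
      s.re * dirDeriv v (dirDeriv 1 h) u + s.im * dirDeriv v (dirDeriv Complex.I h) u := by
    intro v
    rw [h1]
    have h3 : HasFDerivAt (fun u => s.re • dirDeriv 1 h u + s.im • dirDeriv Complex.I h u)
        (s.re • fderiv ℝ (dirDeriv 1 h) u + s.im • fderiv ℝ (dirDeriv Complex.I h) u) u :=
      ((hd 1 u).hasFDerivAt.const_smul s.re).add ((hd Complex.I u).hasFDerivAt.const_smul s.im)
    simp only [dirDeriv] at h3 ⊢
    rw [h3.fderiv]
    simp
  rw [dirDeriv_add_smul, h2, h2]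
  push_cast
  ring

/-- `μ` is a probability law on `ℂ` of mean zero and variance one, with `2 + ε` moment at
most `C`. -/
structure UnitLaw (ε C : ℝ) (μ : Measure ℂ) : Prop where
  prob : IsProbabilityMeasure μ
  mean : ∫ s, s ∂μ = 0
  var : ∫ s, ‖s‖ ^ 2 ∂μ = 1
  moment : ∫⁻ s, ‖s‖ₑ ^ (2 + ε) ∂μ ≤ ENNReal.ofReal C

namespace UnitLaw

variable {ε C : ℝ} {μ : Measure ℂ}

/-- The integral of a non-integrable function is 0 by convention, while the variance is 1. -/
theorem integrable_sq (h : UnitLaw ε C μ) : Integrable (fun s => ‖s‖ ^ 2) μ := by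
  by_contra hn
  have := h.var
  rw [integral_undef hn] at this
  norm_num at this

theorem integrable_of_sq_bound (h : UnitLaw ε C μ) {g : ℂ → ℂ} (hg : Continuous g) {K : ℝ}
    (hb : ∀ s, ‖g s‖ ≤ K * (1 + ‖s‖ ^ 2)) : Integrable g μ := by
  have := h.prob
  exact Integrable.mono' (((integrable_const 1).add h.integrable_sq).const_mul K)
    hg.aestronglyMeasurable (Filter.Eventually.of_forall hb)

theorem integrable_rpow (h : UnitLaw ε C μ) (hε : 0 < ε) :
    Integrable (fun s => ‖s‖ ^ (2 + ε)) μ ∧ ∫ s, ‖s‖ ^ (2 + ε) ∂μ ≤ max C 0 := by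
  have h1 : ∫⁻ s, ENNReal.ofReal (‖s‖ ^ (2 + ε)) ∂μ ≤ ENNReal.ofReal C := by
    refine le_trans (le_of_eq (lintegral_congr (fun s => ?_))) h.moment
    rw [← ENNReal.ofReal_rpow_of_nonneg (norm_nonneg _) (by linarith), ofReal_norm]
  have hm : AEStronglyMeasurable (fun s : ℂ => ‖s‖ ^ (2 + ε)) μ :=
    (Continuous.rpow_const continuous_norm (fun _ => Or.inr (by linarith))).aestronglyMeasurable
  have hn : ∀ s : ℂ, 0 ≤ ‖s‖ ^ (2 + ε) := fun s => by positivity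
  constructor
  · refine ⟨hm, ?_⟩
    rw [hasFiniteIntegral_iff_ofReal (Filter.Eventually.of_forall hn)]
    exact h1.trans_lt ENNReal.ofReal_lt_top
  · rw [integral_eq_lintegral_of_nonneg_ae (Filter.Eventually.of_forall hn) hm]
    refine ENNReal.toReal_le_of_le_ofReal (le_max_right _ _) (h1.trans ?_)
    exact ENNReal.ofReal_le_ofReal (le_max_left _ _)

end UnitLaw

/-- Equality of the moments of order at most two. -/
def SameMoments (μ ν : Measure ℂ) : Prop :=
  ∀ a b : ℕ, a + b ≤ 2 → ∫ s, s.re ^ a * s.im ^ b ∂μ = ∫ s, s.re ^ a * s.im ^ b ∂ν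

/-- For x ≤ 1 the cubic bound is the stronger one, and for x > 1 the quadratic one; 2 + ε lies
between the exponents because ε ≤ 1. -/
theorem min_le_rpow {x ε : ℝ} (hx : 0 ≤ x) (hε : 0 < ε) (hε1 : ε ≤ 1) {r K : ℝ} (hK : 0 ≤ K)
    (h2 : r ≤ K * x ^ 2) (h3 : r ≤ K * x ^ 3) : r ≤ K * x ^ (2 + ε) := by
  rcases le_or_gt x 1 with h | h
  · refine h3.trans ?_
    gcongr
    rcases hx.eq_or_lt with rfl | hx0
    · rw [Real.zero_rpow (by linarith)]; simp
    · rw [← Real.rpow_natCast]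
      exact Real.rpow_le_rpow_of_exponent_ge hx0 h (by norm_num; linarith)
  · refine h2.trans ?_
    gcongr
    rw [← Real.rpow_natCast]
    exact Real.rpow_le_rpow_of_exponent_le h.le (by norm_num; linarith)

/-- Swapping one variable for another one with the same first two moments. -/
theorem norm_integral_sub_integral_le {ε C : ℝ} (hε : 0 < ε) (hε1 : ε ≤ 1) {μ ν : Measure ℂ}
    (hμ : UnitLaw ε C μ) (hν : UnitLaw ε C ν) (hmn : SameMoments μ ν) {h : ℂ → ℂ}
    (hh : ContDiff ℝ (⊤ : ℕ∞) h) {K β : ℝ} (hK : 0 ≤ K) (hβ : 0 ≤ β)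
    (hM : ∀ j, j ≤ 3 → ∀ s, ‖iteratedFDeriv ℝ j h s‖ ≤ K * β ^ j) :
    ‖∫ s, h s ∂μ - ∫ s, h s ∂ν‖ ≤ 4 * K * max C 0 * β ^ (2 + ε) := by
  let P : ℂ → ℂ := fun s => h 0 + ((s.re : ℂ) * dirDeriv 1 h 0 + (s.im : ℂ) * dirDeriv Complex.I h 0)
    + ((s.re ^ 2 : ℝ) * dirDeriv 1 (dirDeriv 1 h) 0 +
      (s.re * s.im : ℝ) * (dirDeriv 1 (dirDeriv Complex.I h) 0 +
        dirDeriv Complex.I (dirDeriv 1 h) 0) +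
      (s.im ^ 2 : ℝ) * dirDeriv Complex.I (dirDeriv Complex.I h) 0) / 2
  have hP : ∀ s, h s = P s + taylorRem h s := by
    intro s
    simp only [taylorRem, P]
    rw [dirDeriv_dirDeriv_eq hh s 0, dirDeriv_add_smul (h := h) s 0]
    ring
  have hrem : ∀ s, ‖taylorRem h s‖ ≤ 2 * K * β ^ (2 + ε) * ‖s‖ ^ (2 + ε) := by
    intro s
    obtain ⟨h2, h3⟩ := norm_taylorRem_le hh hM s
    rw [mul_assoc, ← Real.mul_rpow hβ (norm_nonneg s)]
    refine min_le_rpow (by positivity) hε hε1 (by positivity) ?_ ?_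
    · calc _ ≤ _ := h2
        _ = _ := by ring
    · calc _ ≤ _ := h3
        _ ≤ 2 * (K * β ^ 3 * ‖s‖ ^ 3) := by
          have : 0 ≤ K * β ^ 3 * ‖s‖ ^ 3 := by positivity
          linarith
        _ = _ := by ring
  have hremc : Continuous (taylorRem h) := by
    have : taylorRem h = fun s => h s - P s := by funext s; rw [hP s]; ring
    rw [this]
    refine hh.continuous.sub ?_
    simp only [P]
    fun_prop
  -- Apart from the remainder R, the mean of h depends on the law only through moments of order at
  -- most two, so these terms cancel between μ and ν.
  have key : ∀ {μ : Measure ℂ}, UnitLaw ε C μ → ∃ R : ℂ, ‖R‖ ≤ 2 * K * max C 0 * β ^ (2 + ε) ∧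
      ∫ s, h s ∂μ = h 0 + (((∫ s, s.re ^ 1 * s.im ^ 0 ∂μ : ℝ) : ℂ) * dirDeriv 1 h 0 +
        ((∫ s, s.re ^ 0 * s.im ^ 1 ∂μ : ℝ) : ℂ) * dirDeriv Complex.I h 0)
    + (((∫ s, s.re ^ 2 * s.im ^ 0 ∂μ : ℝ) : ℂ) * dirDeriv 1 (dirDeriv 1 h) 0 +
      ((∫ s, s.re ^ 1 * s.im ^ 1 ∂μ : ℝ) : ℂ) * (dirDeriv 1 (dirDeriv Complex.I h) 0 +
        dirDeriv Complex.I (dirDeriv 1 h) 0) +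
      ((∫ s, s.re ^ 0 * s.im ^ 2 ∂μ : ℝ) : ℂ) * dirDeriv Complex.I (dirDeriv Complex.I h) 0) / 2
      + R := by
    intro μ hμ
    have := hμ.prob
    obtain ⟨hI, hIC⟩ := hμ.integrable_rpow hε
    have hRI : Integrable (taylorRem h) μ :=
      Integrable.mono' (hI.const_mul (2 * K * β ^ (2 + ε))) hremc.aestronglyMeasurable
        (Filter.Eventually.of_forall hrem)
    refine ⟨∫ s, taylorRem h s ∂μ, ?_, ?_⟩
    · refine (norm_integral_le_of_norm_le (hI.const_mul (2 * K * β ^ (2 + ε)))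
        (Filter.Eventually.of_forall hrem)).trans ?_
      rw [integral_const_mul]
      calc _ ≤ 2 * K * β ^ (2 + ε) * max C 0 := by gcongr
        _ = _ := by ring
    · have hre : ∀ s : ℂ, |s.re| ≤ ‖s‖ := Complex.abs_re_le_norm
      have him : ∀ s : ℂ, |s.im| ≤ ‖s‖ := Complex.abs_im_le_norm
      have i1 : ∀ {g : ℂ → ℝ}, Continuous g → (∀ s, |g s| ≤ 1 + ‖s‖ ^ 2) → ∀ c : ℂ,
          Integrable (fun s => ((g s : ℝ) : ℂ) * c) μ := by
        intro g hg hb c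
        refine Integrable.mul_const (hμ.integrable_of_sq_bound (K := 1)
          (Complex.continuous_ofReal.comp hg) (fun s => ?_)) c
        rw [Function.comp, Complex.norm_real, one_mul]
        exact hb s
      have j1 := i1 (g := fun s => s.re) (by fun_prop)
        (fun s => (hre s).trans (by nlinarith [sq_nonneg (‖s‖ - 1)]))
      have j2 := i1 (g := fun s => s.im) (by fun_prop)
        (fun s => (him s).trans (by nlinarith [sq_nonneg (‖s‖ - 1)]))
      have j3 := i1 (g := fun s => s.re ^ 2) (by fun_prop)
        (fun s => by
          have := pow_le_pow_left₀ (abs_nonneg _) (hre s) 2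
          rw [abs_pow]; linarith)
      have j4 := i1 (g := fun s => s.re * s.im) (by fun_prop)
        (fun s => by
          have := mul_le_mul (hre s) (him s) (abs_nonneg _) (norm_nonneg _)
          rw [abs_mul]; nlinarith)
      have j5 := i1 (g := fun s => s.im ^ 2) (by fun_prop)
        (fun s => by
          have := pow_le_pow_left₀ (abs_nonneg _) (him s) 2
          rw [abs_pow]; linarith)
      have e1 : ∫ s, h s ∂μ = ∫ s, (P s + taylorRem h s) ∂μ := by simp only [← hP]
      have hsum3 : Integrable (fun s : ℂ => ((s.re ^ 2 : ℝ) : ℂ) * dirDeriv 1 (dirDeriv 1 h) 0 +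
          ((s.re * s.im : ℝ) : ℂ) * (dirDeriv 1 (dirDeriv Complex.I h) 0 +
            dirDeriv Complex.I (dirDeriv 1 h) 0)) μ := (j3 _).add (j4 _)
      have hsum2 : Integrable (fun s : ℂ => ((s.re ^ 2 : ℝ) : ℂ) * dirDeriv 1 (dirDeriv 1 h) 0 +
          ((s.re * s.im : ℝ) : ℂ) * (dirDeriv 1 (dirDeriv Complex.I h) 0 +
            dirDeriv Complex.I (dirDeriv 1 h) 0) +
          ((s.im ^ 2 : ℝ) : ℂ) * dirDeriv Complex.I (dirDeriv Complex.I h) 0) μ :=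
        hsum3.add (j5 _)
      have hsum1 : Integrable (fun s : ℂ => (s.re : ℂ) * dirDeriv 1 h 0 +
          (s.im : ℂ) * dirDeriv Complex.I h 0) μ := (j1 _).add (j2 _)
      have hsum0 : Integrable (fun s : ℂ => h 0 + ((s.re : ℂ) * dirDeriv 1 h 0 +
          (s.im : ℂ) * dirDeriv Complex.I h 0)) μ := (integrable_const (h 0)).add hsum1
      have hPI : Integrable P μ :=
        hsum0.add (hsum2.div_const 2)
      rw [e1, integral_add hPI hRI]
      congr 1
      simp only [P]
      rw [integral_add hsum0 (hsum2.div_const 2),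
        integral_add (integrable_const (h 0)) hsum1, integral_div, integral_add (j1 _) (j2 _),
        integral_add hsum3 (j5 _), integral_add (j3 _) (j4 _)]
      simp only [integral_mul_const, integral_complex_ofReal, pow_zero, pow_one, mul_one, one_mul]
      simp
  obtain ⟨R, hR, hRe⟩ := key hμ
  obtain ⟨R', hR', hRe'⟩ := key hν
  rw [hRe, hRe', hmn 1 0 (by norm_num), hmn 0 1 (by norm_num), hmn 2 0 (by norm_num),
    hmn 1 1 (by norm_num), hmn 0 2 (by norm_num), add_sub_add_left_eq_sub]
  refine (norm_sub_le _ _).trans ?_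
  linarith

end

/-! ### Lindeberg's exchange for linear forms in independent variables. -/

theorem integral_pi_fin_succ {N : ℕ} (μ : Measure ℂ) [IsProbabilityMeasure μ]
    {F : (Fin (N + 1) → ℂ) → ℂ} (hF : Integrable F (Measure.pi fun _ => μ)) :
    ∫ x, F x ∂(Measure.pi fun _ => μ) =
      ∫ s, ∫ x : Fin N → ℂ, F (Fin.cons s x) ∂(Measure.pi fun _ => μ) ∂μ := by
  have hmp := (measurePreserving_piFinSuccAbove (fun _ : Fin (N + 1) => μ) 0).symm
  have he : ∀ x : ℂ × (Fin N → ℂ), (MeasurableEquiv.piFinSuccAbove (fun _ : Fin (N + 1) => ℂ)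
      0).symm x = Fin.cons x.1 x.2 := by
    intro x
    simp [MeasurableEquiv.piFinSuccAbove_symm_apply, Fin.insertNthEquiv]
  have hI := (hmp.integrable_comp_emb (MeasurableEquiv.measurableEmbedding _)).2 hF
  rw [← hmp.integral_comp' F]
  have h2 := integral_prod _ hI
  simp only [Function.comp, he] at h2 ⊢
  exact h2

/-- The product of the truncated logarithms of the linear forms `y q + ∑ a q i xᵢ`. -/
noncomputable def truncLogProd {m N : ℕ} (d : ℝ) (y : Fin m → ℂ) (a : Fin m → Fin N → ℂ)
    (x : Fin N → ℂ) : ℂ :=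
  ∏ q, ((truncLog d (y q + ∑ i, a q i * x i) : ℝ) : ℂ)

theorem norm_truncLogProd_le {m N : ℕ} {d : ℝ} (hd : 0 < d) (hd1 : d ≤ 1) (y : Fin m → ℂ)
    (a : Fin m → Fin N → ℂ) (x : Fin N → ℂ) : ‖truncLogProd d y a x‖ ≤ Real.log d⁻¹ ^ m := by
  rw [truncLogProd, norm_prod]
  calc _ ≤ ∏ _q : Fin m, Real.log d⁻¹ := by
        refine Finset.prod_le_prod (fun _ _ => norm_nonneg _) (fun q _ => ?_)
        rw [Complex.norm_real]
        exact abs_truncLog_le hd hd1 _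
    _ = _ := by simp

theorem continuous_truncLogProd {m N : ℕ} {d : ℝ} (hd : 0 < d) (y : Fin m → ℂ)
    (a : Fin m → Fin N → ℂ) : Continuous (truncLogProd d y a) := by
  have := (contDiff_truncLog hd).continuous
  unfold truncLogProd
  fun_prop

theorem truncLogProd_cons {m N : ℕ} (d : ℝ) (y : Fin m → ℂ) (a : Fin m → Fin (N + 1) → ℂ) (s : ℂ)
    (x : Fin N → ℂ) : truncLogProd d y a (Fin.cons s x) =
      truncLogProd d (fun q => y q + a q 0 * s) (fun q i => a q i.succ) x := by
  simp only [truncLogProd, Fin.sum_univ_succ, Fin.cons_zero, Fin.cons_succ, add_assoc]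

/-- Lindeberg's exchange argument for products of truncated logarithms. -/
theorem exists_lindeberg_bound (m : ℕ) : ∃ K : ℝ, 0 < K ∧ ∀ (ε C : ℝ), 0 < ε → ε ≤ 1 →
    ∀ (μ ν : Measure ℂ), UnitLaw ε C μ → UnitLaw ε C ν → SameMoments μ ν →
    ∀ (d : ℝ), 0 < d → d ≤ 1 → ∀ (N : ℕ) (y : Fin m → ℂ) (a : Fin m → Fin N → ℂ) (α : Fin N → ℝ),
      (∀ i, 0 ≤ α i) → (∀ q i, ‖a q i‖ ≤ α i) →
      ‖∫ x, truncLogProd d y a x ∂(Measure.pi fun _ => μ) -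
        ∫ x, truncLogProd d y a x ∂(Measure.pi fun _ => ν)‖ ≤
        K * (1 + Real.log d⁻¹) ^ m * max C 0 * ∑ i, (α i / d) ^ (2 + ε) := by
  obtain ⟨K, hK0, hK⟩ := exists_norm_iteratedFDeriv_prod_truncLog_le m
  refine ⟨4 * K, by positivity, ?_⟩
  intro ε C hε hε1 μ ν hμ hν hmn d hd hd1
  have := hμ.prob
  have := hν.prob
  have hlog : 0 ≤ Real.log d⁻¹ := Real.log_nonneg ((one_le_inv₀ hd).2 hd1)
  intro N
  induction N with
  | zero =>
    intro y a α _ _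
    simp [Measure.pi_of_empty _ (fun q : Fin 0 => q.elim0)]
  | succ N ih =>
    intro y a α hα0 hα
    have hI : ∀ (ρ : Measure ℂ) [IsProbabilityMeasure ρ] (N : ℕ) (y : Fin m → ℂ)
        (a : Fin m → Fin N → ℂ), Integrable (truncLogProd d y a) (Measure.pi fun _ => ρ) :=
      fun ρ _ N y a => Integrable.of_bound (continuous_truncLogProd hd y a).aestronglyMeasurable _
        (Filter.Eventually.of_forall (norm_truncLogProd_le hd hd1 y a))
    rw [integral_pi_fin_succ μ (hI μ _ y a), integral_pi_fin_succ ν (hI ν _ y a)]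
    simp only [truncLogProd_cons]
    -- The hybrid: the first variable is fixed at s and the others have law ρ. The induction
    -- hypothesis replaces μ by ν in the others, uniformly in s because the shift y is arbitrary;
    -- afterwards the law of s itself is changed.
    let A : ℂ → Measure ℂ → ℂ := fun s ρ => ∫ x : Fin N → ℂ,
      truncLogProd d (fun q => y q + a q 0 * s) (fun q i => a q i.succ) x ∂(Measure.pi fun _ => ρ)
    have hpt : ∀ s, ‖A s μ - A s ν‖ ≤ 4 * K * (1 + Real.log d⁻¹) ^ m * max C 0 *
        ∑ i : Fin N, (α i.succ / d) ^ (2 + ε) := fun s =>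
      ih _ _ (fun i => α i.succ) (fun i => hα0 _) (fun q i => hα q i.succ)
    have hjoint : Continuous (fun p : ℂ × (Fin N → ℂ) =>
        truncLogProd d (fun q => y q + a q 0 * p.1) (fun q i => a q i.succ) p.2) := by
      have := (contDiff_truncLog hd).continuous
      unfold truncLogProd
      fun_prop
    have hAI : ∀ (ρ ρ' : Measure ℂ) [IsProbabilityMeasure ρ] [IsProbabilityMeasure ρ'],
        Integrable (fun s => A s ρ) ρ' := by
      intro ρ ρ' _ _
      refine Integrable.of_bound (C := Real.log d⁻¹ ^ m) ?_ (Filter.Eventually.of_forall fun s => ?_)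
      · exact (StronglyMeasurable.integral_prod_right
          (ν := (Measure.pi fun _ => ρ : Measure (Fin N → ℂ)))
          hjoint.stronglyMeasurable).aestronglyMeasurable
      · refine (norm_integral_le_of_norm_le_const (C := Real.log d⁻¹ ^ m)
          (Filter.Eventually.of_forall fun x => norm_truncLogProd_le hd hd1 _ _ x)).trans ?_
        simp
    have hfirst : ‖∫ s, A s μ ∂μ - ∫ s, A s ν ∂μ‖ ≤ 4 * K * (1 + Real.log d⁻¹) ^ m * max C 0 *
        ∑ i : Fin N, (α i.succ / d) ^ (2 + ε) := by
      rw [← integral_sub (hAI μ μ) (hAI ν μ)]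
      refine (norm_integral_le_of_norm_le_const (Filter.Eventually.of_forall hpt)).trans ?_
      simp
    -- Fubini brings the first variable inside, so that the one-variable exchange can be made with
    -- all other variables frozen.
    have hswap : ∀ (ρ : Measure ℂ) [IsProbabilityMeasure ρ], ∫ s, A s ν ∂ρ =
        ∫ x : Fin N → ℂ, ∫ s, truncLogProd d (fun q => y q + a q 0 * s) (fun q i => a q i.succ) x
          ∂ρ ∂(Measure.pi fun _ => ν) := by
      intro ρ _
      refine integral_integral_swap ?_
      exact Integrable.of_bound hjoint.aestronglyMeasurable (Real.log d⁻¹ ^ m)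
        (Filter.Eventually.of_forall fun p => norm_truncLogProd_le hd hd1 _ _ _)
    have hBI : ∀ (ρ : Measure ℂ) [IsProbabilityMeasure ρ], Integrable (fun x : Fin N → ℂ =>
        ∫ s, truncLogProd d (fun q => y q + a q 0 * s) (fun q i => a q i.succ) x ∂ρ)
        (Measure.pi fun _ => ν) := by
      intro ρ _
      refine Integrable.of_bound (C := Real.log d⁻¹ ^ m) ?_ (Filter.Eventually.of_forall fun x => ?_)
      · exact (StronglyMeasurable.integral_prod_left (μ := ρ)
          hjoint.stronglyMeasurable).aestronglyMeasurable
      · refine (norm_integral_le_of_norm_le_const (C := Real.log d⁻¹ ^ m)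
          (Filter.Eventually.of_forall fun s => norm_truncLogProd_le hd hd1 _ _ x)).trans ?_
        simp
    have hsecond : ‖∫ s, A s ν ∂μ - ∫ s, A s ν ∂ν‖ ≤ 4 * K * (1 + Real.log d⁻¹) ^ m * max C 0 *
        (α 0 / d) ^ (2 + ε) := by
      rw [hswap μ, hswap ν, ← integral_sub (hBI μ) (hBI ν)]
      have hb : ∀ x : Fin N → ℂ,
          ‖∫ s, truncLogProd d (fun q => y q + a q 0 * s) (fun q i => a q i.succ) x ∂μ -
            ∫ s, truncLogProd d (fun q => y q + a q 0 * s) (fun q i => a q i.succ) x ∂ν‖ ≤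
          4 * K * (1 + Real.log d⁻¹) ^ m * max C 0 * (α 0 / d) ^ (2 + ε) := by
        intro x
        have hform : (fun s => truncLogProd d (fun q => y q + a q 0 * s) (fun q i => a q i.succ) x)
            = fun s => ∏ q, ((truncLog d ((y q + ∑ i : Fin N, a q i.succ * x i) + a q 0 * s) : ℝ)
              : ℂ) := by
          funext s
          simp only [truncLogProd, add_right_comm]
        rw [hform]
        have hsm : ContDiff ℝ (⊤ : ℕ∞) (fun s => ∏ q,
            ((truncLog d ((y q + ∑ i : Fin N, a q i.succ * x i) + a q 0 * s) : ℝ) : ℂ)) := by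
          refine contDiff_prod (fun q _ => ?_)
          exact Complex.ofRealCLM.contDiff.comp
            (f := fun s => truncLog d ((y q + ∑ i : Fin N, a q i.succ * x i) + a q 0 * s))
            ((contDiff_truncLog hd).comp (contDiff_const.add (contDiff_const.mul contDiff_id)))
        have hM := hK d hd hd1 (fun q => y q + ∑ i : Fin N, a q i.succ * x i) (fun q => a q 0) (α 0)
          (fun q => hα q 0)
        rw [max_eq_left (hα0 0)] at hM
        have := norm_integral_sub_integral_le hε hε1 hμ hν hmn hsm
          (K := K * (1 + Real.log d⁻¹) ^ m) (β := α 0 / d) (by positivity)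
          (div_nonneg (hα0 0) hd.le) hM
        refine this.trans (le_of_eq ?_)
        ring
      refine (norm_integral_le_of_norm_le_const (Filter.Eventually.of_forall hb)).trans ?_
      simp
    have htot : ∫ s, A s μ ∂μ - ∫ s, A s ν ∂ν =
        (∫ s, A s μ ∂μ - ∫ s, A s ν ∂μ) + (∫ s, A s ν ∂μ - ∫ s, A s ν ∂ν) := by ring
    change ‖∫ s, A s μ ∂μ - ∫ s, A s ν ∂ν‖ ≤ _
    rw [htot, Fin.sum_univ_succ, mul_add]
    refine (norm_add_le _ _).trans ?_
    linarith

/-! ### Small ball estimates through characteristic functions. -/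

section

theorem norm_exp_sub_taylor_two_le (x : ℝ) :
    ‖Complex.exp (x * Complex.I) - 1 - x * Complex.I + x ^ 2 / 2‖ ≤ 2 * |x| ^ 2 ∧
      ‖Complex.exp (x * Complex.I) - 1 - x * Complex.I + x ^ 2 / 2‖ ≤ |x| ^ 3 := by
  let c : ℂ := x * Complex.I
  have hc : ‖c‖ = |x| := by simp [c]
  have hd : ∀ j : ℕ, ∀ t : ℝ, HasDerivAt (fun t : ℝ => c ^ j * Complex.exp (t * c))
      (c ^ (j + 1) * Complex.exp (t * c)) t := by
    intro j t
    have h1 : HasDerivAt (fun t : ℝ => (t : ℂ) * c) c t := by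
      simpa using (Complex.ofRealCLM.hasDerivAt (x := t)).mul_const c
    exact ((h1.cexp).const_mul (c ^ j)).congr_deriv (by ring)
  have hn : ∀ j : ℕ, ∀ t : ℝ, ‖c ^ j * Complex.exp (t * c)‖ ≤ |x| ^ j := by
    intro j t
    have : (t : ℂ) * c = ((t * x : ℝ) : ℂ) * Complex.I := by simp [c]; ring
    rw [norm_mul, norm_pow, hc, this, Complex.norm_exp_ofReal_mul_I, mul_one]
  have key := norm_taylor_two_le (hd 0) (hd 1) (hd 2) (fun t _ => hn 2 t) (fun t _ => hn 3 t)
  have he : c ^ 0 * Complex.exp ((1 : ℝ) * c) - c ^ 0 * Complex.exp ((0 : ℝ) * c)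
      - c ^ 1 * Complex.exp ((0 : ℝ) * c) - c ^ 2 * Complex.exp ((0 : ℝ) * c) / 2 =
      Complex.exp (x * Complex.I) - 1 - x * Complex.I + x ^ 2 / 2 := by
    simp only [Complex.ofReal_one, Complex.ofReal_zero, zero_mul, Complex.exp_zero, c, mul_pow,
      Complex.I_sq]
    ring_nf
  simp only [zero_add, Nat.reduceAdd] at key
  rwa [he] at key

section

variable {ε C : ℝ} {μ : Measure ℂ}

/-- The characteristic function of `Re (b ξ)`. -/
noncomputable def charRe (μ : Measure ℂ) (b : ℂ) (t : ℝ) : ℂ :=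
  ∫ s, Complex.exp (((t * (b * s).re : ℝ) : ℂ) * Complex.I) ∂μ

/-- Expanding the exponential to second order leaves 1 - t²E(Re bξ)²/2, the linear term vanishing
with the mean, plus a remainder controlled by the moment of order 2 + ε. Then 1 + x ≤ e^x. -/
theorem norm_charRe_le (hε : 0 < ε) (hε1 : ε ≤ 1) (h : UnitLaw ε C μ) (b : ℂ) (t : ℝ)
    (ht : |t| * ‖b‖ ≤ 1) :
    ‖charRe μ b t‖ ≤ Real.exp (-(t ^ 2 * ∫ s, (b * s).re ^ 2 ∂μ) / 2 +
      2 * max C 0 * (|t| * ‖b‖) ^ (2 + ε)) := by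
  have := h.prob
  let X : ℂ → ℝ := fun s => t * (b * s).re
  have hXn : ∀ s, |X s| ≤ |t| * ‖b‖ * ‖s‖ := by
    intro s
    simp only [X, abs_mul]
    calc _ ≤ |t| * ‖b * s‖ := by gcongr; exact Complex.abs_re_le_norm _
      _ = _ := by rw [norm_mul]; ring
  have hXc : Continuous X := by fun_prop
  let R : ℂ → ℂ := fun s => Complex.exp (X s * Complex.I) - 1 - X s * Complex.I + X s ^ 2 / 2
  have hR : ∀ s, ‖R s‖ ≤ 2 * (|t| * ‖b‖) ^ (2 + ε) * ‖s‖ ^ (2 + ε) := by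
    intro s
    obtain ⟨h2, h3⟩ := norm_exp_sub_taylor_two_le (X s)
    have h1 := min_le_rpow (abs_nonneg (X s)) hε hε1 (K := 2) (by norm_num) h2
      (h3.trans (by have : 0 ≤ |X s| ^ 3 := by positivity
                    linarith))
    refine h1.trans ?_
    rw [mul_assoc, ← Real.mul_rpow (by positivity) (norm_nonneg _)]
    gcongr
    exact hXn s
  obtain ⟨hI, hIC⟩ := h.integrable_rpow hε
  have hRI : Integrable R μ := Integrable.mono' (hI.const_mul _)
    (by fun_prop : Continuous R).aestronglyMeasurable (Filter.Eventually.of_forall hR)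
  have hRn : ‖∫ s, R s ∂μ‖ ≤ 2 * max C 0 * (|t| * ‖b‖) ^ (2 + ε) := by
    refine (norm_integral_le_of_norm_le (hI.const_mul _)
      (Filter.Eventually.of_forall hR)).trans ?_
    rw [integral_const_mul]
    calc _ ≤ 2 * (|t| * ‖b‖) ^ (2 + ε) * max C 0 := by gcongr
      _ = _ := by ring
  have hid : Integrable (fun s : ℂ => s) μ :=
    h.integrable_of_sq_bound (g := fun s => s) (K := 1) continuous_id
      (fun s => by nlinarith [sq_nonneg (‖s‖ - 1)])
  have hXI : Integrable X μ := by
    have := ((hid.const_mul b).re).const_mul t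
    simpa [X] using this
  have hX0 : ∫ s, X s ∂μ = 0 := by
    simp only [X]
    rw [integral_const_mul]
    have : ∫ s, (b * s).re ∂μ = (∫ s, b * s ∂μ).re := integral_re (hid.const_mul b)
    rw [this, integral_const_mul, h.mean]
    simp
  have hXsq : Integrable (fun s => X s ^ 2) μ := by
    refine Integrable.mono' (h.integrable_sq.const_mul ((|t| * ‖b‖) ^ 2))
      (hXc.pow 2).aestronglyMeasurable (Filter.Eventually.of_forall fun s => ?_)
    rw [Real.norm_eq_abs, abs_pow, ← mul_pow]
    exact pow_le_pow_left₀ (abs_nonneg _) (hXn s) 2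
  have hvar : ∫ s, X s ^ 2 ∂μ = t ^ 2 * ∫ s, (b * s).re ^ 2 ∂μ := by
    rw [← integral_const_mul]
    congr 1
    funext s
    simp only [X]
    ring
  have hvle : ∫ s, X s ^ 2 ∂μ ≤ 1 := by
    calc _ ≤ ∫ s, (|t| * ‖b‖) ^ 2 * ‖s‖ ^ 2 ∂μ := by
          refine integral_mono hXsq (h.integrable_sq.const_mul _) (fun s => ?_)
          rw [← mul_pow, ← sq_abs (X s)]
          exact pow_le_pow_left₀ (abs_nonneg _) (hXn s) 2
      _ = (|t| * ‖b‖) ^ 2 := by rw [integral_const_mul, h.var, mul_one]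
      _ ≤ 1 := pow_le_one₀ (by positivity) ht
  have hval : charRe μ b t = ((1 - (∫ s, X s ^ 2 ∂μ) / 2 : ℝ) : ℂ) + ∫ s, R s ∂μ := by
    have hs : ∀ s, Complex.exp (((t * (b * s).re : ℝ) : ℂ) * Complex.I) =
        (((1 - X s ^ 2 / 2 : ℝ) : ℂ) + ((X s : ℝ) : ℂ) * Complex.I) + R s := by
      intro s
      simp only [R, X]
      push_cast
      ring
    have hA : Integrable (fun s => 1 - X s ^ 2 / 2) μ := (integrable_const 1).sub (hXsq.div_const 2)
    have hA' : Integrable (fun s => ((1 - X s ^ 2 / 2 : ℝ) : ℂ)) μ := hA.ofReal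
    have hB' : Integrable (fun s => ((X s : ℝ) : ℂ) * Complex.I) μ :=
      (hXI.ofReal (𝕜 := ℂ)).mul_const _
    have hAB : Integrable (fun s => ((1 - X s ^ 2 / 2 : ℝ) : ℂ) + ((X s : ℝ) : ℂ) * Complex.I) μ :=
      hA'.add hB'
    rw [charRe]
    simp only [hs]
    rw [integral_add hAB hRI, integral_add hA' hB', integral_mul_const, integral_complex_ofReal,
      integral_complex_ofReal, hX0, integral_sub (integrable_const 1) (hXsq.div_const 2),
      integral_div]
    simp
  rw [hval, ← hvar]
  refine (norm_add_le _ _).trans ?_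
  -- The condition |t||b| ≤ 1 makes the variance of tRe(bξ) at most one, so 1 minus half of it is
  -- its own absolute value.
  rw [Complex.norm_real, Real.norm_of_nonneg (by linarith)]
  have := Real.add_one_le_exp (-(∫ s, X s ^ 2 ∂μ) / 2 + 2 * max C 0 * (|t| * ‖b‖) ^ (2 + ε))
  linarith

/-- Re(bs) and Re(-i bs) are the real and imaginary parts of bs. Consequently one of the two
rotations 1 and -i keeps at least half of the total variance of a linear form, even when the law of
ξ is degenerate in some direction. -/
theorem integral_re_sq_add (h : UnitLaw ε C μ) (b : ℂ) :
    ∫ s, (1 * b * s).re ^ 2 ∂μ + ∫ s, (-Complex.I * b * s).re ^ 2 ∂μ = ‖b‖ ^ 2 := by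
  have hI : ∀ c : ℂ, Integrable (fun s => (c * s).re ^ 2) μ := by
    intro c
    refine Integrable.mono' (h.integrable_sq.const_mul (‖c‖ ^ 2))
      (by fun_prop) (Filter.Eventually.of_forall fun s => ?_)
    rw [Real.norm_eq_abs, abs_pow, ← mul_pow, ← norm_mul]
    exact pow_le_pow_left₀ (abs_nonneg _) (Complex.abs_re_le_norm _) 2
  rw [← integral_add (hI _) (hI _)]
  have : ∀ s : ℂ, (1 * b * s).re ^ 2 + (-Complex.I * b * s).re ^ 2 = ‖b‖ ^ 2 * ‖s‖ ^ 2 := by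
    intro s
    rw [← mul_pow, ← norm_mul, Complex.sq_norm, Complex.normSq_apply, one_mul]
    simp [Complex.mul_re, Complex.mul_im]
    ring
  simp only [this]
  rw [integral_const_mul, h.var, mul_one]

/-- Gaussian decay of the characteristic function of the real part of a rotated linear form. -/
theorem exists_charRe_decay (hε : 0 < ε) (hε1 : ε ≤ 1) (C : ℝ) : ∃ T₀ : ℝ, 0 < T₀ ∧
    ∀ μ : Measure ℂ, UnitLaw ε C μ → ∀ (N : ℕ) (a : Fin N → ℂ) (τ : ℝ), (∀ i, ‖a i‖ ≤ τ) →
      ∃ ω : ℂ, ‖ω‖ = 1 ∧ ∀ t : ℝ, |t| * τ ≤ T₀ →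
        ∏ i, ‖charRe μ (ω * a i) t‖ ≤ Real.exp (-(∑ i, ‖a i‖ ^ 2) / 8 * t ^ 2) := by
  set C₁ := max C 0 + 1 with hC₁
  have hC₁0 : 0 < C₁ := by positivity
  -- Chosen so that each Taylor error is at most t²|aᵢ|²/8. The retained half of the variance gives
  -- decay t²∑|aᵢ|²/4, of which one half survives.
  refine ⟨min 1 ((1 / (16 * C₁)) ^ (1 / ε)), by positivity, ?_⟩
  intro μ h N a τ ha
  have hsum : ∑ i, ∫ s, (1 * a i * s).re ^ 2 ∂μ + ∑ i, ∫ s, (-Complex.I * a i * s).re ^ 2 ∂μ =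
      ∑ i, ‖a i‖ ^ 2 := by
    rw [← Finset.sum_add_distrib]
    exact Finset.sum_congr rfl (fun i _ => integral_re_sq_add h (a i))
  obtain ⟨ω, hω, hv⟩ : ∃ ω : ℂ, ‖ω‖ = 1 ∧
      (∑ i, ‖a i‖ ^ 2) / 2 ≤ ∑ i, ∫ s, (ω * a i * s).re ^ 2 ∂μ := by
    by_cases hc : (∑ i, ‖a i‖ ^ 2) / 2 ≤ ∑ i, ∫ s, (1 * a i * s).re ^ 2 ∂μ
    · exact ⟨1, by simp, hc⟩
    · exact ⟨-Complex.I, by simp, by linarith⟩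
  refine ⟨ω, hω, fun t ht => ?_⟩
  have hta : ∀ i, |t| * ‖ω * a i‖ ≤ |t| * τ := fun i => by
    rw [norm_mul, hω, one_mul]; gcongr; exact ha i
  have hε' : ∀ i, 2 * max C 0 * (|t| * ‖ω * a i‖) ^ (2 + ε) ≤ t ^ 2 * ‖a i‖ ^ 2 / 8 := by
    intro i
    have h0 : 0 ≤ |t| * ‖ω * a i‖ := by positivity
    have h1 : (|t| * ‖ω * a i‖) ^ (2 + ε) =
        (|t| * ‖ω * a i‖) ^ 2 * (|t| * ‖ω * a i‖) ^ ε := by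
      rw [Real.rpow_add_of_nonneg h0 (by norm_num) hε.le, Real.rpow_two]
    have h2 : (|t| * ‖ω * a i‖) ^ ε ≤ 1 / (16 * C₁) := by
      calc _ ≤ ((1 / (16 * C₁)) ^ (1 / ε)) ^ ε := by
            gcongr
            exact ((hta i).trans ht).trans (min_le_right _ _)
        _ = 1 / (16 * C₁) := by
          rw [← Real.rpow_mul (by positivity), one_div_mul_cancel hε.ne', Real.rpow_one]
    have h3 : (|t| * ‖ω * a i‖) ^ 2 = t ^ 2 * ‖a i‖ ^ 2 := by
      rw [norm_mul, hω, one_mul, mul_pow, sq_abs]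
    rw [h1, h3]
    calc _ ≤ 2 * C₁ * (t ^ 2 * ‖a i‖ ^ 2 * (1 / (16 * C₁))) := by
          gcongr
          rw [hC₁]; linarith
      _ = _ := by field_simp; ring
  calc ∏ i, ‖charRe μ (ω * a i) t‖
      ≤ ∏ i, Real.exp (-(t ^ 2 * ∫ s, (ω * a i * s).re ^ 2 ∂μ) / 2 + t ^ 2 * ‖a i‖ ^ 2 / 8) := by
        refine Finset.prod_le_prod (fun _ _ => norm_nonneg _) (fun i _ => ?_)
        refine (norm_charRe_le hε hε1 h (ω * a i) t
          (((hta i).trans ht).trans (min_le_left _ _))).trans ?_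
        gcongr
        exact hε' i
    _ = Real.exp (-(t ^ 2 * ∑ i, ∫ s, (ω * a i * s).re ^ 2 ∂μ) / 2 +
        t ^ 2 * (∑ i, ‖a i‖ ^ 2) / 8) := by
        rw [← Real.exp_sum, Finset.sum_add_distrib, ← Finset.sum_div, ← Finset.sum_div,
          Finset.sum_neg_distrib, ← Finset.mul_sum, ← Finset.mul_sum]
    _ ≤ _ := by
        gcongr
        have := mul_le_mul_of_nonneg_left hv (sq_nonneg t)
        linarith

theorem integral_exp_linear_eq_prod [IsProbabilityMeasure μ] {N : ℕ} (b : Fin N → ℂ) (t : ℝ) :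
    ∫ x, Complex.exp (((t * (∑ i, b i * x i).re : ℝ) : ℂ) * Complex.I) ∂(Measure.pi fun _ => μ) =
      ∏ i, charRe μ (b i) t := by
  simp only [charRe]
  rw [← integral_fintype_prod_eq_prod (μ := fun _ : Fin N => μ)
    (f := fun i s => Complex.exp (((t * (b i * s).re : ℝ) : ℂ) * Complex.I))]
  congr 1
  funext x
  rw [← Complex.exp_sum, ← Finset.sum_mul, Complex.re_sum, Finset.mul_sum]
  push_cast
  rfl

/-- Esseen's smoothing inequality, with a Gaussian kernel. -/
theorem measure_abs_le_mul_le {Ω : Type*} [MeasurableSpace Ω] (P : Measure Ω)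
    [IsProbabilityMeasure P] {Z : Ω → ℝ} (hZ : Measurable Z) {δ : ℝ} (hδ : 0 < δ) :
    P.real {ω | |Z ω| ≤ δ} * Real.sqrt (2 * Real.pi / δ ^ 2) ≤
      Real.exp (1 / 2) * ∫ t : ℝ, ‖∫ ω, Complex.exp (((t * Z ω : ℝ) : ℂ) * Complex.I) ∂P‖ *
        Real.exp (-(δ ^ 2 / 2) * t ^ 2) := by
  have hb : 0 < δ ^ 2 / 2 := by positivity
  have hg := integrable_exp_neg_mul_sq hb
  -- The Gaussian of width δ, which exceeds e^(-1/2) on [-δ, δ] up to equality at the ends, is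
  -- written as a Fourier integral. Averaging over the random variable then produces its
  -- characteristic function.
  have hfour : ∀ z : ℝ, ((Real.sqrt (2 * Real.pi / δ ^ 2) * Real.exp (-z ^ 2 / (2 * δ ^ 2)) : ℝ) : ℂ)
      = ∫ t : ℝ, Complex.exp (((t * z : ℝ) : ℂ) * Complex.I) *
        ((Real.exp (-(δ ^ 2 / 2) * t ^ 2) : ℝ) : ℂ) := by
    intro z
    have h1 := fourierIntegral_gaussian (b := ((δ ^ 2 / 2 : ℝ) : ℂ))
      (by rw [Complex.ofReal_re]; exact hb) (z : ℂ)
    have h2 : ((Real.pi : ℂ) / ((δ ^ 2 / 2 : ℝ) : ℂ)) ^ (1 / 2 : ℂ) =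
        ((Real.sqrt (2 * Real.pi / δ ^ 2) : ℝ) : ℂ) := by
      rw [Real.sqrt_eq_rpow, Complex.ofReal_cpow (by positivity)]
      push_cast
      congr 1
      field_simp
    rw [h2] at h1
    rw [Complex.ofReal_mul]
    have h3 : ((Real.exp (-z ^ 2 / (2 * δ ^ 2)) : ℝ) : ℂ) =
        Complex.exp (-(z : ℂ) ^ 2 / (4 * ((δ ^ 2 / 2 : ℝ) : ℂ))) := by
      push_cast
      congr 1
      ring
    rw [h3, ← h1]
    congr 1
    funext t
    push_cast
    congr 2
    ring
  have hind : ∀ ω, Set.indicator {ω | |Z ω| ≤ δ} (fun _ => (1 : ℝ)) ω ≤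
      Real.exp (1 / 2) * Real.exp (-(Z ω) ^ 2 / (2 * δ ^ 2)) := by
    intro ω
    by_cases hω : |Z ω| ≤ δ
    · rw [Set.indicator_of_mem (by exact hω), ← Real.exp_add]
      refine Real.one_le_exp ?_
      have : (Z ω) ^ 2 ≤ δ ^ 2 := sq_le_sq' (by linarith [neg_abs_le (Z ω)])
        ((le_abs_self _).trans hω)
      have : (Z ω) ^ 2 / (2 * δ ^ 2) ≤ 1 / 2 := by
        rw [div_le_iff₀ (by positivity)]; linarith
      rw [neg_div]
      linarith
    · rw [Set.indicator_of_notMem (by exact hω)]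
      positivity
  have hmeas : MeasurableSet {ω | |Z ω| ≤ δ} := measurableSet_le hZ.abs measurable_const
  have hgI : Integrable (fun ω => Real.exp (-(Z ω) ^ 2 / (2 * δ ^ 2))) P := by
    refine Integrable.of_bound (C := 1) (by fun_prop) (Filter.Eventually.of_forall fun ω => ?_)
    rw [Real.norm_of_nonneg (by positivity)]
    refine Real.exp_le_one_iff.2 ?_
    rw [neg_div]
    have : 0 ≤ (Z ω) ^ 2 / (2 * δ ^ 2) := by positivity
    linarith
  have h1 : P.real {ω | |Z ω| ≤ δ} ≤
      Real.exp (1 / 2) * ∫ ω, Real.exp (-(Z ω) ^ 2 / (2 * δ ^ 2)) ∂P := by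
    rw [← integral_const_mul, ← integral_indicator_one hmeas]
    exact integral_mono ((integrable_const (1 : ℝ)).indicator hmeas) (hgI.const_mul _) hind
  have h2 : (∫ ω, Real.exp (-(Z ω) ^ 2 / (2 * δ ^ 2)) ∂P) * Real.sqrt (2 * Real.pi / δ ^ 2) ≤
      ∫ t : ℝ, ‖∫ ω, Complex.exp (((t * Z ω : ℝ) : ℂ) * Complex.I) ∂P‖ *
        Real.exp (-(δ ^ 2 / 2) * t ^ 2) := by
    have e1 : (((∫ ω, Real.exp (-(Z ω) ^ 2 / (2 * δ ^ 2)) ∂P) *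
        Real.sqrt (2 * Real.pi / δ ^ 2) : ℝ) : ℂ) =
        ∫ t : ℝ, (∫ ω, Complex.exp (((t * Z ω : ℝ) : ℂ) * Complex.I) ∂P) *
          ((Real.exp (-(δ ^ 2 / 2) * t ^ 2) : ℝ) : ℂ) := by
      rw [mul_comm, ← integral_const_mul, ← integral_complex_ofReal]
      simp only [hfour]
      rw [integral_integral_swap]
      · simp only [integral_mul_const]
      · have hI : Integrable (fun p : Ω × ℝ => Real.exp (-(δ ^ 2 / 2) * p.2 ^ 2))
            (P.prod volume) := hg.comp_snd P
        refine Integrable.mono' hI ?_ (Filter.Eventually.of_forall fun p => ?_)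
        · refine Measurable.aestronglyMeasurable ?_
          simp only [Function.uncurry_def]
          fun_prop
        · simp only [Function.uncurry_def]
          rw [norm_mul, Complex.norm_exp_ofReal_mul_I, one_mul, Complex.norm_real,
            Real.norm_of_nonneg (by positivity)]
    calc _ ≤ ‖(((∫ ω, Real.exp (-(Z ω) ^ 2 / (2 * δ ^ 2)) ∂P) *
        Real.sqrt (2 * Real.pi / δ ^ 2) : ℝ) : ℂ)‖ := by
          rw [Complex.norm_real]; exact Real.le_norm_self _
      _ ≤ _ := by
        rw [e1]
        refine (norm_integral_le_integral_norm _).trans (le_of_eq ?_)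
        congr 1
        funext t
        rw [norm_mul, Complex.norm_real, Real.norm_of_nonneg (Real.exp_pos _).le]
  calc _ ≤ (Real.exp (1 / 2) * ∫ ω, Real.exp (-(Z ω) ^ 2 / (2 * δ ^ 2)) ∂P) *
        Real.sqrt (2 * Real.pi / δ ^ 2) := by gcongr
    _ ≤ _ := by
      rw [mul_assoc]
      gcongr

/-- Small ball estimate for delocalized linear forms. -/
theorem exists_small_ball_bound (hε : 0 < ε) (hε1 : ε ≤ 1) (C : ℝ) {v : ℝ} (hv : 0 < v) :
    ∃ K : ℝ, 0 < K ∧ ∀ μ : Measure ℂ, UnitLaw ε C μ → ∀ (N : ℕ) (a : Fin N → ℂ) (τ : ℝ), 0 < τ →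
      (∀ i, ‖a i‖ ≤ τ) → v ≤ ∑ i, ‖a i‖ ^ 2 → ∀ δ : ℝ, 0 < δ →
      (Measure.pi fun _ => μ).real {x : Fin N → ℂ | ‖∑ i, a i * x i‖ ≤ δ} ≤
        K * (δ + τ ^ 2 / δ ^ 2) := by
  obtain ⟨T₀, hT₀, hT⟩ := exists_charRe_decay hε hε1 C
  refine ⟨Real.exp (1 / 2) * (Real.sqrt (8 * Real.pi / v) + Real.sqrt (4 * Real.pi) * 4 / T₀ ^ 2),
    by positivity, ?_⟩
  intro μ h N a τ hτ ha hva δ hδ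
  have := h.prob
  obtain ⟨ω, hω, hdec⟩ := hT μ h N a τ ha
  let Z : (Fin N → ℂ) → ℝ := fun x => (∑ i, (ω * a i) * x i).re
  have hZm : Measurable Z := by fun_prop
  have hsub : (Measure.pi fun _ => μ).real {x : Fin N → ℂ | ‖∑ i, a i * x i‖ ≤ δ} ≤
      (Measure.pi fun _ => μ).real {x : Fin N → ℂ | |Z x| ≤ δ} := by
    refine measureReal_mono (fun x hx => ?_)
    have h1 : ∑ i, (ω * a i) * x i = ω * ∑ i, a i * x i := by
      rw [Finset.mul_sum]; simp only [mul_assoc]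
    have h2 : |Z x| ≤ ‖ω * ∑ i, a i * x i‖ := by
      simp only [Z]; rw [h1]; exact Complex.abs_re_le_norm _
    rw [norm_mul, hω, one_mul] at h2
    exact h2.trans hx
  have hess := measure_abs_le_mul_le (Measure.pi fun _ => μ) hZm hδ
  -- For |t|τ ≤ T₀ the characteristic function has Gaussian decay. Beyond that it is only at most
  -- one, and half of the kernel pays: e^(-δ²t²/4) ≤ 4/(δ²t²) ≤ 4τ²/(δ²T₀²). The other half keeps
  -- the bound integrable. Multiplying the integral by δ gives the terms δ and τ²/δ².
  have hchar : ∀ t : ℝ, ‖∫ x, Complex.exp (((t * Z x : ℝ) : ℂ) * Complex.I)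
      ∂(Measure.pi fun _ => μ)‖ * Real.exp (-(δ ^ 2 / 2) * t ^ 2) ≤
      Real.exp (-(v / 8) * t ^ 2) +
        4 * τ ^ 2 / (δ ^ 2 * T₀ ^ 2) * Real.exp (-(δ ^ 2 / 4) * t ^ 2) := by
    intro t
    have hE1 : Real.exp (-(δ ^ 2 / 2) * t ^ 2) ≤ 1 := by
      refine Real.exp_le_one_iff.2 ?_
      have : 0 ≤ δ ^ 2 / 2 * t ^ 2 := by positivity
      linarith
    by_cases ht : |t| * τ ≤ T₀
    · have h1 := hdec t ht
      have h2 : ‖∫ x, Complex.exp (((t * Z x : ℝ) : ℂ) * Complex.I)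
          ∂(Measure.pi fun _ => μ)‖ ≤ Real.exp (-(v / 8) * t ^ 2) := by
        simp only [Z]
        rw [integral_exp_linear_eq_prod, norm_prod]
        refine h1.trans ?_
        gcongr
        linarith
      calc _ ≤ Real.exp (-(v / 8) * t ^ 2) * 1 := by gcongr
        _ ≤ _ := by
          rw [mul_one]
          exact le_add_of_nonneg_right (by positivity)
    · have h1 : ‖∫ x, Complex.exp (((t * Z x : ℝ) : ℂ) * Complex.I)
          ∂(Measure.pi fun _ => μ)‖ ≤ 1 := by
        refine (norm_integral_le_of_norm_le_const (C := 1)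
          (Filter.Eventually.of_forall fun x => ?_)).trans (by simp)
        rw [Complex.norm_exp_ofReal_mul_I]
      have h2 : Real.exp (-(δ ^ 2 / 2) * t ^ 2) =
          Real.exp (-(δ ^ 2 / 4) * t ^ 2) * Real.exp (-(δ ^ 2 / 4) * t ^ 2) := by
        rw [← Real.exp_add]; congr 1; ring
      have h3 : Real.exp (-(δ ^ 2 / 4) * t ^ 2) ≤ 4 * τ ^ 2 / (δ ^ 2 * T₀ ^ 2) := by
        have ht' : T₀ ^ 2 < t ^ 2 * τ ^ 2 := by
          rw [← sq_abs t, ← mul_pow]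
          exact pow_lt_pow_left₀ (not_le.1 ht) hT₀.le (by norm_num)
        have ht2 : 0 < t ^ 2 := by
          by_contra hn
          have : t ^ 2 = 0 := le_antisymm (not_lt.1 hn) (sq_nonneg t)
          rw [this, zero_mul] at ht'
          exact absurd ht' (not_lt.2 (sq_nonneg _))
        have e1 : Real.exp (-(δ ^ 2 / 4) * t ^ 2) ≤ (δ ^ 2 / 4 * t ^ 2)⁻¹ := by
          rw [neg_mul, Real.exp_neg]
          refine inv_anti₀ (by positivity) ?_
          linarith [Real.add_one_le_exp (δ ^ 2 / 4 * t ^ 2)]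
        refine e1.trans ?_
        rw [inv_le_comm₀ (by positivity) (by positivity), inv_div, div_le_iff₀ (by positivity)]
        nlinarith [sq_nonneg δ, mul_le_mul_of_nonneg_left ht'.le (sq_nonneg δ)]
      calc _ ≤ 1 * Real.exp (-(δ ^ 2 / 2) * t ^ 2) := by gcongr
        _ ≤ 4 * τ ^ 2 / (δ ^ 2 * T₀ ^ 2) * Real.exp (-(δ ^ 2 / 4) * t ^ 2) := by
          rw [one_mul, h2]; gcongr
        _ ≤ _ := le_add_of_nonneg_left (by positivity)
  have hI1 := integrable_exp_neg_mul_sq (b := v / 8) (by positivity)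
  have hI2 := (integrable_exp_neg_mul_sq (b := δ ^ 2 / 4) (by positivity)).const_mul
    (4 * τ ^ 2 / (δ ^ 2 * T₀ ^ 2))
  have hint : ∫ t : ℝ, ‖∫ x, Complex.exp (((t * Z x : ℝ) : ℂ) * Complex.I)
      ∂(Measure.pi fun _ => μ)‖ * Real.exp (-(δ ^ 2 / 2) * t ^ 2) ≤
      Real.sqrt (8 * Real.pi / v) + 4 * τ ^ 2 / (δ ^ 2 * T₀ ^ 2) *
        (Real.sqrt (4 * Real.pi) / δ) := by
    refine (integral_mono_of_nonneg (Filter.Eventually.of_forall fun t => by positivity)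
      (hI1.add hI2) (Filter.Eventually.of_forall hchar)).trans (le_of_eq ?_)
    have e1 := integral_add hI1 hI2
    simp only [Pi.add_apply]
    rw [e1, integral_const_mul, integral_gaussian, integral_gaussian]
    have e2 : Real.pi / (v / 8) = 8 * Real.pi / v := by field_simp
    have e3 : Real.pi / (δ ^ 2 / 4) = 4 * Real.pi / δ ^ 2 := by field_simp
    rw [e2, e3, Real.sqrt_div (by positivity) (δ ^ 2), Real.sqrt_sq hδ.le]
  have hs : Real.sqrt (2 * Real.pi / δ ^ 2) = Real.sqrt (2 * Real.pi) / δ := by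
    rw [Real.sqrt_div (by positivity), Real.sqrt_sq hδ.le]
  have h2pi : 1 ≤ Real.sqrt (2 * Real.pi) := by
    rw [Real.one_le_sqrt]; linarith [Real.pi_gt_three]
  refine hsub.trans ?_
  set p := (Measure.pi fun _ => μ).real {x : Fin N → ℂ | |Z x| ≤ δ} with hp
  have hp0 : 0 ≤ p := measureReal_nonneg
  have hfin : p * (1 / δ) ≤ Real.exp (1 / 2) * (Real.sqrt (8 * Real.pi / v) +
      4 * τ ^ 2 / (δ ^ 2 * T₀ ^ 2) * (Real.sqrt (4 * Real.pi) / δ)) := by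
    calc p * (1 / δ) ≤ p * (Real.sqrt (2 * Real.pi) / δ) := by gcongr
      _ = p * Real.sqrt (2 * Real.pi / δ ^ 2) := by rw [hs]
      _ ≤ _ := hess
      _ ≤ _ := by gcongr
  have hfin' : p ≤ Real.exp (1 / 2) * (Real.sqrt (8 * Real.pi / v) * δ +
      Real.sqrt (4 * Real.pi) * 4 / T₀ ^ 2 * (τ ^ 2 / δ ^ 2)) := by
    have := mul_le_mul_of_nonneg_right hfin hδ.le
    rw [mul_assoc, one_div_mul_cancel hδ.ne', mul_one] at this
    refine this.trans (le_of_eq ?_)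
    field_simp
  refine hfin'.trans ?_
  rw [mul_assoc]
  gcongr
  have hA : 0 ≤ Real.sqrt (8 * Real.pi / v) * (τ ^ 2 / δ ^ 2) := by positivity
  have hB : 0 ≤ Real.sqrt (4 * Real.pi) * 4 / T₀ ^ 2 * δ := by positivity
  nlinarith
end

end

/-! ### Small ball estimates for sums with many lacunary coefficients. -/

section

/-- A coordinate of a pair. -/
def boolSelect (b : Bool) (p : ℂ × ℂ) : ℂ := if b then p.1 else p.2

theorem measurable_boolSelect (b : Bool) : Measurable (boolSelect b) := by
  cases b
  · exact measurable_snd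
  · exact measurable_fst

theorem norm_boolSelect_sub_le (b b' : Bool) (p : ℂ × ℂ) :
    ‖boolSelect b p - boolSelect b' p‖ ≤ ‖p.1 - p.2‖ := by
  cases b <;> cases b' <;> simp [boolSelect, norm_sub_rev]

theorem norm_boolSelect_sub_of_ne {b b' : Bool} (h : b ≠ b') (p : ℂ × ℂ) :
    ‖boolSelect b p - boolSelect b' p‖ = ‖p.1 - p.2‖ := by
  revert h
  cases b <;> cases b' <;> simp [boolSelect, norm_sub_rev]

/-- Choosing in each coordinate one of two independent copies does not change the law. The
probability of a small sum may therefore be averaged over all 2^N choices, with the pairs held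
fixed. -/
theorem map_boolSelect_pi (μ : Measure ℂ) [IsProbabilityMeasure μ] {N : ℕ} (T : Fin N → Bool) :
    (Measure.pi fun _ : Fin N => μ.prod μ).map (fun y i => boolSelect (T i) (y i)) =
      Measure.pi fun _ => μ := by
  have hm : ∀ b, (μ.prod μ).map (boolSelect b) = μ := by
    intro b
    cases b
    · have : boolSelect false = Prod.snd := by funext p; simp [boolSelect]
      rw [this, Measure.map_snd_prod]; simp
    · have : boolSelect true = Prod.fst := by funext p; simp [boolSelect]
      rw [this, Measure.map_fst_prod]; simp
  have := Measure.pi_map_pi (μ := fun _ : Fin N => μ.prod μ) (f := fun i => boolSelect (T i))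
    (fun i => (measurable_boolSelect _).aemeasurable)
  rw [this]
  simp only [hm]

/-- Among the choices of one point of each pair, few make a lacunary sum small. -/
theorem card_small_sum_le {N : ℕ} (a : Fin N → ℂ) (y : Fin N → ℂ × ℂ) (J : Finset (Fin N))
    {R r : ℝ} (hJ : ∀ i ∈ J, 1 ≤ ‖(y i).1 - (y i).2‖ ∧ ‖(y i).1 - (y i).2‖ ≤ R)
    (hl : ∀ i ∈ J, R * ∑ j ∈ J with j < i, ‖a j‖ ≤ ‖a i‖ / 2) (hr : ∀ i ∈ J, 4 * r < ‖a i‖) :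
    (Finset.univ.filter fun T : Fin N → Bool =>
      ‖∑ i, a i * boolSelect (T i) (y i)‖ ≤ r).card * 2 ^ J.card ≤ 2 ^ N := by
  classical
  set E := Finset.univ.filter fun T : Fin N → Bool => ‖∑ i, a i * boolSelect (T i) (y i)‖ ≤ r
  -- Two choices that agree off J and both make the sum at most r must coincide. Otherwise, at the
  -- largest index where they differ, the change is at least |aᵢ|, the earlier changes total at most
  -- |aᵢ|/2, and the difference of the sums exceeds 2r.
  have hinj : Set.InjOn (fun (T : Fin N → Bool) (i : {i // i ∉ J}) => T i) (E : Set _) := by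
    intro T hT T' hT' hTT'
    by_contra hne
    have hoff : ∀ i, i ∉ J → T i = T' i := fun i hi => congrFun hTT' ⟨i, hi⟩
    set D := Finset.univ.filter fun i => T i ≠ T' i with hD
    have hDne : D.Nonempty := by
      obtain ⟨i, hi⟩ := Function.ne_iff.1 hne
      exact ⟨i, by simp [hD, hi]⟩
    have hDJ : D ⊆ J := by
      intro i hi
      by_contra hn
      exact (Finset.mem_filter.1 hi).2 (hoff i hn)
    set i := D.max' hDne
    have hiD : i ∈ D := Finset.max'_mem _ _
    have hiJ := hDJ hiD
    have hT1 : ‖∑ j, a j * boolSelect (T j) (y j)‖ ≤ r := (Finset.mem_filter.1 hT).2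
    have hT2 : ‖∑ j, a j * boolSelect (T' j) (y j)‖ ≤ r := (Finset.mem_filter.1 hT').2
    set e : Fin N → ℂ := fun j => a j * (boolSelect (T j) (y j) - boolSelect (T' j) (y j)) with he
    have hsum : ∑ j, e j = ∑ j, a j * boolSelect (T j) (y j) - ∑ j, a j * boolSelect (T' j) (y j) := by
      simp only [he, mul_sub, Finset.sum_sub_distrib]
    have hsplit : ∑ j, e j = e i + ∑ j ∈ D with j < i, e j := by
      have h1 : ∑ j, e j = ∑ j ∈ D, e j := by
        refine (Finset.sum_subset (Finset.subset_univ _) (fun j _ hj => ?_)).symm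
        have : T j = T' j := by
          by_contra hn
          exact hj (by simp [hD, hn])
        simp [he, this]
      have h2 : D = insert i (D.filter (· < i)) := by
        ext j
        simp only [Finset.mem_insert, Finset.mem_filter]
        constructor
        · intro hj
          rcases (Finset.le_max' D j hj).eq_or_lt with h | h
          · exact Or.inl h
          · exact Or.inr ⟨hj, h⟩
        · rintro (rfl | h)
          · exact hiD
          · exact h.1
      rw [h1]
      conv_lhs => rw [h2]
      rw [Finset.sum_insert (by simp)]
    have hei : ‖a i‖ ≤ ‖e i‖ := by
      simp only [he, norm_mul]
      rw [norm_boolSelect_sub_of_ne (Finset.mem_filter.1 hiD).2]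
      nlinarith [(hJ i hiJ).1, norm_nonneg (a i)]
    have hrest : ‖∑ j ∈ D with j < i, e j‖ ≤ ‖a i‖ / 2 := by
      refine (norm_sum_le _ _).trans (le_trans ?_ (hl i hiJ))
      rw [Finset.mul_sum]
      have hR : 0 ≤ R := zero_le_one.trans ((hJ i hiJ).1.trans (hJ i hiJ).2)
      refine (Finset.sum_le_sum (fun j hj => ?_)).trans
        (Finset.sum_le_sum_of_subset_of_nonneg (Finset.filter_subset_filter _ hDJ)
          (fun j _ _ => by positivity))
      simp only [he, norm_mul]
      rw [mul_comm]
      gcongr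
      exact (norm_boolSelect_sub_le _ _ _).trans (hJ j (hDJ (Finset.mem_filter.1 hj).1)).2
    have h1 : ‖∑ j, e j‖ ≤ 2 * r := by
      rw [hsum]
      refine (norm_sub_le _ _).trans ?_
      linarith
    have h2 : ‖e i‖ ≤ ‖∑ j, e j‖ + ‖∑ j ∈ D with j < i, e j‖ := by
      rw [hsplit]
      have := norm_sub_le (e i + ∑ j ∈ D with j < i, e j) (∑ j ∈ D with j < i, e j)
      simpa using this
    linarith [hr i hiJ]
  have hcard : E.card ≤ 2 ^ (N - J.card) := by
    have := Finset.card_le_card_of_injOn (t := (Finset.univ : Finset ({i // i ∉ J} → Bool))) _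
      (fun T _ => Finset.mem_coe.2 (Finset.mem_univ _)) hinj
    refine this.trans (le_of_eq ?_)
    rw [Finset.card_univ, Fintype.card_fun, Fintype.card_bool, Fintype.card_subtype_compl]
    simp
  calc E.card * 2 ^ J.card ≤ 2 ^ (N - J.card) * 2 ^ J.card := by gcongr
    _ = 2 ^ N := by
      rw [← pow_add, Nat.sub_add_cancel]
      simpa using Finset.card_le_univ J

variable {ε C : ℝ} {μ : Measure ℂ}

/-- For independent copies E|s - s'|² = 2. Distances below 1 contribute at most 1, distances above R
at most 1/2 by the moment of order 2 + ε, and the rest at most R² times the probability in question.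
-/
theorem exists_pair_separation (hε : 0 < ε) (hε1 : ε ≤ 1) (C : ℝ) : ∃ R : ℝ, 1 ≤ R ∧
    ∀ μ : Measure ℂ, UnitLaw ε C μ →
      1 / (2 * R ^ 2) ≤ (μ.prod μ).real {p : ℂ × ℂ | 1 ≤ ‖p.1 - p.2‖ ∧ ‖p.1 - p.2‖ ≤ R} := by
  set C₁ := max C 1 with hC₁
  have hC1 : 1 ≤ C₁ := le_max_right _ _
  -- With R^ε = 32C₁ the far part is at most (32C₁)⁻¹·8·2C₁ = 1/2, where 8 bounds 2^(2+ε).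
  refine ⟨(32 * C₁) ^ (1 / ε), Real.one_le_rpow (by linarith) (by positivity), fun μ h => ?_⟩
  set R := (32 * C₁) ^ (1 / ε) with hR
  have hR1 : 1 ≤ R := Real.one_le_rpow (by linarith) (by positivity)
  have hRε : R ^ ε = 32 * C₁ := by
    rw [hR, ← Real.rpow_mul (by positivity), one_div_mul_cancel hε.ne', Real.rpow_one]
  have := h.prob
  set A := {p : ℂ × ℂ | 1 ≤ ‖p.1 - p.2‖ ∧ ‖p.1 - p.2‖ ≤ R} with hA
  have hAm : MeasurableSet A :=
    (measurableSet_Icc (a := (1 : ℝ)) (b := R)).preimage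
      (f := fun p : ℂ × ℂ => ‖p.1 - p.2‖) (by fun_prop)
  obtain ⟨hi, hb⟩ := h.integrable_rpow hε
  have hid : Integrable (fun s : ℂ => s) μ :=
    h.integrable_of_sq_bound (by fun_prop) (K := 1) (fun s => by
      nlinarith [sq_nonneg (‖s‖ - 1), norm_nonneg s])
  have hpt : ∀ p : ℂ × ℂ, ‖p.1‖ ^ 2 + ‖p.2‖ ^ 2 - 2 * (p.1.re * p.2.re) - 2 * (p.1.im * p.2.im) ≤
      1 + R ^ 2 * A.indicator (fun _ => (1 : ℝ)) p +
        (32 * C₁)⁻¹ * (8 * (‖p.1‖ ^ (2 + ε) + ‖p.2‖ ^ (2 + ε))) := by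
    intro p
    have e1 : ‖p.1‖ ^ 2 + ‖p.2‖ ^ 2 - 2 * (p.1.re * p.2.re) - 2 * (p.1.im * p.2.im) =
        ‖p.1 - p.2‖ ^ 2 := by
      simp only [Complex.sq_norm, Complex.normSq_apply, Complex.sub_re, Complex.sub_im]; ring
    rw [e1]
    have h8 : 0 ≤ (32 * C₁)⁻¹ * (8 * (‖p.1‖ ^ (2 + ε) + ‖p.2‖ ^ (2 + ε))) := by positivity
    have hind : 0 ≤ A.indicator (fun _ => (1 : ℝ)) p :=
      Set.indicator_nonneg (fun _ _ => zero_le_one) _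
    rcases lt_or_ge ‖p.1 - p.2‖ 1 with h1 | h1
    · have : ‖p.1 - p.2‖ ^ 2 ≤ 1 := pow_le_one₀ (norm_nonneg _) h1.le
      have := mul_nonneg (sq_nonneg R) hind
      linarith
    rcases le_or_gt ‖p.1 - p.2‖ R with h2 | h2
    · have hp : p ∈ A := ⟨h1, h2⟩
      rw [Set.indicator_of_mem hp]
      have : ‖p.1 - p.2‖ ^ 2 ≤ R ^ 2 := by gcongr
      linarith
    · set D := ‖p.1 - p.2‖ with hD
      have hD0 : 0 < D := by linarith
      have hDε : 32 * C₁ ≤ D ^ ε := by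
        rw [← hRε]; gcongr
      have h3 : D ^ (2 + ε) ≤ 8 * (‖p.1‖ ^ (2 + ε) + ‖p.2‖ ^ (2 + ε)) := by
        have hm : D ≤ 2 * max ‖p.1‖ ‖p.2‖ := by
          refine (norm_sub_le _ _).trans ?_
          linarith [le_max_left ‖p.1‖ ‖p.2‖, le_max_right ‖p.1‖ ‖p.2‖]
        have hm0 : 0 ≤ max ‖p.1‖ ‖p.2‖ := (norm_nonneg _).trans (le_max_left _ _)
        calc D ^ (2 + ε) ≤ (2 * max ‖p.1‖ ‖p.2‖) ^ (2 + ε) := by gcongr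
          _ = 2 ^ (2 + ε) * max ‖p.1‖ ‖p.2‖ ^ (2 + ε) := Real.mul_rpow (by norm_num) hm0
          _ ≤ 8 * max ‖p.1‖ ‖p.2‖ ^ (2 + ε) := by
            gcongr
            calc (2 : ℝ) ^ (2 + ε) ≤ 2 ^ (3 : ℝ) := by
                  apply Real.rpow_le_rpow_of_exponent_le <;> linarith
              _ = 8 := by norm_num
          _ ≤ _ := by
            gcongr
            rcases max_cases ‖p.1‖ ‖p.2‖ with hh | hh <;> rw [hh.1]
            · exact le_add_of_nonneg_right (by positivity)
            · exact le_add_of_nonneg_left (by positivity)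
      have h4 : D ^ 2 ≤ (32 * C₁)⁻¹ * D ^ (2 + ε) := by
        rw [Real.rpow_add hD0, Real.rpow_two, inv_mul_eq_div, le_div_iff₀ (by positivity)]
        gcongr
      have h5 : (32 * C₁)⁻¹ * D ^ (2 + ε) ≤
          (32 * C₁)⁻¹ * (8 * (‖p.1‖ ^ (2 + ε) + ‖p.2‖ ^ (2 + ε))) := by gcongr
      have := mul_nonneg (sq_nonneg R) hind
      linarith
  have hre : ∫ s : ℂ, s.re ∂μ = 0 := by
    have := integral_re hid
    simpa [h.mean] using! this
  have him : ∫ s : ℂ, s.im ∂μ = 0 := by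
    have := integral_im hid
    simpa [h.mean] using! this
  have hire : Integrable (fun s : ℂ => s.re) μ := hid.re
  have hiim : Integrable (fun s : ℂ => s.im) μ := hid.im
  have hsq := h.integrable_sq
  have I1 : Integrable (fun p : ℂ × ℂ => ‖p.1‖ ^ 2) (μ.prod μ) := hsq.comp_fst μ
  have I2 : Integrable (fun p : ℂ × ℂ => ‖p.2‖ ^ 2) (μ.prod μ) := hsq.comp_snd μ
  have I3 : Integrable (fun p : ℂ × ℂ => 2 * (p.1.re * p.2.re)) (μ.prod μ) :=
    (hire.mul_prod hire).const_mul 2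
  have I4 : Integrable (fun p : ℂ × ℂ => 2 * (p.1.im * p.2.im)) (μ.prod μ) :=
    (hiim.mul_prod hiim).const_mul 2
  have I5 : Integrable (fun p : ℂ × ℂ => ‖p.1‖ ^ (2 + ε)) (μ.prod μ) := hi.comp_fst μ
  have I6 : Integrable (fun p : ℂ × ℂ => ‖p.2‖ ^ (2 + ε)) (μ.prod μ) := hi.comp_snd μ
  have I7 : Integrable (A.indicator (fun _ => (1 : ℝ))) (μ.prod μ) :=
    (integrable_const _).indicator hAm
  have hmono := integral_mono (((I1.add I2).sub I3).sub I4)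
    (((integrable_const 1).add (I7.const_mul (R ^ 2))).add
      (((I5.add I6).const_mul 8).const_mul (32 * C₁)⁻¹)) hpt
  have E1 : ∫ p : ℂ × ℂ, ‖p.1‖ ^ 2 ∂(μ.prod μ) = 1 := by
    rw [integral_fun_fst (fun s : ℂ => ‖s‖ ^ 2)]; simp [h.var]
  have E2 : ∫ p : ℂ × ℂ, ‖p.2‖ ^ 2 ∂(μ.prod μ) = 1 := by
    rw [integral_fun_snd (fun s : ℂ => ‖s‖ ^ 2)]; simp [h.var]
  have E3 : ∫ p : ℂ × ℂ, 2 * (p.1.re * p.2.re) ∂(μ.prod μ) = 0 := by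
    rw [integral_const_mul, integral_prod_mul (fun s : ℂ => s.re) (fun s : ℂ => s.re), hre]; simp
  have E4 : ∫ p : ℂ × ℂ, 2 * (p.1.im * p.2.im) ∂(μ.prod μ) = 0 := by
    rw [integral_const_mul, integral_prod_mul (fun s : ℂ => s.im) (fun s : ℂ => s.im), him]; simp
  have E5 : ∫ p : ℂ × ℂ, ‖p.1‖ ^ (2 + ε) ∂(μ.prod μ) = ∫ s, ‖s‖ ^ (2 + ε) ∂μ := by
    rw [integral_fun_fst (fun s : ℂ => ‖s‖ ^ (2 + ε))]; simp
  have E6 : ∫ p : ℂ × ℂ, ‖p.2‖ ^ (2 + ε) ∂(μ.prod μ) = ∫ s, ‖s‖ ^ (2 + ε) ∂μ := by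
    rw [integral_fun_snd (fun s : ℂ => ‖s‖ ^ (2 + ε))]; simp
  have L : ∫ p : ℂ × ℂ, (‖p.1‖ ^ 2 + ‖p.2‖ ^ 2 - 2 * (p.1.re * p.2.re) - 2 * (p.1.im * p.2.im))
      ∂(μ.prod μ) = 2 := by
    rw [integral_sub (by exact (I1.add I2).sub I3) I4, integral_sub (by exact I1.add I2) I3,
      integral_add I1 I2, E1, E2, E3, E4]
    norm_num
  have Rr : ∫ p : ℂ × ℂ, (1 + R ^ 2 * A.indicator (fun _ => (1 : ℝ)) p +
        (32 * C₁)⁻¹ * (8 * (‖p.1‖ ^ (2 + ε) + ‖p.2‖ ^ (2 + ε)))) ∂(μ.prod μ) =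
      1 + R ^ 2 * (μ.prod μ).real A +
        (32 * C₁)⁻¹ * (8 * (∫ s, ‖s‖ ^ (2 + ε) ∂μ + ∫ s, ‖s‖ ^ (2 + ε) ∂μ)) := by
    rw [integral_add (by exact (integrable_const 1).add (I7.const_mul (R ^ 2)))
      (by exact ((I5.add I6).const_mul 8).const_mul (32 * C₁)⁻¹),
      integral_add (integrable_const 1) (I7.const_mul _), integral_const_mul, integral_const_mul,
      integral_const_mul, integral_add I5 I6, E5, E6, integral_indicator_const _ hAm]
    simp
  have hfin : 2 ≤ 1 + R ^ 2 * (μ.prod μ).real A +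
        (32 * C₁)⁻¹ * (8 * (∫ s, ‖s‖ ^ (2 + ε) ∂μ + ∫ s, ‖s‖ ^ (2 + ε) ∂μ)) := by
    rw [← Rr]; exact L.symm.le.trans hmono
  have hlast : (32 * C₁)⁻¹ * (8 * (∫ s, ‖s‖ ^ (2 + ε) ∂μ + ∫ s, ‖s‖ ^ (2 + ε) ∂μ)) ≤ 1 / 2 := by
    have : max C 0 ≤ C₁ := max_le (le_max_left _ _) (by linarith)
    rw [inv_mul_eq_div, div_le_iff₀ (by positivity)]
    linarith
  rw [div_le_iff₀ (by positivity)]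
  nlinarith

/-- Small ball estimate for a sum with many lacunary coefficients. -/
theorem exists_lacunary_small_ball (hε : 0 < ε) (hε1 : ε ≤ 1) (C : ℝ) :
    ∃ R q : ℝ, 1 ≤ R ∧ 0 < q ∧ q < 1 ∧ ∀ μ : Measure ℂ, UnitLaw ε C μ →
      ∀ (N : ℕ) (a : Fin N → ℂ) (I : Finset (Fin N)) (r : ℝ),
        (∀ i ∈ I, R * ∑ j ∈ I with j < i, ‖a j‖ ≤ ‖a i‖ / 2) → (∀ i ∈ I, 4 * r < ‖a i‖) →
        (Measure.pi fun _ : Fin N => μ).real {x | ‖∑ i, a i * x i‖ ≤ r} ≤ q ^ I.card := by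
  classical
  obtain ⟨R, hR, hp⟩ := exists_pair_separation hε hε1 C
  have hq : 1 / (2 * R ^ 2) ≤ 1 / 2 := by
    gcongr; nlinarith
  -- Each index of I is separated with probability p ≥ 1/(2R²), and a separated index halves the
  -- proportion of bad choices, so it contributes a factor 1 - p/2.
  refine ⟨R, 1 - 1 / (2 * R ^ 2) / 2, hR, by linarith, by
    have : 0 < 1 / (2 * R ^ 2) := by positivity
    linarith, fun μ h N a I r hl hr => ?_⟩
  have := h.prob
  set A := {p : ℂ × ℂ | 1 ≤ ‖p.1 - p.2‖ ∧ ‖p.1 - p.2‖ ≤ R} with hA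
  have hAm : MeasurableSet A :=
    (measurableSet_Icc (a := (1 : ℝ)) (b := R)).preimage
      (f := fun p : ℂ × ℂ => ‖p.1 - p.2‖) (by fun_prop)
  set Q := Measure.pi fun _ : Fin N => μ.prod μ
  set P := Measure.pi fun _ : Fin N => μ
  set E := {x : Fin N → ℂ | ‖∑ i, a i * x i‖ ≤ r} with hE
  have hEm : MeasurableSet E := measurableSet_le (by fun_prop) measurable_const
  set F : (Fin N → Bool) → Set (Fin N → ℂ × ℂ) := fun T =>
    {y | ‖∑ i, a i * boolSelect (T i) (y i)‖ ≤ r} with hF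
  have hFm : ∀ T, MeasurableSet (F T) := by
    intro T
    refine measurableSet_le (Measurable.norm (Finset.measurable_sum _ fun i _ => ?_))
      measurable_const
    exact ((measurable_boolSelect _).comp (measurable_pi_apply i)).const_mul _
  have hPF : ∀ T, P.real E = Q.real (F T) := by
    intro T
    rw [measureReal_def, measureReal_def]
    congr 1
    change (Measure.pi fun _ : Fin N => μ) E = _
    rw [← map_boolSelect_pi μ T, Measure.map_apply _ hEm]
    · rfl
    · exact measurable_pi_lambda _ fun i =>
        (measurable_boolSelect _).comp (measurable_pi_apply i)
  -- The factor is 1/2 when i lies in I and the pair is separated, and 1 otherwise. The product over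
  -- i is 2^(-|J|) for the random set J of separated indices of I, and its mean factorises.
  set g : Fin N → ℂ × ℂ → ℝ := fun i p =>
    1 - (if i ∈ I then 1 / 2 else 0) * A.indicator (fun _ => (1 : ℝ)) p with hg
  have hgi : ∀ i, ∫ p, g i p ∂(μ.prod μ) = 1 - (if i ∈ I then 1 / 2 else 0) * (μ.prod μ).real A := by
    intro i
    simp only [hg]
    rw [integral_sub (integrable_const _) (((integrable_const _).indicator hAm).const_mul _),
      integral_const_mul, integral_indicator_const _ hAm]
    simp
  have hgint : Integrable (fun y : Fin N → ℂ × ℂ => ∏ i, g i (y i)) Q := by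
    refine Integrable.fintype_prod (f := g) (fun i => ?_)
    exact (integrable_const _).sub (((integrable_const _).indicator hAm).const_mul _)
  have hpt : ∀ y : Fin N → ℂ × ℂ,
      ∑ T : Fin N → Bool, (F T).indicator (fun _ => (1 : ℝ)) y ≤ 2 ^ N * ∏ i, g i (y i) := by
    intro y
    set J := I.filter fun i => y i ∈ A with hJ
    have hprod : ∏ i, g i (y i) = (1 / 2) ^ J.card := by
      rw [← Finset.prod_const, ← Finset.prod_subset (Finset.subset_univ J)]
      · refine Finset.prod_congr rfl fun i hi => ?_
        obtain ⟨h1, h2⟩ := Finset.mem_filter.1 hi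
        simp only [hg, if_pos h1, Set.indicator_of_mem h2]
        norm_num
      · intro i _ hi
        simp only [hg]
        by_cases h1 : i ∈ I
        · have h2 : y i ∉ A := fun h2 => hi (Finset.mem_filter.2 ⟨h1, h2⟩)
          rw [Set.indicator_of_notMem h2]; simp
        · rw [if_neg h1]; simp
    have hc := card_small_sum_le a y J (R := R) (r := r)
      (fun i hi => (Finset.mem_filter.1 hi).2)
      (fun i hi => by
        refine le_trans ?_ (hl i (Finset.mem_filter.1 hi).1)
        gcongr
        exact Finset.filter_subset _ _)
      (fun i hi => hr i (Finset.mem_filter.1 hi).1)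
    have hsum : ∑ T : Fin N → Bool, (F T).indicator (fun _ => (1 : ℝ)) y =
        ((Finset.univ.filter fun T : Fin N → Bool =>
          ‖∑ i, a i * boolSelect (T i) (y i)‖ ≤ r).card : ℝ) := by
      rw [Finset.card_filter]
      push_cast
      refine Finset.sum_congr rfl fun T _ => ?_
      simp only [hF, Set.indicator_apply, Set.mem_ofPred_eq]
    rw [hsum, hprod, one_div, inv_pow, ← div_eq_mul_inv, le_div_iff₀ (by positivity)]
    exact_mod_cast hc
  have hint := integral_mono (integrable_finsetSum _ fun T _ =>
    (integrable_const (1 : ℝ)).indicator (hFm T)) (hgint.const_mul (2 ^ N)) hpt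
  rw [integral_finsetSum _ (fun T _ => (integrable_const (1 : ℝ)).indicator (hFm T)),
    integral_const_mul, integral_fintype_prod_eq_prod (f := g)] at hint
  simp only [hgi, integral_indicator_const _ (hFm _), smul_eq_mul, mul_one, ← hPF] at hint
  rw [Finset.sum_const, Finset.card_univ, Fintype.card_fun, Fintype.card_bool, Fintype.card_fin,
    nsmul_eq_mul] at hint
  push_cast at hint
  have h2N : (0 : ℝ) < 2 ^ N := by positivity
  refine (le_of_mul_le_mul_left hint h2N).trans ?_
  rw [← Finset.prod_const, ← Finset.prod_subset (Finset.subset_univ I)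
    (fun i _ hi => by rw [if_neg hi]; simp)]
  refine Finset.prod_le_prod (fun i hi => ?_) (fun i hi => ?_)
  · rw [if_pos hi]
    have : (μ.prod μ).real A ≤ 1 := measureReal_le_one
    linarith
  · rw [if_pos hi]
    linarith [hp μ h]

end

/-! ### Binomial weights near their mode. -/

section

section BinomialProfile

/-- The unnormalised binomial weight `C(n,i) xⁱ`. -/
noncomputable def binomWeight (n : ℕ) (x : ℝ) (i : ℕ) : ℝ := n.choose i * x ^ i

/-- The mode `(n+1)x/(1+x)` of the binomial weights. -/
noncomputable def binomMode (n : ℕ) (x : ℝ) : ℝ := (n + 1) * x / (1 + x)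

variable {n : ℕ} {x : ℝ}

theorem binomWeight_nonneg (hx : 0 < x) (i : ℕ) : 0 ≤ binomWeight n x i := by
  unfold binomWeight; positivity

theorem sum_binomWeight : ∑ i : Fin (n + 1), binomWeight n x i = (1 + x) ^ n := by
  rw [Fin.sum_univ_eq_sum_range (fun i => binomWeight n x i), add_comm 1 x, add_pow]
  exact Finset.sum_congr rfl fun i _ => by simp [binomWeight, mul_comm]

theorem binomMode_pos (hx : 0 < x) : 0 < binomMode n x := by
  unfold binomMode; positivity

theorem binomMode_lt (hx : 0 < x) : binomMode n x < n + 1 := by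
  unfold binomMode
  rw [div_lt_iff₀ (by positivity)]
  nlinarith [(Nat.cast_nonneg n : (0 : ℝ) ≤ n)]

/-- The ratio of neighbours is (n - i)x/(i + 1). In this form it is visible that the weights
increase while i + 1 stays below the mode M, with a rate governed by the distance M - (i + 1). -/
theorem binomWeight_rec (hx : 0 < x) (i : ℕ) :
    binomWeight n x (i + 1) * (i + 1) =
      binomWeight n x i * (binomMode n x + (binomMode n x - (i + 1)) * x) := by
  have h1 : binomMode n x + (binomMode n x - (i + 1)) * x = (n - i) * x := by
    unfold binomMode; field_simp; ring
  have h2 : ((n.choose (i + 1) : ℝ)) * (i + 1) = n.choose i * (n - i) := by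
    rcases le_or_gt i n with h | h
    · have := Nat.choose_succ_right_eq n i
      rw [← Nat.cast_sub h]
      exact_mod_cast this
    · simp [Nat.choose_eq_zero_of_lt h, Nat.choose_eq_zero_of_lt (Nat.lt_succ_of_lt h)]
  rw [h1]
  unfold binomWeight
  rw [pow_succ]
  linear_combination x ^ i * x * h2

/-- With y = M - (i + 1) the ratio is (M - y)/(M + xy) ≤ 1 - y/M ≤ e^(-y/M). -/
theorem binomWeight_le_step (hx : 0 < x) {i : ℕ} (hi : (i : ℝ) + 1 ≤ binomMode n x) :
    binomWeight n x i ≤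
      binomWeight n x (i + 1) * Real.exp (-((binomMode n x - (i + 1)) / binomMode n x)) := by
  have h0 := binomMode_pos (n := n) hx
  have hrec := binomWeight_rec (n := n) hx i
  set M := binomMode n x
  set y := M - (i + 1) with hy
  have hy0 : 0 ≤ y := by linarith
  have hb := binomWeight_nonneg (n := n) hx (i + 1)
  have hD : 0 < M + y * x := by positivity
  have h1 : binomWeight n x i = binomWeight n x (i + 1) * ((i + 1) / (M + y * x)) := by
    field_simp; linarith
  rw [h1]
  gcongr
  calc ((i : ℝ) + 1) / (M + y * x) ≤ (M - y) / M := by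
        have : (i : ℝ) + 1 = M - y := by rw [hy]; ring
        rw [this]
        have : 0 ≤ M - y := by linarith [(Nat.cast_nonneg i : (0 : ℝ) ≤ i)]
        gcongr
        have : 0 ≤ y * x := by positivity
        linarith
    _ = -(y / M) + 1 := by field_simp; ring
    _ ≤ _ := Real.add_one_le_exp _

theorem binomWeight_le_add (hx : 0 < x) (j s : ℕ) (h : (j : ℝ) + s ≤ binomMode n x) :
    binomWeight n x j ≤ binomWeight n x (j + s) *
      Real.exp (-(s * (binomMode n x - (j + s)) / binomMode n x)) := by
  have h0 := binomMode_pos (n := n) hx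
  induction s with
  | zero => simp
  | succ s ih =>
    push_cast at h
    refine (ih (by linarith)).trans ?_
    have h1 := binomWeight_le_step (n := n) hx (i := j + s) (by push_cast; linarith)
    refine (mul_le_mul_of_nonneg_right h1 (Real.exp_nonneg _)).trans ?_
    rw [mul_assoc, ← Real.exp_add]
    refine mul_le_mul_of_nonneg_left (Real.exp_le_exp.2 ?_) (binomWeight_nonneg hx _)
    rw [← neg_add, ← add_div, neg_le_neg_iff]
    gcongr
    push_cast
    nlinarith [(Nat.cast_nonneg s : (0 : ℝ) ≤ s)]

/-- The ratio (M - y)/(M + xy) is at least 1 - (1 + x)y/M, and 1 - w ≥ e^(-2w) for w ≤ 1/2. A fixed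
bound Y for the distance lets the estimate be iterated with a constant rate. -/
theorem binomWeight_ge_step (hx : 0 < x) {i : ℕ} (hi : (i : ℝ) + 1 ≤ binomMode n x)
    {Y : ℝ} (hY : binomMode n x - (i + 1) ≤ Y) (hY' : (1 + x) * Y ≤ binomMode n x / 2) :
    binomWeight n x (i + 1) * Real.exp (-(2 * (1 + x) * Y / binomMode n x)) ≤
      binomWeight n x i := by
  have h0 := binomMode_pos (n := n) hx
  have hrec := binomWeight_rec (n := n) hx i
  set M := binomMode n x
  set y := M - (i + 1) with hy
  have hy0 : 0 ≤ y := by linarith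
  have hb := binomWeight_nonneg (n := n) hx (i + 1)
  have hD : 0 < M + y * x := by positivity
  have h1 : binomWeight n x i = binomWeight n x (i + 1) * ((i + 1) / (M + y * x)) := by
    field_simp; linarith
  rw [h1]
  gcongr
  set w := (1 + x) * Y / M with hw
  have hY0 : 0 ≤ Y := hy0.trans hY
  have hw0 : 0 ≤ w := by positivity
  have hw1 : w ≤ 1 / 2 := by rw [hw, div_le_iff₀ h0]; linarith
  have hexp : Real.exp (-(2 * (1 + x) * Y / M)) ≤ 1 - w := by
    have e1 : 2 * (1 + x) * Y / M = 2 * w := by rw [hw]; ring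
    rw [e1, Real.exp_neg, inv_le_comm₀ (Real.exp_pos _) (by linarith)]
    refine le_trans ?_ (Real.add_one_le_exp _)
    rw [inv_le_iff_one_le_mul₀ (by linarith)]
    nlinarith
  refine hexp.trans ?_
  have e2 : 1 - w ≤ 1 - (1 + x) * y / M := by
    rw [hw]; gcongr
  refine e2.trans ?_
  rw [le_div_iff₀ hD]
  have : (i : ℝ) + 1 = M - y := by rw [hy]; ring
  rw [this]
  have e3 : (1 - (1 + x) * y / M) * (M + y * x) = M - y - x * (1 + x) * y ^ 2 / M := by
    field_simp; ring
  rw [e3]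
  have : 0 ≤ x * (1 + x) * y ^ 2 / M := by positivity
  linarith

theorem binomWeight_ge_add (hx : 0 < x) (j t : ℕ) (h : (j : ℝ) + t ≤ binomMode n x) {Y : ℝ}
    (hY : binomMode n x - (j + 1) ≤ Y) (hY' : (1 + x) * Y ≤ binomMode n x / 2) :
    binomWeight n x (j + t) * Real.exp (-(2 * (1 + x) * Y * t / binomMode n x)) ≤
      binomWeight n x j := by
  induction t with
  | zero => simp
  | succ t ih =>
    push_cast at h
    refine le_trans ?_ (ih (by linarith))
    have h1 := binomWeight_ge_step (n := n) hx (i := j + t) (by push_cast; linarith)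
      (Y := Y) (by push_cast; linarith [(Nat.cast_nonneg t : (0 : ℝ) ≤ t)]) hY'
    refine le_trans (le_of_eq ?_) (mul_le_mul_of_nonneg_right h1 (Real.exp_nonneg _))
    rw [mul_assoc (binomWeight _ _ _), ← Real.exp_add, add_assoc]
    congr 2
    push_cast
    ring

theorem binomWeight_le_floor (hx : 0 < x) (i : ℕ) :
    binomWeight n x i ≤ binomWeight n x ⌊binomMode n x⌋₊ := by
  have h0 := binomMode_pos (n := n) hx
  have hI : ((⌊binomMode n x⌋₊ : ℕ) : ℝ) ≤ binomMode n x := Nat.floor_le h0.le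
  set I := ⌊binomMode n x⌋₊ with hIdef
  rcases le_total i I with h | h
  · obtain ⟨s, hs⟩ := Nat.exists_eq_add_of_le h
    have hs' : (I : ℝ) = i + s := by exact_mod_cast hs
    have := binomWeight_le_add (n := n) hx i s (by linarith)
    rw [hs]
    refine this.trans (mul_le_of_le_one_right (binomWeight_nonneg hx _) ?_)
    rw [Real.exp_le_one_iff, neg_nonpos]
    have : 0 ≤ binomMode n x - (i + s) := by linarith
    positivity
  · induction i, h using Nat.le_induction with
    | base => exact le_rfl
    | succ i hi ih =>
      refine le_trans ?_ ih
      have hM : binomMode n x ≤ i + 1 := by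
        have := Nat.lt_floor_add_one (binomMode n x)
        have h2 : ((⌊binomMode n x⌋₊ : ℕ) : ℝ) ≤ i := by exact_mod_cast hi
        linarith
      have hrec := binomWeight_rec (n := n) hx i
      have hb := binomWeight_nonneg (n := n) hx i
      have h1 : binomWeight n x (i + 1) * (i + 1) ≤ binomWeight n x i * (i + 1) := by
        rw [hrec]
        refine mul_le_mul_of_nonneg_left ?_ hb
        nlinarith
      exact le_of_mul_le_mul_right h1 (by positivity)

theorem pow_le_mul_binomWeight_floor (hx : 0 < x) :
    (1 + x) ^ n ≤ (n + 1) * binomWeight n x ⌊binomMode n x⌋₊ := by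
  rw [← sum_binomWeight]
  refine (Finset.sum_le_sum fun i _ => binomWeight_le_floor hx _).trans ?_
  simp

/-- The profile to the left of the mode is at least Gaussian of width about √M: within distance T
the weight drops from its maximum by at most e^(-2κT²/M). -/
theorem binomWeight_sub_ge (hx : 0 < x) {κ : ℝ} (hκ : 1 + x ≤ κ) {t T : ℕ} (ht : t ≤ T)
    (hT : κ * T ≤ binomMode n x / 2) (h2 : 2 ≤ binomMode n x) :
    t ≤ ⌊binomMode n x⌋₊ ∧ binomWeight n x ⌊binomMode n x⌋₊ *
      Real.exp (-(2 * κ * T ^ 2 / binomMode n x)) ≤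
      binomWeight n x (⌊binomMode n x⌋₊ - t) := by
  have h0 := binomMode_pos (n := n) hx
  have hI : ((⌊binomMode n x⌋₊ : ℕ) : ℝ) ≤ binomMode n x := Nat.floor_le h0.le
  have hI' := Nat.lt_floor_add_one (binomMode n x)
  set I := ⌊binomMode n x⌋₊ with hIdef
  have htT : (t : ℝ) ≤ T := by exact_mod_cast ht
  have hκ1 : 1 ≤ κ := by linarith
  have htI : t ≤ I := by
    have : (t : ℝ) ≤ I := by nlinarith
    exact_mod_cast this
  refine ⟨htI, ?_⟩
  have hsub : ((I - t : ℕ) : ℝ) = I - t := Nat.cast_sub htI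
  have := binomWeight_ge_add (n := n) hx (I - t) t (by rw [hsub]; linarith) (Y := T)
    (by rw [hsub]; linarith) ((by gcongr : (1 + x) * (T : ℝ) ≤ κ * T).trans hT)
  rw [Nat.sub_add_cancel htI] at this
  refine le_trans ?_ this
  refine mul_le_mul_of_nonneg_left (Real.exp_le_exp.2 ?_) (binomWeight_nonneg hx _)
  rw [neg_le_neg_iff]
  gcongr ?_ / _
  calc 2 * (1 + x) * T * t ≤ 2 * κ * T * T := by gcongr
    _ = _ := by ring

/-- About √M weights next to the mode are within a factor e^(2κ) of the largest one, and all weights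
add up to (1 + x)^n, so no weight exceeds its share. -/
theorem binomWeight_le_of_mode (hx : 0 < x) {κ : ℝ} (hκ : 1 + x ≤ κ)
    (h : 4 * κ ≤ Real.sqrt (binomMode n x)) (i : ℕ) :
    binomWeight n x i ≤ Real.exp (2 * κ) * (1 + x) ^ n / Real.sqrt (binomMode n x) := by
  have h0 := binomMode_pos (n := n) hx
  have hκ1 : 1 ≤ κ := by linarith
  have hs : Real.sqrt (binomMode n x) ^ 2 = binomMode n x := Real.sq_sqrt h0.le
  have hs0 : 0 < Real.sqrt (binomMode n x) := Real.sqrt_pos.2 h0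
  set σ := Real.sqrt (binomMode n x)
  refine (binomWeight_le_floor hx i).trans ?_
  set I := ⌊binomMode n x⌋₊ with hIdef
  set T := ⌊σ⌋₊ with hT
  have hTσ : (T : ℝ) ≤ σ := Nat.floor_le hs0.le
  have hTσ' : σ < T + 1 := Nat.lt_floor_add_one σ
  have hcond : κ * T ≤ binomMode n x / 2 := by nlinarith
  have h2 : 2 ≤ binomMode n x := by nlinarith
  have hlow : ∀ t ∈ Finset.range (T + 1),
      binomWeight n x I * Real.exp (-(2 * κ)) ≤ binomWeight n x (I - t) := by
    intro t ht
    have := (binomWeight_sub_ge (n := n) hx hκ (Nat.lt_succ_iff.1 (Finset.mem_range.1 ht))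
      hcond h2).2
    refine le_trans ?_ this
    refine mul_le_mul_of_nonneg_left (Real.exp_le_exp.2 ?_) (binomWeight_nonneg hx _)
    rw [neg_le_neg_iff, div_le_iff₀ h0]
    have : (T : ℝ) ^ 2 ≤ σ ^ 2 := by gcongr
    rw [hs] at this
    gcongr
  have hTI : T ≤ I := (binomWeight_sub_ge (n := n) hx hκ le_rfl hcond h2).1
  have hIn : I ≤ n := by
    have h1 : (I : ℝ) < n + 1 := (Nat.floor_le h0.le).trans_lt (binomMode_lt hx)
    exact Nat.lt_succ_iff.1 (by exact_mod_cast h1)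
  have hsum : ∑ t ∈ Finset.range (T + 1), binomWeight n x (I - t) ≤ (1 + x) ^ n := by
    rw [← sum_binomWeight, Fin.sum_univ_eq_sum_range (fun i => binomWeight n x i)]
    rw [← Finset.sum_image (f := fun i => binomWeight n x i) (g := fun t => I - t)]
    · refine Finset.sum_le_sum_of_subset_of_nonneg ?_ fun i _ _ => binomWeight_nonneg hx i
      intro i hi
      obtain ⟨t, _, rfl⟩ := Finset.mem_image.1 hi
      exact Finset.mem_range.2 (by omega)
    · intro t ht t' ht' hh
      have h1 := Finset.mem_range.1 (Finset.mem_coe.1 ht)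
      have h2 := Finset.mem_range.1 (Finset.mem_coe.1 ht')
      simp only at hh
      omega
  have hconst : ((T : ℝ) + 1) * (binomWeight n x I * Real.exp (-(2 * κ))) ≤ (1 + x) ^ n := by
    refine le_trans ?_ hsum
    refine le_trans (le_of_eq ?_) (Finset.sum_le_sum hlow)
    simp
  rw [le_div_iff₀ hs0]
  have hb := binomWeight_nonneg (n := n) hx I
  have h3 : σ * (binomWeight n x I * Real.exp (-(2 * κ))) ≤ (1 + x) ^ n :=
    (mul_le_mul_of_nonneg_right hTσ'.le (by positivity)).trans hconst
  have h4 := mul_le_mul_of_nonneg_left h3 (Real.exp_nonneg (2 * κ))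
  refine le_trans (le_of_eq ?_) h4
  rw [Real.exp_neg]
  field_simp

theorem sum_geometric_tail_le {c : ℕ → ℝ} {h : ℕ} {θ : ℝ} (hθ0 : 0 ≤ θ) (hθ : θ ≤ 1 / 2)
    (hc0 : ∀ j, 0 ≤ c j) (hc : ∀ j, j + 1 < h → c (j + 1) ≤ θ * c j) (j : ℕ) (hj : j < h) :
    ∑ i ∈ Finset.Ico (j + 1) h, c i ≤ 2 * θ * c j := by
  obtain ⟨m, rfl⟩ := Nat.exists_eq_add_of_lt hj
  clear hj
  induction m generalizing j with
  | zero => simp; have := hc0 j; positivity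
  | succ m ih =>
    rw [Finset.sum_eq_sum_Ico_succ_bot (by omega)]
    have h1 := ih (j + 1) (fun i hi => hc i (by omega))
    have e : j + 1 + m + 1 = j + (m + 1) + 1 := by ring
    rw [e] at h1
    have h2 := hc j (by omega)
    have h3 := hc0 (j + 1)
    have h4 := hc0 j
    nlinarith [mul_nonneg hθ0 h4]

/-- Many lacunary indices to the left of the mode. -/
theorem exists_lacunary_indices (hx : 0 < x) {κ : ℝ} (hκ : 1 + x ≤ κ) {h : ℕ} (hh : 1 ≤ h)
    (hmode : 8 * κ * h ≤ Real.sqrt (binomMode n x)) :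
    ∃ e : ℕ → ℕ, (∀ j < h, e j ≤ n) ∧ (∀ i j, i < j → j < h → e j < e i) ∧
      (∀ j, j + 1 < h → binomWeight n x (e (j + 1)) ≤ Real.exp (-h) * binomWeight n x (e j)) ∧
      ∀ j < h, (1 + x) ^ n / (n + 1) * Real.exp (-(32 * κ * h ^ 2)) ≤ binomWeight n x (e j) := by
  have h0 := binomMode_pos (n := n) hx
  have hκ1 : 1 ≤ κ := by linarith
  have hs : Real.sqrt (binomMode n x) ^ 2 = binomMode n x := Real.sq_sqrt h0.le
  have hs0 : 0 < Real.sqrt (binomMode n x) := Real.sqrt_pos.2 h0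
  have hh1 : (1 : ℝ) ≤ h := by exact_mod_cast hh
  set M := binomMode n x
  set σ := Real.sqrt M
  have hσ8 : 8 ≤ σ := by nlinarith
  set s := ⌈σ⌉₊ with hsdef
  have hs1 : σ ≤ s := Nat.le_ceil σ
  have hs2 : (s : ℝ) ≤ 2 * σ := by
    have := (Nat.ceil_lt_add_one hs0.le).le
    linarith
  have hspos : 0 < s := Nat.ceil_pos.2 hs0
  set I := ⌊M⌋₊ with hIdef
  have hI : (I : ℝ) ≤ M := Nat.floor_le h0.le
  set T := 2 * h * s with hT
  have hTle : (T : ℝ) ≤ 4 * h * σ := by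
    rw [hT]; push_cast; nlinarith
  have hcond : κ * T ≤ M / 2 := by
    rw [← hs]; nlinarith
  have h2 : 2 ≤ M := by nlinarith
  have htT : ∀ j < h, (h + j) * s ≤ T := fun j hj => by
    rw [hT]; exact Nat.mul_le_mul_right _ (by omega)
  have hlow := fun j hj => binomWeight_sub_ge (n := n) hx hκ (htT j hj) hcond h2
  have hIn : I ≤ n := by
    have h1 : (I : ℝ) < n + 1 := hI.trans_lt (binomMode_lt hx)
    exact Nat.lt_succ_iff.1 (by exact_mod_cast h1)
  -- At distance at least hs from the mode a further step of length s ≥ √M costs a factor of at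
  -- least e^(hs²/M) ≥ e^h. All chosen distances are at most 2hs ≤ 4h√M, so the weights stay above
  -- e^(-32κh²) times the largest.
  refine ⟨fun j => I - (h + j) * s, fun j _ => (Nat.sub_le _ _).trans hIn, ?_, ?_, ?_⟩
  · intro i j hij hj
    have h1 := (hlow j hj).1
    have h3 : (h + i) * s < (h + j) * s := Nat.mul_lt_mul_of_pos_right (by omega) hspos
    change I - (h + j) * s < I - (h + i) * s
    change (h + j) * s ≤ I at h1
    omega
  · intro j hj
    have h1 : (h + (j + 1)) * s ≤ I := (hlow (j + 1) hj).1
    have e1 : (h + (j + 1)) * s = (h + j) * s + s := by ring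
    have e2 : I - (h + (j + 1)) * s + s = I - (h + j) * s := by omega
    have hc : ((I - (h + (j + 1)) * s : ℕ) : ℝ) + s = I - (h + j) * s := by
      rw [Nat.cast_sub h1]; push_cast; ring
    have hpos : 0 ≤ ((h : ℝ) + j) * s := by positivity
    have := binomWeight_le_add (n := n) hx (I - (h + (j + 1)) * s) s (by rw [hc]; linarith)
    rw [e2, hc] at this
    rw [mul_comm (Real.exp _)]
    refine this.trans (mul_le_mul_of_nonneg_left (Real.exp_le_exp.2 ?_) (binomWeight_nonneg hx _))
    rw [neg_le_neg_iff, le_div_iff₀ h0]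
    have hsM : M ≤ (s : ℝ) * s := by rw [← hs]; nlinarith
    have hj0 : (0 : ℝ) ≤ j := Nat.cast_nonneg j
    calc (h : ℝ) * M ≤ h * (s * s) := by gcongr
      _ ≤ (h + j) * (s * s) := by gcongr; linarith
      _ = s * ((h + j) * s) := by ring
      _ ≤ _ := by gcongr; linarith
  · intro j hj
    refine le_trans ?_ (hlow j hj).2
    have h3 : 2 * κ * (T : ℝ) ^ 2 / M ≤ 32 * κ * h ^ 2 := by
      rw [div_le_iff₀ h0, ← hs]
      calc 2 * κ * (T : ℝ) ^ 2 ≤ 2 * κ * (4 * h * σ) ^ 2 := by gcongr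
        _ = _ := by ring
    have h4 := pow_le_mul_binomWeight_floor (n := n) hx
    have hb := binomWeight_nonneg (n := n) hx I
    gcongr
    rw [div_le_iff₀ (by positivity)]
    linarith

end BinomialProfile

end

/-! ### The tilted elliptic polynomial and its normalisation. -/

section

theorem eventually_le_natCast_rpow {β : ℝ} (hβ : 0 < β) (K : ℝ) :
    ∀ᶠ n : ℕ in Filter.atTop, K ≤ (n : ℝ) ^ β :=
  ((tendsto_rpow_atTop hβ).comp tendsto_natCast_atTop_atTop).eventually_ge_atTop K

theorem eventually_mul_rpow_le_rpow {α β : ℝ} (h : α < β) (K : ℝ) :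
    ∀ᶠ n : ℕ in Filter.atTop, K * (n : ℝ) ^ α ≤ (n : ℝ) ^ β := by
  filter_upwards [eventually_le_natCast_rpow (sub_pos.2 h) K, Filter.eventually_ge_atTop 1]
    with n hn h1
  have h1' : (0 : ℝ) < n := by exact_mod_cast h1
  have : (n : ℝ) ^ β = (n : ℝ) ^ (β - α) * (n : ℝ) ^ α := by
    rw [← Real.rpow_add h1']; ring_nf
  rw [this]
  gcongr

theorem eventually_mul_log_le_rpow {β : ℝ} (hβ : 0 < β) (K : ℝ) :
    ∀ᶠ n : ℕ in Filter.atTop, K * Real.log n ≤ (n : ℝ) ^ β := by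
  filter_upwards [eventually_mul_rpow_le_rpow (half_lt_self hβ) (|K| / (β / 2)),
    Filter.eventually_ge_atTop 1] with n hn h1
  have h1' : (1 : ℝ) ≤ n := by exact_mod_cast h1
  have hl : 0 ≤ Real.log n := Real.log_nonneg h1'
  have := Real.log_le_rpow_div (x := (n : ℝ)) (by positivity) (half_pos hβ)
  calc K * Real.log n ≤ |K| * Real.log n := by gcongr; exact le_abs_self K
    _ ≤ |K| * ((n : ℝ) ^ (β / 2) / (β / 2)) := by gcongr
    _ = |K| / (β / 2) * (n : ℝ) ^ (β / 2) := by ring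
    _ ≤ _ := hn

/-- The affine approximation at `z` of `u ↦ (n/2) log (1 + |u|²/n)`. -/
noncomputable def ellipticTilt (n : ℕ) (z u : ℂ) : ℝ :=
  n / 2 * Real.log (1 + ‖z‖ ^ 2 / n) + (starRingEnd ℂ z * (u - z)).re / (1 + ‖z‖ ^ 2 / n)

/-- The coefficients of the tilted polynomial `e^{-A(u)} f(u)` as a linear form in the random
variables. -/
noncomputable def ellipticCoeff (n : ℕ) (z u : ℂ) (i : Fin (n + 1)) : ℂ :=
  ((Real.sqrt ((n.choose i : ℝ) * ((n : ℝ) ^ (i : ℕ))⁻¹) : ℝ) : ℂ) * u ^ (i : ℕ) *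
    ((Real.exp (-ellipticTilt n z u) : ℝ) : ℂ)

/-- This is the form in which the tilt is removed from Green's formula. -/
theorem ellipticTilt_affine (n : ℕ) (z : ℂ) :
    ∃ (c : ℝ) (b : ℂ), ∀ u, ellipticTilt n z u = c + (b * u).re := by
  refine ⟨n / 2 * Real.log (1 + ‖z‖ ^ 2 / n) - (starRingEnd ℂ z * z).re / (1 + ‖z‖ ^ 2 / n),
    starRingEnd ℂ z * (((1 + ‖z‖ ^ 2 / n)⁻¹ : ℝ) : ℂ), fun u => ?_⟩
  have : starRingEnd ℂ z * (((1 + ‖z‖ ^ 2 / n)⁻¹ : ℝ) : ℂ) * u =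
      (((1 + ‖z‖ ^ 2 / n)⁻¹ : ℝ) : ℂ) * (starRingEnd ℂ z * u) := by ring
  rw [this, Complex.re_ofReal_mul, ellipticTilt, mul_sub, Complex.sub_re]
  ring

theorem sum_ellipticCoeff_mul (n : ℕ) (z u : ℂ) (x : Fin (n + 1) → ℂ) :
    ∑ i, ellipticCoeff n z u i * x i =
      (rescaledElliptic n x).eval u * ((Real.exp (-ellipticTilt n z u) : ℝ) : ℂ) := by
  simp only [rescaledElliptic, Polynomial.eval_finsetSum, Polynomial.eval_monomial,
    Finset.sum_mul, ellipticCoeff]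
  exact Finset.sum_congr rfl fun i _ => by ring

theorem norm_sq_ellipticCoeff (n : ℕ) (z u : ℂ) (i : Fin (n + 1)) :
    ‖ellipticCoeff n z u i‖ ^ 2 =
      binomWeight n (‖u‖ ^ 2 / n) i * Real.exp (-(2 * ellipticTilt n z u)) := by
  rw [ellipticCoeff, norm_mul, norm_mul, Complex.norm_real, Complex.norm_real, norm_pow,
    Real.norm_of_nonneg (Real.sqrt_nonneg _), Real.norm_of_nonneg (Real.exp_nonneg _), mul_pow,
    mul_pow, Real.sq_sqrt (by positivity), ← Real.exp_nat_mul, binomWeight, div_pow, ← pow_mul,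
    ← pow_mul]
  congr 1
  · rw [mul_comm (i : ℕ) 2]; ring
  · congr 1; push_cast; ring

theorem sum_norm_sq_ellipticCoeff (n : ℕ) (z u : ℂ) :
    ∑ i, ‖ellipticCoeff n z u i‖ ^ 2 =
      (1 + ‖u‖ ^ 2 / n) ^ n * Real.exp (-(2 * ellipticTilt n z u)) := by
  simp only [norm_sq_ellipticCoeff]
  rw [← Finset.sum_mul, sum_binomWeight]

theorem sub_two_mul_sq_le_log_one_add {δ : ℝ} (h : |δ| ≤ 1 / 2) :
    δ - 2 * δ ^ 2 ≤ Real.log (1 + δ) := by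
  have h1 := abs_le.1 h
  have hp : 0 < 1 + δ := by linarith
  refine le_trans ?_ (Real.one_sub_inv_le_log_of_pos hp)
  have : 1 - (1 + δ)⁻¹ = δ / (1 + δ) := by field_simp; ring
  rw [this, le_div_iff₀ hp]
  nlinarith [sq_nonneg δ]

/-- The variance of the tilted polynomial is of order one. -/
theorem abs_log_variance_le {C : ℝ} (hC : 0 < C) {n : ℕ} (hn : 1 ≤ n)
    (hn' : 6 * C ^ 2 ≤ Real.sqrt n) {z u : ℂ} (hz : ‖z‖ ≤ C * Real.sqrt n) (hu : ‖u - z‖ ≤ C) :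
    |n * Real.log (1 + ‖u‖ ^ 2 / n) - 2 * ellipticTilt n z u| ≤ C ^ 2 + 18 * C ^ 4 := by
  have hn1 : (1 : ℝ) ≤ n := by exact_mod_cast hn
  have hs1 : 1 ≤ Real.sqrt n := Real.one_le_sqrt.2 hn1
  have hs2 : Real.sqrt n ^ 2 = n := Real.sq_sqrt (by positivity)
  set σ := Real.sqrt n
  set w := u - z with hw
  have huw : u = z + w := by rw [hw]; ring
  set p := (starRingEnd ℂ z * w).re with hp
  have hnorm : ‖u‖ ^ 2 = ‖z‖ ^ 2 + 2 * p + ‖w‖ ^ 2 := by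
    rw [huw]
    simp only [hp, Complex.sq_norm, Complex.normSq_apply, Complex.add_re, Complex.add_im,
      Complex.mul_re, Complex.conj_re, Complex.conj_im]
    ring
  have hpb : |p| ≤ C * σ * C := by
    refine (Complex.abs_re_le_norm _).trans ?_
    rw [norm_mul, RCLike.norm_conj]
    gcongr
  have hw2 : ‖w‖ ^ 2 ≤ C ^ 2 := by gcongr
  set L := 1 + ‖z‖ ^ 2 / n with hL
  have hL1 : 1 ≤ L := by rw [hL]; have : 0 ≤ ‖z‖ ^ 2 / n := by positivity
                         linarith
  -- The relative increment of 1 + |u|²/n from z to u. It is O(n^(-1/2)) because |z| ≤ C√n, so n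
  -- log(1 + δ) = nδ + O(1), and the unbounded part 2p/L of nδ is exactly what the tilt subtracts.
  set δ := (2 * p + ‖w‖ ^ 2) / (n * L) with hδ
  have hfac : 1 + ‖u‖ ^ 2 / n = L * (1 + δ) := by
    rw [hδ, hnorm]
    have : L ≠ 0 := by positivity
    field_simp
    rw [hL]; field_simp; ring
  have hδb : |δ| ≤ 3 * C ^ 2 / σ := by
    rw [hδ, abs_div, abs_of_pos (by positivity : 0 < (n : ℝ) * L)]
    have h1 : |2 * p + ‖w‖ ^ 2| ≤ 3 * C ^ 2 * σ := by
      have := abs_le.1 hpb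
      rw [abs_le]
      constructor <;> nlinarith [sq_nonneg ‖w‖, sq_nonneg C]
    calc _ ≤ 3 * C ^ 2 * σ / (n * 1) := by gcongr
      _ = _ := by rw [← hs2]; field_simp
  have hδ2 : |δ| ≤ 1 / 2 := by
    refine hδb.trans ?_
    rw [div_le_iff₀ (by positivity)]; linarith
  have hδpos : 0 < 1 + δ := by have := (abs_le.1 hδ2).1; linarith
  have hlog : Real.log (1 + ‖u‖ ^ 2 / n) = Real.log L + Real.log (1 + δ) := by
    rw [hfac, Real.log_mul (by positivity) hδpos.ne']
  have hA : 2 * ellipticTilt n z u = n * Real.log L + 2 * p / L := by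
    rw [ellipticTilt]; ring
  have hnδ : n * δ = 2 * p / L + ‖w‖ ^ 2 / L := by
    rw [hδ]; field_simp
  have hw3 : ‖w‖ ^ 2 / L ≤ C ^ 2 := (div_le_self (by positivity) hL1).trans hw2
  have hw4 : 0 ≤ ‖w‖ ^ 2 / L := by positivity
  have hnδ2 : n * (2 * δ ^ 2) ≤ 18 * C ^ 4 := by
    have : δ ^ 2 ≤ (3 * C ^ 2 / σ) ^ 2 := by rw [← sq_abs δ]; gcongr
    calc n * (2 * δ ^ 2) ≤ n * (2 * (3 * C ^ 2 / σ) ^ 2) := by gcongr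
      _ = 18 * C ^ 4 := by rw [← hs2]; field_simp; ring
  have hl1 := mul_le_mul_of_nonneg_left (sub_two_mul_sq_le_log_one_add hδ2)
    (by positivity : (0 : ℝ) ≤ n)
  have hl2 := mul_le_mul_of_nonneg_left (Real.log_le_sub_one_of_pos hδpos)
    (by positivity : (0 : ℝ) ≤ n)
  rw [hlog, hA, abs_le]
  have hC4 : 0 ≤ C ^ 4 := by positivity
  constructor <;> nlinarith

/-- The upper bound on |z| keeps x = |u|²/n bounded, and the lower bound makes the mode, which is at
least |u|²/(1 + x), of order at least n^(2ε). The coefficients therefore spread over at least about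
n^ε indices. -/
theorem ellipticMode_bounds {C ε : ℝ} (hC : 0 < C) {n : ℕ} (hn : 1 ≤ n)
    (hn' : 2 * C ≤ (n : ℝ) ^ ε) {z u : ℂ} (hz' : (n : ℝ) ^ ε ≤ ‖z‖)
    (hz : ‖z‖ ≤ C * Real.sqrt n) (hu : ‖u - z‖ ≤ C) :
    0 < ‖u‖ ^ 2 / n ∧ 1 + ‖u‖ ^ 2 / n ≤ 1 + 4 * C ^ 2 ∧
      (n : ℝ) ^ ε / (2 * (1 + 4 * C ^ 2)) ≤ Real.sqrt (binomMode n (‖u‖ ^ 2 / n)) := by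
  have hn1 : (1 : ℝ) ≤ n := by exact_mod_cast hn
  have hs1 : 1 ≤ Real.sqrt n := Real.one_le_sqrt.2 hn1
  have hs2 : Real.sqrt n ^ 2 = n := Real.sq_sqrt (by positivity)
  have hu1 : (n : ℝ) ^ ε / 2 ≤ ‖u‖ := by
    have := norm_sub_norm_le z u
    rw [norm_sub_rev] at this
    linarith
  have hu2 : ‖u‖ ≤ 2 * C * Real.sqrt n := by
    have := norm_sub_norm_le u z
    nlinarith
  have hu0 : 0 < ‖u‖ := by linarith
  have hx0 : 0 < ‖u‖ ^ 2 / n := by positivity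
  have hx1 : ‖u‖ ^ 2 / n ≤ 4 * C ^ 2 := by
    rw [div_le_iff₀ (by positivity)]
    calc ‖u‖ ^ 2 ≤ (2 * C * Real.sqrt n) ^ 2 := by gcongr
      _ = _ := by rw [mul_pow, hs2]; ring
  refine ⟨hx0, by linarith, Real.le_sqrt_of_sq_le ?_⟩
  unfold binomMode
  rw [le_div_iff₀ (by positivity)]
  set κ := 1 + 4 * C ^ 2
  have hκ : 1 ≤ κ := by have : 0 ≤ 4 * C ^ 2 := by positivity
                        linarith
  have e1 : (n : ℝ) ^ ε / (2 * κ) = (n : ℝ) ^ ε / 2 / κ := by field_simp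
  rw [e1, div_pow]
  calc ((n : ℝ) ^ ε / 2) ^ 2 / κ ^ 2 * (1 + ‖u‖ ^ 2 / n)
      ≤ ‖u‖ ^ 2 / κ ^ 2 * κ := by gcongr; linarith
    _ = ‖u‖ ^ 2 / κ := by field_simp
    _ ≤ ‖u‖ ^ 2 := div_le_self (by positivity) hκ
    _ = n * (‖u‖ ^ 2 / n) := by field_simp
    _ ≤ _ := by gcongr; linarith

theorem pow_eq_exp_mul_log {y : ℝ} (hy : 0 < y) (n : ℕ) : y ^ n = Real.exp (n * Real.log y) := by
  rw [Real.exp_nat_mul, Real.exp_log hy]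

/-- Normalisation: the tilted coefficients have bounded `ℓ²` norm and are uniformly small. -/
theorem exists_ellipticCoeff_bounds {ε C : ℝ} (hε : 0 < ε) (hC : 0 < C) :
    ∃ K : ℝ, 1 ≤ K ∧ ∀ᶠ n : ℕ in Filter.atTop, ∀ z u : ℂ, (n : ℝ) ^ ε ≤ ‖z‖ →
      ‖z‖ ≤ C * Real.sqrt n → ‖u - z‖ ≤ C →
        K⁻¹ ≤ ∑ i, ‖ellipticCoeff n z u i‖ ^ 2 ∧ ∑ i, ‖ellipticCoeff n z u i‖ ^ 2 ≤ K ∧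
          ∀ i, ‖ellipticCoeff n z u i‖ ≤ K * (n : ℝ) ^ (-(ε / 2)) := by
  set κ := 1 + 4 * C ^ 2 with hκ
  have hκ1 : 1 ≤ κ := by have : 0 ≤ 4 * C ^ 2 := by positivity
                         linarith
  set B := C ^ 2 + 18 * C ^ 4 with hB
  have hB0 : 0 ≤ B := by positivity
  have hK1 : (1 : ℝ) ≤ Real.exp (2 * κ) * (2 * κ) := by
    have : 1 ≤ Real.exp (2 * κ) := Real.one_le_exp (by positivity)
    nlinarith
  set K := Real.exp B * (Real.exp (2 * κ) * (2 * κ)) with hK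
  have hBK : Real.exp B ≤ K := le_mul_of_one_le_right (Real.exp_nonneg _) hK1
  have hK1' : 1 ≤ K := (Real.one_le_exp hB0).trans hBK
  refine ⟨K, hK1', ?_⟩
  filter_upwards [eventually_le_natCast_rpow hε (2 * C), eventually_le_natCast_rpow hε (8 * κ ^ 2),
    eventually_le_natCast_rpow (half_pos one_pos) (6 * C ^ 2), Filter.eventually_ge_atTop 1]
    with n h1 h2 h3 h4 z u hz1 hz2 hu
  rw [← Real.sqrt_eq_rpow] at h3
  have hv := abs_le.1 (abs_log_variance_le hC h4 h3 hz2 hu)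
  obtain ⟨hx0, hxκ, hmode⟩ := ellipticMode_bounds hC h4 h1 hz1 hz2 hu
  have hn0 : (0 : ℝ) < n := by exact_mod_cast h4
  have hsum : ∑ i, ‖ellipticCoeff n z u i‖ ^ 2 =
      Real.exp (n * Real.log (1 + ‖u‖ ^ 2 / n) - 2 * ellipticTilt n z u) := by
    rw [sum_norm_sq_ellipticCoeff, pow_eq_exp_mul_log (by positivity), ← Real.exp_add, sub_eq_add_neg]
  refine ⟨?_, ?_, fun i => ?_⟩
  · rw [hsum]
    calc K⁻¹ ≤ (Real.exp B)⁻¹ := by gcongr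
      _ = Real.exp (-B) := (Real.exp_neg _).symm
      _ ≤ _ := Real.exp_le_exp.2 hv.1
  · rw [hsum]
    exact (Real.exp_le_exp.2 hv.2).trans hBK
  -- Squared coefficients are at most the variance divided by √M, hence O(n^(-ε)); the square root
  -- gives the exponent ε/2.
  · have hb := binomWeight_le_of_mode (n := n) hx0 hxκ (by
      refine le_trans ?_ hmode
      rw [le_div_iff₀ (by positivity)]
      linarith) (i : ℕ)
    have hsq : ‖ellipticCoeff n z u i‖ ^ 2 ≤ K * (n : ℝ) ^ (-ε) := by
      rw [norm_sq_ellipticCoeff]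
      have hσ : 0 < (n : ℝ) ^ ε / (2 * κ) := by positivity
      calc _ ≤ Real.exp (2 * κ) * (1 + ‖u‖ ^ 2 / n) ^ n /
            Real.sqrt (binomMode n (‖u‖ ^ 2 / n)) * Real.exp (-(2 * ellipticTilt n z u)) := by
            gcongr
        _ ≤ Real.exp (2 * κ) * (1 + ‖u‖ ^ 2 / n) ^ n /
            ((n : ℝ) ^ ε / (2 * κ)) * Real.exp (-(2 * ellipticTilt n z u)) := by gcongr
        _ = ((1 + ‖u‖ ^ 2 / n) ^ n * Real.exp (-(2 * ellipticTilt n z u))) *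
            (Real.exp (2 * κ) * (2 * κ)) * (n : ℝ) ^ (-ε) := by
            rw [Real.rpow_neg hn0.le]; field_simp
        _ ≤ _ := by
            rw [← sum_norm_sq_ellipticCoeff, hsum, hK]
            gcongr
            exact hv.2
    refine le_of_sq_le_sq ?_ (by positivity)
    calc _ ≤ K * (n : ℝ) ^ (-ε) := hsq
      _ ≤ K ^ 2 * (n : ℝ) ^ (-ε) := by gcongr; nlinarith
      _ = _ := by
        rw [mul_pow K, ← Real.rpow_natCast ((n : ℝ) ^ (-(ε / 2))), ← Real.rpow_mul hn0.le]
        congr 2; push_cast; ring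

end

/-! ### Superpolynomial small ball bound for the tilted polynomial. -/

set_option maxHeartbeats 800000 in
/-- The tilted polynomial is exponentially small only with superpolynomially small probability. -/
theorem eventually_elliptic_small_ball {ε C : ℝ} (hε : 0 < ε) (hε1 : ε ≤ 1) (hC : 0 < C)
    (C₁ : ℝ) {η : ℝ} (hη : 0 < η) (hηε : η ≤ ε) (A : ℝ) :
    ∀ᶠ n : ℕ in Filter.atTop, ∀ z u : ℂ, (n : ℝ) ^ ε ≤ ‖z‖ →
      ‖z‖ ≤ C * Real.sqrt n → ‖u - z‖ ≤ C → ∀ μ : Measure ℂ, UnitLaw ε C₁ μ →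
        (Measure.pi fun _ : Fin (n + 1) => μ).real
          {x | ‖∑ i, ellipticCoeff n z u i * x i‖ ≤ Real.exp (-(n : ℝ) ^ η)} ≤ (n : ℝ) ^ (-A) := by
  obtain ⟨R, q, hR, hq0, hq1, hball⟩ := exists_lacunary_small_ball hε hε1 C₁
  obtain ⟨K, hK1, hbd⟩ := exists_ellipticCoeff_bounds hε hC
  set κ := 1 + 4 * C ^ 2 with hκ
  have hκ1 : 1 ≤ κ := by have : 0 ≤ 4 * C ^ 2 := by positivity
                         linarith
  set c := -Real.log q with hc
  have hc0 : 0 < c := by rw [hc]; linarith [Real.log_neg hq0 hq1]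
  have hη4 : 0 < η / 4 := by linarith
  filter_upwards [hbd, eventually_le_natCast_rpow hε (2 * C),
    eventually_mul_rpow_le_rpow (α := η / 4) (β := ε) (by linarith) (16 * κ ^ 2),
    eventually_le_natCast_rpow hη4 (2 + 2 * Real.log (4 * R)),
    eventually_le_natCast_rpow hη4 4,
    eventually_mul_log_le_rpow hη4 (2 * A / c),
    eventually_le_natCast_rpow hη (2 * (Real.log K + Real.log 32 + 1)),
    eventually_mul_rpow_le_rpow (α := η / 2) (β := η) (by linarith) (64 * κ),
    eventually_mul_log_le_rpow hη 2,
    Filter.eventually_ge_atTop 1] with n hn h1 h2 h3 h3' h4 h5 h6 h7 h8 z u hz1 hz2 hu μ hμ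
  obtain ⟨hlow, -, -⟩ := hn z u hz1 hz2 hu
  obtain ⟨hx0, hxκ, hmode⟩ := ellipticMode_bounds hC h8 h1 hz1 hz2 hu
  have hn1 : (1 : ℝ) ≤ n := by exact_mod_cast h8
  -- About n^(η/4) lacunary indices: enough for q^h to beat every power of n, while h² ≤ n^(η/2)
  -- keeps the coefficients well above exp(-n^η).
  set τ := (n : ℝ) ^ (η / 4) with hτ
  set h := ⌊τ⌋₊ with hh
  have hhτ : (h : ℝ) ≤ τ := Nat.floor_le (by positivity)
  have hhτ' : τ < h + 1 := Nat.lt_floor_add_one τ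
  have hh1 : 1 ≤ h := by
    have : (1 : ℝ) < h := by linarith
    exact_mod_cast this.le
  set x := ‖u‖ ^ 2 / n with hx
  obtain ⟨e, hen, hemono, hedec, helow⟩ := exists_lacunary_indices (n := n) hx0 hxκ hh1 (by
    refine le_trans ?_ hmode
    rw [le_div_iff₀ (by positivity)]
    calc 8 * κ * h * (2 * κ) = 16 * κ ^ 2 * h := by ring
      _ ≤ 16 * κ ^ 2 * τ := by gcongr
      _ ≤ _ := h2)
  set a := ellipticCoeff n z u with ha
  -- `Fin.ofNat` reduces modulo n + 1; for j < h nothing is reduced, since e j ≤ n there.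
  let e' : ℕ → Fin (n + 1) := fun j => Fin.ofNat (n + 1) (e j)
  have he' : ∀ j < h, ((e' j : Fin (n + 1)) : ℕ) = e j := fun j hj =>
    Nat.mod_eq_of_lt (Nat.lt_succ_iff.2 (hen j hj))
  -- Weights are squares of moduli, so successive moduli shrink by e^(-h/2). As θ ≤ 1/(4R), the
  -- geometric tail 2θ|aᵢ| times R is at most |aᵢ|/2, the required lacunarity.
  set θ := Real.exp (-(h : ℝ) / 2) with hθ
  have hθR : θ ≤ 1 / (4 * R) := by
    rw [hθ, one_div, ← Real.exp_log (by positivity : 0 < 4 * R), ← Real.exp_neg]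
    rw [Real.exp_le_exp]
    linarith
  have hθ2 : θ ≤ 1 / 2 := hθR.trans (by gcongr; linarith)
  have hθ0 : 0 ≤ θ := Real.exp_nonneg _
  have hE : 0 < Real.exp (-(2 * ellipticTilt n z u)) := Real.exp_pos _
  have hsq : ∀ j < h, ‖a (e' j)‖ ^ 2 =
      binomWeight n x (e j) * Real.exp (-(2 * ellipticTilt n z u)) := by
    intro j hj
    rw [ha, norm_sq_ellipticCoeff, he' j hj]
  have hdec : ∀ j, j + 1 < h → ‖a (e' (j + 1))‖ ≤ θ * ‖a (e' j)‖ := by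
    intro j hj
    refine le_of_sq_le_sq ?_ (by positivity)
    have hθsq : θ ^ 2 = Real.exp (-h) := by
      rw [hθ, ← Real.exp_nat_mul]; congr 1; push_cast; ring
    rw [mul_pow, hsq _ hj, hsq j (by omega), hθsq, ← mul_assoc]
    exact mul_le_mul_of_nonneg_right (hedec j hj) hE.le
  -- The chosen weights are at least a constant times e^(-32κh²)/n with 32κh² ≤ n^η/2, whereas the
  -- square of the threshold is 16e^(-2n^η).
  have hbig : ∀ j < h, 4 * Real.exp (-(n : ℝ) ^ η) < ‖a (e' j)‖ := by
    intro j hj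
    refine lt_of_pow_lt_pow_left₀ 2 (norm_nonneg _) ?_
    have e1 : (1 + x) ^ n * Real.exp (-(2 * ellipticTilt n z u)) / (n + 1) *
        Real.exp (-(32 * κ * h ^ 2)) ≤ ‖a (e' j)‖ ^ 2 := by
      rw [hsq j hj]
      refine le_trans (le_of_eq ?_) (mul_le_mul_of_nonneg_right (helow j hj) hE.le)
      ring
    rw [hx, ← sum_norm_sq_ellipticCoeff] at e1
    refine lt_of_lt_of_le ?_ e1
    have hh2 : 32 * κ * (h : ℝ) ^ 2 ≤ (n : ℝ) ^ η / 2 := by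
      have : (h : ℝ) ^ 2 ≤ (n : ℝ) ^ (η / 2) := by
        calc (h : ℝ) ^ 2 ≤ τ ^ 2 := by gcongr
          _ = _ := by
            rw [hτ, ← Real.rpow_natCast, ← Real.rpow_mul (by positivity)]
            congr 1; push_cast; ring
      have := mul_le_mul_of_nonneg_left this (by positivity : 0 ≤ 32 * κ)
      linarith
    calc (4 * Real.exp (-(n : ℝ) ^ η)) ^ 2 = 16 * Real.exp (-(2 * (n : ℝ) ^ η)) := by
          rw [mul_pow, ← Real.exp_nat_mul]; push_cast; ring_nf
      _ < 16 * Real.exp (-(Real.log K + Real.log 32 + Real.log n + (n : ℝ) ^ η / 2)) := by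
          have : 0 < (n : ℝ) ^ η := by positivity
          gcongr
          linarith
      _ = K⁻¹ / (2 * n) * Real.exp (-((n : ℝ) ^ η / 2)) := by
          rw [neg_add, Real.exp_add, neg_add, Real.exp_add, neg_add, Real.exp_add,
            Real.exp_neg (Real.log K), Real.exp_neg (Real.log 32), Real.exp_neg (Real.log n),
            Real.exp_log (by positivity), Real.exp_log (by positivity),
            Real.exp_log (by positivity)]
          field_simp
          norm_num
      _ ≤ _ := by
          refine mul_le_mul (div_le_div₀ ?_ hlow ?_ ?_) (Real.exp_le_exp.2 (neg_le_neg hh2))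
            (Real.exp_nonneg _) ?_
          · exact Finset.sum_nonneg fun _ _ => sq_nonneg _
          · positivity
          · linarith
          · exact div_nonneg (Finset.sum_nonneg fun _ _ => sq_nonneg _) (by positivity)
  have hinj : Set.InjOn e' (Finset.range h : Set ℕ) := by
    intro i hi j hj hij
    have hi' := Finset.mem_range.1 (Finset.mem_coe.1 hi)
    have hj' := Finset.mem_range.1 (Finset.mem_coe.1 hj)
    have : e i = e j := by rw [← he' i hi', ← he' j hj', hij]
    by_contra hne
    rcases lt_or_gt_of_ne hne with hlt | hlt
    · have := hemono i j hlt hj'; omega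
    · have := hemono j i hlt hi'; omega
  have hcard : ((Finset.range h).image e').card = h := by
    rw [Finset.card_image_of_injOn hinj, Finset.card_range]
  have hfinal := hball μ hμ (n + 1) a ((Finset.range h).image e') (Real.exp (-(n : ℝ) ^ η))
    (fun i hi => by
      obtain ⟨j, hj, rfl⟩ := Finset.mem_image.1 hi
      have hj := Finset.mem_range.1 hj
      have hsub : ((Finset.range h).image e').filter (· < e' j) ⊆
          (Finset.Ico (j + 1) h).image e' := by
        intro i hi
        obtain ⟨h1, h2⟩ := Finset.mem_filter.1 hi
        obtain ⟨l, hl, rfl⟩ := Finset.mem_image.1 h1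
        have hl := Finset.mem_range.1 hl
        refine Finset.mem_image_of_mem _ (Finset.mem_Ico.2 ⟨?_, hl⟩)
        have h3 : e l < e j := by rw [← he' l hl, ← he' j hj]; exact h2
        by_contra hn
        rcases (by omega : l = j ∨ l < j) with rfl | hlt
        · omega
        · have := hemono l j hlt hj; omega
      have h4 := sum_geometric_tail_le (c := fun j => ‖a (e' j)‖) hθ0 hθ2
        (fun _ => norm_nonneg _) hdec j hj
      have h5 : ∑ i ∈ ((Finset.range h).image e').filter (· < e' j), ‖a i‖ ≤
          2 * θ * ‖a (e' j)‖ := by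
        refine (Finset.sum_le_sum_of_subset_of_nonneg hsub fun _ _ _ => norm_nonneg _).trans ?_
        rw [Finset.sum_image]
        · exact h4
        · refine hinj.mono ?_
          intro l hl
          exact Finset.mem_coe.2 (Finset.mem_range.2 (Finset.mem_Ico.1 (Finset.mem_coe.1 hl)).2)
      calc _ ≤ R * (2 * θ * ‖a (e' j)‖) := by gcongr
        _ ≤ R * (2 * (1 / (4 * R)) * ‖a (e' j)‖) := by gcongr
        _ = _ := by field_simp; norm_num)
    (fun i hi => by
      obtain ⟨j, hj, rfl⟩ := Finset.mem_image.1 hi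
      exact hbig j (Finset.mem_range.1 hj))
  rw [hcard] at hfinal
  refine hfinal.trans ?_
  -- Here q^h = e^(-ch) with h ≥ τ/2, and τ ≥ (2A/c) log n for large n.
  rw [pow_eq_exp_mul_log hq0, Real.rpow_def_of_pos (by positivity), Real.exp_le_exp]
  have e1 : Real.log q = -c := by rw [hc]; ring
  rw [e1]
  have e2 : 2 * A / c * Real.log n * (c / 2) ≤ τ * (c / 2) := by gcongr
  have e3 : 2 * A / c * Real.log n * (c / 2) = Real.log n * A := by field_simp
  have e4 : τ / 2 ≤ h := by linarith
  nlinarith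

/-! ### Second moments and logarithmic moments of the tilted polynomial. -/

theorem UnitLaw.integrable_norm_sq_sum {ε C : ℝ} {μ : Measure ℂ} (h : UnitLaw ε C μ) {N : ℕ} (y : ℂ)
    (a : Fin N → ℂ) :
    Integrable (fun x : Fin N → ℂ => ‖y + ∑ i, a i * x i‖ ^ 2) (Measure.pi fun _ => μ) := by
  have := h.prob
  have hi : ∀ i, Integrable (fun x : Fin N → ℂ => ‖x i‖ ^ 2) (Measure.pi fun _ => μ) := fun i =>
    (measurePreserving_eval (fun _ : Fin N => μ) i).integrable_comp_of_integrable h.integrable_sq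
  have hb : Integrable (fun x : Fin N → ℂ =>
      ‖y‖ ^ 2 * 2 + ((∑ i, ‖a i‖ ^ 2) * ∑ i, ‖x i‖ ^ 2) * 2) (Measure.pi fun _ => μ) :=
    (integrable_const _).add (((integrable_finsetSum _ fun i _ => hi i).const_mul _).mul_const _)
  refine hb.mono' (by fun_prop : Continuous fun x : Fin N → ℂ =>
    ‖y + ∑ i, a i * x i‖ ^ 2).aestronglyMeasurable (Filter.Eventually.of_forall fun x => ?_)
  rw [Real.norm_of_nonneg (sq_nonneg _)]
  have h1 : ‖∑ i, a i * x i‖ ^ 2 ≤ (∑ i, ‖a i‖ ^ 2) * ∑ i, ‖x i‖ ^ 2 := by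
    calc ‖∑ i, a i * x i‖ ^ 2 ≤ (∑ i, ‖a i‖ * ‖x i‖) ^ 2 := by
          gcongr
          exact (norm_sum_le _ _).trans_eq (by simp)
      _ ≤ _ := Finset.sum_mul_sq_le_sq_mul_sq _ _ _
  have h2 : ‖y + ∑ i, a i * x i‖ ^ 2 ≤ (‖y‖ + ‖∑ i, a i * x i‖) ^ 2 := by
    gcongr; exact norm_add_le _ _
  nlinarith [sq_nonneg (‖y‖ - ‖∑ i, a i * x i‖)]

theorem UnitLaw.integrable_norm_sq_add {ε C : ℝ} {μ : Measure ℂ} (h : UnitLaw ε C μ) (y b : ℂ) :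
    Integrable (fun s => ‖y + b * s‖ ^ 2) μ := by
  have := h.prob
  refine ((integrable_const (‖y‖ ^ 2 * 2)).add (h.integrable_sq.const_mul (‖b‖ ^ 2 * 2))).mono'
    (by fun_prop : Continuous fun s : ℂ => ‖y + b * s‖ ^ 2).aestronglyMeasurable
    (Filter.Eventually.of_forall fun s => ?_)
  rw [Real.norm_of_nonneg (sq_nonneg _)]
  have h2 : ‖y + b * s‖ ^ 2 ≤ (‖y‖ + ‖b‖ * ‖s‖) ^ 2 := by
    rw [← norm_mul]
    gcongr; exact norm_add_le _ _
  simp only [Pi.add_apply]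
  nlinarith [sq_nonneg (‖y‖ - ‖b‖ * ‖s‖)]

/-- The cross term 2Re(ȳbs) has mean zero. -/
theorem UnitLaw.integral_norm_sq_add {ε C : ℝ} {μ : Measure ℂ} (h : UnitLaw ε C μ) (y b : ℂ) :
    ∫ s, ‖y + b * s‖ ^ 2 ∂μ = ‖y‖ ^ 2 + ‖b‖ ^ 2 := by
  have := h.prob
  have hid : Integrable (fun s : ℂ => s) μ :=
    h.integrable_of_sq_bound (by fun_prop) (K := 1) (fun s => by
      nlinarith [sq_nonneg (‖s‖ - 1), norm_nonneg s])
  have hre : ∫ s, (starRingEnd ℂ y * b * s).re ∂μ = 0 := by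
    have := integral_re (hid.const_mul (starRingEnd ℂ y * b))
    rw [integral_const_mul, h.mean, mul_zero] at this
    simpa using! this
  have hE : ∀ s : ℂ, ‖y + b * s‖ ^ 2 =
      ‖y‖ ^ 2 + ‖b‖ ^ 2 * ‖s‖ ^ 2 + 2 * (starRingEnd ℂ y * b * s).re := by
    intro s
    simp only [Complex.sq_norm, Complex.normSq_apply, Complex.add_re, Complex.add_im,
      Complex.mul_re, Complex.mul_im, Complex.conj_re, Complex.conj_im]
    ring
  have hI : Integrable (fun s : ℂ => (starRingEnd ℂ y * b * s).re) μ :=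
    (hid.const_mul (starRingEnd ℂ y * b)).re
  simp only [hE]
  rw [integral_add (by exact (integrable_const _).add (h.integrable_sq.const_mul _))
    (hI.const_mul 2), integral_add (integrable_const _) (h.integrable_sq.const_mul _),
    integral_const_mul, integral_const_mul, h.var, hre]
  simp

theorem UnitLaw.integral_norm_sq_sum {ε C : ℝ} {μ : Measure ℂ} (h : UnitLaw ε C μ) {N : ℕ} (y : ℂ)
    (a : Fin N → ℂ) :
    ∫ x : Fin N → ℂ, ‖y + ∑ i, a i * x i‖ ^ 2 ∂(Measure.pi fun _ => μ) =
      ‖y‖ ^ 2 + ∑ i, ‖a i‖ ^ 2 := by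
  have := h.prob
  induction N generalizing y with
  | zero => simp
  | succ N ih =>
    have hI : Integrable (fun x : Fin (N + 1) → ℂ => ((‖y + ∑ i, a i * x i‖ ^ 2 : ℝ) : ℂ))
      (Measure.pi fun _ => μ) := (h.integrable_norm_sq_sum y a).ofReal
    have h1 := integral_pi_fin_succ μ hI
    rw [integral_complex_ofReal] at h1
    simp only [Fin.sum_univ_succ, Fin.cons_zero, Fin.cons_succ, ← add_assoc] at h1
    simp only [integral_complex_ofReal, ih] at h1
    simp only [Fin.sum_univ_succ, ← add_assoc]
    have h2 := Complex.ofReal_injective h1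
    rw [h2, integral_add (h.integrable_norm_sq_add y (a 0)) (integrable_const _),
      h.integral_norm_sq_add]
    simp

/-- The tilted polynomial as a linear form. -/
noncomputable def ellipticForm (n : ℕ) (z u : ℂ) (x : Fin (n + 1) → ℂ) : ℂ :=
  ∑ i, ellipticCoeff n z u i * x i

theorem continuous_ellipticForm (n : ℕ) (z : ℂ) :
    Continuous fun p : (Fin (n + 1) → ℂ) × ℂ => ellipticForm n z p.2 p.1 := by
  unfold ellipticForm ellipticCoeff ellipticTilt
  fun_prop

theorem ellipticForm_eq (n : ℕ) (z u : ℂ) (x : Fin (n + 1) → ℂ) :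
    ellipticForm n z u x =
      (rescaledElliptic n x).eval u * ((Real.exp (-ellipticTilt n z u) : ℝ) : ℂ) :=
  sum_ellipticCoeff_mul n z u x

theorem log_norm_ellipticForm {n : ℕ} {z u : ℂ} {x : Fin (n + 1) → ℂ}
    (h : (rescaledElliptic n x).eval u ≠ 0) :
    Real.log ‖ellipticForm n z u x‖ =
      Real.log ‖(rescaledElliptic n x).eval u‖ - ellipticTilt n z u := by
  rw [ellipticForm_eq, norm_mul, Complex.norm_real, Real.norm_of_nonneg (Real.exp_nonneg _),
    Real.log_mul (norm_ne_zero_iff.2 h) (Real.exp_pos _).ne', Real.log_exp, sub_eq_add_neg]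

theorem natDegree_rescaledElliptic_le (n : ℕ) (x : Fin (n + 1) → ℂ) :
    (rescaledElliptic n x).natDegree ≤ n :=
  Polynomial.natDegree_sum_le_of_forall_le _ _ fun i _ =>
    (Polynomial.natDegree_monomial_le _).trans (Nat.lt_succ_iff.1 i.2)

theorem exists_roots_enum (p : Polynomial ℂ) :
    ∃ r : Fin p.natDegree → ℂ, p.roots = Finset.univ.val.map r := by
  have hcard : p.roots.toList.length = p.natDegree := by
    rw [Multiset.length_toList]
    exact IsAlgClosed.card_roots_eq_natDegree
  refine ⟨fun i => p.roots.toList.get (i.cast hcard.symm), ?_⟩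
  have h1 : (Finset.univ : Finset (Fin p.natDegree)).val.map
      (fun i => p.roots.toList.get (i.cast hcard.symm)) =
      (List.ofFn fun i : Fin p.natDegree => p.roots.toList.get (i.cast hcard.symm) : Multiset ℂ) := by
    rw [List.ofFn_eq_map]
    rfl
  rw [h1, List.ofFn_congr hcard.symm]
  conv_lhs => rw [← Multiset.coe_toList p.roots]
  congr 1
  exact (List.ofFn_get _).symm

/-- Where the tilted polynomial is not exponentially small at the centre, its logarithm is bounded
below by a linear term and the contribution of the nearby zeros. -/
theorem neg_log_norm_ellipticForm_le {C : ℝ} (hC : 0 < C) {n : ℕ} (hn : 1 ≤ n) {z u : ℂ}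
    (hz : ‖z‖ ≤ C * Real.sqrt n) (hu : ‖u - z‖ ≤ C) {x : Fin (n + 1) → ℂ}
    (hx : Real.exp (-n) < ‖ellipticForm n z z x‖)
    {r : Fin (rescaledElliptic n x).natDegree → ℂ}
    (hr : (rescaledElliptic n x).roots = Finset.univ.val.map r) (hur : ∀ i, u ≠ r i) :
    -Real.log ‖ellipticForm n z u x‖ ≤
      (1 + C + C ^ 2) * n + ∑ i, max (-Real.log ‖u - r i‖) 0 := by
  have hn1 : (1 : ℝ) ≤ n := by exact_mod_cast hn
  have hform : ellipticForm n z z x ≠ 0 := norm_pos_iff.1 ((Real.exp_pos _).trans hx)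
  have hfz : (rescaledElliptic n x).eval z ≠ 0 := by
    intro h0
    rw [ellipticForm_eq, h0, zero_mul] at hform
    exact hform rfl
  have hp : rescaledElliptic n x ≠ 0 := by
    intro h0
    rw [h0] at hfz
    simp at hfz
  have hzr : ∀ i, z ≠ r i := by
    intro i hi
    refine hfz ?_
    rw [eval_eq_prod_roots hr, Finset.prod_eq_zero (Finset.mem_univ i) (sub_eq_zero.2 hi), mul_zero]
  have hfu : (rescaledElliptic n x).eval u ≠ 0 := by
    rw [eval_eq_prod_roots hr]
    refine mul_ne_zero (by simpa using hp) (Finset.prod_ne_zero_iff.2 fun i _ =>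
      sub_ne_zero.2 (hur i))
  have hlz : -(n : ℝ) ≤ Real.log ‖(rescaledElliptic n x).eval z‖ - ellipticTilt n z z := by
    rw [← log_norm_ellipticForm hfz, ← Real.log_exp (-(n : ℝ))]
    exact Real.log_le_log (Real.exp_pos _) hx.le
  rw [log_norm_eval hp hr hzr] at hlz
  rw [log_norm_ellipticForm hfu, log_norm_eval hp hr hur]
  have htilt : ellipticTilt n z u - ellipticTilt n z z ≤ C ^ 2 * n := by
    unfold ellipticTilt
    have h1 : (starRingEnd ℂ z * (u - z)).re ≤ C ^ 2 * n := by
      refine (Complex.re_le_norm _).trans ?_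
      rw [norm_mul, RCLike.norm_conj]
      have hs : Real.sqrt n ≤ n := Real.sqrt_le_iff.2 ⟨by positivity, by nlinarith⟩
      calc ‖z‖ * ‖u - z‖ ≤ C * Real.sqrt n * C := by gcongr
        _ ≤ C * n * C := by gcongr
        _ = _ := by ring
    have h2 : (starRingEnd ℂ z * (u - z)).re / (1 + ‖z‖ ^ 2 / n) ≤ C ^ 2 * n := by
      rw [div_le_iff₀ (by positivity)]
      refine h1.trans (le_mul_of_one_le_right (by positivity) ?_)
      have : 0 ≤ ‖z‖ ^ 2 / n := by positivity
      linarith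
    simp only [sub_self, mul_zero, Complex.zero_re, zero_div, add_zero]
    linarith
  -- Moving from u to z increases the logarithm of the distance to a root by at most log(1 + C) ≤ C,
  -- unless u is within distance one of the root; then the explicit singularity covers the
  -- difference. There are at most n roots.
  have hroot : ∀ i, Real.log ‖z - r i‖ ≤ Real.log ‖u - r i‖ + (C + max (-Real.log ‖u - r i‖) 0) := by
    intro i
    have h0 : 0 < ‖z - r i‖ := norm_pos_iff.2 (sub_ne_zero.2 (hzr i))
    have h1 : 0 < ‖u - r i‖ := norm_pos_iff.2 (sub_ne_zero.2 (hur i))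
    have h2 : ‖z - r i‖ ≤ ‖u - r i‖ + C := by
      have := norm_sub_le (u - r i) (u - z)
      rw [show u - r i - (u - z) = z - r i by ring] at this
      linarith
    have hlC : Real.log (1 + C) ≤ C := by
      have := Real.log_le_sub_one_of_pos (by linarith : 0 < 1 + C)
      linarith
    rcases le_or_gt 1 ‖u - r i‖ with h3 | h3
    · have h4 : ‖z - r i‖ ≤ ‖u - r i‖ * (1 + C) := by nlinarith
      have := Real.log_le_log h0 h4
      rw [Real.log_mul h1.ne' (by positivity)] at this
      linarith [le_max_right (-Real.log ‖u - r i‖) 0]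
    · have := Real.log_le_log h0 (h2.trans (by linarith : _ ≤ 1 + C))
      linarith [le_max_left (-Real.log ‖u - r i‖) 0]
  have hsum := Finset.sum_le_sum fun i (_ : i ∈ Finset.univ) => hroot i
  rw [Finset.sum_add_distrib, Finset.sum_add_distrib, Finset.sum_const, Finset.card_univ,
    Fintype.card_fin, nsmul_eq_mul] at hsum
  have hdeg : ((rescaledElliptic n x).natDegree : ℝ) ≤ n := by
    exact_mod_cast natDegree_rescaledElliptic_le n x
  have hdC : ((rescaledElliptic n x).natDegree : ℝ) * C ≤ n * C := by gcongr
  linarith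

/-- From s^P/P! ≤ e^s with s the negative part of log t: powers of a logarithmic singularity are
controlled by the integrable t⁻¹. -/
theorem max_neg_log_pow_le (P : ℕ) {t : ℝ} (ht : 0 < t) :
    max (-Real.log t) 0 ^ P ≤ P.factorial * (1 + t⁻¹) := by
  have h1 := Real.pow_div_factorial_le_exp (max (-Real.log t) 0) (le_max_right _ _) P
  rw [div_le_iff₀ (by positivity)] at h1
  rw [mul_comm]
  refine h1.trans ?_
  gcongr
  have : 0 < t⁻¹ := by positivity
  rcases max_cases (-Real.log t) 0 with h | h <;> rw [h.1]
  · rw [Real.exp_neg, Real.exp_log ht]; linarith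
  · simp; linarith

theorem max_log_pow_le (P : ℕ) {t : ℝ} (ht : 0 ≤ t) :
    max (Real.log t) 0 ^ P ≤ P.factorial * (2 + t ^ 2) := by
  have h1 := Real.pow_div_factorial_le_exp (max (Real.log t) 0) (le_max_right _ _) P
  rw [div_le_iff₀ (by positivity)] at h1
  rw [mul_comm]
  refine h1.trans ?_
  gcongr
  rcases max_cases (Real.log t) 0 with h | h <;> rw [h.1]
  · rcases ht.eq_or_lt with rfl | ht
    · simp
    · rw [Real.exp_log ht]; nlinarith [sq_nonneg (t - 1)]
  · simp; nlinarith [sq_nonneg t]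

theorem abs_pow_eq_add {P : ℕ} (hP : P ≠ 0) (t : ℝ) : |t| ^ P = max (-t) 0 ^ P + max t 0 ^ P := by
  rcases le_total 0 t with h | h
  · rw [abs_of_nonneg h, max_eq_right (by linarith), max_eq_left h, zero_pow hP, zero_add]
  · rw [abs_of_nonpos h, max_eq_left (by linarith), max_eq_right h, zero_pow hP, add_zero]

/-- The logarithmic singularities have uniformly bounded moments. -/
theorem exists_lintegral_inv_norm_sub_le (C : ℝ) : ∃ K : ℝ, 0 < K ∧ ∀ z r : ℂ,
    ∫⁻ u in Metric.closedBall z C, ENNReal.ofReal (1 + ‖u - r‖⁻¹) ≤ ENNReal.ofReal K := by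
  set V := (volume (Metric.closedBall (0 : ℂ) C)).toReal with hV
  have hI := integrableOn_norm_inv_ball 1
  set J := ∫ u in Metric.ball (0 : ℂ) 1, ‖u‖⁻¹ with hJ
  have hJ0 : 0 ≤ J := integral_nonneg fun u => by positivity
  refine ⟨2 * V + J + 1, by positivity, fun z r => ?_⟩
  have hpt : ∀ u : ℂ, ENNReal.ofReal (1 + ‖u - r‖⁻¹) ≤ ENNReal.ofReal 2 +
      (Metric.ball (0 : ℂ) 1).indicator (fun v => ENNReal.ofReal ‖v‖⁻¹) (u - r) := by
    intro u
    by_cases h : u - r ∈ Metric.ball (0 : ℂ) 1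
    · rw [Set.indicator_of_mem h, ← ENNReal.ofReal_add (by norm_num) (by positivity)]
      exact ENNReal.ofReal_le_ofReal (by linarith)
    · rw [Set.indicator_of_notMem h, add_zero]
      refine ENNReal.ofReal_le_ofReal ?_
      have : 1 ≤ ‖u - r‖ := by simpa using h
      have := inv_le_one_of_one_le₀ this
      linarith
  have hm : Measurable ((Metric.ball (0 : ℂ) 1).indicator (fun v => ENNReal.ofReal ‖v‖⁻¹)) :=
    Measurable.indicator (by fun_prop) measurableSet_ball
  have hvol : volume (Metric.closedBall z C) = ENNReal.ofReal V := by
    rw [hV, ENNReal.ofReal_toReal (measure_closedBall_lt_top.ne)]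
    simp
  calc ∫⁻ u in Metric.closedBall z C, ENNReal.ofReal (1 + ‖u - r‖⁻¹)
      ≤ ∫⁻ u in Metric.closedBall z C, (ENNReal.ofReal 2 +
          (Metric.ball (0 : ℂ) 1).indicator (fun v => ENNReal.ofReal ‖v‖⁻¹) (u - r)) :=
        lintegral_mono hpt
    _ = ENNReal.ofReal 2 * volume (Metric.closedBall z C) + ∫⁻ u in Metric.closedBall z C,
          (Metric.ball (0 : ℂ) 1).indicator (fun v => ENNReal.ofReal ‖v‖⁻¹) (u - r) := by
        rw [lintegral_add_left measurable_const, setLIntegral_const]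
    _ ≤ ENNReal.ofReal 2 * ENNReal.ofReal V + ∫⁻ u,
          (Metric.ball (0 : ℂ) 1).indicator (fun v => ENNReal.ofReal ‖v‖⁻¹) (u - r) := by
        rw [hvol]
        exact add_le_add le_rfl (setLIntegral_le_lintegral _ _)
    _ = ENNReal.ofReal 2 * ENNReal.ofReal V + ENNReal.ofReal J := by
        rw [lintegral_sub_right_eq_self
          (fun v => (Metric.ball (0 : ℂ) 1).indicator (fun v => ENNReal.ofReal ‖v‖⁻¹) v) r,
          lintegral_indicator measurableSet_ball,
          ofReal_integral_eq_lintegral_ofReal hI (Filter.Eventually.of_forall fun v => by positivity)]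
    _ ≤ _ := by
        rw [← ENNReal.ofReal_mul (by norm_num), ← ENNReal.ofReal_add (by positivity) hJ0]
        exact ENNReal.ofReal_le_ofReal (by linarith)

/-- The event that the tilted polynomial is not exponentially small at its centre. -/
def ellipticGood (n : ℕ) (z : ℂ) : Set (Fin (n + 1) → ℂ) :=
  {x | Real.exp (-n) < ‖ellipticForm n z z x‖}

theorem measurable_ellipticForm (n : ℕ) (z : ℂ) :
    Measurable fun p : (Fin (n + 1) → ℂ) × ℂ => ellipticForm n z p.2 p.1 :=
  (continuous_ellipticForm n z).measurable

theorem measurableSet_ellipticGood (n : ℕ) (z : ℂ) : MeasurableSet (ellipticGood n z) := by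
  have : Continuous (ellipticForm n z z) := by unfold ellipticForm; fun_prop
  exact measurableSet_lt measurable_const this.norm.measurable

theorem volume_closedBall_eq_ofReal (z : ℂ) (C : ℝ) :
    volume (Metric.closedBall z C) =
      ENNReal.ofReal (volume (Metric.closedBall (0 : ℂ) C)).toReal := by
  rw [ENNReal.ofReal_toReal (measure_closedBall_lt_top.ne)]
  simp

/-- The power mean inequality, separating the summands so that each can be integrated on its own. -/
theorem add_sum_pow_le {d P : ℕ} (hP : P ≠ 0) {n B : ℝ} (hB : 0 ≤ B) (hn : (d : ℝ) ≤ n)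
    {L : Fin d → ℝ} (hL : ∀ i, 0 ≤ L i) :
    (B + ∑ i, L i) ^ P ≤ 2 ^ P * (B ^ P + n ^ P * ∑ i, L i ^ P) := by
  have hS : 0 ≤ ∑ i, L i := Finset.sum_nonneg fun i _ => hL i
  refine (add_pow_le hB hS P).trans ?_
  obtain ⟨Q, rfl⟩ := Nat.exists_eq_succ_of_ne_zero hP
  have h2 : (∑ i, L i) ^ (Q + 1) ≤ n ^ (Q + 1) * ∑ i, L i ^ (Q + 1) := by
    rcases Nat.eq_zero_or_pos d with rfl | hd
    · simp
    · have h := pow_sum_div_card_le_sum_pow (s := (Finset.univ : Finset (Fin d))) (f := L)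
        (fun i _ => hL i) Q
      have hd1 : (1 : ℝ) ≤ d := by exact_mod_cast hd
      rw [Finset.card_univ, Fintype.card_fin, div_le_iff₀ (by positivity)] at h
      refine h.trans ?_
      rw [mul_comm]
      have hP0 : 0 ≤ ∑ i, L i ^ (Q + 1) := Finset.sum_nonneg fun i _ => by have := hL i; positivity
      gcongr
      calc (d : ℝ) ^ Q ≤ n ^ Q := by gcongr
        _ ≤ n ^ (Q + 1) := pow_le_pow_right₀ (hd1.trans hn) (Nat.le_succ _)
  have h3 : (2 : ℝ) ^ (Q + 1 - 1) ≤ 2 ^ (Q + 1) := pow_le_pow_right₀ (by norm_num) (Nat.sub_le _ _)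
  have h4 : 0 ≤ (∑ i, L i) ^ (Q + 1) := by positivity
  calc _ ≤ 2 ^ (Q + 1) * (B ^ (Q + 1) + (∑ i, L i) ^ (Q + 1)) := by gcongr
    _ ≤ _ := by gcongr

/-- A deterministic bound for the negative part of the logarithm. -/
theorem exists_lintegral_neg_log_pow_le {C : ℝ} (hC : 0 < C) {P : ℕ} (hP : P ≠ 0) :
    ∃ K : ℝ, 0 < K ∧ ∀ n : ℕ, 1 ≤ n → ∀ z : ℂ, ‖z‖ ≤ C * Real.sqrt n → ∀ x ∈ ellipticGood n z,
      ∫⁻ u in Metric.closedBall z C, ENNReal.ofReal (max (-Real.log ‖ellipticForm n z u x‖) 0 ^ P) ≤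
        ENNReal.ofReal (K * (n : ℝ) ^ (2 * P)) := by
  obtain ⟨K₀, hK₀, hlog⟩ := exists_lintegral_inv_norm_sub_le C
  set V := (volume (Metric.closedBall (0 : ℂ) C)).toReal with hV
  have hV0 : 0 ≤ V := ENNReal.toReal_nonneg
  set b := 1 + C + C ^ 2 with hb
  have hb0 : 0 ≤ b := by positivity
  refine ⟨2 ^ P * b ^ P * V + 2 ^ P * P.factorial * K₀, by positivity, fun n hn z hz x hx => ?_⟩
  have hn1 : (1 : ℝ) ≤ n := by exact_mod_cast hn
  obtain ⟨r, hr⟩ := exists_roots_enum (rescaledElliptic n x)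
  have hdn : ((rescaledElliptic n x).natDegree : ℝ) ≤ n := by exact_mod_cast natDegree_rescaledElliptic_le n x
  have hpt : ∀ᵐ u ∂(volume.restrict (Metric.closedBall z C)),
      ENNReal.ofReal (max (-Real.log ‖ellipticForm n z u x‖) 0 ^ P) ≤
        ENNReal.ofReal (2 ^ P * (b * n) ^ P) + ∑ i, ENNReal.ofReal (2 ^ P * n ^ P * P.factorial) *
          ENNReal.ofReal (1 + ‖u - r i‖⁻¹) := by
    filter_upwards [ae_restrict_of_ae (ae_forall_ne r),
      ae_restrict_mem Metric.isClosed_closedBall.measurableSet] with u hu hu'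
    have h1 := neg_log_norm_ellipticForm_le hC hn hz (mem_closedBall_iff_norm.1 hu') hx hr hu
    have h2 : max (-Real.log ‖ellipticForm n z u x‖) 0 ≤
        b * n + ∑ i, max (-Real.log ‖u - r i‖) 0 :=
      max_le h1 (add_nonneg (by positivity) (Finset.sum_nonneg fun i _ => le_max_right _ _))
    have h3 : max (-Real.log ‖ellipticForm n z u x‖) 0 ^ P ≤ 2 ^ P * (b * n) ^ P +
        ∑ i, 2 ^ P * n ^ P * P.factorial * (1 + ‖u - r i‖⁻¹) := by
      refine (pow_le_pow_left₀ (le_max_right _ _) h2 P).trans ?_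
      refine (add_sum_pow_le hP (by positivity) hdn fun i => le_max_right _ _).trans ?_
      rw [mul_add, ← mul_assoc, Finset.mul_sum]
      refine add_le_add le_rfl (Finset.sum_le_sum fun i _ => ?_)
      rw [mul_assoc (2 ^ P * (n : ℝ) ^ P)]
      refine mul_le_mul_of_nonneg_left ?_ (by positivity)
      exact max_neg_log_pow_le P (norm_pos_iff.2 (sub_ne_zero.2 (hu i)))
    refine (ENNReal.ofReal_le_ofReal h3).trans ?_
    rw [ENNReal.ofReal_add (by positivity) (Finset.sum_nonneg fun i _ => by positivity),
      ENNReal.ofReal_sum_of_nonneg fun i _ => by positivity]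
    refine add_le_add le_rfl (Finset.sum_le_sum fun i _ => ?_)
    rw [ENNReal.ofReal_mul (by positivity)]
  refine (lintegral_mono_ae hpt).trans ?_
  rw [lintegral_add_left measurable_const, setLIntegral_const,
    lintegral_finsetSum _ fun i _ => by fun_prop, volume_closedBall_eq_ofReal, ← hV]
  have hterm : ∀ i, ∫⁻ u in Metric.closedBall z C, ENNReal.ofReal (2 ^ P * n ^ P * P.factorial) *
      ENNReal.ofReal (1 + ‖u - r i‖⁻¹) ≤ ENNReal.ofReal (2 ^ P * n ^ P * P.factorial * K₀) := by
    intro i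
    rw [lintegral_const_mul _ (by fun_prop), ENNReal.ofReal_mul (q := K₀) (by positivity)]
    gcongr
    exact hlog z (r i)
  refine (add_le_add le_rfl (Finset.sum_le_sum fun i _ => hterm i)).trans ?_
  rw [← ENNReal.ofReal_sum_of_nonneg fun i _ => by positivity, ← ENNReal.ofReal_mul (by positivity),
    ← ENNReal.ofReal_add (by positivity) (Finset.sum_nonneg fun i _ => by positivity)]
  refine ENNReal.ofReal_le_ofReal ?_
  rw [Finset.sum_const, Finset.card_univ, Fintype.card_fin, nsmul_eq_mul, add_mul (2 ^ P * b ^ P * V)]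
  -- The roots contribute n·n^P, one factor n for their number; since P ≥ 1 this is within n^(2P).
  have hnP : (n : ℝ) ^ P ≤ n ^ (2 * P) := pow_le_pow_right₀ hn1 (by omega)
  have hnP' : (n : ℝ) * n ^ P ≤ n ^ (2 * P) := by
    rw [← pow_succ']; exact pow_le_pow_right₀ hn1 (by omega)
  refine add_le_add ?_ ?_
  · calc 2 ^ P * (b * n) ^ P * V = 2 ^ P * b ^ P * V * n ^ P := by rw [mul_pow]; ring
      _ ≤ _ := by gcongr
  · calc (rescaledElliptic n x).natDegree * (2 ^ P * (n : ℝ) ^ P * P.factorial * K₀) ≤ n * (2 ^ P * (n : ℝ) ^ P * P.factorial * K₀) := by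
          gcongr
      _ = 2 ^ P * P.factorial * K₀ * (n * n ^ P) := by ring
      _ ≤ _ := by gcongr

/-- Tonelli: bounds that hold for each fixed u are enough, although the integral over u is taken
inside. -/
theorem lintegral_setLIntegral_le {X : Type*} [MeasurableSpace X] (Q : Measure X) [SFinite Q]
    (S : Set X) (z : ℂ) (C : ℝ) {g : X → ℂ → ℝ≥0∞}
    (hg : Measurable fun p : X × ℂ => g p.1 p.2) {c : ℝ≥0∞}
    (h : ∀ u, ‖u - z‖ ≤ C → ∫⁻ x, g x u ∂Q ≤ c) :
    ∫⁻ x in S, (∫⁻ u in Metric.closedBall z C, g x u) ∂Q ≤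
      c * ENNReal.ofReal (volume (Metric.closedBall (0 : ℂ) C)).toReal := by
  rw [← volume_closedBall_eq_ofReal z]
  calc ∫⁻ x in S, (∫⁻ u in Metric.closedBall z C, g x u) ∂Q
      ≤ ∫⁻ x, (∫⁻ u in Metric.closedBall z C, g x u) ∂Q := setLIntegral_le_lintegral _ _
    _ = ∫⁻ u in Metric.closedBall z C, ∫⁻ x, g x u ∂Q := lintegral_lintegral_swap hg.aemeasurable
    _ ≤ ∫⁻ _u in Metric.closedBall z C, c := by
        refine lintegral_mono_ae ?_
        filter_upwards [ae_restrict_mem Metric.isClosed_closedBall.measurableSet] with u hu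
        exact h u (mem_closedBall_iff_norm.1 hu)
    _ = _ := by rw [setLIntegral_const]

theorem lintegral_norm_sq_ellipticForm {ε C : ℝ} {μ : Measure ℂ} (h : UnitLaw ε C μ) (n : ℕ)
    (z u : ℂ) :
    ∫⁻ x, ENNReal.ofReal (‖ellipticForm n z u x‖ ^ 2) ∂(Measure.pi fun _ => μ) =
      ENNReal.ofReal (∑ i, ‖ellipticCoeff n z u i‖ ^ 2) := by
  have h1 := h.integral_norm_sq_sum 0 (ellipticCoeff n z u)
  have h2 := h.integrable_norm_sq_sum 0 (ellipticCoeff n z u)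
  simp only [zero_add, norm_zero, ne_eq, OfNat.ofNat_ne_zero, not_false_eq_true, zero_pow] at h1 h2
  rw [← h1, ofReal_integral_eq_lintegral_ofReal h2 (Filter.Eventually.of_forall fun x => by positivity)]
  rfl

/-- A moment bound for logarithms from a crude deterministic bound and a small ball estimate. -/
theorem lintegral_abs_log_pow_le {X : Type*} [MeasurableSpace X] (Q : Measure X)
    [IsProbabilityMeasure Q] {S : Set X} (hS : MeasurableSet S) (z : ℂ) (C : ℝ) {Y : X → ℂ → ℂ}
    (hY : Measurable fun p : X × ℂ => Y p.1 p.2) {P : ℕ} (hP : P ≠ 0) {N T K₁ K₂ : ℝ} (hN : 0 < N)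
    (hT : 0 ≤ T) (hK₁ : 0 ≤ K₁) (hK₂ : 0 ≤ K₂)
    (hsq : ∀ u, ‖u - z‖ ≤ C → ∫⁻ x, ENNReal.ofReal (‖Y x u‖ ^ 2) ∂Q ≤ ENNReal.ofReal K₂)
    (hsmall : ∀ u, ‖u - z‖ ≤ C → Q.real {x | ‖Y x u‖ ≤ Real.exp (-T)} ≤ N⁻¹)
    (hcrude : ∀ x ∈ S, ∫⁻ u in Metric.closedBall z C,
      ENNReal.ofReal (max (-Real.log ‖Y x u‖) 0 ^ (2 * P)) ≤ ENNReal.ofReal (K₁ * N)) :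
    ∫⁻ x in S, (∫⁻ u in Metric.closedBall z C, ENNReal.ofReal (|Real.log ‖Y x u‖| ^ P)) ∂Q ≤
      ENNReal.ofReal ((T ^ P + 2 * P.factorial + P.factorial * K₂ + 1) *
        (volume (Metric.closedBall (0 : ℂ) C)).toReal + K₁) := by
  set V := (volume (Metric.closedBall (0 : ℂ) C)).toReal with hV
  have hV0 : 0 ≤ V := ENNReal.toReal_nonneg
  have hpos : ∀ x u, max (Real.log ‖Y x u‖) 0 ^ P ≤ (P.factorial : ℝ) * (2 + ‖Y x u‖ ^ 2) :=
    fun x u => max_log_pow_le P (norm_nonneg _)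
  have hF0 : (0 : ℝ) ≤ P.factorial := Nat.cast_nonneg _
  generalize (P.factorial : ℝ) = F at hF0 hpos ⊢
  set E : Set (X × ℂ) := {p | ‖Y p.1 p.2‖ ≤ Real.exp (-T)} with hE
  have hEm : MeasurableSet E := measurableSet_le hY.norm measurable_const
  have m1 : Measurable fun p : X × ℂ => ENNReal.ofReal (‖Y p.1 p.2‖ ^ 2) :=
    (hY.norm.pow_const 2).ennreal_ofReal
  have m2 : Measurable (E.indicator (fun _ => (1 : ℝ≥0∞))) := measurable_const.indicator hEm
  have m3' : ∀ x, Measurable fun u : ℂ =>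
      ENNReal.ofReal (max (-Real.log ‖Y x u‖) 0 ^ (2 * P)) := fun x => by
    have hYx : Measurable (Y x) := hY.comp measurable_prodMk_left
    exact (((Real.measurable_log.comp hYx.norm).neg.max measurable_const).pow_const _).ennreal_ofReal
  have m3 : Measurable fun p : X × ℂ =>
      ENNReal.ofReal (max (-Real.log ‖Y p.1 p.2‖) 0 ^ (2 * P)) :=
    (((Real.measurable_log.comp hY.norm).neg.max measurable_const).pow_const _).ennreal_ofReal
  -- Off E the negative part is at most T. On E, t^P ≤ N + N⁻¹t^(2P): the first term is paid by the
  -- probability 1/N of E, the second by the crude bound K₁N for the moment of order 2P.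
  have hneg : ∀ x u, ENNReal.ofReal (max (-Real.log ‖Y x u‖) 0 ^ P) ≤ ENNReal.ofReal (T ^ P) +
      ENNReal.ofReal N * E.indicator (fun _ => 1) (x, u) +
      ENNReal.ofReal N⁻¹ * ENNReal.ofReal (max (-Real.log ‖Y x u‖) 0 ^ (2 * P)) := by
    intro x u
    by_cases hmem : (x, u) ∈ E
    · rw [Set.indicator_of_mem hmem, mul_one]
      have h : 0 ≤ max (-Real.log ‖Y x u‖) 0 := le_max_right _ _
      have : max (-Real.log ‖Y x u‖) 0 ^ P ≤ N + N⁻¹ * max (-Real.log ‖Y x u‖) 0 ^ (2 * P) := by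
        rw [inv_mul_eq_div, mul_comm 2 P, pow_mul]
        generalize max (-Real.log ‖Y x u‖) 0 = t at h ⊢
        have hq : 0 ≤ t ^ P := by positivity
        rcases le_total (t ^ P) N with h | h
        · exact h.trans (le_add_of_nonneg_right (by positivity))
        · refine le_trans ?_ (le_add_of_nonneg_left hN.le)
          rw [le_div_iff₀ hN]; nlinarith
      refine (ENNReal.ofReal_le_ofReal this).trans ?_
      rw [ENNReal.ofReal_add hN.le (by positivity), ENNReal.ofReal_mul (by positivity), add_assoc]
      exact le_add_self
    · refine le_trans ?_ (le_trans (le_self_add) le_self_add)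
      refine ENNReal.ofReal_le_ofReal ?_
      have hlt : Real.exp (-T) < ‖Y x u‖ := not_le.1 hmem
      have hl : -Real.log ‖Y x u‖ ≤ T := by
        have := Real.log_le_log (Real.exp_pos _) hlt.le
        rw [Real.log_exp] at this
        linarith
      exact pow_le_pow_left₀ (le_max_right _ _) (max_le hl hT) P
  have hpt : ∀ x u, ENNReal.ofReal (|Real.log ‖Y x u‖| ^ P) ≤
      (ENNReal.ofReal (T ^ P + 2 * F) + ENNReal.ofReal F * ENNReal.ofReal (‖Y x u‖ ^ 2) +
      ENNReal.ofReal N * E.indicator (fun _ => 1) (x, u)) +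
      ENNReal.ofReal N⁻¹ * ENNReal.ofReal (max (-Real.log ‖Y x u‖) 0 ^ (2 * P)) := by
    intro x u
    rw [abs_pow_eq_add hP, ENNReal.ofReal_add (by positivity) (by positivity)]
    have e1 : ENNReal.ofReal (max (Real.log ‖Y x u‖) 0 ^ P) ≤
        ENNReal.ofReal (2 * F) + ENNReal.ofReal F * ENNReal.ofReal (‖Y x u‖ ^ 2) := by
      rw [← ENNReal.ofReal_mul (by positivity), ← ENNReal.ofReal_add (by positivity) (by positivity)]
      exact ENNReal.ofReal_le_ofReal ((hpos x u).trans (by linarith))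
    refine (add_le_add (hneg x u) e1).trans (le_of_eq ?_)
    rw [ENNReal.ofReal_add (by positivity) (by positivity)]
    ring
  have I1 : ∫⁻ x in S, (∫⁻ u in Metric.closedBall z C,
      (ENNReal.ofReal (T ^ P + 2 * F) + ENNReal.ofReal F * ENNReal.ofReal (‖Y x u‖ ^ 2) +
        ENNReal.ofReal N * E.indicator (fun _ => 1) (x, u))) ∂Q ≤
      ENNReal.ofReal (T ^ P + 2 * F + F * K₂ + 1) * ENNReal.ofReal V := by
    have mG : Measurable fun p : X × ℂ => ENNReal.ofReal (T ^ P + 2 * F) +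
        ENNReal.ofReal F * ENNReal.ofReal (‖Y p.1 p.2‖ ^ 2) +
        ENNReal.ofReal N * E.indicator (fun _ => 1) (p.1, p.2) :=
      (measurable_const.add (m1.const_mul _)).add (m2.const_mul _)
    refine lintegral_setLIntegral_le Q _ z C mG fun u hu => ?_
    have mu1 : Measurable fun x => ENNReal.ofReal (‖Y x u‖ ^ 2) :=
      m1.comp (measurable_id.prodMk measurable_const)
    have mu2 : Measurable fun x => E.indicator (fun _ => (1 : ℝ≥0∞)) (x, u) :=
      m2.comp (measurable_id.prodMk measurable_const)
    rw [lintegral_add_right _ (mu2.const_mul _), lintegral_add_left measurable_const,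
      lintegral_const_mul _ mu1, lintegral_const_mul _ mu2]
    have e2 : ∫⁻ x, E.indicator (fun _ => (1 : ℝ≥0∞)) (x, u) ∂Q ≤ ENNReal.ofReal N⁻¹ := by
      have hm : MeasurableSet {x | (x, u) ∈ E} := hEm.preimage (measurable_id.prodMk measurable_const)
      have : (fun x => E.indicator (fun _ => (1 : ℝ≥0∞)) (x, u)) =
          {x | (x, u) ∈ E}.indicator (fun _ => 1) := rfl
      rw [this, lintegral_indicator_const hm, one_mul, ← ENNReal.ofReal_toReal (measure_ne_top Q _)]
      exact ENNReal.ofReal_le_ofReal (hsmall u hu)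
    calc _ ≤ ENNReal.ofReal (T ^ P + 2 * F) + ENNReal.ofReal F * ENNReal.ofReal K₂ +
          ENNReal.ofReal N * ENNReal.ofReal N⁻¹ := by
          gcongr
          · simp
          · exact hsq u hu
      _ = _ := by
          rw [← ENNReal.ofReal_mul (by positivity), ← ENNReal.ofReal_mul hN.le,
            ← ENNReal.ofReal_add (by positivity) (by positivity),
            ← ENNReal.ofReal_add (by positivity) (by positivity), mul_inv_cancel₀ hN.ne']
  have I2 : ∫⁻ x in S, (∫⁻ u in Metric.closedBall z C, ENNReal.ofReal N⁻¹ *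
      ENNReal.ofReal (max (-Real.log ‖Y x u‖) 0 ^ (2 * P))) ∂Q ≤ ENNReal.ofReal K₁ := by
    have hin : ∀ x ∈ S, ∫⁻ u in Metric.closedBall z C, ENNReal.ofReal N⁻¹ *
        ENNReal.ofReal (max (-Real.log ‖Y x u‖) 0 ^ (2 * P)) ≤ ENNReal.ofReal K₁ := by
      intro x hx
      rw [lintegral_const_mul _ (m3' x)]
      refine (mul_le_mul_right (hcrude x hx) _).trans (le_of_eq ?_)
      rw [← ENNReal.ofReal_mul (by positivity)]
      congr 1; field_simp
    have hae : ∀ᵐ x ∂(Q.restrict S), ∫⁻ u in Metric.closedBall z C, ENNReal.ofReal N⁻¹ *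
        ENNReal.ofReal (max (-Real.log ‖Y x u‖) 0 ^ (2 * P)) ≤ ENNReal.ofReal K₁ :=
      (ae_restrict_iff' hS).2 (Filter.Eventually.of_forall hin)
    refine (lintegral_mono_ae hae).trans ?_
    rw [setLIntegral_const]
    exact mul_le_of_le_one_right' prob_le_one
  calc _ ≤ ∫⁻ x in S, (∫⁻ u in Metric.closedBall z C,
      ((ENNReal.ofReal (T ^ P + 2 * F) + ENNReal.ofReal F * ENNReal.ofReal (‖Y x u‖ ^ 2) +
        ENNReal.ofReal N * E.indicator (fun _ => 1) (x, u)) +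
        ENNReal.ofReal N⁻¹ * ENNReal.ofReal (max (-Real.log ‖Y x u‖) 0 ^ (2 * P)))) ∂Q :=
        lintegral_mono fun x => lintegral_mono fun u => hpt x u
    _ = ∫⁻ x in S, (∫⁻ u in Metric.closedBall z C,
      (ENNReal.ofReal (T ^ P + 2 * F) + ENNReal.ofReal F * ENNReal.ofReal (‖Y x u‖ ^ 2) +
        ENNReal.ofReal N * E.indicator (fun _ => 1) (x, u))) ∂Q +
        ∫⁻ x in S, (∫⁻ u in Metric.closedBall z C,
          ENNReal.ofReal N⁻¹ * ENNReal.ofReal (max (-Real.log ‖Y x u‖) 0 ^ (2 * P))) ∂Q := by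
        rw [← lintegral_add_right _ (m3.const_mul _).lintegral_prod_right']
        refine lintegral_congr fun x => ?_
        rw [lintegral_add_right _ ((m3' x).const_mul _)]
    _ ≤ ENNReal.ofReal (T ^ P + 2 * F + F * K₂ + 1) * ENNReal.ofReal V +
        ENNReal.ofReal K₁ := add_le_add I1 I2
    _ = _ := by
        rw [← ENNReal.ofReal_mul (by positivity), ← ENNReal.ofReal_add (by positivity) hK₁]

/-- All logarithmic moments of the tilted polynomial near its centre are `O(n^η)`. -/
theorem exists_log_moment_le {ε C : ℝ} (hε : 0 < ε) (hε1 : ε ≤ 1) (hC : 0 < C) (C₁ : ℝ) {P : ℕ}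
    (hP : P ≠ 0) {η : ℝ} (hη : 0 < η) :
    ∃ K : ℝ, 0 < K ∧ ∀ᶠ n : ℕ in Filter.atTop, ∀ z : ℂ, (n : ℝ) ^ ε ≤ ‖z‖ →
      ‖z‖ ≤ C * Real.sqrt n → ∀ μ : Measure ℂ, UnitLaw ε C₁ μ →
        ∫⁻ x in ellipticGood n z, (∫⁻ u in Metric.closedBall z C,
          ENNReal.ofReal (|Real.log ‖ellipticForm n z u x‖| ^ P)) ∂(Measure.pi fun _ => μ) ≤
            ENNReal.ofReal (K * (n : ℝ) ^ η) := by
  obtain ⟨K₁, hK₁, hcrude⟩ := exists_lintegral_neg_log_pow_le hC (P := 2 * P) (by omega)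
  obtain ⟨K₂, hK₂, hbd⟩ := exists_ellipticCoeff_bounds hε hC
  set V := (volume (Metric.closedBall (0 : ℂ) C)).toReal with hV
  have hV0 : 0 ≤ V := ENNReal.toReal_nonneg
  have hF0 : (0 : ℝ) ≤ P.factorial := Nat.cast_nonneg _
  have hP1 : (1 : ℝ) ≤ P := by exact_mod_cast Nat.one_le_iff_ne_zero.2 hP
  -- The threshold exp(-n^η₁) must satisfy (n^η₁)^P ≤ n^η, and the small ball bound asks for η₁ ≤ ε.
  set η₁ := min (η / P) ε with hη₁
  have hη₁0 : 0 < η₁ := lt_min (by positivity) hε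
  refine ⟨(1 + 2 * P.factorial + P.factorial * K₂ + 1) * V + K₁, by positivity, ?_⟩
  filter_upwards [hbd, eventually_elliptic_small_ball hε hε1 hC C₁ hη₁0 (min_le_right _ _)
    ((2 * (2 * P) : ℕ) : ℝ), Filter.eventually_ge_atTop 1] with n hn hsmall h1 z hz1 hz2 μ hμ
  have := hμ.prob
  have hn1 : (1 : ℝ) ≤ n := by exact_mod_cast h1
  -- N = n^(4P) is the size of the crude bound for the moment of order 2P, and the small ball
  -- probability was requested below its inverse.
  have hmain := lintegral_abs_log_pow_le (Measure.pi fun _ : Fin (n + 1) => μ)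
    (measurableSet_ellipticGood n z) z C (measurable_ellipticForm n z) hP
    (N := (n : ℝ) ^ (2 * (2 * P))) (T := (n : ℝ) ^ η₁) (K₁ := K₁) (K₂ := K₂) (by positivity)
    (by positivity) hK₁.le (by linarith)
    (fun u hu => (lintegral_norm_sq_ellipticForm hμ n z u).trans_le
      (ENNReal.ofReal_le_ofReal (hn z u hz1 hz2 hu).2.1))
    (fun u hu => by
      have hs := hsmall z u hz1 hz2 hu μ hμ
      rw [Real.rpow_neg (by positivity), Real.rpow_natCast] at hs
      exact hs)
    (fun x hx => hcrude n h1 z hz2 x hx)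
  refine hmain.trans (ENNReal.ofReal_le_ofReal ?_)
  have hηn : ((n : ℝ) ^ η₁) ^ P ≤ (n : ℝ) ^ η := by
    rw [← Real.rpow_natCast, ← Real.rpow_mul (by positivity)]
    refine Real.rpow_le_rpow_of_exponent_le hn1 ?_
    calc η₁ * P ≤ η / P * P := by gcongr; exact min_le_left _ _
      _ = η := by field_simp
  have hη1 : 1 ≤ (n : ℝ) ^ η := Real.one_le_rpow hn1 hη.le
  have g0 : (0 : ℝ) ≤ 2 * P.factorial + P.factorial * K₂ + 1 := by positivity
  rw [← hV]
  calc _ ≤ (n ^ η + (2 * P.factorial + P.factorial * K₂ + 1) * n ^ η) * V + K₁ * n ^ η := by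
        refine add_le_add (mul_le_mul_of_nonneg_right ?_ hV0) (le_mul_of_one_le_right hK₁.le hη1)
        have := le_mul_of_one_le_right g0 hη1
        linarith
    _ = _ := by ring

/-! ### Mean square error of the truncation. -/

/-- Away from the origin the truncated logarithm is close to the logarithm. -/
theorem abs_log_sub_truncLog_sq_le {δ : ℝ} (hδ : 0 < δ) (hδ1 : δ ≤ 1) {y : ℂ} (hy : δ ≤ ‖y‖) :
    |Real.log ‖y‖ - truncLog (δ ^ 2) y| ^ 2 ≤ δ ^ 2 + δ ^ 2 * ‖y‖ ^ 2 := by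
  set t := ‖y‖ with ht
  have ht0 : 0 < t := hδ.trans_le hy
  set d := δ ^ 2 with hd
  have hd0 : 0 < d := by positivity
  have hd1 : d ≤ 1 := pow_le_one₀ hδ.le hδ1
  have hdt : d ≤ t ^ 2 := by rw [hd]; gcongr
  -- The truncation level is d = δ², so that for |y| ≥ δ the lower correction d²/|y|² is at most δ²;
  -- the upper one, log(1 + d²|y|²), is at most 2d|y|.
  have h1 : truncLog d y - Real.log t =
      (Real.log (1 + d ^ 2 / t ^ 2) - Real.log (1 + d ^ 2 * t ^ 2)) / 2 := by
    rw [truncLog_eq hd0, ← ht]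
    have : (t ^ 2 + d ^ 2) / (1 + d ^ 2 * t ^ 2) = t ^ 2 * ((1 + d ^ 2 / t ^ 2) / (1 + d ^ 2 * t ^ 2)) := by
      field_simp
    rw [this, Real.log_mul (by positivity) (by positivity), Real.log_div (by positivity) (by positivity),
      Real.log_pow]
    push_cast; ring
  have h2 : Real.log (1 + d ^ 2 / t ^ 2) ≤ d := by
    have := Real.log_le_sub_one_of_pos (by positivity : 0 < 1 + d ^ 2 / t ^ 2)
    have h3 : d ^ 2 / t ^ 2 ≤ d := by
      rw [div_le_iff₀ (by positivity)]; nlinarith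
    linarith
  have h2' : 0 ≤ Real.log (1 + d ^ 2 / t ^ 2) :=
    Real.log_nonneg (le_add_of_nonneg_right (by positivity))
  have h3 : Real.log (1 + d ^ 2 * t ^ 2) ≤ 2 * (d * t) := by
    have e1 : Real.log (1 + d ^ 2 * t ^ 2) ≤ Real.log ((1 + d * t) ^ 2) := by
      refine Real.log_le_log (by positivity) ?_
      have : 0 ≤ d * t := by positivity
      nlinarith
    have e2 := Real.log_le_sub_one_of_pos (by positivity : 0 < 1 + d * t)
    rw [Real.log_pow] at e1
    push_cast at e1
    linarith
  have h3' : 0 ≤ Real.log (1 + d ^ 2 * t ^ 2) :=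
    Real.log_nonneg (le_add_of_nonneg_right (by positivity))
  rw [abs_sub_comm, sq_abs, h1]
  have hb : d ^ 2 ≤ d := by nlinarith
  have hbt : d ^ 2 * t ^ 2 ≤ d * t ^ 2 := by gcongr
  have hA : Real.log (1 + d ^ 2 / t ^ 2) ^ 2 ≤ d ^ 2 := by gcongr
  have hB : Real.log (1 + d ^ 2 * t ^ 2) ^ 2 ≤ (2 * (d * t)) ^ 2 := by gcongr
  nlinarith [mul_nonneg h2' h3', sq_nonneg d]

theorem continuous_truncLog {d : ℝ} (hd : 0 < d) : Continuous (truncLog d) :=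
  (contDiff_truncLog hd).continuous

/-- The mean square distance between the logarithm and its truncation. -/
theorem lintegral_log_sub_truncLog_le {X : Type*} [MeasurableSpace X] (Q : Measure X)
    [IsProbabilityMeasure Q] {S : Set X} (z : ℂ) (C : ℝ) {Y : X → ℂ → ℂ}
    (hY : Measurable fun p : X × ℂ => Y p.1 p.2) {δ N p K M : ℝ} (hδ : 0 < δ) (hδ1 : δ ≤ 1)
    (hN : 0 < N) (hp : 0 ≤ p) (hK : 0 ≤ K) (hM0 : 0 ≤ M)
    (hsq : ∀ u, ‖u - z‖ ≤ C → ∫⁻ x, ENNReal.ofReal (‖Y x u‖ ^ 2) ∂Q ≤ ENNReal.ofReal K)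
    (hsmall : ∀ u, ‖u - z‖ ≤ C → Q.real {x | ‖Y x u‖ ≤ δ} ≤ p)
    (hM : ∫⁻ x in S, (∫⁻ u in Metric.closedBall z C, ENNReal.ofReal (|Real.log ‖Y x u‖| ^ 4)) ∂Q ≤
      ENNReal.ofReal M) :
    ∫⁻ x in S, (∫⁻ u in Metric.closedBall z C,
        ENNReal.ofReal (|Real.log ‖Y x u‖ - truncLog (δ ^ 2) (Y x u)| ^ 2)) ∂Q ≤
      ENNReal.ofReal ((δ ^ 2 + δ ^ 2 * K + (2 * N + 2 * Real.log (δ ^ 2)⁻¹ ^ 2) * p) *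
        (volume (Metric.closedBall (0 : ℂ) C)).toReal + 2 / N * M) := by
  set V := (volume (Metric.closedBall (0 : ℂ) C)).toReal with hV
  have hV0 : 0 ≤ V := ENNReal.toReal_nonneg
  set L := Real.log (δ ^ 2)⁻¹ with hL
  set E : Set (X × ℂ) := {p | ‖Y p.1 p.2‖ ≤ δ} with hE
  have hEm : MeasurableSet E := measurableSet_le hY.norm measurable_const
  set B := 2 * N + 2 * L ^ 2 with hB
  have hB0 : 0 ≤ B := by positivity
  have m1 : Measurable fun p : X × ℂ => ENNReal.ofReal (‖Y p.1 p.2‖ ^ 2) :=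
    (hY.norm.pow_const 2).ennreal_ofReal
  have m2 : Measurable (E.indicator (fun _ => (1 : ℝ≥0∞))) := measurable_const.indicator hEm
  have hYx : ∀ x, Measurable (Y x) := fun x => hY.comp measurable_prodMk_left
  have hpow : Measurable fun t : ℝ => ENNReal.ofReal (|t| ^ 4) := by fun_prop
  have m3 : Measurable fun p : X × ℂ => ENNReal.ofReal (|Real.log ‖Y p.1 p.2‖| ^ 4) :=
    hpow.comp (Real.measurable_log.comp hY.norm)
  have m3' : ∀ x, Measurable fun u : ℂ => ENNReal.ofReal (|Real.log ‖Y x u‖| ^ 4) := fun x =>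
    hpow.comp (Real.measurable_log.comp (hYx x).norm)
  have hpt : ∀ x u, ENNReal.ofReal (|Real.log ‖Y x u‖ - truncLog (δ ^ 2) (Y x u)| ^ 2) ≤
      (ENNReal.ofReal (δ ^ 2) + ENNReal.ofReal (δ ^ 2) * ENNReal.ofReal (‖Y x u‖ ^ 2) +
      ENNReal.ofReal B * E.indicator (fun _ => 1) (x, u)) +
      ENNReal.ofReal (2 / N) * ENNReal.ofReal (|Real.log ‖Y x u‖| ^ 4) := by
    intro x u
    by_cases hmem : (x, u) ∈ E
    · rw [Set.indicator_of_mem hmem, mul_one]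
      have h1 := abs_truncLog_le (d := δ ^ 2) (by positivity) (pow_le_one₀ hδ.le hδ1) (Y x u)
      have h2 : |Real.log ‖Y x u‖ - truncLog (δ ^ 2) (Y x u)| ^ 2 ≤
          B + 2 / N * |Real.log ‖Y x u‖| ^ 4 := by
        generalize truncLog (δ ^ 2) (Y x u) = b at h1 ⊢
        generalize Real.log ‖Y x u‖ = a
        have e1 : |b| ^ 2 ≤ L ^ 2 := by gcongr
        -- Where the form is small, N is paid by the probability p, and the fourth moment carries
        -- the factor 1/N.
        have e2 : |a| ^ 2 ≤ N + |a| ^ 4 / N := by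
          have h4 : |a| ^ 4 = (|a| ^ 2) ^ 2 := by ring
          rw [h4]
          have hq : 0 ≤ |a| ^ 2 := by positivity
          generalize |a| ^ 2 = q at hq ⊢
          rcases le_total q N with h | h
          · exact h.trans (le_add_of_nonneg_right (by positivity))
          · refine le_trans ?_ (le_add_of_nonneg_left hN.le)
            rw [le_div_iff₀ hN]; nlinarith
        have e3 : 2 / N * |a| ^ 4 = 2 * (|a| ^ 4 / N) := by ring
        rw [e3, sq_abs]
        rw [sq_abs] at e1 e2
        nlinarith [sq_nonneg (a + b)]
      refine (ENNReal.ofReal_le_ofReal h2).trans ?_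
      rw [ENNReal.ofReal_add hB0 (by positivity), ENNReal.ofReal_mul (by positivity)]
      exact add_le_add le_add_self le_rfl
    · refine le_trans ?_ (le_trans le_self_add le_self_add)
      have hlt : δ < ‖Y x u‖ := not_le.1 hmem
      rw [← ENNReal.ofReal_mul (by positivity), ← ENNReal.ofReal_add (by positivity) (by positivity)]
      exact ENNReal.ofReal_le_ofReal (abs_log_sub_truncLog_sq_le hδ hδ1 hlt.le)
  have I1 : ∫⁻ x in S, (∫⁻ u in Metric.closedBall z C,
      (ENNReal.ofReal (δ ^ 2) + ENNReal.ofReal (δ ^ 2) * ENNReal.ofReal (‖Y x u‖ ^ 2) +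
        ENNReal.ofReal B * E.indicator (fun _ => 1) (x, u))) ∂Q ≤
      ENNReal.ofReal (δ ^ 2 + δ ^ 2 * K + B * p) * ENNReal.ofReal V := by
    have mG : Measurable fun p : X × ℂ => ENNReal.ofReal (δ ^ 2) +
        ENNReal.ofReal (δ ^ 2) * ENNReal.ofReal (‖Y p.1 p.2‖ ^ 2) +
        ENNReal.ofReal B * E.indicator (fun _ => 1) (p.1, p.2) :=
      (measurable_const.add (m1.const_mul _)).add (m2.const_mul _)
    refine lintegral_setLIntegral_le Q _ z C mG fun u hu => ?_
    have mu1 : Measurable fun x => ENNReal.ofReal (‖Y x u‖ ^ 2) :=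
      m1.comp (measurable_id.prodMk measurable_const)
    have mu2 : Measurable fun x => E.indicator (fun _ => (1 : ℝ≥0∞)) (x, u) :=
      m2.comp (measurable_id.prodMk measurable_const)
    rw [lintegral_add_right _ (mu2.const_mul _), lintegral_add_left measurable_const,
      lintegral_const_mul _ mu1, lintegral_const_mul _ mu2]
    have e2 : ∫⁻ x, E.indicator (fun _ => (1 : ℝ≥0∞)) (x, u) ∂Q ≤ ENNReal.ofReal p := by
      have hm : MeasurableSet {x | (x, u) ∈ E} := hEm.preimage (measurable_id.prodMk measurable_const)
      have : (fun x => E.indicator (fun _ => (1 : ℝ≥0∞)) (x, u)) =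
          {x | (x, u) ∈ E}.indicator (fun _ => 1) := rfl
      rw [this, lintegral_indicator_const hm, one_mul, ← ENNReal.ofReal_toReal (measure_ne_top Q _)]
      exact ENNReal.ofReal_le_ofReal (hsmall u hu)
    calc _ ≤ ENNReal.ofReal (δ ^ 2) + ENNReal.ofReal (δ ^ 2) * ENNReal.ofReal K +
          ENNReal.ofReal B * ENNReal.ofReal p := by
          gcongr
          · simp
          · exact hsq u hu
      _ = _ := by
          rw [← ENNReal.ofReal_mul (by positivity), ← ENNReal.ofReal_mul hB0,
            ← ENNReal.ofReal_add (by positivity) (by positivity),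
            ← ENNReal.ofReal_add (by positivity) (by positivity)]
  calc _ ≤ ∫⁻ x in S, (∫⁻ u in Metric.closedBall z C,
      ((ENNReal.ofReal (δ ^ 2) + ENNReal.ofReal (δ ^ 2) * ENNReal.ofReal (‖Y x u‖ ^ 2) +
        ENNReal.ofReal B * E.indicator (fun _ => 1) (x, u)) +
        ENNReal.ofReal (2 / N) * ENNReal.ofReal (|Real.log ‖Y x u‖| ^ 4))) ∂Q :=
        lintegral_mono fun x => lintegral_mono fun u => hpt x u
    _ = ∫⁻ x in S, (∫⁻ u in Metric.closedBall z C,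
      (ENNReal.ofReal (δ ^ 2) + ENNReal.ofReal (δ ^ 2) * ENNReal.ofReal (‖Y x u‖ ^ 2) +
        ENNReal.ofReal B * E.indicator (fun _ => 1) (x, u))) ∂Q +
        ENNReal.ofReal (2 / N) * ∫⁻ x in S, (∫⁻ u in Metric.closedBall z C,
          ENNReal.ofReal (|Real.log ‖Y x u‖| ^ 4)) ∂Q := by
        rw [← lintegral_const_mul _ m3.lintegral_prod_right',
          ← lintegral_add_right _ (m3.lintegral_prod_right'.const_mul _)]
        refine lintegral_congr fun x => ?_
        rw [lintegral_add_right _ ((m3' x).const_mul _), lintegral_const_mul _ (m3' x)]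
    _ ≤ ENNReal.ofReal (δ ^ 2 + δ ^ 2 * K + B * p) * ENNReal.ofReal V +
        ENNReal.ofReal (2 / N) * ENNReal.ofReal M := by gcongr
    _ = _ := by
        rw [← ENNReal.ofReal_mul (by positivity), ← ENNReal.ofReal_mul (by positivity),
          ← ENNReal.ofReal_add (by positivity) (by positivity)]

/-- Replacing the logarithm by its truncation costs a negative power of `n` in mean square. -/
theorem exists_log_sub_truncLog_le {ε C : ℝ} (hε : 0 < ε) (hε1 : ε ≤ 1) (hC : 0 < C) (C₁ : ℝ)
    {γ : ℝ} (hγ : 0 < γ) (hγε : 3 * γ ≤ ε) :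
    ∃ K : ℝ, 0 < K ∧ ∀ᶠ n : ℕ in Filter.atTop, ∀ z : ℂ, (n : ℝ) ^ ε ≤ ‖z‖ →
      ‖z‖ ≤ C * Real.sqrt n → ∀ μ : Measure ℂ, UnitLaw ε C₁ μ →
        ∫⁻ x in ellipticGood n z, (∫⁻ u in Metric.closedBall z C,
          ENNReal.ofReal (|Real.log ‖ellipticForm n z u x‖ -
            truncLog (((n : ℝ) ^ (-γ)) ^ 2) (ellipticForm n z u x)| ^ 2))
            ∂(Measure.pi fun _ => μ) ≤ ENNReal.ofReal (K * (n : ℝ) ^ (-(5 * γ / 12))) := by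
  obtain ⟨K₂, hK₂, hbd⟩ := exists_ellipticCoeff_bounds hε hC
  obtain ⟨K₃, hK₃, hball⟩ := exists_small_ball_bound hε hε1 C₁ (v := K₂⁻¹) (by positivity)
  obtain ⟨K₄, hK₄, hmom⟩ := exists_log_moment_le hε hε1 hC C₁ (P := 4) (by norm_num)
    (η := γ / 12) (by positivity)
  set V := (volume (Metric.closedBall (0 : ℂ) C)).toReal with hV
  have hV0 : 0 ≤ V := ENNReal.toReal_nonneg
  refine ⟨(1 + K₂ + 4 * (K₃ * (1 + K₂ ^ 2))) * V + 2 * K₄, by positivity, ?_⟩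
  filter_upwards [hbd, hmom, eventually_mul_log_le_rpow (β := γ / 4) (by positivity) (2 * γ),
    Filter.eventually_ge_atTop 1] with n hn hm hlog h1 z hz1 hz2 μ hμ
  have := hμ.prob
  have hn1 : (1 : ℝ) ≤ n := by exact_mod_cast h1
  have hn0 : (0 : ℝ) < n := by linarith
  set δ := (n : ℝ) ^ (-γ) with hδ
  have hδ0 : 0 < δ := by positivity
  have hδ1 : δ ≤ 1 := Real.rpow_le_one_of_one_le_of_nonpos hn1 (by linarith)
  have hL : Real.log (δ ^ 2)⁻¹ = 2 * γ * Real.log n := by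
    rw [Real.log_inv, Real.log_pow, hδ, Real.log_rpow hn0]; push_cast; ring
  -- With coefficients O(n^(-ε/2)) the small ball bound is δ + n^(-ε)/δ² up to constants; the
  -- condition 3γ ≤ ε makes the second term at most n^(-γ) = δ.
  have hp : ∀ u, ‖u - z‖ ≤ C → (Measure.pi fun _ : Fin (n + 1) => μ).real
      {x | ‖ellipticForm n z u x‖ ≤ δ} ≤ K₃ * (1 + K₂ ^ 2) * (n : ℝ) ^ (-γ) := by
    intro u hu
    obtain ⟨b1, b2, b3⟩ := hn z u hz1 hz2 hu
    refine (hball μ hμ (n + 1) (ellipticCoeff n z u) _ (by positivity) b3 b1 δ hδ0).trans ?_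
    have e1 : (K₂ * (n : ℝ) ^ (-(ε / 2))) ^ 2 / δ ^ 2 = K₂ ^ 2 * (n : ℝ) ^ (-ε + 2 * γ) := by
      rw [hδ, mul_pow, ← Real.rpow_natCast ((n : ℝ) ^ (-(ε / 2))), ← Real.rpow_natCast ((n : ℝ) ^ (-γ)),
        ← Real.rpow_mul hn0.le, ← Real.rpow_mul hn0.le, mul_div_assoc, ← Real.rpow_sub hn0]
      congr 2; push_cast; ring
    have e2 : (n : ℝ) ^ (-ε + 2 * γ) ≤ (n : ℝ) ^ (-γ) :=
      Real.rpow_le_rpow_of_exponent_le hn1 (by linarith)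
    rw [e1, mul_assoc]
    gcongr
    have := mul_le_mul_of_nonneg_left e2 (sq_nonneg K₂)
    linarith
  -- Balance with N = n^(γ/2): the terms are δ² = n^(-2γ), Np of order n^(-γ/2), and n^(γ/12)/N =
  -- n^(-5γ/12). The last one dominates.
  refine (lintegral_log_sub_truncLog_le (Measure.pi fun _ : Fin (n + 1) => μ) z C
    (measurable_ellipticForm n z) (N := (n : ℝ) ^ (γ / 2)) hδ0 hδ1 (by positivity) (by positivity)
    (by linarith) (by positivity)
    (fun u hu => (lintegral_norm_sq_ellipticForm hμ n z u).trans_le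
      (ENNReal.ofReal_le_ofReal (hn z u hz1 hz2 hu).2.1)) hp (hm z hz1 hz2 μ hμ)).trans
      (ENNReal.ofReal_le_ofReal ?_)
  set ρ := (n : ℝ) ^ (-(5 * γ / 12)) with hρ
  have r1 : δ ^ 2 ≤ ρ := by
    rw [hδ, ← Real.rpow_natCast, ← Real.rpow_mul hn0.le]
    refine Real.rpow_le_rpow_of_exponent_le hn1 ?_
    push_cast; linarith
  have r2 : (n : ℝ) ^ (γ / 2) * (n : ℝ) ^ (-γ) ≤ ρ := by
    rw [← Real.rpow_add hn0]
    exact Real.rpow_le_rpow_of_exponent_le hn1 (by linarith)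
  have r3 : (n : ℝ) ^ (γ / 12) / (n : ℝ) ^ (γ / 2) = ρ := by
    rw [← Real.rpow_sub hn0]; congr 1; ring
  have r4 : Real.log (δ ^ 2)⁻¹ ^ 2 ≤ (n : ℝ) ^ (γ / 2) := by
    rw [hL]
    have h0 : 0 ≤ 2 * γ * Real.log n := mul_nonneg (by positivity) (Real.log_nonneg hn1)
    calc (2 * γ * Real.log n) ^ 2 ≤ ((n : ℝ) ^ (γ / 4)) ^ 2 := by gcongr
      _ = _ := by rw [← Real.rpow_natCast, ← Real.rpow_mul hn0.le]; congr 1; push_cast; ring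
  have t2 : (2 * (n : ℝ) ^ (γ / 2) + 2 * Real.log (δ ^ 2)⁻¹ ^ 2) *
      (K₃ * (1 + K₂ ^ 2) * (n : ℝ) ^ (-γ)) ≤ 4 * (K₃ * (1 + K₂ ^ 2)) * ρ := by
    calc _ ≤ (4 * (n : ℝ) ^ (γ / 2)) * (K₃ * (1 + K₂ ^ 2) * (n : ℝ) ^ (-γ)) := by
          gcongr; linarith
      _ = 4 * (K₃ * (1 + K₂ ^ 2)) * ((n : ℝ) ^ (γ / 2) * (n : ℝ) ^ (-γ)) := by ring
      _ ≤ _ := by gcongr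
  have t3 : 2 / (n : ℝ) ^ (γ / 2) * (K₄ * (n : ℝ) ^ (γ / 12)) = 2 * K₄ * ρ := by
    rw [← r3]; ring
  have t1 : δ ^ 2 * K₂ ≤ ρ * K₂ := by gcongr
  rw [t3]
  calc _ ≤ (ρ + ρ * K₂ + 4 * (K₃ * (1 + K₂ ^ 2)) * ρ) * V + 2 * K₄ * ρ := by gcongr
    _ = _ := by ring

/-! ### From one logarithm to products of logarithms. -/

/-- Telescoping: the factors are replaced one at a time. -/
theorem abs_prod_sub_prod_le {m : ℕ} {a b : Fin m → ℝ} {M : ℝ} (hM : 1 ≤ M) (ha : ∀ q, |a q| ≤ M)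
    (hb : ∀ q, |b q| ≤ M) : |∏ q, a q - ∏ q, b q| ≤ (∑ q, |a q - b q|) * M ^ m := by
  induction m with
  | zero => simp
  | succ m ih =>
    rw [Fin.prod_univ_succ, Fin.prod_univ_succ, Fin.sum_univ_succ]
    have h1 := ih (a := fun q => a q.succ) (b := fun q => b q.succ) (fun q => ha _) fun q => hb _
    have h2 : |∏ q : Fin m, a q.succ| ≤ M ^ m := by
      rw [Finset.abs_prod]
      calc _ ≤ ∏ _q : Fin m, M := Finset.prod_le_prod (fun _ _ => abs_nonneg _) fun q _ => ha _
        _ = _ := by simp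
    have e : a 0 * ∏ q : Fin m, a q.succ - b 0 * ∏ q : Fin m, b q.succ =
        (a 0 - b 0) * ∏ q : Fin m, a q.succ +
          b 0 * (∏ q : Fin m, a q.succ - ∏ q : Fin m, b q.succ) := by ring
    rw [e]
    refine (abs_add_le _ _).trans ?_
    rw [abs_mul, abs_mul]
    have hMm : M ^ m ≤ M ^ (m + 1) := pow_le_pow_right₀ hM (Nat.le_succ m)
    calc _ ≤ |a 0 - b 0| * M ^ (m + 1) + M * ((∑ q : Fin m, |a q.succ - b q.succ|) * M ^ m) := by
          gcongr
          · exact h2.trans hMm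
          · exact hb 0
      _ = _ := by ring

/-- The difference of two products, bounded by functions of one coordinate each. -/
theorem abs_prod_sub_prod_le_sum {m : ℕ} (hm : m ≠ 0) {a b : Fin m → ℝ} {L s : ℝ} (hL : 0 ≤ L)
    (hs : 0 < s) (hb : ∀ q, |b q| ≤ L) :
    |∏ q, a q - ∏ q, b q| ≤ (m / s * (4 ^ m * (1 + L) ^ (2 * m))) +
      ∑ q, (s * |a q - b q| ^ 2 + m / s * (4 ^ m * m ^ (2 * m)) * |a q| ^ (2 * m)) := by
  have hS : 0 ≤ ∑ q, |a q| := Finset.sum_nonneg fun _ _ => abs_nonneg _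
  set M := (1 + L) + ∑ q, |a q| with hM
  have hM1 : 1 ≤ M := by linarith
  have h1 := abs_prod_sub_prod_le (a := a) (b := b) hM1
    (fun q => by
      have := Finset.single_le_sum (f := fun q => |a q|) (fun _ _ => abs_nonneg _) (Finset.mem_univ q)
      linarith)
    (fun q => by linarith [hb q])
  have h2 := add_sum_pow_le (P := 2 * m) (by omega) (n := (m : ℝ)) (B := 1 + L) (by positivity) le_rfl
    (L := fun q => |a q|) fun q => abs_nonneg _
  rw [← hM] at h2
  have h4 : (2 : ℝ) ^ (2 * m) = 4 ^ m := by rw [pow_mul]; norm_num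
  rw [h4] at h2
  -- Weighted arithmetic–geometric mean. It decouples the variables: the difference enters through
  -- its mean square and the size through a high moment, with s free to balance them.
  have h3 : ∀ q, |a q - b q| * M ^ m ≤ s * |a q - b q| ^ 2 + 1 / s * M ^ (2 * m) := by
    intro q
    have e1 : M ^ (2 * m) = (M ^ m) ^ 2 := by rw [← pow_mul, mul_comm]
    rw [e1]
    have hq : 0 ≤ |a q - b q| := abs_nonneg _
    have hr : 0 ≤ M ^ m := by positivity
    generalize |a q - b q| = D at hq ⊢
    generalize M ^ m = R at hr ⊢
    have e2 : s * D ^ 2 + 1 / s * R ^ 2 - D * R = ((s * D - R / 2) ^ 2 + 3 / 4 * R ^ 2) / s := by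
      field_simp; ring
    have : 0 ≤ ((s * D - R / 2) ^ 2 + 3 / 4 * R ^ 2) / s := by positivity
    linarith
  rw [Finset.sum_mul] at h1
  refine (h1.trans (Finset.sum_le_sum fun q _ => h3 q)).trans ?_
  rw [Finset.sum_add_distrib, Finset.sum_add_distrib, Finset.sum_const, Finset.card_univ,
    Fintype.card_fin, nsmul_eq_mul, ← Finset.mul_sum Finset.univ (fun q => |a q| ^ (2 * m))]
  have h5 : m * (1 / s * M ^ (2 * m)) ≤ m / s * (4 ^ m * ((1 + L) ^ (2 * m) +
      m ^ (2 * m) * ∑ q, |a q| ^ (2 * m))) := by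
    rw [← mul_assoc, mul_one_div]
    gcongr
  refine (add_le_add le_rfl h5).trans (le_of_eq ?_)
  ring

/-- Integrating a function of one coordinate over a product of discs. -/
theorem lintegral_pi_closedBall_eval_le {m : ℕ} (c : Fin m → ℂ) (C : ℝ) (q : Fin m) {g : ℂ → ℝ≥0∞}
    (hg : Measurable g) :
    ∫⁻ u in Set.univ.pi (fun q => Metric.closedBall (c q) C), g (u q) ≤
      ENNReal.ofReal ((1 + (volume (Metric.closedBall (0 : ℂ) C)).toReal) ^ m) *
        ∫⁻ v in Metric.closedBall (c q) C, g v := by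
  set V := (volume (Metric.closedBall (0 : ℂ) C)).toReal with hV
  have hV0 : 0 ≤ V := ENNReal.toReal_nonneg
  rw [volume_pi, Measure.restrict_pi_pi]
  have hmap := Measure.pi_map_eval (fun q => (volume : Measure ℂ).restrict (Metric.closedBall (c q) C)) q
  have h1 : ∫⁻ u, g (u q) ∂(Measure.pi fun q =>
      (volume : Measure ℂ).restrict (Metric.closedBall (c q) C)) =
      ∫⁻ v, g v ∂((Measure.pi fun q =>
        (volume : Measure ℂ).restrict (Metric.closedBall (c q) C)).map (Function.eval q)) := by
    rw [lintegral_map hg (measurable_pi_apply q)]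
  rw [h1, hmap, lintegral_smul_measure, smul_eq_mul]
  gcongr
  have h2 : ∀ j, (volume : Measure ℂ).restrict (Metric.closedBall (c j) C) Set.univ =
      ENNReal.ofReal V := fun j => by
    rw [Measure.restrict_apply_univ, volume_closedBall_eq_ofReal]
  simp only [h2, Finset.prod_const]
  rw [← ENNReal.ofReal_pow hV0]
  refine ENNReal.ofReal_le_ofReal ?_
  calc V ^ (Finset.univ.erase q).card ≤ (1 + V) ^ (Finset.univ.erase q).card := by
        gcongr; linarith
    _ ≤ _ := by
        refine pow_le_pow_right₀ (by linarith) ?_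
        refine (Finset.card_le_univ _).trans (by simp)

theorem volume_pi_closedBall_le {m : ℕ} (c : Fin m → ℂ) (C : ℝ) :
    volume (Set.univ.pi (fun q => Metric.closedBall (c q) C)) ≤
      ENNReal.ofReal ((1 + (volume (Metric.closedBall (0 : ℂ) C)).toReal) ^ m) := by
  have hV0 : 0 ≤ (volume (Metric.closedBall (0 : ℂ) C)).toReal := ENNReal.toReal_nonneg
  have h2 : ∀ q, volume (Metric.closedBall (c q) C) =
      ENNReal.ofReal (volume (Metric.closedBall (0 : ℂ) C)).toReal := fun q =>
    volume_closedBall_eq_ofReal _ _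
  rw [volume_pi_pi, Finset.prod_congr rfl fun q _ => h2 q]
  simp only [Finset.prod_const, Finset.card_univ,
    Fintype.card_fin]
  rw [← ENNReal.ofReal_pow hV0]
  exact ENNReal.ofReal_le_ofReal (by gcongr; linarith)

theorem lintegral_abs_prod_sub_prod_le {X : Type*} [MeasurableSpace X] (Q : Measure X)
    [IsProbabilityMeasure Q] {m : ℕ} (hm : m ≠ 0) (c : Fin m → ℂ) (C : ℝ) {S : Set X}
    {a b : Fin m → X → ℂ → ℝ} (ha : ∀ q, Measurable fun p : X × ℂ => a q p.1 p.2)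
    (hb : ∀ q, Measurable fun p : X × ℂ => b q p.1 p.2) {L s A B : ℝ} (hL : 0 ≤ L) (hs : 0 < s)
    (hA : 0 ≤ A) (hB : 0 ≤ B) (hbL : ∀ q x v, |b q x v| ≤ L)
    (hd : ∀ q, ∫⁻ x in S, (∫⁻ v in Metric.closedBall (c q) C,
      ENNReal.ofReal (|a q x v - b q x v| ^ 2)) ∂Q ≤ ENNReal.ofReal A)
    (hmom : ∀ q, ∫⁻ x in S, (∫⁻ v in Metric.closedBall (c q) C,
      ENNReal.ofReal (|a q x v| ^ (2 * m))) ∂Q ≤ ENNReal.ofReal B) :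
    ∫⁻ x in S, (∫⁻ u in Set.univ.pi (fun q => Metric.closedBall (c q) C),
      ENNReal.ofReal |∏ q, a q x (u q) - ∏ q, b q x (u q)|) ∂Q ≤
      ENNReal.ofReal ((1 + (volume (Metric.closedBall (0 : ℂ) C)).toReal) ^ m *
        (m / s * (4 ^ m * (1 + L) ^ (2 * m)) +
          m * (s * A + m / s * (4 ^ m * m ^ (2 * m)) * B))) := by
  set W := (1 + (volume (Metric.closedBall (0 : ℂ) C)).toReal) ^ m with hW
  have hW0 : 0 ≤ W := by
    have : 0 ≤ (volume (Metric.closedBall (0 : ℂ) C)).toReal := ENNReal.toReal_nonneg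
    positivity
  set c₁ : ℝ := m / s * (4 ^ m * (1 + L) ^ (2 * m)) with hc₁
  set c₂ : ℝ := m / s * (4 ^ m * m ^ (2 * m)) with hc₂
  have hc₁0 : 0 ≤ c₁ := by positivity
  have hc₂0 : 0 ≤ c₂ := by positivity
  have hpow : Measurable fun t : ℝ => ENNReal.ofReal (|t| ^ (2 * m)) := by fun_prop
  have hpow2 : Measurable fun t : ℝ => ENNReal.ofReal (|t| ^ 2) := by fun_prop
  have md : ∀ q, Measurable fun p : X × ℂ => ENNReal.ofReal (|a q p.1 p.2 - b q p.1 p.2| ^ 2) :=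
    fun q => hpow2.comp ((ha q).sub (hb q))
  have mm : ∀ q, Measurable fun p : X × ℂ => ENNReal.ofReal (|a q p.1 p.2| ^ (2 * m)) :=
    fun q => hpow.comp (ha q)
  have hax : ∀ q x, Measurable (a q x) := fun q x => (ha q).comp measurable_prodMk_left
  have hbx : ∀ q x, Measurable (b q x) := fun q x => (hb q).comp measurable_prodMk_left
  have mdx : ∀ q x, Measurable fun v => ENNReal.ofReal (|a q x v - b q x v| ^ 2) :=
    fun q x => hpow2.comp ((hax q x).sub (hbx q x))
  have mmx : ∀ q x, Measurable fun v => ENNReal.ofReal (|a q x v| ^ (2 * m)) :=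
    fun q x => hpow.comp (hax q x)
  set D : Fin m → X → ℝ≥0∞ := fun q x => ∫⁻ v in Metric.closedBall (c q) C,
    ENNReal.ofReal (|a q x v - b q x v| ^ 2) with hD
  set G : Fin m → X → ℝ≥0∞ := fun q x => ∫⁻ v in Metric.closedBall (c q) C,
    ENNReal.ofReal (|a q x v| ^ (2 * m)) with hG
  have hDm : ∀ q, Measurable (D q) := fun q => (md q).lintegral_prod_right'
  have hGm : ∀ q, Measurable (G q) := fun q => (mm q).lintegral_prod_right'
  have hin : ∀ x, ∫⁻ u in Set.univ.pi (fun q => Metric.closedBall (c q) C),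
      ENNReal.ofReal |∏ q, a q x (u q) - ∏ q, b q x (u q)| ≤
      ENNReal.ofReal W * (ENNReal.ofReal c₁ +
        ∑ q, (ENNReal.ofReal s * D q x + ENNReal.ofReal c₂ * G q x)) := by
    intro x
    have hpt : ∀ u : Fin m → ℂ, ENNReal.ofReal |∏ q, a q x (u q) - ∏ q, b q x (u q)| ≤
        ENNReal.ofReal c₁ + ∑ q, (ENNReal.ofReal s * ENNReal.ofReal (|a q x (u q) - b q x (u q)| ^ 2) +
          ENNReal.ofReal c₂ * ENNReal.ofReal (|a q x (u q)| ^ (2 * m))) := by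
      intro u
      refine (ENNReal.ofReal_le_ofReal (abs_prod_sub_prod_le_sum hm hL hs
        fun q => hbL q x (u q))).trans ?_
      rw [ENNReal.ofReal_add hc₁0 (Finset.sum_nonneg fun q _ => by positivity),
        ENNReal.ofReal_sum_of_nonneg fun q _ => by positivity]
      refine add_le_add le_rfl (Finset.sum_le_sum fun q _ => ?_)
      rw [ENNReal.ofReal_add (by positivity) (by positivity), ENNReal.ofReal_mul hs.le,
        ENNReal.ofReal_mul hc₂0]
    refine (lintegral_mono hpt).trans ?_
    have me1 : ∀ q, Measurable fun u : Fin m → ℂ =>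
        ENNReal.ofReal (|a q x (u q) - b q x (u q)| ^ 2) :=
      fun q => (mdx q x).comp (measurable_pi_apply q)
    have me2 : ∀ q, Measurable fun u : Fin m → ℂ => ENNReal.ofReal (|a q x (u q)| ^ (2 * m)) :=
      fun q => (mmx q x).comp (measurable_pi_apply q)
    have me3 : ∀ q, Measurable fun u : Fin m → ℂ =>
        ENNReal.ofReal s * ENNReal.ofReal (|a q x (u q) - b q x (u q)| ^ 2) +
          ENNReal.ofReal c₂ * ENNReal.ofReal (|a q x (u q)| ^ (2 * m)) :=
      fun q => ((me1 q).const_mul _).add ((me2 q).const_mul _)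
    rw [lintegral_add_left measurable_const, setLIntegral_const,
      lintegral_finsetSum _ fun q _ => me3 q, mul_add, Finset.mul_sum]
    refine add_le_add ?_ (Finset.sum_le_sum fun q _ => ?_)
    · rw [mul_comm]
      gcongr
      exact volume_pi_closedBall_le c C
    · rw [lintegral_add_right _ ((me2 q).const_mul _), lintegral_const_mul _ (me1 q),
        lintegral_const_mul _ (me2 q), mul_add, mul_left_comm (ENNReal.ofReal W),
        mul_left_comm (ENNReal.ofReal W)]
      gcongr
      · exact lintegral_pi_closedBall_eval_le c C q (mdx q x)
      · exact lintegral_pi_closedBall_eval_le c C q (mmx q x)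
  refine (lintegral_mono hin).trans ?_
  have mq : ∀ q, Measurable fun x => ENNReal.ofReal s * D q x + ENNReal.ofReal c₂ * G q x :=
    fun q => ((hDm q).const_mul _).add ((hGm q).const_mul _)
  have ms : Measurable fun x => ENNReal.ofReal c₁ +
      ∑ q, (ENNReal.ofReal s * D q x + ENNReal.ofReal c₂ * G q x) :=
    measurable_const.add (Finset.measurable_sum _ fun q _ => mq q)
  rw [lintegral_const_mul _ ms,
    lintegral_add_left measurable_const, setLIntegral_const, lintegral_finsetSum _ fun q _ => mq q,
    ENNReal.ofReal_mul hW0]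
  gcongr
  have hq : ∀ q, ∫⁻ x in S, (ENNReal.ofReal s * D q x + ENNReal.ofReal c₂ * G q x) ∂Q ≤
      ENNReal.ofReal (s * A + c₂ * B) := by
    intro q
    rw [lintegral_add_right _ ((hGm q).const_mul _), lintegral_const_mul _ (hDm q),
      lintegral_const_mul _ (hGm q), ENNReal.ofReal_add (by positivity) (by positivity),
      ENNReal.ofReal_mul hs.le, ENNReal.ofReal_mul hc₂0]
    gcongr
    · exact hd q
    · exact hmom q
  rw [ENNReal.ofReal_add hc₁0 (by positivity)]
  refine add_le_add (mul_le_of_le_one_right' prob_le_one) ?_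
  refine (Finset.sum_le_sum fun q _ => hq q).trans (le_of_eq ?_)
  rw [Finset.sum_const, Finset.card_univ, Fintype.card_fin, nsmul_eq_mul,
    ENNReal.ofReal_mul (Nat.cast_nonneg m), ENNReal.ofReal_natCast]

theorem lintegral_abs_prod_log_sub_le {X : Type*} [MeasurableSpace X] (Q : Measure X)
    [IsProbabilityMeasure Q] {m : ℕ} (hm : m ≠ 0) (c : Fin m → ℂ) (C : ℝ) {S : Set X}
    {Y : Fin m → X → ℂ → ℂ} (hY : ∀ q, Measurable fun p : X × ℂ => Y q p.1 p.2) {d s A B : ℝ}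
    (hd0 : 0 < d) (hd1 : d ≤ 1) (hs : 0 < s) (hA : 0 ≤ A) (hB : 0 ≤ B)
    (hd : ∀ q, ∫⁻ x in S, (∫⁻ v in Metric.closedBall (c q) C,
      ENNReal.ofReal (|Real.log ‖Y q x v‖ - truncLog d (Y q x v)| ^ 2)) ∂Q ≤ ENNReal.ofReal A)
    (hmom : ∀ q, ∫⁻ x in S, (∫⁻ v in Metric.closedBall (c q) C,
      ENNReal.ofReal (|Real.log ‖Y q x v‖| ^ (2 * m))) ∂Q ≤ ENNReal.ofReal B) :
    ∫⁻ x in S, (∫⁻ u in Set.univ.pi (fun q => Metric.closedBall (c q) C),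
      ENNReal.ofReal |∏ q, Real.log ‖Y q x (u q)‖ - ∏ q, truncLog d (Y q x (u q))|) ∂Q ≤
      ENNReal.ofReal ((1 + (volume (Metric.closedBall (0 : ℂ) C)).toReal) ^ m *
        (m / s * (4 ^ m * (1 + Real.log d⁻¹) ^ (2 * m)) +
          m * (s * A + m / s * (4 ^ m * m ^ (2 * m)) * B))) := by
  have hL : 0 ≤ Real.log d⁻¹ := Real.log_nonneg ((one_le_inv₀ hd0).2 hd1)
  have ha : ∀ q, Measurable fun p : X × ℂ => Real.log ‖Y q p.1 p.2‖ := fun q =>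
    Real.measurable_log.comp (hY q).norm
  have hb : ∀ q, Measurable fun p : X × ℂ => truncLog d (Y q p.1 p.2) := fun q =>
    (continuous_truncLog hd0).measurable.comp (hY q)
  exact lintegral_abs_prod_sub_prod_le Q hm c C (a := fun q x v => Real.log ‖Y q x v‖)
    (b := fun q x v => truncLog d (Y q x v)) ha hb hL hs hA hB
    (fun q x v => abs_truncLog_le hd0 hd1 _) hd hmom

/-- In mean, the product of logarithms is close to the product of truncated logarithms. -/
theorem exists_prod_log_sub_le {ε C : ℝ} (hε : 0 < ε) (hε1 : ε ≤ 1) (hC : 0 < C) (C₁ : ℝ)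
    {γ : ℝ} (hγ : 0 < γ) (hγε : 3 * γ ≤ ε) {m : ℕ} (hm : m ≠ 0) :
    ∃ K : ℝ, 0 < K ∧ ∀ᶠ n : ℕ in Filter.atTop, ∀ c : Fin m → ℂ, (∀ q, (n : ℝ) ^ ε ≤ ‖c q‖ ∧
      ‖c q‖ ≤ C * Real.sqrt n) → ∀ μ : Measure ℂ, UnitLaw ε C₁ μ →
        ∀ S : Set (Fin (n + 1) → ℂ), (∀ q, S ⊆ ellipticGood n (c q)) →
        ∫⁻ x in S, (∫⁻ u in Set.univ.pi (fun q => Metric.closedBall (c q) C),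
          ENNReal.ofReal |∏ q, Real.log ‖ellipticForm n (c q) (u q) x‖ -
            ∏ q, truncLog (((n : ℝ) ^ (-γ)) ^ 2) (ellipticForm n (c q) (u q) x)|)
            ∂(Measure.pi fun _ => μ) ≤ ENNReal.ofReal (K * (n : ℝ) ^ (-(γ / 12))) := by
  obtain ⟨K₁, hK₁, hd⟩ := exists_log_sub_truncLog_le hε hε1 hC C₁ hγ hγε
  obtain ⟨K₂, hK₂, hmom⟩ := exists_log_moment_le hε hε1 hC C₁ (P := 2 * m) (by omega)
    (η := γ / 12) (by positivity)
  set W := (1 + (volume (Metric.closedBall (0 : ℂ) C)).toReal) ^ m with hW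
  have hW0 : 0 ≤ W := by
    have : 0 ≤ (volume (Metric.closedBall (0 : ℂ) C)).toReal := ENNReal.toReal_nonneg
    positivity
  have hm0 : (0 : ℝ) < m := by exact_mod_cast Nat.pos_of_ne_zero hm
  refine ⟨W * (m * 4 ^ m + m * (K₁ + m * (4 ^ m * m ^ (2 * m)) * K₂)) + 1, by positivity, ?_⟩
  filter_upwards [hd, hmom, eventually_mul_log_le_rpow (β := γ / (24 * m)) (by positivity) (4 * γ),
    eventually_le_natCast_rpow (β := γ / (24 * m)) (by positivity) 2,
    Filter.eventually_ge_atTop 1] with n hn1 hn2 hlog h2 h1 c hc μ hμ S hS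
  have := hμ.prob
  have hn1' : (1 : ℝ) ≤ n := by exact_mod_cast h1
  have hn0 : (0 : ℝ) < n := by linarith
  set δ := (n : ℝ) ^ (-γ) with hδ
  have hδ0 : 0 < δ := by positivity
  have hδ1 : δ ≤ 1 := Real.rpow_le_one_of_one_le_of_nonpos hn1' (by linarith)
  have hL : Real.log (δ ^ 2)⁻¹ = 2 * γ * Real.log n := by
    rw [Real.log_inv, Real.log_pow, hδ, Real.log_rpow hn0]; push_cast; ring
  have hL0 : 0 ≤ Real.log (δ ^ 2)⁻¹ := by
    rw [hL]; exact mul_nonneg (by positivity) (Real.log_nonneg hn1')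
  have hA := fun q => (lintegral_mono_set (hS q)).trans (hn1 (c q) (hc q).1 (hc q).2 μ hμ)
  have hB := fun q => (lintegral_mono_set (hS q)).trans (hn2 (c q) (hc q).1 (hc q).2 μ hμ)
  -- With s = n^(γ/6) the mean square part is n^(γ/6 - 5γ/12) = n^(-γ/4), and the moment part
  -- n^(γ/12 - γ/6) = n^(-γ/12) determines the rate.
  have hmain := lintegral_abs_prod_log_sub_le (Measure.pi fun _ : Fin (n + 1) => μ) hm c C
    (fun q => measurable_ellipticForm n (c q)) (s := (n : ℝ) ^ (γ / 6)) (by positivity)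
    (pow_le_one₀ hδ0.le hδ1) (by positivity) (by positivity) (by positivity) hA hB
  refine hmain.trans (ENNReal.ofReal_le_ofReal ?_)
  rw [← hW]
  set ρ := (n : ℝ) ^ (-(γ / 12)) with hρ
  have hρ0 : 0 < ρ := by positivity
  have hLp : (1 + Real.log (δ ^ 2)⁻¹) ^ (2 * m) ≤ (n : ℝ) ^ (γ / 12) := by
    have e1 : 1 + Real.log (δ ^ 2)⁻¹ ≤ (n : ℝ) ^ (γ / (24 * m)) := by
      rw [hL]; linarith
    calc _ ≤ ((n : ℝ) ^ (γ / (24 * m))) ^ (2 * m) := by gcongr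
      _ = _ := by
        rw [← Real.rpow_natCast, ← Real.rpow_mul hn0.le]
        congr 1; push_cast; field_simp; norm_num
  have r1 : (n : ℝ) ^ (γ / 12) / (n : ℝ) ^ (γ / 6) = ρ := by
    rw [← Real.rpow_sub hn0]; congr 1; ring
  have r2 : (n : ℝ) ^ (γ / 6) * (n : ℝ) ^ (-(5 * γ / 12)) ≤ ρ := by
    rw [← Real.rpow_add hn0]
    exact Real.rpow_le_rpow_of_exponent_le hn1' (by linarith)
  have t1 : m / (n : ℝ) ^ (γ / 6) * (4 ^ m * (1 + Real.log (δ ^ 2)⁻¹) ^ (2 * m)) ≤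
      m * 4 ^ m * ρ := by
    calc _ ≤ m / (n : ℝ) ^ (γ / 6) * (4 ^ m * (n : ℝ) ^ (γ / 12)) := by gcongr
      _ = _ := by rw [← r1]; ring
  have t2 : (n : ℝ) ^ (γ / 6) * (K₁ * (n : ℝ) ^ (-(5 * γ / 12))) ≤ K₁ * ρ := by
    calc _ = K₁ * ((n : ℝ) ^ (γ / 6) * (n : ℝ) ^ (-(5 * γ / 12))) := by ring
      _ ≤ _ := by gcongr
  have t3 : m / (n : ℝ) ^ (γ / 6) * (4 ^ m * m ^ (2 * m)) * (K₂ * (n : ℝ) ^ (γ / 12)) =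
      m * (4 ^ m * m ^ (2 * m)) * K₂ * ρ := by
    rw [← r1]; ring
  rw [t3]
  calc _ ≤ W * (m * 4 ^ m * ρ + m * (K₁ * ρ + m * (4 ^ m * m ^ (2 * m)) * K₂ * ρ)) := by gcongr
    _ ≤ W * (m * 4 ^ m * ρ + m * (K₁ * ρ + m * (4 ^ m * m ^ (2 * m)) * K₂ * ρ)) + ρ := by linarith
    _ = _ := by ring

/-! ### Weighted integrals, with the logarithms restricted to a large event. -/

/-- Comparison of two weighted integrals, one of them restricted to a large event. -/
theorem norm_setIntegral_sub_integral_le {X W : Type*} [MeasurableSpace X] [MeasurableSpace W]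
    (Q : Measure X) [IsProbabilityMeasure Q] (κ : Measure W) [SigmaFinite κ] {S : Set X}
    (hS : MeasurableSet S) {B : Set W} (hB : MeasurableSet B) {Ψ : W → ℂ} (hΨ : Measurable Ψ)
    {M Λ v b p : ℝ} (hM : 0 ≤ M) (hΛ : 0 ≤ Λ) (hv : 0 ≤ v) (hb : 0 ≤ b) (hΨM : ∀ u, ‖Ψ u‖ ≤ M)
    (hΨB : ∀ u, u ∉ B → Ψ u = 0) (hBv : κ B ≤ ENNReal.ofReal v) {A T : X → W → ℝ}
    (hA : Measurable fun q : X × W => A q.1 q.2) (hT : Measurable fun q : X × W => T q.1 q.2)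
    (hTΛ : ∀ x u, |T x u| ≤ Λ) (hp : Q.real Sᶜ ≤ p)
    (hAi : ∀ x ∈ S, Integrable (fun u => Ψ u * ((A x u : ℝ) : ℂ)) κ)
    (hd : ∫⁻ x in S, (∫⁻ u in B, ENNReal.ofReal |A x u - T x u| ∂κ) ∂Q ≤ ENNReal.ofReal b) :
    IntegrableOn (fun x => ∫ u, Ψ u * ((A x u : ℝ) : ℂ) ∂κ) S Q ∧
      Integrable (fun u => Ψ u * ((∫ x, T x u ∂Q : ℝ) : ℂ)) κ ∧
      ‖∫ x in S, (∫ u, Ψ u * ((A x u : ℝ) : ℂ) ∂κ) ∂Q -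
        ∫ u, Ψ u * ((∫ x, T x u ∂Q : ℝ) : ℂ) ∂κ‖ ≤ M * b + M * Λ * v * p := by
  have hBfin : κ B < ∞ := hBv.trans_lt ENNReal.ofReal_lt_top
  have hBr : κ.real B ≤ v := ENNReal.toReal_le_of_le_ofReal hv hBv
  have mA : Measurable fun q : X × W => Ψ q.2 * ((A q.1 q.2 : ℝ) : ℂ) :=
    (hΨ.comp measurable_snd).mul (Complex.measurable_ofReal.comp hA)
  have mT : Measurable fun q : X × W => Ψ q.2 * ((T q.1 q.2 : ℝ) : ℂ) :=
    (hΨ.comp measurable_snd).mul (Complex.measurable_ofReal.comp hT)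
  have hTn : ∀ x u, ‖Ψ u * ((T x u : ℝ) : ℂ)‖ ≤ B.indicator (fun _ => M * Λ) u := by
    intro x u
    by_cases hu : u ∈ B
    · rw [Set.indicator_of_mem hu, norm_mul, Complex.norm_real]
      exact mul_le_mul (hΨM u) (hTΛ x u) (norm_nonneg _) hM
    · rw [hΨB u hu, Set.indicator_of_notMem hu]; simp
  have hTi : Integrable (fun q : X × W => Ψ q.2 * ((T q.1 q.2 : ℝ) : ℂ)) (Q.prod κ) := by
    have h0 : Integrable (B.indicator fun _ => M * Λ) κ :=
      (integrable_indicator_iff hB).2 (integrableOn_const hBfin.ne)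
    have h1 : Integrable (fun q : X × W => B.indicator (fun _ => M * Λ) q.2) (Q.prod κ) :=
      h0.comp_snd Q
    exact h1.mono' mT.aestronglyMeasurable (Filter.Eventually.of_forall fun q => hTn q.1 q.2)
  have hTx : ∀ x, Integrable (fun u => Ψ u * ((T x u : ℝ) : ℂ)) κ := by
    intro x
    have h1 : Integrable (B.indicator fun _ => M * Λ) κ :=
      (integrable_indicator_iff hB).2 (integrableOn_const hBfin.ne)
    exact h1.mono' (mT.comp measurable_prodMk_left).aestronglyMeasurable
      (Filter.Eventually.of_forall (hTn x))
  set DA : X → ℂ := fun x => ∫ u, Ψ u * ((A x u : ℝ) : ℂ) ∂κ with hDA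
  set DT : X → ℂ := fun x => ∫ u, Ψ u * ((T x u : ℝ) : ℂ) ∂κ with hDT
  have sDA : StronglyMeasurable DA := mA.stronglyMeasurable.integral_prod_right'
  have sDT : StronglyMeasurable DT := mT.stronglyMeasurable.integral_prod_right'
  have hDTb : ∀ x, ‖DT x‖ ≤ M * Λ * v := by
    intro x
    have h1 : Integrable (B.indicator fun _ => M * Λ) κ :=
      (integrable_indicator_iff hB).2 (integrableOn_const hBfin.ne)
    refine (norm_integral_le_of_norm_le h1 (Filter.Eventually.of_forall (hTn x))).trans ?_
    rw [integral_indicator_const _ hB, smul_eq_mul, mul_comm]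
    gcongr
  have hDTi : Integrable DT Q := (integrable_const (M * Λ * v)).mono' sDT.aestronglyMeasurable
    (Filter.Eventually.of_forall hDTb)
  have hdiff : ∀ x ∈ S, ‖DA x - DT x‖ₑ ≤
      ENNReal.ofReal M * ∫⁻ u in B, ENNReal.ofReal |A x u - T x u| ∂κ := by
    intro x hx
    simp only [hDA, hDT]
    rw [← integral_sub (hAi x hx) (hTx x)]
    refine (enorm_integral_le_lintegral_enorm _).trans ?_
    rw [← lintegral_const_mul' _ _ ENNReal.ofReal_ne_top, ← lintegral_indicator hB]
    refine lintegral_mono fun u => ?_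
    by_cases hu : u ∈ B
    · rw [Set.indicator_of_mem hu, ← mul_sub, ← Complex.ofReal_sub, enorm_mul,
        ← ofReal_norm, ← ofReal_norm, Complex.norm_real, Real.norm_eq_abs]
      gcongr
      exact hΨM u
    · rw [hΨB u hu, Set.indicator_of_notMem hu]; simp
  have hlint : ∫⁻ x in S, ‖DA x - DT x‖ₑ ∂Q ≤ ENNReal.ofReal (M * b) := by
    have h1 : ∀ᵐ x ∂(Q.restrict S), ‖DA x - DT x‖ₑ ≤
        ENNReal.ofReal M * ∫⁻ u in B, ENNReal.ofReal |A x u - T x u| ∂κ :=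
      (ae_restrict_iff' hS).2 (Filter.Eventually.of_forall hdiff)
    refine (lintegral_mono_ae h1).trans ?_
    rw [lintegral_const_mul' _ _ ENNReal.ofReal_ne_top, ENNReal.ofReal_mul hM]
    gcongr
  have hsubi : IntegrableOn (fun x => DA x - DT x) S Q :=
    ⟨(sDA.sub sDT).aestronglyMeasurable, hlint.trans_lt ENNReal.ofReal_lt_top⟩
  have hDAi : IntegrableOn DA S Q := by
    have := hsubi.add hDTi.integrableOn
    refine this.congr (Filter.Eventually.of_forall fun x => ?_)
    simp
  have hinner : ∀ u, ∫ x, Ψ u * ((T x u : ℝ) : ℂ) ∂Q = Ψ u * ((∫ x, T x u ∂Q : ℝ) : ℂ) := by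
    intro u
    rw [integral_const_mul, integral_complex_ofReal]
  refine ⟨hDAi, hTi.integral_prod_right.congr (Filter.Eventually.of_forall hinner), ?_⟩
  have hswap : ∫ u, Ψ u * ((∫ x, T x u ∂Q : ℝ) : ℂ) ∂κ = ∫ x, DT x ∂Q := by
    have h1 := integral_integral_swap (f := fun x u => Ψ u * ((T x u : ℝ) : ℂ)) hTi
    simp only [hDT]
    rw [h1]
    congr 1
    funext u
    exact (hinner u).symm
  have hsplit := integral_add_compl hS hDTi
  rw [hswap, ← hsplit]
  have h1 : ‖∫ x in S, (DA x - DT x) ∂Q‖ ≤ M * b := by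
    have h2 := (enorm_integral_le_lintegral_enorm (μ := Q.restrict S) fun x => DA x - DT x).trans hlint
    rw [← ofReal_norm] at h2
    exact (ENNReal.ofReal_le_ofReal_iff (by positivity)).1 h2
  rw [integral_sub hDAi hDTi.integrableOn] at h1
  -- Off S nothing is known about A, but only the bounded T is integrated there.
  have h2 : ‖∫ x in Sᶜ, DT x ∂Q‖ ≤ M * Λ * v * p := by
    refine (norm_setIntegral_le_of_norm_le_const (measure_lt_top Q _) fun x _ => hDTb x).trans ?_
    gcongr
  calc _ = ‖(∫ x in S, DA x ∂Q - ∫ x in S, DT x ∂Q) - ∫ x in Sᶜ, DT x ∂Q‖ := by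
        congr 1; ring
    _ ≤ _ := (norm_sub_le _ _).trans (add_le_add h1 h2)

theorem norm_integral_mul_sub_integral_mul_le {W : Type*} [MeasurableSpace W] (κ : Measure W)
    {B : Set W} (hB : MeasurableSet B) {Ψ : W → ℂ} {M v e : ℝ} (hM : 0 ≤ M) (hv : 0 ≤ v)
    (he : 0 ≤ e) (hΨM : ∀ u, ‖Ψ u‖ ≤ M) (hΨB : ∀ u, u ∉ B → Ψ u = 0)
    (hBv : κ B ≤ ENNReal.ofReal v) {s t : W → ℝ} (hs : Integrable (fun u => Ψ u * ((s u : ℝ) : ℂ)) κ)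
    (ht : Integrable (fun u => Ψ u * ((t u : ℝ) : ℂ)) κ) (hst : ∀ u ∈ B, |s u - t u| ≤ e) :
    ‖∫ u, Ψ u * ((s u : ℝ) : ℂ) ∂κ - ∫ u, Ψ u * ((t u : ℝ) : ℂ) ∂κ‖ ≤ M * e * v := by
  have hBfin : κ B < ∞ := hBv.trans_lt ENNReal.ofReal_lt_top
  have hBr : κ.real B ≤ v := ENNReal.toReal_le_of_le_ofReal hv hBv
  rw [← integral_sub hs ht]
  have h1 : Integrable (B.indicator fun _ => M * e) κ :=
    (integrable_indicator_iff hB).2 (integrableOn_const hBfin.ne)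
  refine (norm_integral_le_of_norm_le h1 (Filter.Eventually.of_forall fun u => ?_)).trans ?_
  · by_cases hu : u ∈ B
    · rw [Set.indicator_of_mem hu, ← mul_sub, ← Complex.ofReal_sub, norm_mul, Complex.norm_real]
      exact mul_le_mul (hΨM u) (hst u hu) (norm_nonneg _) hM
    · rw [hΨB u hu, Set.indicator_of_notMem hu]; simp
  · rw [integral_indicator_const _ hB, smul_eq_mul, mul_comm]
    gcongr

/-! The tilted polynomial and Green's formula. -/

theorem rescaledElliptic_ne_zero_of_mem {n : ℕ} {z : ℂ} {x : Fin (n + 1) → ℂ}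
    (hx : x ∈ ellipticGood n z) : rescaledElliptic n x ≠ 0 := by
  intro h0
  have h1 : Real.exp (-n) < ‖ellipticForm n z z x‖ := hx
  rw [ellipticForm_eq, h0] at h1
  simp only [Polynomial.eval_zero, zero_mul, norm_zero] at h1
  exact absurd h1 (not_lt.2 (Real.exp_nonneg _))

theorem ae_log_norm_ellipticForm {n : ℕ} {x : Fin (n + 1) → ℂ} (hp : rescaledElliptic n x ≠ 0)
    (z : ℂ) : (fun u => Real.log ‖(rescaledElliptic n x).eval u‖ - ellipticTilt n z u) =ᵐ[volume]
      fun u => Real.log ‖ellipticForm n z u x‖ := by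
  obtain ⟨r, hr⟩ := exists_roots_enum (rescaledElliptic n x)
  filter_upwards [ae_forall_ne r] with u hu
  rw [log_norm_ellipticForm]
  rw [eval_eq_prod_roots hr]
  exact mul_ne_zero (by simpa using hp)
    (Finset.prod_ne_zero_iff.2 fun i _ => sub_ne_zero.2 (hu i))

theorem locallyIntegrable_log_norm_ellipticForm {n : ℕ} {x : Fin (n + 1) → ℂ}
    (hp : rescaledElliptic n x ≠ 0) (z : ℂ) :
    LocallyIntegrable fun u => Real.log ‖ellipticForm n z u x‖ := by
  obtain ⟨r, hr⟩ := exists_roots_enum (rescaledElliptic n x)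
  have h1 : Continuous fun u => ellipticTilt n z u := by unfold ellipticTilt; fun_prop
  exact ((locallyIntegrable_log_norm_eval hp hr).sub h1.locallyIntegrable).congr
    (ae_log_norm_ellipticForm hp z)

theorem integral_lap_mul_log_norm_ellipticForm {n : ℕ} {x : Fin (n + 1) → ℂ}
    (hp : rescaledElliptic n x ≠ 0) {d : ℕ} {r : Fin d → ℂ}
    (hr : (rescaledElliptic n x).roots = Finset.univ.val.map r) (z : ℂ) {h : ℂ → ℂ}
    (hh : ContDiff ℝ (⊤ : ℕ∞) h) (hc : HasCompactSupport h) :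
    ∫ u, lap h u * ((Real.log ‖ellipticForm n z u x‖ : ℝ) : ℂ) = 2 * Real.pi * ∑ i, h (r i) := by
  obtain ⟨c, b, hcb⟩ := ellipticTilt_affine n z
  rw [← integral_lap_mul_log_norm_eval hh hc hp hr c b]
  refine integral_congr_ae ?_
  filter_upwards [ae_log_norm_ellipticForm hp z] with u hu
  rw [← hu, hcb]

/-- Green's formula for statistics of tuples of zeros. -/
theorem integral_lapList_mul_prod_log_norm_ellipticForm {n m : ℕ} {x : Fin (n + 1) → ℂ}
    (hp : rescaledElliptic n x ≠ 0) {d : ℕ} {r : Fin d → ℂ}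
    (hr : (rescaledElliptic n x).roots = Finset.univ.val.map r) (c : Fin m → ℂ)
    {H : (Fin m → ℂ) → ℂ} (hH : ContDiff ℝ (⊤ : ℕ∞) H) (hc : HasCompactSupport H) :
    ∫ u, lapList (List.finRange m) H u *
        ((∏ q, Real.log ‖ellipticForm n (c q) (u q) x‖ : ℝ) : ℂ) =
      (2 * Real.pi) ^ m * ∑ e : Fin m → Fin d, H (fun j => r (e j)) :=
  integral_lapList_mul_prod r (2 * Real.pi) m
    (fun q u => Real.log ‖ellipticForm n (c q) u x‖)
    (fun q => locallyIntegrable_log_norm_ellipticForm hp (c q))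
    (fun q _ hh hc => integral_lap_mul_log_norm_ellipticForm hp hr (c q) hh hc) H hH hc

/-! ### Comparison of the two laws, with exponents in n. -/

/-- Two powers are summed by the bounded variance; the extra power ε is estimated by the largest
coefficient and provides the gain. -/
theorem sum_rpow_le_of_sum_sq_le {N : ℕ} {α : Fin N → ℝ} (hα : ∀ i, 0 ≤ α i) {τ A ε d : ℝ}
    (hd : 0 < d) (hε : 0 < ε) (hτ : 0 ≤ τ) (hατ : ∀ i, α i ≤ τ) (hA : ∑ i, α i ^ 2 ≤ A) :
    ∑ i, (α i / d) ^ (2 + ε) ≤ A / d ^ 2 * (τ / d) ^ ε := by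
  have h1 : ∀ i, (α i / d) ^ (2 + ε) ≤ α i ^ 2 / d ^ 2 * (τ / d) ^ ε := by
    intro i
    have h0 : 0 ≤ α i / d := div_nonneg (hα i) hd.le
    rw [Real.rpow_add_of_nonneg h0 (by norm_num) hε.le, Real.rpow_two, div_pow]
    gcongr
    exact hατ i
  refine (Finset.sum_le_sum fun i _ => h1 i).trans ?_
  rw [← Finset.sum_mul, ← Finset.sum_div]
  gcongr

theorem sum_sq_sum_norm_le {m N : ℕ} {a : Fin m → Fin N → ℂ} {K : ℝ}
    (ha : ∀ q, ∑ i, ‖a q i‖ ^ 2 ≤ K) : ∑ i, (∑ q, ‖a q i‖) ^ 2 ≤ m ^ 2 * K := by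
  have h1 : ∀ i, (∑ q, ‖a q i‖) ^ 2 ≤ m * ∑ q, ‖a q i‖ ^ 2 := by
    intro i
    have := sq_sum_le_card_mul_sum_sq (s := Finset.univ) (f := fun q => ‖a q i‖)
    simpa using this
  refine (Finset.sum_le_sum fun i _ => h1 i).trans ?_
  rw [← Finset.mul_sum, Finset.sum_comm, sq, mul_assoc]
  gcongr
  refine (Finset.sum_le_sum fun q _ => ha q).trans ?_
  simp

theorem eventually_log_pow_le {γ : ℝ} (hγ : 0 < γ) {m : ℕ} (hm : m ≠ 0) :
    ∀ᶠ n : ℕ in Filter.atTop, (1 + Real.log (((n : ℝ) ^ (-γ)) ^ 2)⁻¹) ^ m ≤ (n : ℝ) ^ γ := by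
  have hm0 : (0 : ℝ) < m := by exact_mod_cast Nat.pos_of_ne_zero hm
  filter_upwards [eventually_mul_log_le_rpow (β := γ / (2 * m)) (by positivity) (2 * γ),
    eventually_le_natCast_rpow (β := γ / (2 * m)) (by positivity) 2,
    Filter.eventually_ge_atTop 1] with n h1 h2 hn
  have hn1 : (1 : ℝ) ≤ n := by exact_mod_cast hn
  have hn0 : (0 : ℝ) < n := by linarith
  have hlog : Real.log (((n : ℝ) ^ (-γ)) ^ 2)⁻¹ = 2 * γ * Real.log n := by
    rw [Real.log_inv, Real.log_pow, Real.log_rpow hn0]; push_cast; ring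
  rw [hlog]
  have h3 : 1 + 2 * γ * Real.log n ≤ ((n : ℝ) ^ (γ / (2 * m))) ^ 2 := by nlinarith
  have h4 : 0 ≤ Real.log n := Real.log_nonneg hn1
  calc _ ≤ (((n : ℝ) ^ (γ / (2 * m))) ^ 2) ^ m := by gcongr
    _ = (n : ℝ) ^ γ := by
      rw [← pow_mul, ← Real.rpow_natCast, ← Real.rpow_mul hn0.le]
      congr 1
      push_cast
      field_simp

/-- Comparison of the two expectations of a product of truncated logarithms. -/
theorem exists_integral_prod_truncLog_sub_le {ε C : ℝ} (hε : 0 < ε) (hε1 : ε ≤ 1) (hC : 0 < C)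
    (C₁ : ℝ) {γ : ℝ} (hγ : γ = ε ^ 2 / 24) {m : ℕ} (hm : m ≠ 0) :
    ∃ K : ℝ, 0 < K ∧ ∀ᶠ n : ℕ in Filter.atTop, ∀ c u : Fin m → ℂ, (∀ q, (n : ℝ) ^ ε ≤ ‖c q‖ ∧
      ‖c q‖ ≤ C * Real.sqrt n) → (∀ q, ‖u q - c q‖ ≤ C) → ∀ μ ν : Measure ℂ, UnitLaw ε C₁ μ →
      UnitLaw ε C₁ ν → SameMoments μ ν →
        |∫ x, ∏ q, truncLog (((n : ℝ) ^ (-γ)) ^ 2) (ellipticForm n (c q) (u q) x)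
            ∂(Measure.pi fun _ => μ) -
          ∫ x, ∏ q, truncLog (((n : ℝ) ^ (-γ)) ^ 2) (ellipticForm n (c q) (u q) x)
            ∂(Measure.pi fun _ => ν)| ≤ K * (n : ℝ) ^ (-(γ / 12)) := by
  have hγ0 : 0 < γ := by rw [hγ]; positivity
  obtain ⟨K₁, hK₁, hlin⟩ := exists_lindeberg_bound m
  obtain ⟨K₂, hK₂, hco⟩ := exists_ellipticCoeff_bounds hε hC
  have hm1 : (1 : ℝ) ≤ m := by exact_mod_cast Nat.one_le_iff_ne_zero.2 hm
  set τ₀ := m * K₂ with hτ₀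
  have hτ₀1 : 1 ≤ τ₀ := by nlinarith
  have hmax : 0 ≤ max C₁ 0 := le_max_right _ _
  refine ⟨K₁ * (max C₁ 0) * (m ^ 2 * K₂ * τ₀ ^ ε) + 1, by positivity, ?_⟩
  filter_upwards [hco, eventually_log_pow_le hγ0 hm, Filter.eventually_ge_atTop 1] with
    n hcn hlog hn c u hc hu μ ν hμ hν hmn
  have hn1 : (1 : ℝ) ≤ n := by exact_mod_cast hn
  have hn0 : (0 : ℝ) < n := by linarith
  set d := ((n : ℝ) ^ (-γ)) ^ 2 with hd
  have hd0 : 0 < d := by positivity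
  have hd1 : d ≤ 1 := pow_le_one₀ (by positivity)
    (Real.rpow_le_one_of_one_le_of_nonpos hn1 (by linarith))
  have hdn : d = (n : ℝ) ^ (-(2 * γ)) := by
    rw [hd, ← Real.rpow_natCast, ← Real.rpow_mul hn0.le]; congr 1; push_cast; ring
  have hb := fun q => hcn (c q) (u q) (hc q).1 (hc q).2 (hu q)
  set a : Fin m → Fin (n + 1) → ℂ := fun q i => ellipticCoeff n (c q) (u q) i with ha
  -- The i-th variable enters all m forms at once, so αᵢ must bound its coefficient in each; the sum
  -- over q does, with only constants lost.
  have hα0 : ∀ i, 0 ≤ ∑ q, ‖a q i‖ := fun i => Finset.sum_nonneg fun q _ => norm_nonneg _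
  have hαle : ∀ q i, ‖a q i‖ ≤ ∑ q, ‖a q i‖ := fun q i =>
    Finset.single_le_sum (f := fun q => ‖a q i‖) (fun _ _ => norm_nonneg _) (Finset.mem_univ q)
  have hατ : ∀ i, ∑ q, ‖a q i‖ ≤ τ₀ * (n : ℝ) ^ (-(ε / 2)) := by
    intro i
    refine (Finset.sum_le_sum fun q _ => (hb q).2.2 i).trans ?_
    simp [hτ₀, mul_assoc]
  have hmain := hlin ε C₁ hε hε1 μ ν hμ hν hmn d hd0 hd1 (n + 1) 0 a (fun i => ∑ q, ‖a q i‖)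
    hα0 hαle
  have hcast : ∀ ρ : Measure (Fin (n + 1) → ℂ), ∫ x, truncLogProd d 0 a x ∂ρ =
      ((∫ x, ∏ q, truncLog d (ellipticForm n (c q) (u q) x) ∂ρ : ℝ) : ℂ) := by
    intro ρ
    rw [← integral_complex_ofReal]
    refine integral_congr_ae (Filter.Eventually.of_forall fun x => ?_)
    simp [truncLogProd, ellipticForm, ha]
  rw [hcast, hcast, ← Complex.ofReal_sub, Complex.norm_real, Real.norm_eq_abs] at hmain
  refine hmain.trans ?_
  have hsum := sum_rpow_le_of_sum_sq_le hα0 hd0 hε (by positivity) hατ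
    (sum_sq_sum_norm_le fun q => (hb q).2.1)
  have hlog0 : 0 ≤ Real.log d⁻¹ := Real.log_nonneg ((one_le_inv₀ hd0).2 hd1)
  -- The source of γ = ε²/24. The exponent is 4γ + 2γε - ε²/2 with ε²/2 = 12γ, so it is at most -6γ
  -- when ε ≤ 1. The logarithmic factors afterwards cost only n^γ.
  have hpow : (m ^ 2 * K₂) / d ^ 2 * (τ₀ * (n : ℝ) ^ (-(ε / 2)) / d) ^ ε ≤
      (m ^ 2 * K₂ * τ₀ ^ ε) * (n : ℝ) ^ (-(6 * γ)) := by
    have e1 : τ₀ * (n : ℝ) ^ (-(ε / 2)) / d = τ₀ * (n : ℝ) ^ (-(ε / 2) + 2 * γ) := by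
      rw [hdn, Real.rpow_neg hn0.le (2 * γ), div_inv_eq_mul, mul_assoc, ← Real.rpow_add hn0]
    have e2 : (m ^ 2 * K₂) / d ^ 2 = (m ^ 2 * K₂) * (n : ℝ) ^ (4 * γ) := by
      rw [hdn, ← Real.rpow_natCast ((n : ℝ) ^ (-(2 * γ))), ← Real.rpow_mul hn0.le, div_eq_mul_inv,
        ← Real.rpow_neg hn0.le]
      congr 2; push_cast; ring
    rw [e1, e2, Real.mul_rpow (by positivity) (by positivity), ← Real.rpow_mul hn0.le]
    have e3 : (m ^ 2 * K₂) * (n : ℝ) ^ (4 * γ) * (τ₀ ^ ε * (n : ℝ) ^ ((-(ε / 2) + 2 * γ) * ε)) =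
        (m ^ 2 * K₂ * τ₀ ^ ε) * (n : ℝ) ^ (4 * γ + (-(ε / 2) + 2 * γ) * ε) := by
      rw [Real.rpow_add hn0]; ring
    rw [e3]
    refine mul_le_mul_of_nonneg_left (Real.rpow_le_rpow_of_exponent_le hn1 ?_) (by positivity)
    nlinarith
  calc _ ≤ K₁ * (n : ℝ) ^ γ * max C₁ 0 * ((m ^ 2 * K₂ * τ₀ ^ ε) * (n : ℝ) ^ (-(6 * γ))) := by
        gcongr
        exact hsum.trans hpow
    _ = K₁ * max C₁ 0 * (m ^ 2 * K₂ * τ₀ ^ ε) * (n : ℝ) ^ (γ + -(6 * γ)) := by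
        rw [Real.rpow_add hn0]; ring
    _ ≤ (K₁ * max C₁ 0 * (m ^ 2 * K₂ * τ₀ ^ ε) + 1) * (n : ℝ) ^ (-(γ / 12)) := by
        refine mul_le_mul (by linarith) (Real.rpow_le_rpow_of_exponent_le hn1 (by linarith))
          (by positivity) (by positivity)

/-- Comparison of a weighted integral under two laws, through a truncation. -/
theorem norm_setIntegral_sub_setIntegral_le {X W : Type*} [MeasurableSpace X] [MeasurableSpace W]
    (Q Q' : Measure X) [IsProbabilityMeasure Q] [IsProbabilityMeasure Q'] (κ : Measure W)
    [SigmaFinite κ] {S : Set X} (hS : MeasurableSet S) {B : Set W} (hB : MeasurableSet B)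
    {Ψ : W → ℂ} (hΨ : Measurable Ψ) {M Λ v b p e : ℝ} (hM : 0 ≤ M) (hΛ : 0 ≤ Λ) (hv : 0 ≤ v)
    (hb : 0 ≤ b) (he : 0 ≤ e) (hΨM : ∀ u, ‖Ψ u‖ ≤ M) (hΨB : ∀ u, u ∉ B → Ψ u = 0)
    (hBv : κ B ≤ ENNReal.ofReal v) {A T : X → W → ℝ}
    (hA : Measurable fun q : X × W => A q.1 q.2) (hT : Measurable fun q : X × W => T q.1 q.2)
    (hTΛ : ∀ x u, |T x u| ≤ Λ) (hp : Q.real Sᶜ ≤ p) (hp' : Q'.real Sᶜ ≤ p)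
    (hAi : ∀ x ∈ S, Integrable (fun u => Ψ u * ((A x u : ℝ) : ℂ)) κ)
    (hd : ∫⁻ x in S, (∫⁻ u in B, ENNReal.ofReal |A x u - T x u| ∂κ) ∂Q ≤ ENNReal.ofReal b)
    (hd' : ∫⁻ x in S, (∫⁻ u in B, ENNReal.ofReal |A x u - T x u| ∂κ) ∂Q' ≤ ENNReal.ofReal b)
    (hst : ∀ u ∈ B, |∫ x, T x u ∂Q - ∫ x, T x u ∂Q'| ≤ e) :
    IntegrableOn (fun x => ∫ u, Ψ u * ((A x u : ℝ) : ℂ) ∂κ) S Q ∧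
      IntegrableOn (fun x => ∫ u, Ψ u * ((A x u : ℝ) : ℂ) ∂κ) S Q' ∧
      ‖∫ x in S, (∫ u, Ψ u * ((A x u : ℝ) : ℂ) ∂κ) ∂Q -
        ∫ x in S, (∫ u, Ψ u * ((A x u : ℝ) : ℂ) ∂κ) ∂Q'‖ ≤
          2 * (M * b + M * Λ * v * p) + M * e * v := by
  obtain ⟨i₁, t₁, b₁⟩ :=
    norm_setIntegral_sub_integral_le Q κ hS hB hΨ hM hΛ hv hb hΨM hΨB hBv hA hT hTΛ hp hAi hd
  obtain ⟨i₂, t₂, b₂⟩ :=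
    norm_setIntegral_sub_integral_le Q' κ hS hB hΨ hM hΛ hv hb hΨM hΨB hBv hA hT hTΛ hp' hAi hd'
  refine ⟨i₁, i₂, ?_⟩
  have hmid := norm_integral_mul_sub_integral_mul_le κ hB hM hv he hΨM hΨB hBv t₁ t₂ hst
  have htri : ∀ a b s t : ℂ, ‖a - b‖ ≤ ‖a - s‖ + ‖s - t‖ + ‖b - t‖ := by
    intro a b s t
    calc _ = ‖(a - s) + (s - t) - (b - t)‖ := by congr 1; ring
      _ ≤ _ := (norm_sub_le _ _).trans (by gcongr; exact norm_add_le _ _)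
  refine (htri _ _ _ _).trans ((add_le_add (add_le_add b₁ hmid) b₂).trans ?_)
  linarith

theorem measurable_comp_pair {X A B D : Type*} [MeasurableSpace X] [MeasurableSpace A]
    [MeasurableSpace B] [MeasurableSpace D] {F : A → B → D}
    (hF : Measurable fun p : A × B => F p.1 p.2) {f : X → A} {g : X → B} (hf : Measurable f)
    (hg : Measurable g) : Measurable fun p => F (f p) (g p) :=
  hF.comp (hf.prodMk hg)

theorem measurable_ellipticForm_comp {X : Type*} [MeasurableSpace X] (n : ℕ) (z : ℂ)
    {f : X → Fin (n + 1) → ℂ} {g : X → ℂ} (hf : Measurable f) (hg : Measurable g) :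
    Measurable fun p => ellipticForm n z (g p) (f p) :=
  measurable_comp_pair (F := fun x u => ellipticForm n z u x) (measurable_ellipticForm n z) hf hg

theorem measurable_prod_comp {X Y : Type*} [MeasurableSpace X] [MeasurableSpace Y] {m : ℕ}
    {g : Y → ℝ} (hg : Measurable g) {f : Fin m → X → Y} (hf : ∀ q, Measurable (f q)) :
    Measurable fun p => ∏ q, g (f q p) :=
  Finset.measurable_prod _ fun q _ => hg.comp (hf q)

/-- Comparison of the two expectations of a statistic of tuples of zeros, off a small event. -/
theorem exists_setIntegral_sub_setIntegral_le {ε C : ℝ} (hε : 0 < ε) (hε1 : ε ≤ 1) (hC : 0 < C)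
    (C₁ : ℝ) {γ : ℝ} (hγ : γ = ε ^ 2 / 24) {m : ℕ} (hm : m ≠ 0) :
    ∃ K : ℝ, 0 < K ∧ ∀ᶠ n : ℕ in Filter.atTop, ∀ c : Fin m → ℂ, (∀ q, (n : ℝ) ^ ε ≤ ‖c q‖ ∧
      ‖c q‖ ≤ C * Real.sqrt n) → ∀ μ ν : Measure ℂ, UnitLaw ε C₁ μ →
      UnitLaw ε C₁ ν → SameMoments μ ν → ∀ S : Set (Fin (n + 1) → ℂ), MeasurableSet S →
      (∀ q, S ⊆ ellipticGood n (c q)) → (Measure.pi fun _ => μ).real Sᶜ ≤ (n : ℝ) ^ (-1 : ℝ) →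
      (Measure.pi fun _ => ν).real Sᶜ ≤ (n : ℝ) ^ (-1 : ℝ) →
      ∀ Ψ : (Fin m → ℂ) → ℂ, Continuous Ψ → HasCompactSupport Ψ →
      (∀ u, u ∉ Set.univ.pi (fun q => Metric.closedBall (c q) C) → Ψ u = 0) →
      ∀ M : ℝ, 0 ≤ M → (∀ u, ‖Ψ u‖ ≤ M) →
      IntegrableOn (fun x => ∫ u, Ψ u *
        ((∏ q, Real.log ‖ellipticForm n (c q) (u q) x‖ : ℝ) : ℂ)) S (Measure.pi fun _ => μ) ∧
      IntegrableOn (fun x => ∫ u, Ψ u *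
        ((∏ q, Real.log ‖ellipticForm n (c q) (u q) x‖ : ℝ) : ℂ)) S (Measure.pi fun _ => ν) ∧
      ‖∫ x in S, (∫ u, Ψ u * ((∏ q, Real.log ‖ellipticForm n (c q) (u q) x‖ : ℝ) : ℂ))
          ∂(Measure.pi fun _ => μ) -
        ∫ x in S, (∫ u, Ψ u * ((∏ q, Real.log ‖ellipticForm n (c q) (u q) x‖ : ℝ) : ℂ))
          ∂(Measure.pi fun _ => ν)‖ ≤ K * M * (n : ℝ) ^ (-(γ / 12)) := by
  have hγ0 : 0 < γ := by rw [hγ]; positivity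
  have hγ1 : γ ≤ 1 / 24 := by rw [hγ]; nlinarith
  have hγε : 3 * γ ≤ ε := by rw [hγ]; nlinarith
  obtain ⟨K₁, hK₁, h1⟩ := exists_prod_log_sub_le hε hε1 hC C₁ hγ0 hγε hm
  obtain ⟨K₂, hK₂, h2⟩ := exists_integral_prod_truncLog_sub_le hε hε1 hC C₁ hγ hm
  set v := (1 + (volume (Metric.closedBall (0 : ℂ) C)).toReal) ^ m with hv
  have hv0 : 0 ≤ v := by
    have : 0 ≤ (volume (Metric.closedBall (0 : ℂ) C)).toReal := ENNReal.toReal_nonneg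
    positivity
  refine ⟨2 * (K₁ + v) + K₂ * v, by positivity, ?_⟩
  filter_upwards [h1, h2, eventually_log_pow_le hγ0 hm, Filter.eventually_ge_atTop 1] with
    n hn1 hn2 hlog hn c hc μ ν hμ hν hmn S hS hSg hSμ hSν Ψ hΨ hΨc hΨB M hM hΨM
  have hn1' : (1 : ℝ) ≤ n := by exact_mod_cast hn
  have hn0 : (0 : ℝ) < n := by linarith
  have := hμ.prob
  have := hν.prob
  set d := ((n : ℝ) ^ (-γ)) ^ 2 with hd
  have hd0 : 0 < d := by positivity
  have hd1 : d ≤ 1 := pow_le_one₀ (by positivity)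
    (Real.rpow_le_one_of_one_le_of_nonpos hn1' (by linarith))
  have hlog0 : 0 ≤ Real.log d⁻¹ := Real.log_nonneg ((one_le_inv₀ hd0).2 hd1)
  have hBm : MeasurableSet (Set.univ.pi (fun q => Metric.closedBall (c q) C)) :=
    MeasurableSet.univ_pi fun q => measurableSet_closedBall
  have hform : ∀ q, Measurable fun p : (Fin (n + 1) → ℂ) × (Fin m → ℂ) =>
      ellipticForm n (c q) (p.2 q) p.1 := fun q =>
    measurable_ellipticForm_comp n (c q) measurable_fst
      ((measurable_pi_apply q).comp measurable_snd)
  have hA := measurable_prod_comp Real.measurable_log fun q => (hform q).norm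
  have hT := measurable_prod_comp (continuous_truncLog hd0).measurable hform
  have hTΛ : ∀ (x : Fin (n + 1) → ℂ) (u : Fin m → ℂ),
      |∏ q, truncLog d (ellipticForm n (c q) (u q) x)| ≤ Real.log d⁻¹ ^ m := by
    intro x u
    rw [Finset.abs_prod]
    refine (Finset.prod_le_prod (fun _ _ => abs_nonneg _)
      fun q _ => abs_truncLog_le hd0 hd1 _).trans ?_
    simp
  have hAi : ∀ x ∈ S, Integrable (fun u => Ψ u *
      ((∏ q, Real.log ‖ellipticForm n (c q) (u q) x‖ : ℝ) : ℂ)) := by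
    intro x hx
    exact integrable_mul_prod hΨ hΨc (ℓ := fun q u => Real.log ‖ellipticForm n (c q) u x‖)
      fun q => locallyIntegrable_log_norm_ellipticForm
        (rescaledElliptic_ne_zero_of_mem (hSg q hx)) (c q)
  have hmid : ∀ u ∈ Set.univ.pi (fun q => Metric.closedBall (c q) C),
      |∫ x, ∏ q, truncLog d (ellipticForm n (c q) (u q) x) ∂(Measure.pi fun _ => μ) -
        ∫ x, ∏ q, truncLog d (ellipticForm n (c q) (u q) x) ∂(Measure.pi fun _ => ν)| ≤
        K₂ * (n : ℝ) ^ (-(γ / 12)) := by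
    intro u hu
    refine hn2 c u hc (fun q => ?_) μ ν hμ hν hmn
    have := hu q (Set.mem_univ q)
    rwa [Metric.mem_closedBall, dist_eq_norm] at this
  obtain ⟨iμ, iν, hbd⟩ := norm_setIntegral_sub_setIntegral_le (Measure.pi fun _ => μ)
    (Measure.pi fun _ => ν) volume hS hBm hΨ.measurable hM (Λ := Real.log d⁻¹ ^ m)
    (pow_nonneg hlog0 m) hv0 (b := K₁ * (n : ℝ) ^ (-(γ / 12))) (e := K₂ * (n : ℝ) ^ (-(γ / 12)))
    (by positivity) (by positivity) hΨM hΨB (volume_pi_closedBall_le c C)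
    (A := fun x u => ∏ q, Real.log ‖ellipticForm n (c q) (u q) x‖)
    (T := fun x u => ∏ q, truncLog d (ellipticForm n (c q) (u q) x))
    hA hT hTΛ hSμ hSν hAi (hn1 c hc μ hμ S hSg) (hn1 c hc ν hν S hSg) hmid
  refine ⟨iμ, iν, hbd.trans ?_⟩
  -- The complement of S has probability at most 1/n, and the truncated product is at most n^γ
  -- there.
  have hΛ : Real.log d⁻¹ ^ m * (n : ℝ) ^ (-1 : ℝ) ≤ (n : ℝ) ^ (-(γ / 12)) := by
    calc _ ≤ (n : ℝ) ^ γ * (n : ℝ) ^ (-1 : ℝ) := by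
          gcongr
          refine le_trans ?_ hlog
          gcongr
          linarith
      _ = (n : ℝ) ^ (γ + -1) := (Real.rpow_add hn0 _ _).symm
      _ ≤ _ := Real.rpow_le_rpow_of_exponent_le hn1' (by linarith)
  have := mul_le_mul_of_nonneg_left hΛ (mul_nonneg hM hv0)
  linarith

/-! Statistics of tuples of zeros. -/

/-- The sum of `φ` over the `k`-tuples of zeros of `p` with distinct indices. -/
noncomputable def zeroStat (k : ℕ) (φ : (Fin k → ℂ) → ℂ) (p : Polynomial ℂ) : ℂ :=
  ∑ e : Fin k ↪ p.roots, φ (fun j => (e j : ℂ))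

theorem integral_zeroTupleMeasure (k : ℕ) (φ : (Fin k → ℂ) → ℂ) (p : Polynomial ℂ) :
    ∫ u, φ u ∂(zeroTupleMeasure k p) = zeroStat k φ p := by
  unfold zeroTupleMeasure zeroStat
  rw [integral_finsetSum_measure fun e _ => integrable_dirac (by simp)]
  simp

theorem zeroStat_eq {d : ℕ} (k : ℕ) (φ : (Fin k → ℂ) → ℂ) {p : Polynomial ℂ} {r : Fin d → ℂ}
    (h : p.roots = Finset.univ.val.map r) :
    zeroStat k φ p = ∑ e : Fin k ↪ Fin d, φ (fun j => r (e j)) := by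
  rw [← integral_zeroTupleMeasure, zeroTupleMeasure_eq k p r h,
    integral_finsetSum_measure fun e _ => integrable_dirac (by simp)]
  simp

theorem norm_zeroStat_le {n k : ℕ} {φ : (Fin k → ℂ) → ℂ} {M : ℝ} (hM : 0 ≤ M)
    (hφ : ∀ u, ‖φ u‖ ≤ M) {p : Polynomial ℂ} (hp : p.natDegree ≤ n) :
    ‖zeroStat k φ p‖ ≤ M * (n : ℝ) ^ k := by
  unfold zeroStat
  refine (norm_sum_le_of_le _ fun e _ => hφ _).trans ?_
  simp only [Finset.sum_const, nsmul_eq_mul, Finset.card_univ, Fintype.card_embedding_eq,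
    Multiset.card_coe, Fintype.card_fin]
  rw [mul_comm]
  gcongr
  exact_mod_cast (Nat.descFactorial_le_pow _ _).trans
    (Nat.pow_le_pow_left ((Polynomial.card_roots' _).trans hp) _)

theorem stronglyMeasurable_zeroStat_rescaledElliptic (n k : ℕ) {φ : (Fin k → ℂ) → ℂ}
    (hφ : Continuous φ) : StronglyMeasurable fun x => zeroStat k φ (rescaledElliptic n x) := by
  let κ : Kernel (Fin (n + 1) → ℂ) (Fin k → ℂ) :=
    ⟨fun a => zeroTupleMeasure k (∑ i : Fin (n + 1), Polynomial.monomial (i : ℕ) (a i)),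
      measurable_zeroTupleMeasure n k⟩
  have h1 : StronglyMeasurable fun a => ∫ u, φ u ∂(κ a) :=
    StronglyMeasurable.integral_kernel hφ.stronglyMeasurable
  have h2 : Measurable fun (x : Fin (n + 1) → ℂ) (i : Fin (n + 1)) =>
      ((Real.sqrt ((n.choose i : ℝ) * ((n : ℝ) ^ (i : ℕ))⁻¹) : ℝ) : ℂ) * x i :=
    Continuous.measurable (by fun_prop)
  have h3 := h1.comp_measurable h2
  convert h3 using 1
  funext x
  exact (integral_zeroTupleMeasure k φ _).symm

/-- By independence the joint law of the coefficients is a power of the law of ξ. From here on only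
that law matters, and the underlying probability spaces disappear. -/
theorem integral_correlationMeasure_rescaledElliptic {Ω : Type*} [MeasurableSpace Ω]
    (P : Measure Ω) [IsProbabilityMeasure P] {n : ℕ} {ξ : Ω → ℂ} {X : Fin (n + 1) → Ω → ℂ}
    (h : IsIndepCopies P ξ X) {k : ℕ} {φ : (Fin k → ℂ) → ℂ} (hφ : Continuous φ)
    (hφc : HasCompactSupport φ) :
    ∫ u, φ u ∂(correlationMeasure P (fun ω => rescaledElliptic n (fun i => X i ω)) k) =
      ∫ x, zeroStat k φ (rescaledElliptic n x) ∂(Measure.pi fun _ => P.map ξ) := by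
  have hX : ∀ i, AEMeasurable (X i) P := fun i => (h.identDistrib i).aemeasurable_fst
  have hXX : AEMeasurable (fun ω i => X i ω) P := aemeasurable_pi_lambda _ hX
  have hmap : P.map (fun ω i => X i ω) = Measure.pi fun _ => P.map ξ := by
    rw [(iIndepFun_iff_map_fun_eq_pi_map hX).1 h.indep]
    congr 1
    funext i
    exact (h.identDistrib i).map_eq
  have hc : ∀ j, Continuous fun x : Fin (n + 1) → ℂ => (rescaledElliptic n x).coeff j := by
    intro j
    simp only [rescaledElliptic, Polynomial.finsetSum_coeff, Polynomial.coeff_monomial]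
    refine continuous_finsetSum _ fun i _ => ?_
    split_ifs <;> fun_prop
  rw [(integral_correlationMeasure P _ n k (fun ω => natDegree_rescaledElliptic_le n _)
    (fun j => (hc j).measurable.comp_aemeasurable hXX) φ hφ hφc).2, ← hmap,
    integral_map hXX (stronglyMeasurable_zeroStat_rescaledElliptic n k hφ).aestronglyMeasurable]
  rfl

/-- The exponent may be lowered, since t^(2+ε') ≤ 1 + t^(2+ε); this accounts for the moment bound 1
+ C. -/
theorem unitLaw_map {Ω : Type*} [MeasurableSpace Ω] (P : Measure Ω) [IsProbabilityMeasure P]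
    {ξ : Ω → ℂ} (hξ : AEMeasurable ξ P) (hmean : ∫ ω, ξ ω ∂P = 0)
    (hvar : ∫ ω, ‖ξ ω‖ ^ 2 ∂P = 1) {ε ε' C : ℝ} (hε' : 0 < ε') (hle : ε' ≤ ε) (hC : 0 ≤ C)
    (hmom : ∫⁻ ω, ‖ξ ω‖ₑ ^ (2 + ε) ∂P ≤ ENNReal.ofReal C) :
    UnitLaw ε' (1 + C) (P.map ξ) := by
  refine ⟨Measure.isProbabilityMeasure_map hξ, ?_, ?_, ?_⟩
  · rw [integral_map hξ (f := fun s : ℂ => s) (by fun_prop), hmean]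
  · rw [integral_map hξ (f := fun s : ℂ => ‖s‖ ^ 2)
      (Continuous.aestronglyMeasurable (by fun_prop)), hvar]
  · rw [lintegral_map' (by fun_prop) hξ]
    have h1 : ∀ t : ℝ≥0∞, t ^ (2 + ε') ≤ 1 + t ^ (2 + ε) := by
      intro t
      rcases le_or_gt t 1 with ht | ht
      · exact (ENNReal.rpow_le_one ht (by linarith)).trans le_self_add
      · exact (ENNReal.rpow_le_rpow_of_exponent_le ht.le (by linarith)).trans le_add_self
    refine (lintegral_mono fun ω => h1 ‖ξ ω‖ₑ).trans ?_
    rw [lintegral_add_left measurable_const, ENNReal.ofReal_add zero_le_one hC]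
    simpa using hmom

theorem sameMoments_map {Ω Ω' : Type*} [MeasurableSpace Ω] [MeasurableSpace Ω'] {P : Measure Ω}
    {P' : Measure Ω'} {ξ : Ω → ℂ} {ξ' : Ω' → ℂ} (hξ : AEMeasurable ξ P) (hξ' : AEMeasurable ξ' P')
    (h : MatchMoments P P' ξ ξ' 2) : SameMoments (P.map ξ) (P'.map ξ') := by
  intro a b hab
  have hc : Continuous fun s : ℂ => s.re ^ a * s.im ^ b := by fun_prop
  rw [integral_map hξ hc.aestronglyMeasurable, integral_map hξ' hc.aestronglyMeasurable]
  exact h a b hab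

/-! ### Assembly of the comparison. -/

/-- Two laws can be compared through a decomposition that is valid off a small event. -/
theorem norm_integral_sub_integral_le_of_sum {X ι : Type*} [MeasurableSpace X] (Q Q' : Measure X)
    [IsProbabilityMeasure Q] [IsProbabilityMeasure Q'] {S : Set X} (hS : MeasurableSet S)
    {F : X → ℂ} (hF : StronglyMeasurable F) {B p : ℝ} (hB : 0 ≤ B) (hFB : ∀ x, ‖F x‖ ≤ B)
    (hp : Q.real Sᶜ ≤ p) (hp' : Q'.real Sᶜ ≤ p) (s : Finset ι) (c : ι → ℂ) (I : ι → X → ℂ)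
    (b : ι → ℝ) (hc : ∀ i, ‖c i‖ ≤ 1) (hFI : ∀ x ∈ S, F x = ∑ i ∈ s, c i * I i x)
    (hI : ∀ i, IntegrableOn (I i) S Q) (hI' : ∀ i, IntegrableOn (I i) S Q')
    (hb : ∀ i, ‖∫ x in S, I i x ∂Q - ∫ x in S, I i x ∂Q'‖ ≤ b i) :
    ‖∫ x, F x ∂Q - ∫ x, F x ∂Q'‖ ≤ ∑ i ∈ s, b i + 2 * (B * p) := by
  have hint : ∀ ρ : Measure X, IsProbabilityMeasure ρ → Integrable F ρ := fun ρ _ =>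
    (integrable_const B).mono' hF.aestronglyMeasurable (Filter.Eventually.of_forall hFB)
  have hout : ∀ ρ : Measure X, IsProbabilityMeasure ρ → ρ.real Sᶜ ≤ p →
      ‖∫ x in Sᶜ, F x ∂ρ‖ ≤ B * p := fun ρ _ hρ =>
    (norm_setIntegral_le_of_norm_le_const (measure_lt_top ρ _) fun x _ => hFB x).trans (by gcongr)
  have hin : ∀ ρ : Measure X, (∀ i, IntegrableOn (I i) S ρ) →
      ∫ x in S, F x ∂ρ = ∑ i ∈ s, c i * ∫ x in S, I i x ∂ρ := by
    intro ρ hρ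
    rw [setIntegral_congr_fun hS hFI, integral_finsetSum _ fun i _ => (hρ i).const_mul (c i)]
    exact Finset.sum_congr rfl fun i _ => integral_const_mul _ _
  rw [← integral_add_compl hS (hint Q inferInstance),
    ← integral_add_compl hS (hint Q' inferInstance), hin Q hI, hin Q' hI']
  have hsum : ‖∑ i ∈ s, c i * ∫ x in S, I i x ∂Q - ∑ i ∈ s, c i * ∫ x in S, I i x ∂Q'‖ ≤
      ∑ i ∈ s, b i := by
    rw [← Finset.sum_sub_distrib]
    refine norm_sum_le_of_le _ fun i _ => ?_
    rw [← mul_sub, norm_mul]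
    calc _ ≤ 1 * ‖∫ x in S, I i x ∂Q - ∫ x in S, I i x ∂Q'‖ := by gcongr; exact hc i
      _ ≤ b i := by rw [one_mul]; exact hb i
  have htri : ∀ a b s t : ℂ, ‖(a + s) - (b + t)‖ ≤ ‖a - b‖ + (‖s‖ + ‖t‖) := by
    intro a b s t
    calc _ = ‖(a - b) + (s - t)‖ := by congr 1; ring
      _ ≤ _ := (norm_add_le _ _).trans (by gcongr; exact norm_sub_le _ _)
  refine (htri _ _ _ _).trans ?_
  have := hout Q inferInstance hp
  have := hout Q' inferInstance hp'
  linarith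

/-- With high probability the tilted polynomials are not exponentially small at their centres. -/
theorem eventually_measure_compl_iInter_ellipticGood_le {ε C : ℝ} (hε : 0 < ε) (hε1 : ε ≤ 1)
    (hC : 0 < C) (C₁ : ℝ) (k : ℕ) (A : ℝ) :
    ∀ᶠ n : ℕ in Filter.atTop, ∀ z : Fin k → ℂ, (∀ i, (n : ℝ) ^ ε ≤ ‖z i‖ ∧
      ‖z i‖ ≤ C * Real.sqrt n) → ∀ μ : Measure ℂ, UnitLaw ε C₁ μ →
        (Measure.pi fun _ : Fin (n + 1) => μ).real (⋂ i, ellipticGood n (z i))ᶜ ≤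
          (n : ℝ) ^ (-A) := by
  -- The exponent A + 1 absorbs the union over k ≤ n centres. The threshold used is exp(-n^ε), which
  -- is at least exp(-n) because ε ≤ 1.
  filter_upwards [eventually_elliptic_small_ball hε hε1 hC C₁ hε le_rfl (A + 1),
    Filter.eventually_ge_atTop 1, Filter.eventually_ge_atTop k] with n hn h1 hk z hz μ hμ
  have := hμ.prob
  have hn1 : (1 : ℝ) ≤ n := by exact_mod_cast h1
  have hn0 : (0 : ℝ) < n := by linarith
  have hsub : (⋂ i, ellipticGood n (z i))ᶜ ⊆ ⋃ i, {x | ‖∑ j, ellipticCoeff n (z i) (z i) j * x j‖ ≤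
      Real.exp (-(n : ℝ) ^ ε)} := by
    intro x hx
    rw [Set.compl_iInter, Set.mem_iUnion] at hx
    obtain ⟨i, hi⟩ := hx
    refine Set.mem_iUnion.2 ⟨i, ?_⟩
    have h2 : ‖∑ j, ellipticCoeff n (z i) (z i) j * x j‖ ≤ Real.exp (-n) := not_lt.1 hi
    refine h2.trans (Real.exp_le_exp.2 (neg_le_neg ?_))
    simpa using Real.rpow_le_rpow_of_exponent_le hn1 hε1
  refine (measureReal_mono hsub).trans ((measureReal_iUnion_fintype_le _).trans ?_)
  refine (Finset.sum_le_sum fun i _ => hn (z i) (z i) (hz i).1 (hz i).2 (by simpa using hC.le)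
    μ hμ).trans ?_
  rw [Finset.sum_const, Finset.card_univ, Fintype.card_fin, nsmul_eq_mul]
  calc (k : ℝ) * (n : ℝ) ^ (-(A + 1)) ≤ (n : ℝ) ^ (1 : ℝ) * (n : ℝ) ^ (-(A + 1)) := by
        rw [Real.rpow_one]
        gcongr
    _ = (n : ℝ) ^ (-A) := by rw [← Real.rpow_add hn0]; congr 1; ring

theorem hasCompactSupport_diagRestrict {k m : ℕ} {π : Fin k → Fin m} {z : Fin k → ℂ}
    {G : (Fin k → ℂ) → ℂ} {C : ℝ}
    (hG : Function.support G ⊆ {w | ∀ i, w i ∈ Metric.ball (0 : ℂ) C}) {s : Fin m → Fin k}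
    (hs : ∀ q, π (s q) = q) : HasCompactSupport (diagRestrict π z G) :=
  (isCompact_univ_pi fun q => isCompact_closedBall (z (s q)) C).of_isClosed_subset
    (isClosed_tsupport _) (tsupport_diagRestrict_subset π hG hs)

/-- The integral of `Ψ` against the product of the logarithms of the tilted polynomials. -/
noncomputable def logStat {m : ℕ} (n : ℕ) (c : Fin m → ℂ) (Ψ : (Fin m → ℂ) → ℂ)
    (x : Fin (n + 1) → ℂ) : ℂ :=
  ∫ u, Ψ u * ((∏ q, Real.log ‖ellipticForm n (c q) (u q) x‖ : ℝ) : ℂ)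

theorem exists_setIntegral_logStat_sub_le {ε C : ℝ} (hε : 0 < ε) (hε1 : ε ≤ 1) (hC : 0 < C)
    (C₁ : ℝ) {γ : ℝ} (hγ : γ = ε ^ 2 / 24) {m : ℕ} (hm : m ≠ 0) :
    ∃ K : ℝ, 0 < K ∧ ∀ᶠ n : ℕ in Filter.atTop, ∀ c : Fin m → ℂ, (∀ q, (n : ℝ) ^ ε ≤ ‖c q‖ ∧
      ‖c q‖ ≤ C * Real.sqrt n) → ∀ μ ν : Measure ℂ, UnitLaw ε C₁ μ →
      UnitLaw ε C₁ ν → SameMoments μ ν → ∀ S : Set (Fin (n + 1) → ℂ), MeasurableSet S →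
      (∀ q, S ⊆ ellipticGood n (c q)) → (Measure.pi fun _ => μ).real Sᶜ ≤ (n : ℝ) ^ (-1 : ℝ) →
      (Measure.pi fun _ => ν).real Sᶜ ≤ (n : ℝ) ^ (-1 : ℝ) →
      ∀ Ψ : (Fin m → ℂ) → ℂ, Continuous Ψ → HasCompactSupport Ψ →
      (∀ u, u ∉ Set.univ.pi (fun q => Metric.closedBall (c q) C) → Ψ u = 0) →
      ∀ M : ℝ, 0 ≤ M → (∀ u, ‖Ψ u‖ ≤ M) →
      IntegrableOn (logStat n c Ψ) S (Measure.pi fun _ => μ) ∧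
      IntegrableOn (logStat n c Ψ) S (Measure.pi fun _ => ν) ∧
      ‖∫ x in S, logStat n c Ψ x ∂(Measure.pi fun _ => μ) -
        ∫ x in S, logStat n c Ψ x ∂(Measure.pi fun _ => ν)‖ ≤ K * M * (n : ℝ) ^ (-(γ / 12)) :=
  exists_setIntegral_sub_setIntegral_le hε hε1 hC C₁ hγ hm

/-- Statistics of tuples of zeros with distinct indices, in terms of logarithms. -/
theorem zeroStat_eq_sum_logStat {n k : ℕ} {z : Fin k → ℂ} {G : (Fin k → ℂ) → ℂ} {C : ℝ}
    (hG : ContDiff ℝ (⊤ : ℕ∞) G)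
    (hGs : Function.support G ⊆ {w | ∀ i, w i ∈ Metric.ball (0 : ℂ) C})
    {m : Finset (Fin k × Fin k) → ℕ} {π : ∀ T, Fin k → Fin (m T)} {s : ∀ T, Fin (m T) → Fin k}
    (hs : ∀ T q, π T (s T q) = q)
    (hπ : ∀ T (d : ℕ) (φ : (Fin k → Fin d) → ℂ),
      (∑ e : Fin k → Fin d, if ∀ p ∈ T, e p.1 = e p.2 then φ e else 0) =
        ∑ e : Fin (m T) → Fin d, φ (e ∘ π T))
    {x : Fin (n + 1) → ℂ} (hx : rescaledElliptic n x ≠ 0) :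
    zeroStat k (fun u => G (u - z)) (rescaledElliptic n x) =
      ∑ T ∈ (Finset.univ.filter (fun p : Fin k × Fin k => p.1 < p.2)).powerset,
        (-1) ^ T.card * ((2 * Real.pi : ℂ) ^ m T)⁻¹ * logStat n (fun q => z (s T q))
          (lapList (List.finRange (m T)) (diagRestrict (π T) z G)) x := by
  obtain ⟨r, hr⟩ := exists_roots_enum (rescaledElliptic n x)
  rw [zeroStat_eq k _ hr, sum_embedding_eq (fun e => G ((fun j => r (e j)) - z))]
  refine Finset.sum_congr rfl fun T _ => ?_
  rw [hπ T, mul_assoc]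
  congr 1
  have h1 := integral_lapList_mul_prod_log_norm_ellipticForm hx hr (fun q => z (s T q))
    (contDiff_diagRestrict (π T) z hG) (hasCompactSupport_diagRestrict hGs (hs T))
  have h2 : (2 * Real.pi : ℂ) ^ m T ≠ 0 := pow_ne_zero _ (by simp [Real.pi_ne_zero])
  rw [eq_inv_mul_iff_mul_eq₀ h2]
  unfold logStat
  rw [h1]
  rfl

theorem norm_le_of_gradNorm_le {k : ℕ} {G : (Fin k → ℂ) → ℂ} {C : ℝ}
    (h : ∀ w, gradNorm 0 G w ≤ C) (w : Fin k → ℂ) : ‖G w‖ ≤ C := by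
  have := norm_iteratedFDeriv_le_gradNorm 0 G w
  rw [norm_iteratedFDeriv_zero, pow_zero, one_mul] at this
  exact this.trans (h w)

/-- Comparison of the statistics of tuples of zeros, for large degree. -/
theorem exists_integral_zeroStat_sub_le {ε C : ℝ} (hε : 0 < ε) (hε1 : ε ≤ 1) (hC : 0 < C)
    (C₁ : ℝ) {γ : ℝ} (hγ : γ = ε ^ 2 / 24) {k : ℕ} (hk : 1 ≤ k) :
    ∃ K : ℝ, 0 < K ∧ ∀ᶠ n : ℕ in Filter.atTop, ∀ μ ν : Measure ℂ, UnitLaw ε C₁ μ →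
      UnitLaw ε C₁ ν → SameMoments μ ν → ∀ z : Fin k → ℂ, (∀ i, (n : ℝ) ^ ε ≤ ‖z i‖ ∧
      ‖z i‖ ≤ C * Real.sqrt n) → ∀ G : (Fin k → ℂ) → ℂ, ContDiff ℝ (⊤ : ℕ∞) G →
      Function.support G ⊆ {w | ∀ i, w i ∈ Metric.ball (0 : ℂ) C} →
      (∀ a : ℕ, a ≤ 2 * k → ∀ w, gradNorm a G w ≤ C) →
      ‖∫ x, zeroStat k (fun u => G (u - z)) (rescaledElliptic n x) ∂(Measure.pi fun _ => μ) -
        ∫ x, zeroStat k (fun u => G (u - z)) (rescaledElliptic n x) ∂(Measure.pi fun _ => ν)‖ ≤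
          K * (n : ℝ) ^ (-(γ / 12)) := by
  have hγ0 : 0 < γ := by rw [hγ]; positivity
  have hγ1 : γ ≤ 1 / 24 := by rw [hγ]; nlinarith
  choose m π hπs hπ using exists_surjective_factor (k := k)
  -- As k ≥ 1 there is at least one class of indices, so every term is a genuine product of
  -- logarithms.
  have hm0 : ∀ T, m T ≠ 0 := fun T h0 => by
    have i := π T ⟨0, hk⟩
    rw [h0] at i
    exact i.elim0
  have hmk : ∀ T, m T ≤ k := fun T => by
    simpa using Fintype.card_le_of_surjective _ (hπs T)
  let s : ∀ T, Fin (m T) → Fin k := fun T => Function.surjInv (hπs T)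
  have hs : ∀ T q, π T (s T q) = q := fun T q => Function.surjInv_eq (hπs T) q
  choose K hK0 hK using fun T =>
    exists_setIntegral_logStat_sub_le hε hε1 hC C₁ hγ (m := m T) (hm0 T)
  -- A bound for the m-fold Laplacian of the restricted G: 2^m from the two directions in each
  -- variable, and (2k)^(2m) from the passage between partial derivatives and the operator norm at
  -- order 2m ≤ 2k.
  set M : Finset (Fin k × Fin k) → ℝ := fun T => 2 ^ m T * ((2 * k : ℝ) ^ (2 * m T) * C) with hM
  have hM0 : ∀ T, 0 ≤ M T := fun T => by positivity
  have hsum0 : 0 ≤ ∑ T ∈ (Finset.univ.filter (fun p : Fin k × Fin k => p.1 < p.2)).powerset,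
      K T * M T := Finset.sum_nonneg fun T _ => mul_nonneg (hK0 T).le (hM0 T)
  refine ⟨∑ T ∈ (Finset.univ.filter (fun p : Fin k × Fin k => p.1 < p.2)).powerset, K T * M T +
    2 * C, by positivity, ?_⟩
  filter_upwards [Filter.eventually_all.2 hK,
    eventually_measure_compl_iInter_ellipticGood_le hε hε1 hC C₁ k (k + 1),
    Filter.eventually_ge_atTop 1] with n hn hgood h1 μ ν hμ hν hmn z hz G hG hGs hGC
  have hn1 : (1 : ℝ) ≤ n := by exact_mod_cast h1
  have hn0 : (0 : ℝ) < n := by linarith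
  have := hμ.prob
  have := hν.prob
  set S : Set (Fin (n + 1) → ℂ) := ⋂ i, ellipticGood n (z i) with hS
  have hSm : MeasurableSet S := MeasurableSet.iInter fun i => measurableSet_ellipticGood n (z i)
  have hpow : (n : ℝ) ^ (-((k : ℝ) + 1)) ≤ (n : ℝ) ^ (-1 : ℝ) :=
    Real.rpow_le_rpow_of_exponent_le hn1 (by have : (0 : ℝ) ≤ k := Nat.cast_nonneg k
                                             linarith)
  have hSμ := hgood z hz μ hμ
  have hSν := hgood z hz ν hν
  have hφ : Continuous fun u => G (u - z) := hG.continuous.comp (by fun_prop)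
  have hb := fun T => hn T (fun q => z (s T q)) (fun q => hz _) μ ν hμ hν hmn S hSm
    (fun q => Set.iInter_subset _ _) (hSμ.trans hpow) (hSν.trans hpow)
    (lapList (List.finRange (m T)) (diagRestrict (π T) z G))
    (contDiff_lapList _ (contDiff_diagRestrict (π T) z hG)).continuous
    (hasCompactSupport_lapList _ (hasCompactSupport_diagRestrict hGs (hs T)))
    (fun u hu => by
      by_contra h0
      exact hu (tsupport_diagRestrict_subset (π T) hGs (hs T)
        (tsupport_lapList_subset _ _ (subset_tsupport _ h0))))
    (M T) (hM0 T) (fun u => by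
      have h2 := norm_lapList_le (List.finRange (m T)) (contDiff_diagRestrict (π T) z hG) 0 u
      rw [norm_iteratedFDeriv_zero, List.length_finRange, zero_add] at h2
      refine h2.trans (mul_le_mul_of_nonneg_left ?_ (by positivity))
      refine norm_iteratedFDeriv_diagRestrict_le (π T) z hG _ (fun w => ?_) u
      refine (norm_iteratedFDeriv_le_gradNorm _ G w).trans ?_
      exact mul_le_mul_of_nonneg_left (hGC _ (by have := hmk T; omega) w) (by positivity))
  have hcoef : ∀ T : Finset (Fin k × Fin k),
      ‖(-1 : ℂ) ^ T.card * ((2 * Real.pi : ℂ) ^ m T)⁻¹‖ ≤ 1 := by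
    intro T
    have h2 : ‖(2 * Real.pi : ℂ)‖ = 2 * Real.pi := by
      rw [norm_mul, Complex.norm_ofNat, Complex.norm_real, Real.norm_of_nonneg Real.pi_pos.le]
    rw [norm_mul, norm_pow, norm_neg, norm_one, one_pow, one_mul, norm_inv, norm_pow, h2]
    exact inv_le_one_of_one_le₀ (one_le_pow₀ (by linarith [Real.pi_gt_three]))
  have hGn := norm_le_of_gradNorm_le (hGC 0 (Nat.zero_le _))
  refine (norm_integral_sub_integral_le_of_sum _ _ hSm
    (stronglyMeasurable_zeroStat_rescaledElliptic n k hφ) (B := C * (n : ℝ) ^ k) (by positivity)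
    (fun x => norm_zeroStat_le hC.le (fun u => hGn _) (natDegree_rescaledElliptic_le n x))
    hSμ hSν _ (fun T => (-1 : ℂ) ^ T.card * ((2 * Real.pi : ℂ) ^ m T)⁻¹) _
    (fun T => K T * M T * (n : ℝ) ^ (-(γ / 12))) hcoef
    (fun x hx => zeroStat_eq_sum_logStat hG hGs hs hπ
      (rescaledElliptic_ne_zero_of_mem (Set.mem_iInter.1 hx ⟨0, hk⟩)))
    (fun T => (hb T).1) (fun T => (hb T).2.1) (fun T => (hb T).2.2)).trans ?_
  rw [← Finset.sum_mul, add_mul]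
  -- Off the good event there are at most n^k tuples; the exponent k + 1 in its probability leaves
  -- n^(-1).
  have hlast : C * (n : ℝ) ^ k * (n : ℝ) ^ (-((k : ℝ) + 1)) ≤ C * (n : ℝ) ^ (-(γ / 12)) := by
    rw [mul_assoc, ← Real.rpow_natCast, ← Real.rpow_add hn0]
    refine mul_le_mul_of_nonneg_left (Real.rpow_le_rpow_of_exponent_le hn1 ?_) hC.le
    linarith
  linarith

/-- Two moment theorem for the zeros of rescaled elliptic polynomials, complex case. -/
theorem theorem5p4 :
    ∀ ε : ℝ, 0 < ε → ∃ c₀ : ℝ, 0 < c₀ ∧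
      ∀ k : ℕ, 1 ≤ k → ∀ C : ℝ, 0 < C → ∃ C' : ℝ,
        ∀ n : ℕ, 1 ≤ n →
        ∀ (Ω : Type*) [MeasurableSpace Ω] (P : Measure Ω) [IsProbabilityMeasure P]
          (Ω' : Type*) [MeasurableSpace Ω'] (P' : Measure Ω') [IsProbabilityMeasure P']
          (ξ : Ω → ℂ) (ξ' : Ω' → ℂ)
          (X : Fin (n + 1) → Ω → ℂ) (X' : Fin (n + 1) → Ω' → ℂ),
          IsIndepCopies P ξ X → IsIndepCopies P' ξ' X' →
          -- mean zero and variance one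
          ∫ ω, ξ ω ∂P = 0 → ∫ ω, ‖ξ ω‖ ^ 2 ∂P = 1 →
          ∫ ω, ξ' ω ∂P' = 0 → ∫ ω, ‖ξ' ω‖ ^ 2 ∂P' = 1 →
          MatchMoments P P' ξ ξ' 2 →
          ∫⁻ ω, ‖ξ ω‖ₑ ^ (2 + ε) ∂P ≤ ENNReal.ofReal C →
          ∫⁻ ω, ‖ξ' ω‖ₑ ^ (2 + ε) ∂P' ≤ ENNReal.ofReal C →
        ∀ z : Fin k → ℂ, (∀ i, (n : ℝ) ^ ε ≤ ‖z i‖ ∧ ‖z i‖ ≤ C * Real.sqrt n) →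
        ∀ G : (Fin k → ℂ) → ℂ, ContDiff ℝ (⊤ : ℕ∞) G →
          Function.support G ⊆ {w | ∀ i, w i ∈ Metric.ball (0 : ℂ) C} →
          (∀ a : ℕ, a ≤ 5 * k + 1 → ∀ w, gradNorm a G w ≤ C) →
          ‖∫ u, G (u - z) ∂(correlationMeasure P (fun ω => rescaledElliptic n (fun i => X i ω)) k)
            - ∫ u, G (u - z)
                ∂(correlationMeasure P' (fun ω => rescaledElliptic n (fun i => X' i ω)) k)‖
            ≤ C' * (n : ℝ) ^ (-c₀) := by
  intro ε₀ hε₀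
  -- Only exponents up to 3 can be gained from a second order expansion. Lowering ε weakens both the
  -- moment condition, up to the constant 1 + C, and the lower bound on |z i|.
  set ε := min ε₀ 1 with hεdef
  have hε : 0 < ε := lt_min hε₀ one_pos
  have hε1 : ε ≤ 1 := min_le_right _ _
  have hεε : ε ≤ ε₀ := min_le_left _ _
  set γ := ε ^ 2 / 24 with hγ
  have hγ0 : 0 < γ := by positivity
  have hγ1 : γ ≤ 1 / 24 := by rw [hγ]; nlinarith
  refine ⟨γ / 12, by positivity, fun k hk C hC => ?_⟩
  obtain ⟨K, hK0, hK⟩ := exists_integral_zeroStat_sub_le hε hε1 hC (1 + C) hγ hk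
  obtain ⟨n₀, hn₀⟩ := Filter.eventually_atTop.1 hK
  -- The second summand serves the finitely many n < n₀, where each statistic is at most C n^k and
  -- n^k = n^(k+1) n^(-1) ≤ n₀^(k+1) n^(-γ/12).
  refine ⟨K + 2 * C * (n₀ : ℝ) ^ (k + 1), ?_⟩
  intro n h1 Ω _ P _ Ω' _ P' _ ξ ξ' X X' hX hX' hmean hvar hmean' hvar' hmatch hmom hmom' z hz G hG
    hGs hGC
  have hn1 : (1 : ℝ) ≤ n := by exact_mod_cast h1
  have hn0 : (0 : ℝ) < n := by linarith
  have hξ : AEMeasurable ξ P := (hX.identDistrib 0).aemeasurable_snd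
  have hξ' : AEMeasurable ξ' P' := (hX'.identDistrib 0).aemeasurable_snd
  have hμ := unitLaw_map P hξ hmean hvar hε hεε hC.le hmom
  have hν := unitLaw_map P' hξ' hmean' hvar' hε hεε hC.le hmom'
  have := hμ.prob
  have := hν.prob
  have hφ : Continuous fun u => G (u - z) := hG.continuous.comp (by fun_prop)
  -- A translate is the restriction to the trivial diagonal, the one given by the identity.
  have hφc : HasCompactSupport fun u => G (u - z) :=
    hasCompactSupport_diagRestrict (π := id) (s := id) hGs fun _ => rfl
  rw [integral_correlationMeasure_rescaledElliptic P hX hφ hφc,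
    integral_correlationMeasure_rescaledElliptic P' hX' hφ hφc]
  have hz' : ∀ i, (n : ℝ) ^ ε ≤ ‖z i‖ ∧ ‖z i‖ ≤ C * Real.sqrt n := fun i =>
    ⟨(Real.rpow_le_rpow_of_exponent_le hn1 hεε).trans (hz i).1, (hz i).2⟩
  have hpos : 0 ≤ (n : ℝ) ^ (-(γ / 12)) := by positivity
  rw [add_mul]
  rcases le_or_gt n₀ n with hn | hn
  · refine (hn₀ n hn _ _ hμ hν (sameMoments_map hξ hξ' hmatch) z hz' G hG hGs
      fun a ha => hGC a (by omega)).trans ?_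
    have : 0 ≤ 2 * C * (n₀ : ℝ) ^ (k + 1) * (n : ℝ) ^ (-(γ / 12)) := by positivity
    linarith
  · have hGn := norm_le_of_gradNorm_le (hGC 0 (Nat.zero_le _))
    have hbd : ∀ ρ : Measure (Fin (n + 1) → ℂ), IsProbabilityMeasure ρ →
        ‖∫ x, zeroStat k (fun u => G (u - z)) (rescaledElliptic n x) ∂ρ‖ ≤ C * (n : ℝ) ^ k := by
      intro ρ _
      refine (norm_integral_le_of_norm_le_const (Filter.Eventually.of_forall fun x =>
        norm_zeroStat_le hC.le (fun u => hGn _) (natDegree_rescaledElliptic_le n x))).trans ?_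
      simp
    refine (norm_sub_le _ _).trans ((add_le_add (hbd _ inferInstance) (hbd _ inferInstance)).trans ?_)
    have hnn : (n : ℝ) ≤ n₀ := by exact_mod_cast hn.le
    have h2 : (n : ℝ) ^ k ≤ (n₀ : ℝ) ^ (k + 1) * (n : ℝ) ^ (-(γ / 12)) := by
      calc (n : ℝ) ^ k = (n : ℝ) ^ (k + 1) * (n : ℝ) ^ (-1 : ℝ) := by
            rw [Real.rpow_neg_one, pow_succ, mul_assoc, mul_inv_cancel₀ hn0.ne', mul_one]
        _ ≤ _ := by
            gcongr ?_ * ?_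
            · gcongr
            · exact Real.rpow_le_rpow_of_exponent_le hn1 (by linarith)
    have h3 := mul_le_mul_of_nonneg_left h2 hC.le
    have : 0 ≤ K * (n : ℝ) ^ (-(γ / 12)) := by positivity
    linarith
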